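/- Let $d_1,d_2\ge 1$, let $N\ge 1$ be an integer and $T\in\mathbb C^*$. Let $V_1$, $V_2$ be complex polynomials of degrees $d_1+1$, $d_2+1$, and write $V_2(y)=\tilde g_0+\sum_{k=1}^{d_2+1}\frac{\tilde g_k}{k}y^k$. Let $\Gamma^x_1,\dots,\Gamma^x_{d_1}$ (resp. $\Gamma^y_1,\dots,\Gamma^y_{d_2}$) be homologically independent $C^1$ paths going from $\infty$ to $\infty$, whose velocities have limits at both ends, with end directions inside sectors where $\mathrm{Re}(V_1/T)\to+\infty$ (resp. $\mathrm{Re}(V_2/T)\to+\infty$). Let $\kappa$ be a complex $d_1\times d_2$ matrix and $\Gamma=\sum_{i,j}\kappa_{ij}\,\Gamma^x_i\times\Gamma^y_j$. If $d_1=d_2=1$, assume moreover that the quadratic part of $\mathrm{Re}\,\frac1T(V_1(x)+V_2(y)-xy)$ is strictly positive at all $(x,y)=(au,bv)$ with $a,b\ge0$, $a+b>0$, $u$ an end direction of $\Gamma^x_1$ and $v$ one of $\Gamma^y_1$. Assume that there are monic polynomials $\pi_n,\sigma_n$ of degree $n$ ($n\ge0$) and numbers $h_n\neq0$ with $$\int_\Gamma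 \pi_n(x)\sigma_m(y)\,e^{-\frac NT[V_1(x)+V_2(y)-xy]}\,dx\,dy=h_n\delta_{nm}.$$ Put $\phi_j(y)=h_j^{-1/2}\sigma_j(y)e^{-\frac NT V_2(y)}$ (for any fixed choice of the roots $\sqrt{h_j}$), $$\tilde\phi^{(k)}_j(x)=\int_{\Gamma^y_k}\phi_j(y)e^{\frac NT xy}\,dy\ (1\le k\le d_2),\qquad \tilde\phi_j^{(0)}(x)=e^{\frac NT V_1(x)}\int_\Gamma\frac{\phi_j(y)}{x-x'}\,e^{-\frac NT V_1(x')+\frac NT x'y}\,dx'\,dy\quad(x\notin\textstyle\bigcup_i\Gamma^x_i).$$ For $n\ge1$ let $\tilde{\mathbf\Phi}_n(x)$ be the $(d_2+1)\times(d_2+1)$ matrix $\big(\tilde\phi^{(k)}_{n-1+i}(x)\big)_{0\le i,k\le d_2}$. Put $\omega=e^{2i\pi/d_2}$; $\Omega_{00}=1$, $\Omega_{ij}=\omega^{ij}$ for $i,j\geq 1$, $\Omega_{i0}=\Omega_{0i}=0$ for $i\ge1$; $G=\mathrm{diag}\big(-n,\frac{2n+1-d_2}{2d_2},\dots,\frac{2n-1+d_2}{2d_2}\big)$;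 $r$ any fixed root $\tilde g_{d_2+1}^{1/d_2}$; $Y_0=\mathrm{diag}\big(\sqrt{h_{n-1}},\frac{r^{-(n+1)}}{\sqrt{h_n}},\dots,\frac{r^{-(n+d_2)}}{\sqrt{h_{n+d_2-1}}}\big)$. The powers of $x$ are defined through $\zeta=\log x$ (i.e. on the universal cover of $\mathbb C^*$). Let $y_1(x),\dots,y_{d_2}(x)$ be the solutions of $V_2'(y)=x$ for large $x$, labelled by $y_k(x)\sim \omega^k r^{-1}x^{1/d_2}$, and let $T(x)=\mathrm{diag}(V_1(x),T_1(x),\dots,T_{d_2}(x))$, $T_k(x)=\sum_{l=0}^{d_2}\frac{l}{l+1}\tilde g_{l+1}y_k(x)^{l+1}$. For $\alpha\in\mathbb R$ and $m\in\mathbb Z$ let $\Sigma_m$ be the sector of angle $\pi/d_2$ $$\Sigma_m=\Big\{x:\ \theta_0+\tfrac{m\pi}{d_2}\le\arg x\le\theta_0+\tfrac{(m+1)\pi}{d_2}\Big\},\qquad \theta_0=\alpha+\tfrac1{d_2+1}\,\mathrm{Arg}\big(\tilde g_{d_2+1}u^{d_2+1}/T\big),$$ where $u$ is the direction of the outgoing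 end of $\Gamma^y_1$ and $\mathrm{Arg}\in(-\pi/2,\pi/2)$ here. Then, for given $N$, $T$, $\Gamma^y_1,\dots,\Gamma^y_{d_2}$ and $\alpha$, there are invertible matrices (Stokes matrices) $S_m$, $m\in\mathbb Z$, which do not depend on $n$, on $x$, or on the potentials $V_1,V_2$ (of the given degrees, and for which the contours are as above), nor on $\kappa$ and $\Gamma^x$, such that, for all such data, there are a constant lower triangular matrix $L$ with unit diagonal and $L_{i0}=0$ for $i\geq 1$, and constant invertible matrices $C_m$ with $$C_m^{-1}C_{m+1}=S_m\qquad(m\in\mathbb Z),$$ for which, as $x\to\infty$ in $\Sigma_m\setminus\bigcup_i\Gamma_i^x$, uniformly, $$\tilde{\mathbf\Phi}_n(x)=Y_0\,\big(L+O(x^{-1/d_2})\big)\,x^G\,\Omega\,e^{\frac NT T(x)}\,C_m ,$$ where moreover every entry of the matrix $\big(L+O(x^{-1/d_2})\big)x^G\Omega$ at a place at which $\Omega$ does not vanish equals $(1+O(x^{-1/d_2}))$ times the corresponding entry of $x^G\Omega$. (Thus $C(x)=C_m$ on $\Sigma_m$ is piecewise constant.) -/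

import Mathlib

open Polynomial Filter Topology

noncomputable section

namespace TwoMatrix

/-- An oriented path in the complex plane going from infinity to infinity: a `C¹` map whose
velocity has limits at both ends.  `startDir` and `endDir` are the directions in which the path
leaves towards infinity at its two ends; the velocity points inwards at the start. The path may
slow down to speed zero, so corners are allowed. -/
structure Contour where
  toFun : ℝ → ℂ
  contDiff : ContDiff ℝ 1 toFun
  startDir : ℂ
  endDir : ℂ
  tendsto_start : Tendsto (deriv toFun) atBot (𝓝 (-startDir))
  tendsto_end : Tendsto (deriv toFun) atTop (𝓝 endDir)

/-- The integral of `f` along a contour. -/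
def Contour.integral (γ : Contour) (f : ℂ → ℂ) : ℂ :=
  ∫ t : ℝ, f (γ.toFun t) * deriv γ.toFun t

/-- The union of the open sectors in which `Re (V(z)/T)` tends to `+∞`. -/
def decaySectors (V : ℂ[X]) (T : ℂ) : Set ℂ :=
  {z | 0 < (V.leadingCoeff * z ^ V.natDegree / T).re}

/-- Both ends of the contour lie in sectors where `Re (V/T)` is positive. -/
def Contour.Admissible (γ : Contour) (V : ℂ[X]) (T : ℂ) : Prop :=
  γ.startDir ∈ decaySectors V T ∧ γ.endDir ∈ decaySectors V T

/-- The boundary at infinity of the contour: (sector of the end) − (sector of the start), in the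
free abelian group on the sectors. It determines the homology class of an admissible contour. -/
def Contour.homologyClass (γ : Contour) (V : ℂ[X]) (T : ℂ) : Set ℂ →₀ ℤ :=
  Finsupp.single (connectedComponentIn (decaySectors V T) γ.endDir) 1
    - Finsupp.single (connectedComponentIn (decaySectors V T) γ.startDir) 1

/-- `d` homologically independent admissible contours for a potential of degree `d + 1`. -/
def IsContourBasis {d : ℕ} (Γ : Fin d → Contour) (V : ℂ[X]) (T : ℂ) : Prop :=
  (∀ k, (Γ k).Admissible V T) ∧ LinearIndependent ℤ (fun k => (Γ k).homologyClass V T)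

/-- The integral over `∑ κᵢⱼ Γˣᵢ × Γʸⱼ`. -/
def doubleIntegral {d₁ d₂ : ℕ} (κ : Matrix (Fin d₁) (Fin d₂) ℂ) (Γx : Fin d₁ → Contour)
    (Γy : Fin d₂ → Contour) (F : ℂ → ℂ → ℂ) : ℂ :=
  ∑ i, ∑ j, κ i j * (Γx i).integral (fun x => (Γy j).integral (fun y => F x y))

/-- Two potentials `V₁`, `V₂` of degrees `d₁ + 1`, `d₂ + 1`, bases of contours `Γx`, `Γy`, a
coefficient matrix `κ`, and the corresponding monic biorthogonal polynomials `π`, `σ` with non-zero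
norms `h`; `s n` is any choice of a square root of `h n`. -/
structure Model (d₁ d₂ N : ℕ) (T : ℂ) (Γy : Fin d₂ → Contour) where
  V₁ : ℂ[X]
  V₂ : ℂ[X]
  natDegree_V₁ : V₁.natDegree = d₁ + 1
  natDegree_V₂ : V₂.natDegree = d₂ + 1
  Γx : Fin d₁ → Contour
  basis_x : IsContourBasis Γx V₁ T
  basis_y : IsContourBasis Γy V₂ T
  /-- Convergence of the double integrals in the Gaussian case; it is automatic otherwise. -/
  gaussian : d₁ = 1 → d₂ = 1 → ∀ i j,
    ∀ u ∈ ({(Γx i).startDir, (Γx i).endDir} : Set ℂ),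
    ∀ v ∈ ({(Γy j).startDir, (Γy j).endDir} : Set ℂ),
    ∀ a b : ℝ, 0 ≤ a → 0 ≤ b → 0 < a + b →
      0 < ((V₁.leadingCoeff * (a * u) ^ 2 + V₂.leadingCoeff * (b * v) ^ 2
        - (a * u) * (b * v)) / T).re
  κ : Matrix (Fin d₁) (Fin d₂) ℂ
  π : ℕ → ℂ[X]
  σ : ℕ → ℂ[X]
  h : ℕ → ℂ
  s : ℕ → ℂ
  monic_π : ∀ n, (π n).Monic
  monic_σ : ∀ n, (σ n).Monic
  natDegree_π : ∀ n, (π n).natDegree = n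
  natDegree_σ : ∀ n, (σ n).natDegree = n
  biorthogonal : ∀ n m, doubleIntegral κ Γx Γy (fun x y =>
    (π n).eval x * (σ m).eval y * Complex.exp (-(N / T) * (V₁.eval x + V₂.eval y - x * y)))
      = if n = m then h n else 0
  h_ne_zero : ∀ n, h n ≠ 0
  s_sq : ∀ n, s n ^ 2 = h n

namespace Model

variable {d₁ d₂ N : ℕ} {T : ℂ} {Γy : Fin d₂ → Contour}

/-- The wave function `φₙ(y) = σₙ(y) e^{-(N/T) V₂(y)} / √hₙ`. -/
def φ (M : Model d₁ d₂ N T Γy) (n : ℕ) (y : ℂ) : ℂ :=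
  (M.σ n).eval y / M.s n * Complex.exp (-(N / T) * M.V₂.eval y)

/-- The Fourier–Laplace transform of `φₙ` along `Γʸₖ`. -/
def fourier (M : Model d₁ d₂ N T Γy) (k : Fin d₂) (n : ℕ) (x : ℂ) : ℂ :=
  (Γy k).integral (fun y => M.φ n y * Complex.exp (N / T * (x * y)))

/-- The Hilbert transform of `φₙ`, meaningful for `x` outside the contours `Γx`. -/
def hilbert (M : Model d₁ d₂ N T Γy) (n : ℕ) (x : ℂ) : ℂ :=
  Complex.exp (N / T * M.V₁.eval x) * doubleIntegral M.κ M.Γx Γy (fun x' y =>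
    M.φ n y / (x - x') * Complex.exp (-(N / T) * M.V₁.eval x') * Complex.exp (N / T * (x' * y)))

/-- The matrix whose row `i` has index `n - 1 + i` (`0 ≤ i ≤ d₂`), with the Hilbert transform in
column `0` and the Fourier–Laplace transforms in columns `1, …, d₂`. -/
def fundamental (M : Model d₁ d₂ N T Γy) (n : ℕ) (x : ℂ) :
    Matrix (Fin (d₂ + 1)) (Fin (d₂ + 1)) ℂ :=
  fun i k => Fin.cases (M.hilbert (n - 1 + i) x) (fun l => M.fourier l (n - 1 + i) x) k

/-- The coefficients in `V₂(y) = g̃₀ + ∑ (g̃ₖ / k) yᵏ`, for `k ≥ 1`. -/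
def g₂ (M : Model d₁ d₂ N T Γy) (k : ℕ) : ℂ := k * M.V₂.coeff k

/-- `diag(√h_{n-1}, r^{-(n+1)}/√h_n, …, r^{-(n+d₂)}/√h_{n+d₂-1})`, where `r` stands for the
root `g̃_{d₂+1}^{1/d₂}`. -/
def Y₀ (M : Model d₁ d₂ N T Γy) (r : ℂ) (n : ℕ) : Matrix (Fin (d₂ + 1)) (Fin (d₂ + 1)) ℂ :=
  Matrix.diagonal (fun i =>
    if i = 0 then M.s (n - 1) else (r ^ (n + (i : ℕ)))⁻¹ / M.s (n - 1 + i))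

/-- `y k`, for `k : Fin d₂`, are the `d₂` solutions of `V₂'(y) = x` for large `x`, seen as functions
of `ζ = log x`, with the labelling
`y_k ~ ω^k (x / g̃_{d₂+1})^{1/d₂}`, `k = 1, …, d₂`. -/
def IsSaddles (M : Model d₁ d₂ N T Γy) (r : ℂ) (y : Fin d₂ → ℂ → ℂ) : Prop :=
  ∀ k : Fin d₂,
    (∀ᶠ ζ in comap Complex.re atTop, M.V₂.derivative.eval (y k ζ) = Complex.exp ζ) ∧
    Tendsto (fun ζ => y k ζ * Complex.exp (-ζ / d₂)) (comap Complex.re atTop)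
      (𝓝 (Complex.exp (2 * Real.pi * Complex.I / d₂) ^ ((k : ℕ) + 1) / r))

/-- `e^{(N/T) T(x)}` with `T = diag(V₁(x), T₁(x), …, T_{d₂}(x))`, where
`T_k = ∑_{l ≤ d₂} l/(l+1) g̃_{l+1} y_k^{l+1}` and `x = e^ζ`. -/
def expT (M : Model d₁ d₂ N T Γy) (y : Fin d₂ → ℂ → ℂ) (ζ : ℂ) :
    Matrix (Fin (d₂ + 1)) (Fin (d₂ + 1)) ℂ :=
  Matrix.diagonal (Fin.cases (Complex.exp (N / T * M.V₁.eval (Complex.exp ζ)))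
    (fun k => Complex.exp (N / T *
      ∑ l ∈ Finset.range (d₂ + 1), (l / (l + 1) : ℂ) * M.g₂ (l + 1) * y k ζ ^ (l + 1))))

/-- The `m`-th closed sector of opening `π/d₂`, as a set of values of `ζ = log x`. The sectors are
rotated by `1/(d₂+1)` of the argument of the leading coefficient of `V₂`, that argument being
measured with respect to the contours. -/
def sector (M : Model d₁ d₂ N T Γy) (hd : 0 < d₂) (α : ℝ) (m : ℤ) : Set ℂ :=
  let θ : ℝ := α + Complex.arg (M.g₂ (d₂ + 1) * (Γy ⟨0, hd⟩).endDir ^ (d₂ + 1) / T) / (d₂ + 1)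
  {ζ | ζ.im ∈ Set.Icc (θ + m * (Real.pi / d₂)) (θ + (m + 1) * (Real.pi / d₂))}

end Model

/-- `x^G` for `x = e^ζ`, with
`G = diag(-n, (2n+1-d₂)/(2d₂), …, (2n-1+d₂)/(2d₂))`. -/
def xPowG (d₂ n : ℕ) (ζ : ℂ) : Matrix (Fin (d₂ + 1)) (Fin (d₂ + 1)) ℂ :=
  Matrix.diagonal (fun i => Complex.exp
    ((if i = 0 then -(n : ℂ) else (2 * n + 2 * (i : ℕ) - 1 - d₂) / (2 * d₂)) * ζ))

/-- `Ω₀₀ = 1` and `Ωᵢⱼ = e^{2iπ ij/d₂}` for `i, j > 0`; the other entries vanish. -/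
def Ω (d₂ : ℕ) : Matrix (Fin (d₂ + 1)) (Fin (d₂ + 1)) ℂ :=
  fun i j => if i = 0 ∧ j = 0 then 1 else if i = 0 ∨ j = 0 then 0
    else Complex.exp (2 * Real.pi * Complex.I / d₂) ^ ((i : ℕ) * (j : ℕ))

end TwoMatrix

end

/-! Write `d = d₂` and `c = N/T`. The columns of positive index and column `0` are treated by
different means.

An integral of `σ(y) e^{c(xy - V₂(y))}` along a contour depends only on the sectors of its two ends:
it is a difference of limits of a primitive (`Contour.integral_eq_sub`). Between two neighbouring
sectors the integral is given by one saddle point `V₂'(y) = x` alone, as long as `arg x` stays in a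
certain range. After scaling by a constant times `|x|^{1/d}` the phase becomes `t^{d+1}/(d+1) -
e^{ids} t` with saddle `e^{is}`, and the range is `|s| < π/d` (everything if `d = 1`). In this range
explicit paths of descent join the saddle to both sectors (`hasDescent_ray`, `hasDescent_mirror`,
`hasDescent_middle`, `hasDescent_line`), and a uniform Laplace method (`laplace`) computes the
contribution (`saddleAsymptotics`, `saddle_contribution`).

For `x` in `Σ_m` there is a window of `d` consecutive steps between neighbouring sectors whose
saddles are all in this range (`exists_window_margin`) and are all different (`residue_injective`).
Each contour is an integral combination of these `d` steps. The coefficient matrix `crossing` is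
invertible because the contours are homologically independent (`det_crossing_ne_zero`). The rotation
of `Σ_m` by the argument of the leading coefficient is made so that the window depends only on `α`,
`N/T`, the end of the first contour and `m`, not on the potential. Hence so do `crossing` and the
phases `e^{iπp/d}` that distinguish the steps (`saddleConst_add`), and together they form
`connection`. Everything that depends on the model, on `n` or on the chosen roots sits in a left
factor which is the same for all `m` and disappears from `C_m⁻¹ C_{m+1}`.

Each saddle contribution is expanded to `d` terms in powers of `(x/g)^{-1/d}`, `g` being the leading
coefficient of `V₂'`. The coefficients are the same at all saddles and the remainder is `O(1/x)`
(`exists_saddle_expansion`). The factor `x^G Ω` is inverted by a discrete Fourier transform over the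
saddles. Orthogonality of roots of unity keeps integral powers of `x` only: the constant ones make
up `L`, the others are small, and the remainders are enlarged by at most `x^{(d-1)/d}`
(`norm_dftMatrix_sub_le`).

For column `0`, `1/(x - x')` is expanded in a finite geometric series. Orthogonality removes the
moments of low order and the first surviving one is `h` (`hilbert_expansion`). The remainder is a
Cauchy integral that must be controlled up to the contours; it is `O(|x|)` there
(`Contour.exists_cauchy_le`), which two additional terms of the series make harmless. The
convergence of the double integrals comes from `Model.exists_action_lower`. -/

namespace TwoMatrix

/-! ### Growth of polynomials, decay in cones, integrals along contours. -/

theorem exists_norm_eval_le (P : ℂ[X]) {n : ℕ} (h : P.natDegree ≤ n) :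
    ∃ C : ℝ, 0 < C ∧ ∀ z : ℂ, ‖P.eval z‖ ≤ C * (1 + ‖z‖) ^ n := by
  refine ⟨∑ i ∈ Finset.range (n + 1), ‖P.coeff i‖ + 1, by positivity, fun z => ?_⟩
  rw [eval_eq_sum_range' (Nat.lt_succ_of_le h)]
  calc ‖∑ i ∈ Finset.range (n + 1), P.coeff i * z ^ i‖
      ≤ ∑ i ∈ Finset.range (n + 1), ‖P.coeff i‖ * (1 + ‖z‖) ^ n := by
        refine (norm_sum_le _ _).trans (Finset.sum_le_sum fun i hi => ?_)
        rw [norm_mul, norm_pow]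
        have h1 : ‖z‖ ^ i ≤ (1 + ‖z‖) ^ i :=
          pow_le_pow_left₀ (norm_nonneg _) (by linarith [norm_nonneg z]) _
        have h2 : (1 + ‖z‖) ^ i ≤ (1 + ‖z‖) ^ n :=
          pow_le_pow_right₀ (by linarith [norm_nonneg z])
            (Nat.lt_succ_iff.mp (Finset.mem_range.mp hi))
        gcongr
        exact h1.trans h2
    _ ≤ _ := by
        rw [← Finset.sum_mul]
        gcongr
        linarith

theorem exists_norm_eval_sub_leading_le (Q : ℂ[X]) {e : ℕ} (h : Q.natDegree = e) :
    ∃ C : ℝ, 0 < C ∧ ∀ z : ℂ, ‖Q.eval z - Q.leadingCoeff * z ^ e‖ ≤ C * (1 + ‖z‖) ^ (e - 1) := by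
  obtain ⟨C, hC, hb⟩ := exists_norm_eval_le Q.eraseLead (n := e - 1)
    (h ▸ Q.eraseLead_natDegree_le)
  refine ⟨C, hC, fun z => ?_⟩
  have : Q.eval z - Q.leadingCoeff * z ^ e = Q.eraseLead.eval z := by
    have h1 := congrArg (eval z) Q.eraseLead_add_monomial_natDegree_leadingCoeff
    rw [eval_add, eval_monomial, h] at h1
    rw [← h1]
    ring
  rw [this]
  exact hb z

theorem exists_one_add_pow_le_exp (n : ℕ) {δ : ℝ} (hδ : 0 < δ) :
    ∃ C : ℝ, 0 < C ∧ ∀ r : ℝ, 0 ≤ r → (1 + r) ^ n ≤ C * Real.exp (δ * r) := by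
  refine ⟨n.factorial / δ ^ n * Real.exp δ, by positivity, fun r hr => ?_⟩
  have := Real.pow_div_factorial_le_exp (δ * (1 + r)) (by positivity) n
  rw [mul_pow, div_le_iff₀ (by positivity)] at this
  rw [mul_assoc, ← Real.exp_add, show δ + δ * r = δ * (1 + r) by ring, div_mul_eq_mul_div,
    le_div_iff₀ (by positivity)]
  linarith

/-- The directions along which `exp (-Q)` decays. -/
def decayDirs (Q : ℂ[X]) : Set ℂ := {w | 0 < (Q.leadingCoeff * w ^ Q.natDegree).re}

theorem isOpen_decayDirs (Q : ℂ[X]) : IsOpen (decayDirs Q) :=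
  isOpen_lt continuous_const (by fun_prop)

/-- Compactness makes the positivity of the leading term uniform, even on a neighbourhood of `S`. By
homogeneity this term grows like `r ^ natDegree`; the lower order terms, smaller by a factor `r`,
take away at most half of it beyond `R`. -/
theorem cone_lower_bound (Q : ℂ[X]) (he : 1 ≤ Q.natDegree) {S : Set ℂ} (hS : IsCompact S)
    (hSQ : S ⊆ decayDirs Q) :
    ∃ ε > (0 : ℝ), ∃ δ > (0 : ℝ), ∃ R ≥ (1 : ℝ), ∀ r : ℝ, R ≤ r → ∀ w : ℂ, (∃ w₀ ∈ S, ‖w - w₀‖ ≤ ε) →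
      δ * r ^ Q.natDegree ≤ (Q.eval (r * w)).re := by
  obtain ⟨ε, hε, hεS⟩ := hS.exists_cthickening_subset_open (isOpen_decayDirs Q) hSQ
  have hK : IsCompact (Metric.cthickening ε S) := hS.cthickening
  obtain ⟨δ, hδ, hδK⟩ : ∃ δ > 0, ∀ w ∈ Metric.cthickening ε S,
      2 * δ ≤ (Q.leadingCoeff * w ^ Q.natDegree).re := by
    rcases (Metric.cthickening ε S).eq_empty_or_nonempty with h | h
    · exact ⟨1, one_pos, by simp [h]⟩
    · obtain ⟨w₁, hw₁, hmin⟩ := hK.exists_isMinOn h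
        (f := fun w => (Q.leadingCoeff * w ^ Q.natDegree).re) (by fun_prop)
      refine ⟨(Q.leadingCoeff * w₁ ^ Q.natDegree).re / 2, half_pos (hεS hw₁), fun w hw => ?_⟩
      have := hmin hw
      simp only [Set.mem_ofPred_eq] at this
      linarith
  obtain ⟨M, hM⟩ := hK.isBounded.exists_norm_le
  obtain ⟨C, hC, hlead⟩ := exists_norm_eval_sub_leading_le Q rfl
  set e := Q.natDegree
  refine ⟨ε, hε, δ, hδ, max 1 (C * (1 + |M|) ^ (e - 1) / δ), le_max_left _ _, ?_⟩
  rintro r hr w ⟨w₀, hw₀, hww⟩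
  have hr1 : 1 ≤ r := (le_max_left _ _).trans hr
  have hr2 : C * (1 + |M|) ^ (e - 1) ≤ r * δ := by
    rw [← div_le_iff₀ hδ]; exact (le_max_right _ _).trans hr
  have hw : w ∈ Metric.cthickening ε S :=
    Metric.mem_cthickening_of_dist_le w w₀ ε S hw₀ (by rwa [dist_eq_norm])
  have h1 := hlead (r * w)
  have h2 := hδK w hw
  have h3 : (Q.leadingCoeff * ((r : ℂ) * w) ^ e).re = r ^ e * (Q.leadingCoeff * w ^ e).re := by
    rw [mul_pow, show Q.leadingCoeff * ((r : ℂ) ^ e * w ^ e)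
      = ((r ^ e : ℝ) : ℂ) * (Q.leadingCoeff * w ^ e) by push_cast; ring, Complex.re_ofReal_mul]
  have h4 := (Complex.abs_re_le_norm _).trans h1
  rw [Complex.sub_re, h3] at h4
  have h5 : 1 + ‖(r : ℂ) * w‖ ≤ r * (1 + |M|) := by
    rw [norm_mul, Complex.norm_real, Real.norm_of_nonneg (by linarith)]
    have : ‖w‖ ≤ |M| := (hM w hw).trans (le_abs_self M)
    nlinarith
  have h6 : C * (1 + ‖(r : ℂ) * w‖) ^ (e - 1) ≤ r ^ e * δ := by
    calc _ ≤ C * (r * (1 + |M|)) ^ (e - 1) := by gcongr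
      _ = r ^ (e - 1) * (C * (1 + |M|) ^ (e - 1)) := by rw [mul_pow]; ring
      _ ≤ r ^ (e - 1) * (r * δ) := by gcongr
      _ = r ^ e * δ := by
        rw [← mul_assoc, ← pow_succ, Nat.sub_add_cancel he]
  have h7 := (abs_le.mp (h4.trans h6)).1
  nlinarith [pow_pos (by linarith : 0 < r) e]

/-- Exponential decay of `P exp (-Q)` near compact sets of decaying directions. -/
theorem cone_decay (P Q : ℂ[X]) (he : 1 ≤ Q.natDegree) {S : Set ℂ} (hS : IsCompact S)
    (hSQ : S ⊆ decayDirs Q) :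
    ∃ ε > (0 : ℝ), ∃ δ > (0 : ℝ), ∃ R ≥ (1 : ℝ), ∃ C > (0 : ℝ), ∀ r : ℝ, R ≤ r → ∀ w : ℂ, (∃ w₀ ∈ S, ‖w - w₀‖ ≤ ε) →
      ‖P.eval (r * w) * Complex.exp (-Q.eval (r * w))‖ ≤ C * Real.exp (-δ * r) := by
  obtain ⟨ε, hε, δ, hδ, R, hR, hlow⟩ := cone_lower_bound Q he hS hSQ
  obtain ⟨M, hM⟩ := hS.isBounded.exists_norm_le
  obtain ⟨C₁, hC₁, hP⟩ := exists_norm_eval_le P le_rfl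
  -- Half of the decay rate pays for the polynomial factor.
  obtain ⟨C₂, hC₂, hexp⟩ := exists_one_add_pow_le_exp P.natDegree (half_pos hδ)
  refine ⟨ε, hε, δ / 2, half_pos hδ, R, hR, C₁ * (1 + |M| + ε) ^ P.natDegree * C₂,
    by positivity, ?_⟩
  rintro r hr w ⟨w₀, hw₀, hww⟩
  have hr0 : 1 ≤ r := hR.trans hr
  have hwM : ‖w‖ ≤ |M| + ε := by
    calc ‖w‖ = ‖w₀ + (w - w₀)‖ := by ring_nf
      _ ≤ ‖w₀‖ + ‖w - w₀‖ := norm_add_le _ _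
      _ ≤ |M| + ε := add_le_add ((hM _ hw₀).trans (le_abs_self M)) hww
  have h1 : ‖P.eval ((r : ℂ) * w)‖ ≤ C₁ * (1 + |M| + ε) ^ P.natDegree *
      (C₂ * Real.exp (δ / 2 * r)) := by
    refine (hP _).trans ?_
    rw [mul_assoc]
    refine mul_le_mul_of_nonneg_left ?_ hC₁.le
    refine le_trans ?_ (mul_le_mul_of_nonneg_left (hexp r (by linarith)) (by positivity))
    rw [← mul_pow]
    refine pow_le_pow_left₀ (by positivity) ?_ _
    rw [norm_mul, Complex.norm_real, Real.norm_of_nonneg (by linarith)]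
    nlinarith [abs_nonneg M]
  have h2 : ‖Complex.exp (-Q.eval ((r : ℂ) * w))‖ ≤ Real.exp (-δ * r) := by
    rw [Complex.norm_exp, Real.exp_le_exp, Complex.neg_re]
    have := hlow r hr w ⟨w₀, hw₀, hww⟩
    have h3 : r ≤ r ^ Q.natDegree := le_self_pow₀ hr0 (by omega)
    nlinarith
  rw [norm_mul]
  calc _ ≤ (C₁ * (1 + |M| + ε) ^ P.natDegree * (C₂ * Real.exp (δ / 2 * r))) *
        Real.exp (-δ * r) := by gcongr
    _ = C₁ * (1 + |M| + ε) ^ P.natDegree * C₂ *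
        (Real.exp (δ / 2 * r) * Real.exp (-δ * r)) := by ring
    _ = _ := by rw [← Real.exp_add]; congr 2; ring

/-- A primitive of `P exp (-Q)` takes the same limit along all curves whose directions tend to a
point of the same decaying sector. -/
theorem tendsto_primitive_of_segment {P Q : ℂ[X]} (he : 1 ≤ Q.natDegree) {Φ : ℂ → ℂ}
    (hΦ : ∀ z, HasDerivAt Φ (P.eval z * Complex.exp (-Q.eval z)) z) {w₁ w₂ : ℂ}
    (hseg : segment ℝ w₁ w₂ ⊆ decayDirs Q) {ι : Type*} {l : Filter ι} {r : ι → ℝ} {z : ι → ℂ}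
    (hr : Tendsto r l atTop) (hz : Tendsto (fun i => z i / (r i : ℂ)) l (𝓝 w₁)) {a : ℂ}
    (ha : Tendsto (fun v : ℝ => Φ (v * w₂)) atTop (𝓝 a)) :
    Tendsto (fun i => Φ (z i)) l (𝓝 a) := by
  have hcomp : IsCompact (segment ℝ w₁ w₂) := by
    rw [segment_eq_image_lineMap]
    exact isCompact_Icc.image (by fun_prop)
  obtain ⟨ε, hε, δ, hδ, R, hR, C, hC, hdec⟩ := cone_decay P Q he hcomp hseg
  -- The two points are joined by a straight segment which, divided by `r i`, stays in the
  -- `ε`-neighbourhood of `segment ℝ w₁ w₂`. The derivative of `Φ` is exponentially small on it,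
  -- while its length is only `O(r i)`.
  have key : ∀ᶠ i in l, ‖Φ (z i) - Φ (r i * w₂)‖ ≤
      (C * Real.exp (-δ * r i)) * (r i * (‖w₁ - w₂‖ + ε)) := by
    have h1 : ∀ᶠ i in l, ‖z i / (r i : ℂ) - w₁‖ < ε := by
      have := (Metric.tendsto_nhds.mp hz) ε hε
      simpa [dist_eq_norm] using this
    filter_upwards [h1, hr.eventually_ge_atTop R] with i hi hri
    have hr0 : 0 < r i := by linarith
    have hr0' : (r i : ℂ) ≠ 0 := by exact_mod_cast hr0.ne'
    set q := z i / (r i : ℂ) with hq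
    have hzq : z i = r i * q := by rw [hq]; field_simp
    have hb : ∀ x ∈ segment ℝ ((r i : ℂ) * w₂) (z i),
        ‖P.eval x * Complex.exp (-Q.eval x)‖ ≤ C * Real.exp (-δ * r i) := by
      rintro x ⟨s, t, hs, ht, hst, rfl⟩
      have : s • ((r i : ℂ) * w₂) + t • z i = r i * (s • w₂ + t • q) := by
        rw [hzq]; simp only [Complex.real_smul]; ring
      rw [this]
      refine hdec _ hri _ ⟨t • w₁ + s • w₂, ⟨t, s, ht, hs, by linarith, rfl⟩, ?_⟩
      rw [show s • w₂ + t • q - (t • w₁ + s • w₂) = t • (q - w₁) by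
        simp only [Complex.real_smul]; ring, norm_smul, Real.norm_of_nonneg ht]
      nlinarith [norm_nonneg (q - w₁)]
    have := Convex.norm_image_sub_le_of_norm_hasDerivWithin_le
      (fun x _ => (hΦ x).hasDerivWithinAt) hb (convex_segment _ _)
      (left_mem_segment ℝ _ _) (right_mem_segment ℝ _ _)
    refine this.trans (mul_le_mul_of_nonneg_left ?_ (by positivity))
    rw [hzq, ← mul_sub, norm_mul, Complex.norm_real, Real.norm_of_nonneg hr0.le]
    refine mul_le_mul_of_nonneg_left ?_ hr0.le
    calc ‖q - w₂‖ = ‖(w₁ - w₂) + (q - w₁)‖ := by ring_nf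
      _ ≤ ‖w₁ - w₂‖ + ε := (norm_add_le _ _).trans (by linarith)
  have hlim : Tendsto (fun i => (C * Real.exp (-δ * r i)) * (r i * (‖w₁ - w₂‖ + ε))) l (𝓝 0) := by
    have h0 : Tendsto (fun x : ℝ => x ^ (1 : ℝ) * Real.exp (-δ * x)) atTop (𝓝 0) :=
      tendsto_rpow_mul_exp_neg_mul_atTop_nhds_zero 1 δ hδ
    have := (h0.comp hr).mul_const (C * (‖w₁ - w₂‖ + ε))
    simp only [zero_mul] at this
    refine this.congr fun i => ?_
    simp only [Function.comp, Real.rpow_one]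
    ring
  have h2 : Tendsto (fun i => Φ (z i) - Φ (r i * w₂)) l (𝓝 0) := squeeze_zero_norm' key hlim
  have h3 := h2.add (ha.comp hr)
  simpa using h3

/-- The derivative along the ray decays exponentially, hence is integrable. -/
theorem exists_tendsto_primitive {P Q : ℂ[X]} (he : 1 ≤ Q.natDegree) {Φ : ℂ → ℂ}
    (hΦ : ∀ z, HasDerivAt Φ (P.eval z * Complex.exp (-Q.eval z)) z) {w : ℂ}
    (hw : w ∈ decayDirs Q) : ∃ a, Tendsto (fun v : ℝ => Φ (v * w)) atTop (𝓝 a) := by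
  obtain ⟨ε, hε, δ, hδ, R, hR, C, hC, hdec⟩ :=
    cone_decay P Q he (isCompact_singleton (x := w)) (by simpa using hw)
  have hd : ∀ v : ℝ, HasDerivAt (fun v : ℝ => Φ (v * w))
      (P.eval (v * w) * Complex.exp (-Q.eval (v * w)) * w) v := fun v => by
    have h1 : HasDerivAt (fun v : ℝ => (v : ℂ) * w) w v := by
      simpa using (Complex.ofRealCLM.hasDerivAt (x := v)).mul_const w
    exact (hΦ _).comp v h1
  have hint : MeasureTheory.IntegrableOn
      (fun v : ℝ => P.eval (v * w) * Complex.exp (-Q.eval (v * w)) * w) (Set.Ioi R) := by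
    have hexp := (exp_neg_integrableOn_Ioi R hδ).const_mul (C * ‖w‖)
    refine MeasureTheory.Integrable.mono' hexp ?_ ?_
    · exact Continuous.aestronglyMeasurable (by fun_prop)
    · filter_upwards [MeasureTheory.ae_restrict_mem measurableSet_Ioi] with v hv
      rw [norm_mul]
      have := hdec v (le_of_lt hv) w ⟨w, rfl, by simpa using hε.le⟩
      nlinarith [norm_nonneg w]
  exact ⟨_, MeasureTheory.tendsto_limUnder_of_hasDerivAt_of_integrableOn_Ioi
    (fun v _ => hd v) hint⟩

/-- Mean value inequality for `γ t - t u` on `[t₀, ∞)`, where the derivative is below `ε / 2`; the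
value at `t₀` disappears after division by `t`. -/
theorem tendsto_div_of_tendsto_deriv {γ : ℝ → ℂ} (hγ : Differentiable ℝ γ) {u : ℂ}
    (hu : Tendsto (deriv γ) atTop (𝓝 u)) :
    Tendsto (fun t : ℝ => γ t / (t : ℂ)) atTop (𝓝 u) := by
  rw [Metric.tendsto_nhds]
  intro ε hε
  obtain ⟨t₀, ht₀⟩ := (Metric.tendsto_nhds.mp hu (ε / 2) (half_pos hε)).exists_forall_of_atTop
  have hd : ∀ t ≥ t₀, ‖(γ t - t * u) - (γ t₀ - t₀ * u)‖ ≤ ε / 2 * ‖t - t₀‖ := fun t ht => by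
    refine Convex.norm_image_sub_le_of_norm_hasDerivWithin_le (s := Set.Ici t₀)
      (f := fun t : ℝ => γ t - t * u) (f' := fun t => deriv γ t - u) ?_ ?_ (convex_Ici _)
      Set.self_mem_Ici ht
    · intro x _
      refine (HasDerivAt.sub (hγ x).hasDerivAt ?_).hasDerivWithinAt
      simpa using (Complex.ofRealCLM.hasDerivAt (x := x)).mul_const u
    · intro x hx
      have := ht₀ x hx
      rw [dist_eq_norm] at this
      exact this.le
  have hsmall : Tendsto (fun t : ℝ => ‖γ t₀ - t₀ * u‖ / t) atTop (𝓝 0) :=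
    tendsto_const_nhds.div_atTop tendsto_id
  -- With `|t₀| < t / 2` and an initial value below `ε t / 8` the total is less than `(3/4 + 1/8) ε
  -- t`.
  filter_upwards [eventually_ge_atTop t₀, eventually_gt_atTop (max 0 (-t₀)),
    hsmall.eventually_lt_const (show (0 : ℝ) < ε / 8 by positivity),
    (tendsto_const_nhds (x := |t₀|) |>.div_atTop tendsto_id).eventually_lt_const
      (show (0 : ℝ) < 1 / 2 by norm_num)] with t h1 h2 h3 h4
  have ht : 0 < t := (le_max_left _ _).trans_lt h2
  have htc : (t : ℂ) ≠ 0 := by exact_mod_cast ht.ne'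
  have h5 := hd t h1
  rw [dist_eq_norm, show γ t / (t : ℂ) - u = (γ t - t * u) / t by field_simp, norm_div,
    Complex.norm_real, Real.norm_of_nonneg ht.le, div_lt_iff₀ ht]
  simp only [id] at h4
  rw [div_lt_iff₀ ht] at h3 h4
  have h6 : ‖t - t₀‖ ≤ t + |t₀| := by
    rw [Real.norm_eq_abs]
    exact (abs_sub _ _).trans_eq (by rw [abs_of_pos ht])
  have h7 : ‖γ t - t * u‖ ≤ ε / 2 * ‖t - t₀‖ + ‖γ t₀ - t₀ * u‖ := by
    calc _ = ‖((γ t - t * u) - (γ t₀ - t₀ * u)) + (γ t₀ - t₀ * u)‖ := by ring_nf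
      _ ≤ _ := (norm_add_le _ _).trans (by linarith)
  nlinarith

/-- The contour traversed backwards. -/
noncomputable def Contour.reverse (γ : Contour) : Contour where
  toFun t := γ.toFun (-t)
  contDiff := γ.contDiff.comp contDiff_neg
  startDir := γ.endDir
  endDir := γ.startDir
  tendsto_start := by
    have : deriv (fun t => γ.toFun (-t)) = fun t => -deriv γ.toFun (-t) := by
      ext t; exact deriv_comp_neg _ _
    rw [this]
    exact (γ.tendsto_end.comp tendsto_neg_atBot_atTop).neg
  tendsto_end := by
    have : deriv (fun t => γ.toFun (-t)) = fun t => -deriv γ.toFun (-t) := by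
      ext t; exact deriv_comp_neg _ _
    rw [this]
    simpa using (γ.tendsto_start.comp tendsto_neg_atTop_atBot).neg

theorem Contour.differentiable (γ : Contour) : Differentiable ℝ γ.toFun :=
  γ.contDiff.differentiable one_ne_zero

theorem Contour.continuous_deriv (γ : Contour) : Continuous (deriv γ.toFun) :=
  γ.contDiff.continuous_deriv le_rfl

theorem Contour.deriv_reverse (γ : Contour) (t : ℝ) :
    deriv γ.reverse.toFun t = -deriv γ.toFun (-t) := deriv_comp_neg _ _

theorem Contour.tendsto_div_end (γ : Contour) :
    Tendsto (fun t : ℝ => γ.toFun t / (t : ℂ)) atTop (𝓝 γ.endDir) :=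
  tendsto_div_of_tendsto_deriv γ.differentiable γ.tendsto_end

theorem Contour.exists_norm_deriv_le (γ : Contour) : ∃ C > 0, ∀ t, ‖deriv γ.toFun t‖ ≤ C := by
  have h1 := γ.tendsto_end.norm.eventually_le_const (lt_add_one _)
  have h2 := γ.tendsto_start.norm.eventually_le_const (lt_add_one _)
  obtain ⟨a, ha⟩ := h1.exists_forall_of_atTop
  obtain ⟨b, hb⟩ := h2.exists_forall_of_atBot
  obtain ⟨C, hC⟩ := (isCompact_Icc (a := b) (b := a)).exists_bound_of_continuousOn
    γ.continuous_deriv.continuousOn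
  refine ⟨(‖γ.endDir‖ + 1) + (‖-γ.startDir‖ + 1) + |C|, by positivity, fun t => ?_⟩
  have e1 := norm_nonneg γ.endDir
  have e2 := norm_nonneg (-γ.startDir)
  have e3 := abs_nonneg C
  rcases le_total a t with h | h
  · linarith [ha t h]
  rcases le_total t b with h' | h'
  · linarith [hb t h']
  · linarith [hC t ⟨h', h⟩, le_abs_self C]

/-- Eventual exponential decay of `P exp (-Q)` at the end of a contour. -/
theorem Contour.exists_decay_end (γ : Contour) (P Q : ℂ[X]) (he : 1 ≤ Q.natDegree)
    (h : γ.endDir ∈ decayDirs Q) :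
    ∃ δ > (0 : ℝ), ∃ C > (0 : ℝ), ∀ᶠ t : ℝ in atTop,
      ‖P.eval (γ.toFun t) * Complex.exp (-Q.eval (γ.toFun t))‖ ≤ C * Real.exp (-δ * t) := by
  obtain ⟨ε, hε, δ, hδ, R, hR, C, hC, hdec⟩ :=
    cone_decay P Q he (isCompact_singleton (x := γ.endDir)) (by simpa using h)
  refine ⟨δ, hδ, C, hC, ?_⟩
  have h1 := Metric.tendsto_nhds.mp γ.tendsto_div_end ε hε
  filter_upwards [h1, eventually_ge_atTop R] with t ht htR
  have h0 : (t : ℂ) ≠ 0 := by exact_mod_cast (show (0:ℝ) < t by linarith).ne'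
  have := hdec t htR (γ.toFun t / t) ⟨_, rfl, by rw [dist_eq_norm] at ht; exact ht.le⟩
  rwa [mul_div_cancel₀ _ h0] at this

theorem integrable_of_isBigO_exp_neg_both {f : ℝ → ℂ} (hf : Continuous f) {δ δ' : ℝ} (hδ : 0 < δ)
    (hδ' : 0 < δ') (h : f =O[atTop] fun t : ℝ => Real.exp (-δ * t))
    (h' : (fun t => f (-t)) =O[atTop] fun t : ℝ => Real.exp (-δ' * t)) :
    MeasureTheory.Integrable f := by
  refine hf.locallyIntegrable.integrable_of_isBigO_atBot_atTop
    (g := fun t : ℝ => Real.exp (δ' * t)) (g' := fun t : ℝ => Real.exp (-δ * t)) ?_ ?_ h ?_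
  · have := h'.comp_tendsto tendsto_neg_atBot_atTop
    simpa [Function.comp_def] using this
  · exact ⟨Set.Iic 0, Iic_mem_atBot 0, integrableOn_exp_mul_Iic hδ' 0⟩
  · exact ⟨Set.Ioi 0, Ioi_mem_atTop 0, exp_neg_integrableOn_Ioi 0 hδ⟩

theorem Contour.exists_isBigO_end (γ : Contour) (P Q : ℂ[X]) (he : 1 ≤ Q.natDegree)
    (h : γ.endDir ∈ decayDirs Q) : ∃ δ > (0 : ℝ), (fun t : ℝ =>
      P.eval (γ.toFun t) * Complex.exp (-Q.eval (γ.toFun t)) * deriv γ.toFun t) =O[atTop]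
        fun t : ℝ => Real.exp (-δ * t) := by
  obtain ⟨δ, hδ, C, hC, hev⟩ := γ.exists_decay_end P Q he h
  obtain ⟨D, hD, hder⟩ := γ.exists_norm_deriv_le
  refine ⟨δ, hδ, Asymptotics.IsBigO.of_bound (C * D) ?_⟩
  filter_upwards [hev] with t ht
  rw [norm_mul, Real.norm_of_nonneg (Real.exp_pos _).le]
  calc _ ≤ (C * Real.exp (-δ * t)) * D := by gcongr; exact hder t
    _ = _ := by ring

theorem Contour.integrable (γ : Contour) (P Q : ℂ[X]) (he : 1 ≤ Q.natDegree)
    (h : γ.endDir ∈ decayDirs Q) (h' : γ.startDir ∈ decayDirs Q) :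
    MeasureTheory.Integrable (fun t : ℝ =>
      P.eval (γ.toFun t) * Complex.exp (-Q.eval (γ.toFun t)) * deriv γ.toFun t) := by
  obtain ⟨δ, hδ, hO⟩ := γ.exists_isBigO_end P Q he h
  obtain ⟨δ', hδ', hO'⟩ := γ.reverse.exists_isBigO_end P Q he h'
  refine integrable_of_isBigO_exp_neg_both ?_ hδ hδ' hO ?_
  · have := γ.differentiable.continuous
    have := γ.continuous_deriv
    fun_prop
  · simp only [γ.deriv_reverse, mul_neg] at hO'
    simpa using! hO'.neg_left

/-- The integral of `P exp (-Q)` along a contour is the difference of the limits of a primitive. -/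
theorem Contour.integral_eq_sub {P Q : ℂ[X]} (γ : Contour) (he : 1 ≤ Q.natDegree) {Φ : ℂ → ℂ}
    (hΦ : ∀ z, HasDerivAt Φ (P.eval z * Complex.exp (-Q.eval z)) z) {w w' a a' : ℂ}
    (hw : segment ℝ γ.endDir w ⊆ decayDirs Q) (hw' : segment ℝ γ.startDir w' ⊆ decayDirs Q)
    (ha : Tendsto (fun v : ℝ => Φ (v * w)) atTop (𝓝 a))
    (ha' : Tendsto (fun v : ℝ => Φ (v * w')) atTop (𝓝 a')) :
    γ.integral (fun z => P.eval z * Complex.exp (-Q.eval z)) = a - a' := by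
  refine MeasureTheory.integral_of_hasDerivAt_of_tendsto (f := fun t => Φ (γ.toFun t))
    (fun t => (hΦ _).comp t (γ.differentiable t).hasDerivAt)
    (γ.integrable P Q he (hw (left_mem_segment ℝ _ _)) (hw' (left_mem_segment ℝ _ _))) ?_ ?_
  -- The start of the contour is the end of the reversed one.
  · have := tendsto_primitive_of_segment he hΦ hw' tendsto_id γ.reverse.tendsto_div_end ha'
    have := this.comp tendsto_neg_atBot_atTop
    simpa [Contour.reverse, Function.comp_def] using this
  · exact tendsto_primitive_of_segment he hΦ hw tendsto_id γ.tendsto_div_end ha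


/-! ### Laplace's method with an error uniform in the coefficients. -/

theorem exp_taylor_two (z : ℂ) : ‖Complex.exp z - 1 - z‖ ≤ ‖z‖ ^ 2 * Real.exp ‖z‖ := by
  have := Complex.norm_exp_sub_sum_le_norm_mul_exp z 2
  simpa [Finset.sum_range_succ, sub_sub] using this

theorem intervalIntegral_odd_eq_zero {f : ℝ → ℂ} (hf : ∀ v, f (-v) = -f v) (δ : ℝ) :
    ∫ v in -δ..δ, f v = 0 := by
  have h1 : ∫ v in -δ..δ, f (-v) = ∫ v in -δ..δ, f v := by
    rw [intervalIntegral.integral_comp_neg]; simp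
  simp only [hf, intervalIntegral.integral_neg] at h1
  exact self_eq_neg.mp h1.symm

theorem norm_sum_mul_pow_le {n : ℕ} {C : ℝ} {a : ℕ → ℂ} (ha : ∀ k, ‖a k‖ ≤ C) {v : ℂ}
    (hv : ‖v‖ ≤ 1) : ‖∑ k ∈ Finset.range n, a k * v ^ k‖ ≤ n * C := by
  refine (norm_sum_le _ _).trans ?_
  calc ∑ k ∈ Finset.range n, ‖a k * v ^ k‖ ≤ ∑ k ∈ Finset.range n, C := by
        refine Finset.sum_le_sum fun k _ => ?_
        rw [norm_mul, norm_pow]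
        have h0 := norm_nonneg (a k)
        have := pow_le_one₀ (n := k) (norm_nonneg v) hv
        nlinarith [ha k]
    _ = n * C := by simp

theorem sum_range_add_two (a : ℕ → ℂ) (n : ℕ) (v : ℂ) :
    ∑ k ∈ Finset.range (n + 2), a k * v ^ k =
      a 0 + a 1 * v + (∑ k ∈ Finset.range n, a (k + 2) * v ^ k) * v ^ 2 := by
  rw [Finset.sum_range_succ', Finset.sum_range_succ', Finset.sum_mul]
  simp only [pow_zero, mul_one, zero_add, pow_one]
  have : ∀ k ∈ Finset.range n, a (k + 1 + 1) * v ^ (k + 1 + 1) = a (k + 2) * v ^ k * v ^ 2 :=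
    fun k _ => by ring
  rw [Finset.sum_congr rfl this]
  ring

/-- In the variable `X = B w²` every term of the remainder is a polynomial in `X` of degree at most
three, divided by `B`. This is the origin of the relative error `1 / B`. -/
theorem laplace_remainder_le {M B w X E : ℝ} (hM : 1 ≤ M) (hB0 : 0 < B) (hX : X = B * w ^ 2)
    (hX0 : 0 ≤ X) (hE : 1 ≤ E) :
    (M * w ^ 2 + M * B * M * w ^ 4 + (2 * M * w) * (2 * M * B * w ^ 3)) +
      3 * M * ((2 * M * B * w ^ 3) ^ 2 * E) ≤ 18 * M ^ 3 / B * (1 + X) ^ 3 * E := by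
  have hM2 : M ≤ M ^ 3 := le_self_pow₀ hM (by norm_num)
  have hM3 : M ^ 2 ≤ M ^ 3 := pow_le_pow_right₀ hM (by norm_num)
  have u3 : 0 ≤ M ^ 3 := by positivity
  have u4 : X + 5 * X ^ 2 + 12 * X ^ 3 ≤ 18 * (1 + X) ^ 3 := by
    nlinarith [pow_nonneg hX0 2, pow_nonneg hX0 3]
  have u1 : M * X ≤ M ^ 3 * X := by gcongr
  have u2 : M ^ 2 * X ^ 2 ≤ M ^ 3 * X ^ 2 := by gcongr
  have u5 : M ^ 3 * (X + 5 * X ^ 2 + 12 * X ^ 3) ≤ M ^ 3 * (18 * (1 + X) ^ 3) := by gcongr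
  have s4 : M * X + 5 * M ^ 2 * X ^ 2 + 12 * M ^ 3 * X ^ 3 ≤ 18 * M ^ 3 * (1 + X) ^ 3 := by
    linarith
  have s2 : (M * w ^ 2 + M * B * M * w ^ 4 + (2 * M * w) * (2 * M * B * w ^ 3)) =
      (M * X + 5 * M ^ 2 * X ^ 2) / B := by rw [eq_div_iff hB0.ne', hX]; ring
  have s3 : 3 * M * ((2 * M * B * w ^ 3) ^ 2 * E) = 12 * M ^ 3 * X ^ 3 / B * E := by
    rw [div_mul_eq_mul_div, eq_div_iff hB0.ne', hX]; ring
  rw [s2, s3]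
  have hM0 : 0 ≤ M := by linarith
  calc _ ≤ (M * X + 5 * M ^ 2 * X ^ 2) / B * E + 12 * M ^ 3 * X ^ 3 / B * E := by
        gcongr
        exact le_mul_of_one_le_right (by positivity) hE
    _ = (M * X + 5 * M ^ 2 * X ^ 2 + 12 * M ^ 3 * X ^ 3) / B * E := by ring
    _ ≤ 18 * M ^ 3 * (1 + X) ^ 3 / B * E := by gcongr
    _ = _ := by ring

/-- Relative to the Gaussian `exp (B a₀ v²)`, the cubic and higher terms of the exponent form a
small quantity `z`. When `exp z` is expanded to first order, the terms of relative size `B^{-1/2}`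
are odd in `v`; they are subtracted here, and all that is left is `O(1 / B)`. With `X = B v²`, the
decay `c₀ X` of the Gaussian is shared: `c₀ / 2` pays for `exp ‖z‖`, `c₀ / 4` for the polynomial in
`X`, and `c₀ / 4` remains. -/
theorem laplace_pointwise {n : ℕ} {M c₀ C₃ : ℝ} (hM : 1 ≤ M)
    (hC₃ : ∀ r : ℝ, 0 ≤ r → (1 + r) ^ 3 ≤ C₃ * Real.exp (c₀ / 4 * r))
    {B : ℝ} (hB : 1 ≤ B) {a b : ℕ → ℂ} {C : ℝ} (hCM : C ≤ M) (hnC : n * C ≤ M)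
    (ha : ∀ k, ‖a k‖ ≤ C) (hb : ∀ k, ‖b k‖ ≤ C) (ha₀ : (a 0).re ≤ -c₀) {v : ℝ} (hv : |v| ≤ 1)
    (hv' : 4 * M * |v| ≤ c₀) :
    ‖(∑ k ∈ Finset.range (n + 2), b k * (v : ℂ) ^ k) *
        Complex.exp (B * ((∑ k ∈ Finset.range (n + 2), a k * (v : ℂ) ^ k) * (v : ℂ) ^ 2)) -
      (b 1 * v + b 0 * (B * a 1) * v ^ 3) * Complex.exp (B * a 0 * v ^ 2) -
      b 0 * Complex.exp (B * a 0 * v ^ 2)‖ ≤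
      18 * M ^ 3 * C₃ / B * Real.exp (-(c₀ / 4 * B) * v ^ 2) := by
  rw [sum_range_add_two, sum_range_add_two]
  have hvc : ‖(v : ℂ)‖ ≤ 1 := by rwa [Complex.norm_real]
  have hβ := (norm_sum_mul_pow_le (n := n) (fun k => hb (k + 2)) hvc).trans hnC
  have hρ := (norm_sum_mul_pow_le (n := n) (fun k => ha (k + 2)) hvc).trans hnC
  set β := ∑ k ∈ Finset.range n, b (k + 2) * (v : ℂ) ^ k
  set ρ := ∑ k ∈ Finset.range n, a (k + 2) * (v : ℂ) ^ k
  set w := |v| with hw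
  have hw0 : 0 ≤ w := abs_nonneg v
  have hvn : ‖(v : ℂ)‖ = w := by rw [Complex.norm_real, Real.norm_eq_abs]
  have hv2 : v ^ 2 = w ^ 2 := (sq_abs v).symm
  have hB0 : 0 < B := by linarith
  have ha1 := (ha 1).trans hCM
  have hb0 := (hb 0).trans hCM
  have hb1 := (hb 1).trans hCM
  set z : ℂ := B * (a 1 * v ^ 3 + ρ * v ^ 4) with hz
  have hBn : ‖(B : ℂ)‖ = B := by rw [Complex.norm_real, Real.norm_of_nonneg hB0.le]
  have hzn : ‖z‖ ≤ 2 * M * B * w ^ 3 := by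
    rw [hz, norm_mul, hBn]
    have h1 : ‖a 1 * (v : ℂ) ^ 3 + ρ * v ^ 4‖ ≤ M * w ^ 3 + M * w ^ 3 := by
      refine (norm_add_le _ _).trans (add_le_add ?_ ?_)
      · rw [norm_mul, norm_pow, hvn]; gcongr
      · rw [norm_mul, norm_pow, hvn]
        have : w ^ 4 ≤ w ^ 3 := pow_le_pow_of_le_one hw0 hv (by norm_num)
        gcongr
    nlinarith
  set X := B * w ^ 2 with hX
  have hX0 : 0 ≤ X := by positivity
  have hzX : ‖z‖ ≤ c₀ / 2 * X := hzn.trans (by nlinarith [mul_nonneg hB0.le (sq_nonneg w)])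
  have hG : Complex.exp (B * ((a 0 + a 1 * v + ρ * v ^ 2) * (v : ℂ) ^ 2)) =
      Complex.exp z * Complex.exp (B * a 0 * v ^ 2) := by
    rw [← Complex.exp_add]; congr 1; rw [hz]; ring
  have hGn : ‖Complex.exp (B * a 0 * (v : ℂ) ^ 2)‖ ≤ Real.exp (-c₀ * X) := by
    rw [Complex.norm_exp, Real.exp_le_exp,
      show (B : ℂ) * a 0 * (v : ℂ) ^ 2 = ((B * v ^ 2 : ℝ) : ℂ) * a 0 by push_cast; ring,
      Complex.re_ofReal_mul, hv2]
    nlinarith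
  have hR := exp_taylor_two z
  set R := Complex.exp z - 1 - z with hRdef
  have hez : Complex.exp z = 1 + z + R := by rw [hRdef]; ring
  rw [hG, hez]
  set G := Complex.exp (B * a 0 * (v : ℂ) ^ 2)
  set h := b 0 + b 1 * (v : ℂ) + β * v ^ 2 with hh
  have hhn : ‖h‖ ≤ 3 * M := by
    have e1 : ‖b 1 * (v : ℂ)‖ ≤ M := by rw [norm_mul, hvn]; nlinarith [norm_nonneg (b 1)]
    have e2 : ‖β * (v : ℂ) ^ 2‖ ≤ M := by
      rw [norm_mul, norm_pow, hvn]
      have : w ^ 2 ≤ 1 := pow_le_one₀ hw0 hv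
      nlinarith [norm_nonneg β]
    calc _ ≤ ‖b 0‖ + ‖b 1 * (v : ℂ)‖ + ‖β * (v : ℂ) ^ 2‖ := norm_add₃_le
      _ ≤ M + M + M := add_le_add_three hb0 e1 e2
      _ = _ := by ring
  have hid : h * ((1 + z + R) * G) - (b 1 * v + b 0 * (B * a 1) * v ^ 3) * G - b 0 * G =
      (β * v ^ 2 + b 0 * B * ρ * v ^ 4 + (b 1 * v + β * v ^ 2) * z + h * R) * G := by
    rw [hh, hz]; ring
  rw [hid, norm_mul]
  have hw21 : w ^ 2 ≤ w := by nlinarith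
  have t1 : ‖β * (v : ℂ) ^ 2‖ ≤ M * w ^ 2 := by rw [norm_mul, norm_pow, hvn]; gcongr
  have t2 : ‖b 0 * B * ρ * (v : ℂ) ^ 4‖ ≤ M * B * M * w ^ 4 := by
    rw [norm_mul, norm_mul, norm_mul, norm_pow, hvn, hBn]; gcongr
  have t3 : ‖(b 1 * v + β * (v : ℂ) ^ 2) * z‖ ≤ (2 * M * w) * (2 * M * B * w ^ 3) := by
    rw [norm_mul]
    refine mul_le_mul ?_ hzn (norm_nonneg _) (by positivity)
    refine (norm_add_le _ _).trans ?_
    rw [norm_mul, hvn]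
    nlinarith [mul_le_mul_of_nonneg_right hb1 hw0]
  have t4 : ‖h * R‖ ≤ 3 * M * ((2 * M * B * w ^ 3) ^ 2 * Real.exp (c₀ / 2 * X)) := by
    rw [norm_mul]
    refine mul_le_mul hhn (hR.trans ?_) (norm_nonneg _) (by positivity)
    gcongr
  have hE1 : 1 ≤ Real.exp (c₀ / 2 * X) := Real.one_le_exp ((norm_nonneg z).trans hzX)
  have hrem : ‖β * (v : ℂ) ^ 2 + b 0 * B * ρ * v ^ 4 + (b 1 * v + β * v ^ 2) * z + h * R‖ ≤
      18 * M ^ 3 / B * (1 + X) ^ 3 * Real.exp (c₀ / 2 * X) := by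
    have s1 : ‖β * (v : ℂ) ^ 2 + b 0 * B * ρ * v ^ 4 + (b 1 * v + β * v ^ 2) * z + h * R‖ ≤
        (M * w ^ 2 + M * B * M * w ^ 4 + (2 * M * w) * (2 * M * B * w ^ 3)) +
          3 * M * ((2 * M * B * w ^ 3) ^ 2 * Real.exp (c₀ / 2 * X)) :=
      (norm_add_le _ _).trans (add_le_add (norm_add₃_le.trans (by linarith)) t4)
    exact s1.trans (laplace_remainder_le hM hB0 hX hX0 hE1)
  calc _ ≤ (18 * M ^ 3 / B * (1 + X) ^ 3 * Real.exp (c₀ / 2 * X)) * Real.exp (-c₀ * X) := by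
        gcongr
    _ ≤ (18 * M ^ 3 / B * (C₃ * Real.exp (c₀ / 4 * X)) * Real.exp (c₀ / 2 * X)) *
        Real.exp (-c₀ * X) := by gcongr; exact hC₃ X hX0
    _ = 18 * M ^ 3 * C₃ / B * (Real.exp (c₀ / 4 * X) * Real.exp (c₀ / 2 * X) *
        Real.exp (-c₀ * X)) := by ring
    _ = _ := by
        rw [← Real.exp_add, ← Real.exp_add, hX, hv2]
        congr 2; ring

/-- Laplace's method with relative error `O(1/B)`, uniformly in the coefficients. -/
theorem laplace (n : ℕ) (C : ℝ) {c₀ : ℝ} (hc₀ : 0 < c₀) :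
    ∃ δ₀ > (0 : ℝ), ∀ δ : ℝ, 0 < δ → δ ≤ δ₀ → ∃ K : ℝ, ∀ B : ℝ, 1 ≤ B → ∀ a b : ℕ → ℂ,
      (∀ k, ‖a k‖ ≤ C) → (∀ k, ‖b k‖ ≤ C) → (a 0).re ≤ -c₀ →
      ‖(∫ v in -δ..δ, (∑ k ∈ Finset.range (n + 2), b k * (v : ℂ) ^ k) *
          Complex.exp (B * ((∑ k ∈ Finset.range (n + 2), a k * (v : ℂ) ^ k) * (v : ℂ) ^ 2))) -
        b 0 * (Real.pi / (-(B * a 0))) ^ (1 / 2 : ℂ)‖ ≤ K / (B * √B) := by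
  obtain ⟨C₃, hC₃, hexp⟩ := exists_one_add_pow_le_exp 3 (show (0 : ℝ) < c₀ / 4 by positivity)
  set M := (n + 1) * |C| + 1 with hM
  have hM1 : 1 ≤ M := by rw [hM]; nlinarith [abs_nonneg C]
  have hnC : n * |C| ≤ M := by rw [hM]; nlinarith [abs_nonneg C]
  have hCM : |C| ≤ M := by rw [hM]; nlinarith [abs_nonneg C, (Nat.cast_nonneg n : (0 : ℝ) ≤ n)]
  refine ⟨min 1 (c₀ / (4 * M)), by positivity, fun δ hδ hδ₀ => ?_⟩
  have hδ1 : δ ≤ 1 := hδ₀.trans (min_le_left _ _)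
  have hδ2 : 4 * M * δ ≤ c₀ := by
    have := hδ₀.trans (min_le_right _ _)
    rw [le_div_iff₀ (by positivity)] at this
    linarith
  set K₁ := 18 * M ^ 3 * C₃ + |C| * C₃ / δ ^ 2 with hK₁
  refine ⟨K₁ * √(Real.pi / (c₀ / 4)), fun B hB a b ha hb ha₀ => ?_⟩
  have hB0 : 0 < B := by linarith
  have ha' : ∀ k, ‖a k‖ ≤ |C| := fun k => (ha k).trans (le_abs_self C)
  have hb' : ∀ k, ‖b k‖ ≤ |C| := fun k => (hb k).trans (le_abs_self C)
  set H : ℝ → ℂ := fun v => (∑ k ∈ Finset.range (n + 2), b k * (v : ℂ) ^ k) *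
    Complex.exp (B * ((∑ k ∈ Finset.range (n + 2), a k * (v : ℂ) ^ k) * (v : ℂ) ^ 2)) with hH
  set G : ℝ → ℂ := fun v => Complex.exp (B * a 0 * v ^ 2) with hG
  -- The odd correction. Subtracting it costs nothing, as its integral over `[-δ, δ]` vanishes.
  set O : ℝ → ℂ := fun v => (b 1 * v + b 0 * (B * a 1) * v ^ 3) * G v with hO
  have hre : 0 < (-(B * a 0) : ℂ).re := by
    rw [Complex.neg_re, Complex.re_ofReal_mul]; nlinarith
  have hGint : MeasureTheory.Integrable G := by
    have := integrable_cexp_neg_mul_sq hre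
    simpa [hG] using this
  have hgauss : ∫ v, G v = (Real.pi / (-(B * a 0))) ^ (1 / 2 : ℂ) := by
    rw [← integral_gaussian_complex hre]
    simp [hG]
  have hHc : Continuous H := by rw [hH]; fun_prop
  have hOc : Continuous O := by rw [hO, hG]; fun_prop
  have hodd : ∫ v in -δ..δ, O v = 0 :=
    intervalIntegral_odd_eq_zero (fun v => by simp only [hO, hG]; push_cast; ring_nf) δ
  have hsplit : (∫ v in -δ..δ, H v) - b 0 * (Real.pi / (-(B * a 0))) ^ (1 / 2 : ℂ) =
      ∫ v, ((Set.Ioc (-δ) δ).indicator (fun v => H v - O v) v - b 0 * G v) := by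
    rw [MeasureTheory.integral_sub, MeasureTheory.integral_indicator measurableSet_Ioc,
      ← intervalIntegral.integral_of_le (by linarith),
      intervalIntegral.integral_sub (hHc.intervalIntegrable _ _) (hOc.intervalIntegrable _ _),
      hodd, sub_zero, MeasureTheory.integral_const_mul, hgauss]
    · refine MeasureTheory.IntegrableOn.integrable_indicator ?_ measurableSet_Ioc
      exact ((hHc.sub hOc).integrableOn_Icc).mono_set Set.Ioc_subset_Icc_self
    · exact hGint.const_mul _
  rw [hsplit]
  have hb4 : 0 < c₀ / 4 * B := by positivity
  have hbound : ∀ v : ℝ, ‖(Set.Ioc (-δ) δ).indicator (fun v => H v - O v) v - b 0 * G v‖ ≤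
      K₁ / B * Real.exp (-(c₀ / 4 * B) * v ^ 2) := by
    intro v
    by_cases hv : v ∈ Set.Ioc (-δ) δ
    · rw [Set.indicator_of_mem hv]
      have hvδ : |v| ≤ δ := abs_le.mpr ⟨hv.1.le, hv.2⟩
      refine (laplace_pointwise hM1 hexp hB hCM hnC ha' hb' ha₀ (hvδ.trans hδ1)
        (by nlinarith)).trans ?_
      gcongr
      rw [hK₁]
      have : 0 ≤ |C| * C₃ / δ ^ 2 := by positivity
      linarith
    -- Outside the interval only the tail of the Gaussian is left, and `1 ≤ X / (δ² B)` provides the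
    -- missing factor `1 / B`.
    · rw [Set.indicator_of_notMem hv, zero_sub, norm_neg, norm_mul]
      have hvδ : δ ≤ |v| := by
        by_contra hlt
        have := abs_lt.mp (not_le.mp hlt)
        exact hv ⟨this.1, this.2.le⟩
      have hGn : ‖G v‖ ≤ Real.exp (-c₀ * (B * v ^ 2)) := by
        rw [hG, Complex.norm_exp, Real.exp_le_exp,
          show (B : ℂ) * a 0 * (v : ℂ) ^ 2 = ((B * v ^ 2 : ℝ) : ℂ) * a 0 by push_cast; ring,
          Complex.re_ofReal_mul]
        nlinarith [mul_nonneg hB0.le (sq_nonneg v)]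
      set X := B * v ^ 2 with hX
      have hX0 : 0 ≤ X := by positivity
      have h1 : 1 ≤ X / (δ ^ 2 * B) := by
        rw [le_div_iff₀ (by positivity), hX, ← sq_abs v]
        nlinarith [pow_le_pow_left₀ hδ.le hvδ 2]
      have h2 : X ≤ C₃ * Real.exp (c₀ / 4 * X) := le_trans (by nlinarith [pow_nonneg hX0 3]) (hexp X hX0)
      calc ‖b 0‖ * ‖G v‖ ≤ |C| * (1 * Real.exp (-c₀ * X)) := by rw [one_mul]; gcongr; exact hb' 0
        _ ≤ |C| * ((C₃ * Real.exp (c₀ / 4 * X)) / (δ ^ 2 * B) * Real.exp (-c₀ * X)) := by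
          gcongr
          exact h1.trans (by gcongr)
        _ = |C| * C₃ / δ ^ 2 / B * (Real.exp (c₀ / 4 * X) * Real.exp (-c₀ * X)) := by
          field_simp
        _ = |C| * C₃ / δ ^ 2 / B * Real.exp (-(3 * c₀ / 4) * X) := by
          rw [← Real.exp_add]; congr 2; ring
        _ ≤ K₁ / B * Real.exp (-(c₀ / 4 * B) * v ^ 2) := by
          have e1 : |C| * C₃ / δ ^ 2 ≤ K₁ := by
            rw [hK₁]; have : 0 ≤ 18 * M ^ 3 * C₃ := by positivity
            linarith
          have e2 : -(3 * c₀ / 4) * X ≤ -(c₀ / 4 * B) * v ^ 2 := by rw [hX] at *; nlinarith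
          gcongr
  refine (MeasureTheory.norm_integral_le_of_norm_le
    ((integrable_exp_neg_mul_sq hb4).const_mul _) (Eventually.of_forall hbound)).trans ?_
  rw [MeasureTheory.integral_const_mul, integral_gaussian, ← div_div, Real.sqrt_div (by positivity),
    ]
  rw [show K₁ / B * (√(Real.pi / (c₀ / 4)) / √B) = K₁ * √(Real.pi / (c₀ / 4)) / (B * √B) by
    field_simp]


/-! ### The rescaled phase, and smallness of the integral away from the saddle. -/

/-- The rescaled phase function, with saddle point `exp (i s)`. -/
noncomputable def phase (d : ℕ) (s : ℝ) (t : ℂ) : ℂ :=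
  t ^ (d + 1) / (d + 1) - Complex.exp (d * s * Complex.I) * t

theorem exp_mul_natCast_I (d : ℕ) (s : ℝ) :
    Complex.exp (d * s * Complex.I) = Complex.exp (s * Complex.I) ^ d := by
  rw [← Complex.exp_nat_mul]; ring_nf

/-- The induction multiplies by `u + z`, whose modulus is at most `2`. This keeps the constant
independent of `u`, that is, of the position of the saddle on the unit circle. -/
theorem norm_add_pow_taylor_le (n : ℕ) : ∃ C : ℝ, 0 ≤ C ∧ ∀ u z : ℂ, ‖u‖ = 1 → ‖z‖ ≤ 1 →
    ‖(u + z) ^ n - u ^ n - n * u ^ (n - 1) * z - n.choose 2 * u ^ (n - 2) * z ^ 2‖ ≤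
      C * ‖z‖ ^ 3 := by
  induction n with
  | zero => exact ⟨0, le_rfl, fun u z _ _ => by simp⟩
  | succ n ih =>
    obtain ⟨C, hC, h⟩ := ih
    refine ⟨2 * C + n.choose 2, by positivity, fun u z hu hz => ?_⟩
    set R := (u + z) ^ n - u ^ n - n * u ^ (n - 1) * z - n.choose 2 * u ^ (n - 2) * z ^ 2 with hR
    have hRb := h u z hu hz
    have e1 : (n : ℂ) * u ^ (n - 1) * u = n * u ^ n := by
      rcases n with _ | n
      · simp
      · simp [pow_succ, mul_assoc]
    have e2 : (n.choose 2 : ℂ) * u ^ (n - 2) * u = n.choose 2 * u ^ (n - 1) := by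
      rcases n with _ | _ | n
      · simp
      · simp
      · simp [pow_succ, mul_assoc]
    have hch : ((n + 1).choose 2 : ℂ) = n + n.choose 2 := by
      have := Nat.choose_succ_succ n 1
      rw [Nat.choose_one_right] at this
      exact_mod_cast this
    have key : (u + z) ^ (n + 1) - u ^ (n + 1) - ((n + 1 : ℕ) : ℂ) * u ^ (n + 1 - 1) * z -
        (n + 1).choose 2 * u ^ (n + 1 - 2) * z ^ 2 =
        (u + z) * R + n.choose 2 * u ^ (n - 2) * z ^ 3 := by
      rw [hch, hR, Nat.add_sub_cancel, show n + 1 - 2 = n - 1 by omega]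
      push_cast
      linear_combination z * e1 + z ^ 2 * e2
    rw [key]
    have hu2 : ‖u ^ (n - 2)‖ = 1 := by rw [norm_pow, hu, one_pow]
    calc _ ≤ ‖(u + z) * R‖ + ‖n.choose 2 * u ^ (n - 2) * z ^ 3‖ := norm_add_le _ _
      _ ≤ 2 * (C * ‖z‖ ^ 3) + n.choose 2 * ‖z‖ ^ 3 := by
        gcongr
        · rw [norm_mul]
          gcongr
          calc ‖u + z‖ ≤ ‖u‖ + ‖z‖ := norm_add_le _ _
            _ ≤ 2 := by rw [hu]; linarith
        · rw [norm_mul, norm_mul, hu2, norm_pow, mul_one, Complex.norm_natCast]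
      _ = _ := by ring

/-- There is no linear term because `exp (i s)` is a critical point of the phase. -/
theorem phase_taylor (d : ℕ) : ∃ C : ℝ, 0 ≤ C ∧ ∀ (s : ℝ) (z : ℂ), ‖z‖ ≤ 1 →
    ‖phase d s (Complex.exp (s * Complex.I) + z) - phase d s (Complex.exp (s * Complex.I)) -
      d / 2 * Complex.exp (s * Complex.I) ^ (d - 1) * z ^ 2‖ ≤ C * ‖z‖ ^ 3 := by
  obtain ⟨C, hC, h⟩ := norm_add_pow_taylor_le (d + 1)
  refine ⟨C, hC, fun s z hz => ?_⟩
  set u := Complex.exp (s * Complex.I)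
  have hd : (d + 1 : ℂ) ≠ 0 := by exact_mod_cast d.succ_ne_zero
  have hch : ((d + 1).choose 2 : ℂ) = (d + 1) * d / 2 := by
    rw [eq_div_iff two_ne_zero]
    have := Nat.add_one_mul_choose_eq d 1
    rw [Nat.choose_one_right] at this
    exact_mod_cast this.symm
  have key : phase d s (u + z) - phase d s u - d / 2 * u ^ (d - 1) * z ^ 2 =
      ((u + z) ^ (d + 1) - u ^ (d + 1) - ((d + 1 : ℕ) : ℂ) * u ^ (d + 1 - 1) * z -
        (d + 1).choose 2 * u ^ (d + 1 - 2) * z ^ 2) / (d + 1) := by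
    rw [hch, phase, phase, exp_mul_natCast_I, show d + 1 - 2 = d - 1 by omega,
      Nat.add_sub_cancel]
    push_cast
    field_simp
    ring
  rw [key, norm_div]
  have h1 : 1 ≤ ‖(d + 1 : ℂ)‖ := by
    have : ‖((d + 1 : ℕ) : ℂ)‖ = (d + 1 : ℕ) := Complex.norm_natCast _
    push_cast at this
    rw [this]
    linarith [(Nat.cast_nonneg d : (0 : ℝ) ≤ d)]
  exact (div_le_self (norm_nonneg _) h1).trans (h u z (Complex.norm_exp_ofReal_mul_I s) hz)

/-- The phase is strictly below its saddle value in a small disc in a descent direction. -/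
theorem phase_disc (d : ℕ) (hd : 1 ≤ d) {c₀ : ℝ} (hc₀ : 0 < c₀) (hc₁ : c₀ ≤ 1) :
    ∃ δ₁ > (0 : ℝ), δ₁ ≤ 1 / 2 ∧ ∀ δ : ℝ, 0 < δ → δ ≤ δ₁ → ∀ (s : ℝ) (κ τ : ℂ), ‖κ‖ = 1 →
      (Complex.exp (s * Complex.I) ^ (d - 1) * κ ^ 2).re ≤ -c₀ →
      ‖τ - (Complex.exp (s * Complex.I) + δ * κ)‖ ≤ c₀ / 12 * δ →
      (phase d s τ - phase d s (Complex.exp (s * Complex.I))).re ≤ -(c₀ / 4 * δ ^ 2) := by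
  obtain ⟨C, hC, htay⟩ := phase_taylor d
  -- The radius `c₀ δ / 12` of the disc costs at most `c₀ δ² / 4` in the quadratic form, which
  -- leaves `-3 c₀ δ² / 8` after multiplication by `d / 2 ≥ 1 / 2`. The bound on `δ` makes the cubic
  -- error `8 C δ³` at most `c₀ δ² / 8`.
  refine ⟨min (1 / 2) (c₀ / (64 * (C + 1))), by positivity, min_le_left _ _, ?_⟩
  intro δ hδ hδ1 s κ τ hκ hre hτ
  have hδ2 : δ ≤ 1 / 2 := hδ1.trans (min_le_left _ _)
  have hδ3 : δ * (64 * (C + 1)) ≤ c₀ := by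
    have := hδ1.trans (min_le_right _ _)
    rwa [le_div_iff₀ (by positivity)] at this
  set u := Complex.exp (s * Complex.I) with hu
  have hun : ‖u‖ = 1 := Complex.norm_exp_ofReal_mul_I s
  set z := τ - u with hz
  set e := τ - (u + δ * κ) with he
  have hze : z = δ * κ + e := by rw [hz, he]; ring
  have hδκ : ‖(δ : ℂ) * κ‖ = δ := by
    rw [norm_mul, hκ, mul_one, Complex.norm_real, Real.norm_of_nonneg hδ.le]
  have hzn : ‖z‖ ≤ 2 * δ := by
    rw [hze]
    refine (norm_add_le _ _).trans ?_
    rw [hδκ]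
    nlinarith
  have h1 := htay s z (by linarith)
  rw [← hu, show u + z = τ by rw [hz]; ring] at h1
  have h2 := (abs_le.mp ((Complex.abs_re_le_norm _).trans h1)).2
  rw [Complex.sub_re] at h2
  have hzcube : C * ‖z‖ ^ 3 ≤ C * (2 * δ) ^ 3 := by gcongr
  have hsq : (u ^ (d - 1) * z ^ 2).re ≤ -(3 / 4 * c₀ * δ ^ 2) := by
    have e1 : u ^ (d - 1) * z ^ 2 =
        ((δ ^ 2 : ℝ) : ℂ) * (u ^ (d - 1) * κ ^ 2) + u ^ (d - 1) * (2 * (δ * κ) * e + e ^ 2) := by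
      rw [hze]; push_cast; ring
    have e2 : ‖u ^ (d - 1) * (2 * (δ * κ) * e + e ^ 2)‖ ≤ c₀ / 4 * δ ^ 2 := by
      rw [norm_mul, norm_pow, hun, one_pow, one_mul]
      refine (norm_add_le _ _).trans ?_
      rw [norm_mul, norm_mul, norm_pow, hδκ, Complex.norm_ofNat]
      have : ‖e‖ ^ 2 ≤ (c₀ / 12 * δ) ^ 2 := by gcongr
      nlinarith [mul_le_mul_of_nonneg_left hτ hδ.le, sq_nonneg δ]
    rw [e1, Complex.add_re, Complex.re_ofReal_mul]
    have e3 := (abs_le.mp ((Complex.abs_re_le_norm _).trans e2)).2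
    nlinarith [mul_le_mul_of_nonneg_left hre (sq_nonneg δ)]
  have hd1 : (1 : ℝ) ≤ d := by exact_mod_cast hd
  have hmain : ((d : ℂ) / 2 * u ^ (d - 1) * z ^ 2).re ≤ -(3 / 8 * c₀ * δ ^ 2) := by
    rw [show (d : ℂ) / 2 * u ^ (d - 1) * z ^ 2 =
      ((d / 2 : ℝ) : ℂ) * (u ^ (d - 1) * z ^ 2) by push_cast; ring, Complex.re_ofReal_mul]
    have : 0 ≤ c₀ * δ ^ 2 := by positivity
    nlinarith
  nlinarith [mul_le_mul_of_nonneg_left hδ3 (sq_nonneg δ)]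

/-- A potential normalized so that its derivative is monic of degree `d`. -/
structure IsNormalized (d : ℕ) (W : ℂ[X]) : Prop where
  natDegree : W.natDegree = d + 1
  leadingCoeff : W.leadingCoeff = 1 / (d + 1)

/-- At `t = A τ` the leading and the linear term of `W(t) - x t` add up to exactly `A^{d+1}` times
the phase. Only the lower order terms of `W` are left, and they have lost a factor `A`. -/
theorem eval_sub_phase_le {d : ℕ} {W : ℂ[X]} (hW : IsNormalized d W) :
    ∃ C : ℝ, 0 < C ∧ ∀ (A s : ℝ) (τ : ℂ), 1 ≤ A →
      ‖W.eval (A * τ) - A ^ d * Complex.exp (d * s * Complex.I) * (A * τ) -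
        A ^ (d + 1) * phase d s τ‖ ≤ C * A ^ d * (1 + ‖τ‖) ^ d := by
  obtain ⟨C, hC, h⟩ := exists_norm_eval_sub_leading_le W hW.natDegree
  refine ⟨C, hC, fun A s τ hA => ?_⟩
  have h1 := h (A * τ)
  rw [hW.leadingCoeff, Nat.add_sub_cancel] at h1
  rw [show W.eval (A * τ) - A ^ d * Complex.exp (d * s * Complex.I) * (A * τ) -
        A ^ (d + 1) * phase d s τ = W.eval (A * τ) - 1 / (d + 1) * (A * τ) ^ (d + 1) by
      rw [phase]; ring]
  refine h1.trans ?_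
  rw [mul_assoc, ← mul_pow]
  gcongr
  rw [norm_mul, Complex.norm_real, Real.norm_of_nonneg (by linarith)]
  linarith

/-- The polynomial `x t - W(t)` with `x = A^d exp (i d s)`. -/
noncomputable def tilted (d : ℕ) (W : ℂ[X]) (A s : ℝ) : ℂ[X] :=
  C (A ^ d * Complex.exp (d * s * Complex.I)) * X - W

theorem neg_eval_tilted (d : ℕ) (W : ℂ[X]) (A s : ℝ) (t : ℂ) :
    -(tilted d W A s).eval t = W.eval t - A ^ d * Complex.exp (d * s * Complex.I) * t := by
  simp [tilted]

/-- The exponent is below the critical value `S` by `A^{d+1}` times the drop of the phase, up to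
errors of order `A^d`, which are absorbed when `A` is large. Each hypothesis on the drop is used for
one half: the one in `v` gives decay along a path, the one in `‖τ‖` pays for the growth of `σ` and
for the errors. -/
theorem outer_pointwise {d m : ℕ} {W σ : ℂ[X]} (hW : IsNormalized d W) (hσ : σ.natDegree ≤ m)
    {c : ℝ} (hc : 0 < c) (C' : ℝ) : ∃ K > (0 : ℝ), ∃ A₀ ≥ (1 : ℝ), ∀ (A s : ℝ) (S τ : ℂ) (v : ℝ),
      A₀ ≤ A → ‖S - A ^ (d + 1) * phase d s (Complex.exp (s * Complex.I))‖ ≤ C' * A ^ d → 0 ≤ v →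
      (phase d s τ - phase d s (Complex.exp (s * Complex.I))).re ≤ -(c * (1 + v)) →
      (phase d s τ - phase d s (Complex.exp (s * Complex.I))).re ≤ -(c * (1 + ‖τ‖) ^ (d + 1)) →
      ‖σ.eval (A * τ) * Complex.exp (-(tilted d W A s).eval (A * τ)) * A‖ ≤
        Real.exp S.re * K * Real.exp (-(c / 2 * A) * (1 + v)) := by
  obtain ⟨C, hC, hph⟩ := eval_sub_phase_le hW
  obtain ⟨C₁, hC₁, hpol⟩ := exists_norm_eval_le σ hσ
  obtain ⟨C₂, hC₂, hexp⟩ := exists_one_add_pow_le_exp (m + 1) (show (0 : ℝ) < c / 4 by positivity)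
  refine ⟨C₁ * C₂, by positivity, max 1 (4 * (C + |C'|) / c), le_max_left _ _, ?_⟩
  intro A s S τ v hA hS hv h1 h2
  have hA1 : 1 ≤ A := (le_max_left _ _).trans hA
  have hA0 : 0 < A := by linarith
  have hA2 : 4 * (C + |C'|) ≤ A * c := by
    have := (le_max_right _ _).trans hA
    rwa [div_le_iff₀ hc] at this
  set u := Complex.exp (s * Complex.I)
  set T := 1 + ‖τ‖ with hT
  have hT1 : 1 ≤ T := by rw [hT]; linarith [norm_nonneg τ]
  have h3 := hph A s τ hA1
  rw [neg_eval_tilted]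
  set w := W.eval (A * τ) - A ^ d * Complex.exp (d * s * Complex.I) * (A * τ) with hw
  have h4 := (abs_le.mp ((Complex.abs_re_le_norm _).trans h3)).2
  have h5 := (abs_le.mp ((Complex.abs_re_le_norm _).trans hS)).1
  have hre : ∀ q : ℂ, ((A : ℂ) ^ (d + 1) * q).re = A ^ (d + 1) * q.re := fun q => by
    rw [← Complex.ofReal_pow, Complex.re_ofReal_mul]
  rw [Complex.sub_re, hre] at h4 h5
  rw [Complex.sub_re] at h1 h2
  have hAd : A ^ (d + 1) = A ^ d * A := pow_succ _ _
  have hAd1 : 1 ≤ A ^ d := one_le_pow₀ hA1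
  have hTd : T ^ d ≤ T ^ (d + 1) := pow_le_pow_right₀ hT1 (by omega)
  have hTd1 : 1 ≤ T ^ (d + 1) := one_le_pow₀ hT1
  have hTT : T ≤ T ^ (d + 1) := le_self_pow₀ hT1 (by omega)
  have h6 : w.re - S.re ≤ -(c / 2 * A) * (1 + v) - c / 4 * (A * T) := by
    have e1 : A ^ (d + 1) * ((phase d s τ).re - (phase d s u).re) ≤
        A ^ (d + 1) * (-(c * (1 + v)) / 2 - c * T ^ (d + 1) / 2) :=
      mul_le_mul_of_nonneg_left (by linarith) (by positivity)
    have e2 : C * A ^ d * T ^ d + C' * A ^ d ≤ A ^ d * ((C + |C'|) * T ^ (d + 1)) := by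
      have : C' ≤ |C'| * T ^ (d + 1) := (le_abs_self _).trans
        (le_mul_of_one_le_right (abs_nonneg _) hTd1)
      nlinarith [mul_le_mul_of_nonneg_left hTd (mul_nonneg hC.le (pow_nonneg hA0.le d)),
        mul_le_mul_of_nonneg_left this (pow_nonneg hA0.le d)]
    have e3 : A ^ d * ((C + |C'|) * T ^ (d + 1)) ≤ A ^ (d + 1) * (c / 4 * T ^ (d + 1)) := by
      rw [hAd, mul_assoc]
      gcongr ?_ * ?_
      nlinarith
    have e4 : A * (c * (1 + v) / 2) ≤ A ^ (d + 1) * (c * (1 + v) / 2) := by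
      gcongr
      exact le_self_pow₀ hA1 (by omega)
    have e5 : A * (c / 4 * T) ≤ A ^ (d + 1) * (c / 4 * T ^ (d + 1)) := by
      gcongr
      exact le_self_pow₀ hA1 (by omega)
    nlinarith
  have h7 : ‖σ.eval (A * τ)‖ * A ≤ C₁ * (C₂ * Real.exp (c / 4 * (A * T))) := by
    have := hexp (A * T) (by positivity)
    calc ‖σ.eval (A * τ)‖ * A ≤ C₁ * (1 + A * T) ^ m * (1 + A * T) := by
          gcongr
          · refine (hpol _).trans ?_
            gcongr
            rw [norm_mul, Complex.norm_real, Real.norm_of_nonneg hA0.le, hT]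
            nlinarith [norm_nonneg τ]
          · nlinarith
      _ = C₁ * (1 + A * T) ^ (m + 1) := by ring
      _ ≤ _ := by gcongr
  rw [norm_mul, norm_mul, Complex.norm_real, Real.norm_of_nonneg hA0.le, Complex.norm_exp]
  calc ‖σ.eval (A * τ)‖ * Real.exp w.re * A = ‖σ.eval (A * τ)‖ * A * Real.exp w.re := by ring
    _ ≤ C₁ * (C₂ * Real.exp (c / 4 * (A * T))) *
        Real.exp (S.re + (-(c / 2 * A) * (1 + v) - c / 4 * (A * T))) := by
        gcongr; linarith
    _ = Real.exp S.re * (C₁ * C₂) * Real.exp (-(c / 2 * A) * (1 + v)) *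
        (Real.exp (c / 4 * (A * T)) * Real.exp (-(c / 4 * (A * T)))) := by
        rw [Real.exp_add, sub_eq_add_neg, Real.exp_add]; ring
    _ = _ := by rw [← Real.exp_add, add_neg_cancel, Real.exp_zero, mul_one]

/-- Bound for the increment up to infinity of a curve with exponentially decaying velocity. -/
theorem norm_sub_le_of_exp_decay {F F' : ℝ → ℂ} {a b M : ℝ} {L : ℂ} (hb : 0 < b)
    (hF : ∀ v, a ≤ v → HasDerivAt F (F' v) v)
    (hF' : ∀ v, a ≤ v → ‖F' v‖ ≤ M * Real.exp (-b * v)) (hL : Tendsto F atTop (𝓝 L)) :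
    ‖L - F a‖ ≤ M / b * Real.exp (-b * a) := by
  have hM : 0 ≤ M := by
    have h1 := (norm_nonneg _).trans (hF' a le_rfl)
    exact nonneg_of_mul_nonneg_left h1 (Real.exp_pos _)
  have key : ∀ v, a ≤ v → ‖F v - F a‖ ≤ M / b * Real.exp (-b * a) := by
    intro v hv
    have := image_norm_le_of_norm_deriv_right_le_deriv_boundary (f := fun v => F v - F a)
      (f' := F') (a := a) (b := v)
      (B := fun v => M / b * Real.exp (-b * a) - M / b * Real.exp (-b * v))
      (B' := fun v => M * Real.exp (-b * v)) ?_ ?_ ?_ ?_ ?_ (Set.right_mem_Icc.mpr hv)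
    · refine this.trans ?_
      have : 0 ≤ M / b * Real.exp (-b * v) := by positivity
      linarith
    · exact fun x hx => ((hF x hx.1).sub_const _).continuousAt.continuousWithinAt
    · exact fun x hx => ((hF x hx.1).sub_const _).hasDerivWithinAt
    · simp
    · intro x
      have h1 : HasDerivAt (fun v : ℝ => Real.exp (-b * v)) (Real.exp (-b * x) * (-b)) x := by
        simpa using ((hasDerivAt_id x).const_mul (-b)).exp
      refine ((h1.const_mul (M / b)).const_sub (M / b * Real.exp (-b * a))).congr_deriv ?_
      field_simp
    · exact fun x hx => hF' x hx.1
  refine le_of_tendsto (hL.sub_const (F a)).norm ?_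
  filter_upwards [eventually_ge_atTop a] with v hv using key v hv

/-- There are curves, below the saddle value of the phase, from the points near
`exp (i s) + δ κ` to infinity in the direction `w`. -/
def HasDescent (d : ℕ) (I : Set ℝ) (κ : ℝ → ℂ) (w : ℂ) : Prop :=
  ∀ η > (0 : ℝ), ∃ δ₁ > (0 : ℝ), ∀ δ : ℝ, 0 < δ → δ ≤ δ₁ → ∃ c > (0 : ℝ), ∃ D > (0 : ℝ),
    ∀ s ∈ I, ∃ (P : ℂ) (p p' : ℝ → ℂ) (a : ℝ) (w₁ : ℂ) (r : ℝ → ℝ), 0 ≤ a ∧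
      ‖P - (Complex.exp (s * Complex.I) + δ * κ s)‖ ≤ η * δ ∧
      (∀ τ ∈ segment ℝ P (p a), ‖τ‖ ≤ D ∧
        (phase d s τ - phase d s (Complex.exp (s * Complex.I))).re ≤ -c) ∧
      (∀ v, a ≤ v → HasDerivAt p (p' v) v ∧ ‖p' v‖ ≤ D ∧
        (phase d s (p v) - phase d s (Complex.exp (s * Complex.I))).re ≤ -(c * (1 + v)) ∧
        (phase d s (p v) - phase d s (Complex.exp (s * Complex.I))).re
          ≤ -(c * (1 + ‖p v‖) ^ (d + 1))) ∧
      Tendsto r atTop atTop ∧ Tendsto (fun v => p v / (r v : ℂ)) atTop (𝓝 w₁) ∧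
      ∀ x ∈ segment ℝ w₁ w, (x ^ (d + 1)).re < 0

theorem natDegree_tilted {d : ℕ} (hd : 1 ≤ d) {W : ℂ[X]} (hW : IsNormalized d W) (A s : ℝ) :
    (tilted d W A s).natDegree = d + 1 := by
  rw [tilted, natDegree_sub_eq_right_of_natDegree_lt, hW.natDegree]
  rw [hW.natDegree]
  exact ((natDegree_C_mul_le _ _).trans natDegree_X_le).trans_lt (by omega)

theorem leadingCoeff_tilted {d : ℕ} (hd : 1 ≤ d) {W : ℂ[X]} (hW : IsNormalized d W) (A s : ℝ) :
    (tilted d W A s).leadingCoeff = -(1 / (d + 1)) := by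
  rw [leadingCoeff, natDegree_tilted hd hW, tilted, coeff_sub, ← hW.leadingCoeff, leadingCoeff,
    hW.natDegree, coeff_C_mul, coeff_X, if_neg (by omega), mul_zero, zero_sub]

theorem mem_decayDirs_tilted {d : ℕ} (hd : 1 ≤ d) {W : ℂ[X]} (hW : IsNormalized d W) (A s : ℝ)
    {x : ℂ} : x ∈ decayDirs (tilted d W A s) ↔ (x ^ (d + 1)).re < 0 := by
  have h1 : (0 : ℝ) < 1 / (d + 1) := by positivity
  rw [decayDirs, Set.mem_ofPred_eq, leadingCoeff_tilted hd hW, natDegree_tilted hd hW,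
    show -(1 / (d + 1) : ℂ) * x ^ (d + 1) = ((1 / (d + 1) : ℝ) : ℂ) * (-(x ^ (d + 1))) by
      push_cast; ring, Complex.re_ofReal_mul, mul_pos_iff_of_pos_left h1, Complex.neg_re,
    neg_pos]

/-- Infinity is reached in three pieces: from `τ` to `P` inside the small disc, from `P` to the
beginning of `p`, and along `p`, where `tendsto_primitive_of_segment` identifies the limit with `L`.
On all of them the phase is below its saddle value by a fixed amount, so that they contribute
exponentially little compared with `exp S`. -/
theorem descent_bound {d m : ℕ} (hd : 1 ≤ d) {W σ : ℂ[X]} (hW : IsNormalized d W)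
    (hσ : σ.natDegree ≤ m) (C' : ℝ) {I : Set ℝ} {κ : ℝ → ℂ} {w : ℂ} (h : HasDescent d I κ w)
    {c₀ : ℝ} (hc₀ : 0 < c₀) (hc₁ : c₀ ≤ 1) (hκ : ∀ s ∈ I, ‖κ s‖ = 1)
    (hκ' : ∀ s ∈ I, (Complex.exp (s * Complex.I) ^ (d - 1) * κ s ^ 2).re ≤ -c₀) :
    ∃ δ₁ > (0 : ℝ), ∀ δ : ℝ, 0 < δ → δ ≤ δ₁ → ∃ c > (0 : ℝ), ∃ K > (0 : ℝ), ∃ A₀ ≥ (1 : ℝ),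
      ∀ A : ℝ, A₀ ≤ A → ∀ s ∈ I, ∀ S : ℂ,
        ‖S - A ^ (d + 1) * phase d s (Complex.exp (s * Complex.I))‖ ≤ C' * A ^ d →
        ∀ Φ : ℂ → ℂ, (∀ z, HasDerivAt Φ
          (σ.eval z * Complex.exp (-(tilted d W A s).eval z)) z) →
        ∀ L : ℂ, Tendsto (fun v : ℝ => Φ (v * w)) atTop (𝓝 L) →
        ∀ τ : ℂ, ‖τ - (Complex.exp (s * Complex.I) + δ * κ s)‖ ≤ c₀ / 12 * δ →
          ‖L - Φ (A * τ)‖ ≤ Real.exp S.re * K * Real.exp (-c * A) := by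
  obtain ⟨δ₂, hδ₂, hδ₂', hdisc⟩ := phase_disc d hd hc₀ hc₁
  obtain ⟨δ₃, hδ₃, hpath⟩ := h (c₀ / 12) (by positivity)
  refine ⟨min δ₂ δ₃, by positivity, fun δ hδ hδ1 => ?_⟩
  have hδ2 := hδ1.trans (min_le_left _ _)
  obtain ⟨c₁, hc₁', D, hD, hpath⟩ := hpath δ hδ (hδ1.trans (min_le_right _ _))
  set D' := max D 2 with hD'
  -- On the bounded pieces `‖τ‖ ≤ D'`. Division by `(1 + D') ^ (d + 1)` therefore turns a constant
  -- drop into one that dominates `(1 + ‖τ‖) ^ (d + 1)`, as `outer_pointwise` requires.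
  set c := min (c₀ / 4 * δ ^ 2) c₁ / (1 + D') ^ (d + 1) with hc
  have hc0 : 0 < c := by positivity
  have hDp : 1 ≤ (1 + D') ^ (d + 1) := one_le_pow₀ (by
    have := le_max_right D 2
    linarith)
  have hcD : c * (1 + D') ^ (d + 1) = min (c₀ / 4 * δ ^ 2) c₁ := by
    rw [hc]; field_simp
  have hcc : c ≤ min (c₀ / 4 * δ ^ 2) c₁ := by
    rw [← hcD]; exact le_mul_of_one_le_right hc0.le hDp
  obtain ⟨K, hK, A₀, hA₀, hpt⟩ := outer_pointwise (m := m) hW hσ hc0 C'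
  refine ⟨c / 2, by positivity, (1 + 2 * D' + D / (c / 2)) * K, by positivity, A₀, hA₀, ?_⟩
  intro A hA s hs S hS Φ hΦ L hL τ hτ
  have hA1 : 1 ≤ A := hA₀.trans hA
  obtain ⟨P, p, p', a, w₁, r, ha, hP, hseg, hp, hr, hpr, hw⟩ := hpath s hs
  set u := Complex.exp (s * Complex.I)
  have hun : ‖u‖ = 1 := Complex.norm_exp_ofReal_mul_I s
  have hM : 0 ≤ Real.exp S.re * K := by positivity
  have hsegment : ∀ x y : ℂ, (∀ τ ∈ segment ℝ x y, ‖τ‖ ≤ D' ∧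
      (phase d s τ - phase d s u).re ≤ -min (c₀ / 4 * δ ^ 2) c₁) →
      ‖Φ (A * y) - Φ (A * x)‖ ≤ Real.exp S.re * K * Real.exp (-(c / 2) * A) * ‖y - x‖ := by
    intro x y hxy
    refine Convex.norm_image_sub_le_of_norm_hasDerivWithin_le (f := fun τ => Φ (A * τ))
      (f' := fun τ => σ.eval (A * τ) * Complex.exp (-(tilted d W A s).eval (A * τ)) * A)
      ?_ ?_ (convex_segment x y) (left_mem_segment ℝ _ _) (right_mem_segment ℝ _ _)
    · intro τ _
      have h1 : HasDerivAt (fun τ : ℂ => (A : ℂ) * τ) A τ := by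
        simpa using (hasDerivAt_id τ).const_mul (A : ℂ)
      exact ((hΦ _).comp τ h1).hasDerivWithinAt
    · intro τ hτ
      obtain ⟨h1, h2⟩ := hxy τ hτ
      refine (hpt A s S τ 0 hA hS le_rfl (by linarith) ?_).trans (by
        rw [add_zero, mul_one, neg_mul])
      have : (1 + ‖τ‖) ^ (d + 1) ≤ (1 + D') ^ (d + 1) := by gcongr
      nlinarith [mul_le_mul_of_nonneg_left this hc0.le]
  have hball : ∀ x : ℂ, ‖x - (u + δ * κ s)‖ ≤ c₀ / 12 * δ → ‖x‖ ≤ 2 := by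
    intro x hx
    calc ‖x‖ = ‖(x - (u + δ * κ s)) + u + δ * κ s‖ := by congr 1; ring
      _ ≤ ‖x - (u + δ * κ s)‖ + ‖u‖ + ‖δ * κ s‖ := norm_add₃_le
      _ ≤ c₀ / 12 * δ + 1 + δ := by
        rw [hun, norm_mul, hκ s hs, mul_one, Complex.norm_real, Real.norm_of_nonneg hδ.le]
        linarith
      _ ≤ 2 := by nlinarith
  have b1 := hsegment τ P (fun x hx => by
    have hx' : ‖x - (u + δ * κ s)‖ ≤ c₀ / 12 * δ := by
      have hcv := convex_closedBall (u + δ * κ s) (c₀ / 12 * δ)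
      have := hcv.segment_subset (x := τ) (y := P) (by
        rwa [Metric.mem_closedBall, dist_eq_norm]) (by rwa [Metric.mem_closedBall, dist_eq_norm]) hx
      rwa [Metric.mem_closedBall, dist_eq_norm] at this
    refine ⟨(hball x hx').trans (le_max_right _ _), ?_⟩
    refine (hdisc δ hδ hδ2 s (κ s) x (hκ s hs) (hκ' s hs) hx').trans ?_
    exact neg_le_neg (min_le_left _ _))
  have b2 := hsegment P (p a) (fun x hx => ⟨(hseg x hx).1.trans (le_max_left _ _),
    (hseg x hx).2.trans (neg_le_neg (min_le_right _ _))⟩)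
  have hlim : Tendsto (fun v => Φ (A * p v)) atTop (𝓝 L) := by
    refine tendsto_primitive_of_segment (by rw [natDegree_tilted hd hW]; omega) hΦ
      (w₁ := w₁) (w₂ := w) (r := fun v => A * r v)
      (fun x hx => (mem_decayDirs_tilted hd hW A s).mpr (hw x hx))
      (hr.const_mul_atTop (by linarith)) ?_ hL
    refine hpr.congr fun v => ?_
    have : (A : ℂ) ≠ 0 := by exact_mod_cast (by linarith : A ≠ 0)
    push_cast
    rw [mul_div_mul_left _ _ this]
  have b3 := norm_sub_le_of_exp_decay (F := fun v => Φ (A * p v))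
    (F' := fun v => σ.eval (A * p v) * Complex.exp (-(tilted d W A s).eval (A * p v)) * A * p' v)
    (a := a) (b := c / 2 * A) (M := Real.exp S.re * K * Real.exp (-(c / 2 * A)) * D) (L := L)
    (by positivity) (fun v hv => by
      have h1 : HasDerivAt (fun v : ℝ => (A : ℂ) * p v) (A * p' v) v :=
        ((hp v hv).1).const_mul (A : ℂ)
      exact ((hΦ _).comp v h1).congr_deriv (by ring)) (fun v hv => by
      obtain ⟨-, h2, h3, h4⟩ := hp v hv
      have hv0 : 0 ≤ v := ha.trans hv
      have hcl : c ≤ c₁ := hcc.trans (min_le_right _ _)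
      rw [norm_mul]
      have := hpt A s S (p v) v hA hS hv0
        (h3.trans (neg_le_neg (by gcongr))) (h4.trans (neg_le_neg (by gcongr)))
      calc _ ≤ (Real.exp S.re * K * Real.exp (-(c / 2 * A) * (1 + v))) * D := by gcongr
        _ = _ := by
          rw [mul_add, Real.exp_add, mul_one]; ring) hlim
  have hna : ∀ x : ℂ, ‖x‖ ≤ D' → ∀ y : ℂ, ‖y‖ ≤ D' → ‖y - x‖ ≤ 2 * D' := fun x hx y hy => by
    have := norm_sub_le y x
    linarith
  have hτ1 : ‖P - τ‖ ≤ 1 := by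
    calc ‖P - τ‖ = ‖(P - (u + δ * κ s)) - (τ - (u + δ * κ s))‖ := by congr 1; ring
      _ ≤ c₀ / 12 * δ + c₀ / 12 * δ := (norm_sub_le _ _).trans (add_le_add hP hτ)
      _ ≤ 1 := by nlinarith
  have hPp : ‖p a - P‖ ≤ 2 * D' :=
    hna P ((hseg P (left_mem_segment ℝ _ _)).1.trans (le_max_left _ _)) _
      ((hseg _ (right_mem_segment ℝ _ _)).1.trans (le_max_left _ _))
  have hE : 0 < Real.exp (-(c / 2) * A) := Real.exp_pos _
  set M := Real.exp S.re * K * Real.exp (-(c / 2) * A) with hMdef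
  have hM0 : 0 ≤ M := by positivity
  have b3' : ‖L - Φ (A * p a)‖ ≤ M * (D / (c / 2)) := by
    refine b3.trans ?_
    have e1 : Real.exp (-(c / 2 * A) * a) ≤ 1 := Real.exp_le_one_iff.mpr (by
      have : 0 ≤ c / 2 * A * a := by positivity
      linarith)
    have e2 : D / (c / 2 * A) ≤ D / (c / 2) := by
      gcongr
      exact le_mul_of_one_le_right (by positivity) hA1
    rw [show Real.exp S.re * K * Real.exp (-(c / 2 * A)) * D / (c / 2 * A) = M * (D / (c / 2 * A))
      by rw [hMdef, neg_mul]; ring]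
    calc _ ≤ M * (D / (c / 2 * A)) * 1 := by gcongr
      _ ≤ _ := by rw [mul_one]; gcongr
  calc ‖L - Φ (A * τ)‖ = ‖(L - Φ (A * p a)) + (Φ (A * p a) - Φ (A * P)) +
        (Φ (A * P) - Φ (A * τ))‖ := by congr 1; ring
    _ ≤ M * (D / (c / 2)) + M * (2 * D') + M * 1 := by
        refine norm_add₃_le.trans (add_le_add (add_le_add b3' (b2.trans ?_)) (b1.trans ?_))
        · gcongr
        · gcongr
    _ = _ := by rw [hMdef]; ring


/-! ### Laplace's method at the exact saddle point. -/

/-- The `k`-th Taylor coefficient is a polynomial in `t` of degree at most `m - k`, so it is `O(A ^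
(m - k))` when `‖t‖ ≤ 2 A`. -/
theorem taylor_coeff_bound (f : ℂ[X]) {m : ℕ} (hf : f.natDegree ≤ m) :
    ∃ C : ℝ, 0 ≤ C ∧ ∀ (A : ℝ) (t : ℂ), 1 ≤ A → ‖t‖ ≤ 2 * A →
      ∀ k, ‖(taylor t f).coeff k‖ * A ^ k ≤ C * A ^ m := by
  have h : ∀ k, ∃ C : ℝ, 0 < C ∧ ∀ z : ℂ, ‖(hasseDeriv k f).eval z‖ ≤ C * (1 + ‖z‖) ^ (m - k) :=
    fun k => exists_norm_eval_le _ ((natDegree_hasseDeriv_le f k).trans (by omega))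
  choose C hC hb using h
  refine ⟨∑ k ∈ Finset.range (m + 1), C k * 3 ^ m,
    Finset.sum_nonneg fun k _ => by have := hC k; positivity, fun A t hA ht k => ?_⟩
  have hA0 : 0 < A := by linarith
  by_cases hk : k ≤ m
  · rw [taylor_coeff]
    calc ‖(hasseDeriv k f).eval t‖ * A ^ k ≤ C k * (3 * A) ^ (m - k) * A ^ k := by
          gcongr
          refine (hb k t).trans ?_
          have := hC k
          gcongr
          linarith
      _ = C k * 3 ^ (m - k) * (A ^ (m - k) * A ^ k) := by rw [mul_pow]; ring
      _ = C k * 3 ^ (m - k) * A ^ m := by rw [← pow_add, Nat.sub_add_cancel hk]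
      _ ≤ C k * 3 ^ m * A ^ m := by
          have := hC k
          gcongr
          · norm_num
          · omega
      _ ≤ _ := by
          gcongr
          exact Finset.single_le_sum (f := fun k => C k * 3 ^ m)
            (fun k _ => by have := hC k; positivity) (Finset.mem_range.mpr (by omega))
  · rw [coeff_eq_zero_of_natDegree_lt (by rw [natDegree_taylor]; omega), norm_zero, zero_mul]
    have : 0 ≤ ∑ k ∈ Finset.range (m + 1), C k * 3 ^ m :=
      Finset.sum_nonneg fun k _ => by have := hC k; positivity
    positivity

theorem eval_add_eq_sum_taylor (f : ℂ[X]) {n : ℕ} (hf : f.natDegree < n) (t h : ℂ) :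
    f.eval (t + h) = ∑ k ∈ Finset.range n, (taylor t f).coeff k * h ^ k := by
  rw [← eval_eq_sum_range' (by rwa [natDegree_taylor]), taylor_eval, add_comm]

/-- With the point written as `t + A κ v`, the exponent is its value at `t` plus `A^{d+1} v² ∑ a_k
v^k`; the saddle equation removes the linear term. The `a_k` and `b_k` are bounded uniformly in `A`,
`s` and `t`, and this is why `laplace` has to be uniform in the coefficients. -/
theorem local_laplace {d m : ℕ} {W σ : ℂ[X]} (hW : IsNormalized d W) (hσ : σ.natDegree ≤ m)
    {c₀ : ℝ} (hc₀ : 0 < c₀) :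
    ∃ δ₀ > (0 : ℝ), ∀ δ : ℝ, 0 < δ → δ ≤ δ₀ → ∃ K : ℝ, ∀ (A s : ℝ) (t κ : ℂ), 1 ≤ A →
      ‖κ‖ = 1 → ‖t‖ ≤ 2 * A →
      W.derivative.eval t = A ^ d * Complex.exp (d * s * Complex.I) →
      ((taylor t W).coeff 2 * (A * κ) ^ 2 / A ^ (d + 1)).re ≤ -c₀ →
      ∀ Φ : ℂ → ℂ, (∀ z, HasDerivAt Φ
          (σ.eval z * Complex.exp (-(tilted d W A s).eval z)) z) →
      ‖(Φ (t + A * (δ * κ)) - Φ (t - A * (δ * κ))) * Complex.exp ((tilted d W A s).eval t) -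
        A * κ * σ.eval t * (Real.pi / (-((taylor t W).coeff 2 * (A * κ) ^ 2))) ^ (1 / 2 : ℂ)‖ ≤
        K * (A ^ (m + 1) / (A ^ (d + 1) * √(A ^ (d + 1)))) := by
  obtain ⟨C₁, hC₁, h₁⟩ := taylor_coeff_bound W hW.natDegree.le
  obtain ⟨C₂, hC₂, h₂⟩ := taylor_coeff_bound σ hσ
  set n := max d m with hn
  obtain ⟨δ₀, hδ₀, hlap⟩ := laplace n (max C₁ C₂) hc₀
  refine ⟨δ₀, hδ₀, fun δ hδ hδ' => ?_⟩
  obtain ⟨K, hK⟩ := hlap δ hδ hδ'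
  refine ⟨K, fun A s t κ hA hκ ht hX hre Φ hΦ => ?_⟩
  have hA0 : 0 < A := by linarith
  have hAc : (A : ℂ) ≠ 0 := by exact_mod_cast hA0.ne'
  set a : ℕ → ℂ := fun k => (taylor t W).coeff (k + 2) * (A * κ) ^ (k + 2) / A ^ (d + 1) with ha
  set b : ℕ → ℂ := fun k => (taylor t σ).coeff k * (A * κ) ^ k / A ^ m with hb
  have hAκ : ∀ k, ‖((A : ℂ) * κ) ^ k‖ = A ^ k := fun k => by
    rw [norm_pow, norm_mul, hκ, mul_one, Complex.norm_real, Real.norm_of_nonneg hA0.le]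
  have hAn : ∀ k, ‖(A : ℂ) ^ k‖ = A ^ k := fun k => by
    rw [norm_pow, Complex.norm_real, Real.norm_of_nonneg hA0.le]
  have hab : ∀ k, ‖a k‖ ≤ max C₁ C₂ := fun k => by
    rw [ha, norm_div, norm_mul, hAκ, hAn, div_le_iff₀ (by positivity)]
    exact (h₁ A t hA ht (k + 2)).trans (by gcongr; exact le_max_left _ _)
  have hbb : ∀ k, ‖b k‖ ≤ max C₁ C₂ := fun k => by
    rw [hb, norm_div, norm_mul, hAκ, hAn, div_le_iff₀ (by positivity)]
    exact (h₂ A t hA ht k).trans (by gcongr; exact le_max_right _ _)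
  have hmain := hK (A ^ (d + 1)) (one_le_pow₀ hA) a b hab hbb hre
  have hWe : ∀ v : ℝ, W.eval (t + A * κ * v) - W.eval t - W.derivative.eval t * (A * κ * v) =
      A ^ (d + 1) * ((∑ k ∈ Finset.range (n + 2), a k * (v : ℂ) ^ k) * (v : ℂ) ^ 2) := fun v => by
    rw [eval_add_eq_sum_taylor W (n := n + 2 + 2) (by rw [hW.natDegree]; omega),
      sum_range_add_two, taylor_coeff_zero, taylor_coeff_one]
    have hcancel : ∀ x y z : ℂ, x + y + z - x - y = z := fun x y z => by ring
    rw [hcancel, Finset.sum_mul, Finset.sum_mul, Finset.mul_sum]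
    refine Finset.sum_congr rfl fun k _ => ?_
    simp only [ha]
    rw [mul_pow ((A : ℂ) * κ) (v : ℂ) k]
    field_simp
    ring
  have hσe : ∀ v : ℝ, σ.eval (t + A * κ * v) =
      A ^ m * ∑ k ∈ Finset.range (n + 2), b k * (v : ℂ) ^ k := fun v => by
    rw [eval_add_eq_sum_taylor σ (n := n + 2) (by omega), Finset.mul_sum]
    refine Finset.sum_congr rfl fun k _ => ?_
    simp only [hb]
    rw [mul_pow ((A : ℂ) * κ)]
    field_simp
  set H : ℝ → ℂ := fun v => (∑ k ∈ Finset.range (n + 2), b k * (v : ℂ) ^ k) *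
    Complex.exp ((A ^ (d + 1) : ℝ) * ((∑ k ∈ Finset.range (n + 2), a k * (v : ℂ) ^ k) *
      (v : ℂ) ^ 2)) with hH
  have hderiv : ∀ v : ℝ, HasDerivAt (fun v : ℝ => Φ (t + A * κ * v))
      (A ^ (m + 1) * κ * Complex.exp (-(tilted d W A s).eval t) * H v) v := fun v => by
    have h1 : HasDerivAt (fun v : ℝ => t + A * κ * (v : ℂ)) (A * κ) v := by
      simpa using ((Complex.ofRealCLM.hasDerivAt (x := v)).const_mul (A * κ)).const_add t
    refine ((hΦ _).comp v h1).congr_deriv ?_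
    have h2 : -(tilted d W A s).eval (t + A * κ * v) = -(tilted d W A s).eval t +
        (A ^ (d + 1) : ℝ) * ((∑ k ∈ Finset.range (n + 2), a k * (v : ℂ) ^ k) * (v : ℂ) ^ 2) := by
      rw [neg_eval_tilted, neg_eval_tilted]
      push_cast
      rw [← hWe v, ← hX]
      ring
    rw [hσe, h2, Complex.exp_add, hH]
    ring
  have hint := intervalIntegral.integral_eq_sub_of_hasDerivAt (a := -δ) (b := δ)
    (fun v _ => hderiv v) (Continuous.intervalIntegrable (by rw [hH]; fun_prop) _ _)
  rw [intervalIntegral.integral_const_mul] at hint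
  have e1 : t + A * κ * (δ : ℝ) = t + A * (δ * κ) := by ring
  have e2 : t + A * κ * ((-δ : ℝ) : ℂ) = t - A * (δ * κ) := by push_cast; ring
  rw [e1, e2] at hint
  rw [← hint]
  have hb0 : A ^ m * b 0 = σ.eval t := by
    simp only [hb, taylor_coeff_zero, pow_zero, mul_one]
    field_simp
  have ha0 : ((A ^ (d + 1) : ℝ) : ℂ) * a 0 = (taylor t W).coeff 2 * (A * κ) ^ 2 := by
    simp only [ha, zero_add]
    push_cast
    field_simp
  rw [ha0] at hmain
  have key : A ^ (m + 1) * κ * Complex.exp (-(tilted d W A s).eval t) * (∫ v in -δ..δ, H v) *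
      Complex.exp ((tilted d W A s).eval t) - A * κ * σ.eval t *
        (Real.pi / (-((taylor t W).coeff 2 * (A * κ) ^ 2))) ^ (1 / 2 : ℂ) =
      A ^ (m + 1) * κ * ((∫ v in -δ..δ, H v) -
        b 0 * (Real.pi / (-((taylor t W).coeff 2 * (A * κ) ^ 2))) ^ (1 / 2 : ℂ)) := by
    have : Complex.exp (-(tilted d W A s).eval t) * Complex.exp ((tilted d W A s).eval t) = 1 := by
      rw [← Complex.exp_add, neg_add_cancel, Complex.exp_zero]
    rw [← hb0]
    linear_combination (A ^ (m + 1) * κ * (∫ v in -δ..δ, H v)) * this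
  rw [key, norm_mul, norm_mul, hAn, hκ, mul_one]
  calc _ ≤ A ^ (m + 1) * (K / (A ^ (d + 1) * √(A ^ (d + 1)))) := by gcongr
    _ = _ := by ring

theorem norm_one_add_pow_sub_one_le (n : ℕ) : ∃ C : ℝ, 0 ≤ C ∧ ∀ x : ℂ, ‖x‖ ≤ 1 →
    ‖(1 + x) ^ n - 1‖ ≤ C * ‖x‖ ∧ ‖(1 + x) ^ n - 1 - n * x‖ ≤ C * ‖x‖ ^ 2 := by
  obtain ⟨C, hC, h⟩ := norm_add_pow_taylor_le n
  refine ⟨C + n.choose 2 + n, by positivity, fun x hx => ?_⟩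
  have h1 := h 1 x norm_one hx
  simp only [one_pow, mul_one] at h1
  have hx3 : ‖x‖ ^ 3 ≤ ‖x‖ ^ 2 := pow_le_pow_of_le_one (norm_nonneg _) hx (by norm_num)
  have hx2 : ‖x‖ ^ 2 ≤ ‖x‖ := by nlinarith [norm_nonneg x]
  have h2 : ‖(1 + x) ^ n - 1 - n * x‖ ≤ (C + n.choose 2) * ‖x‖ ^ 2 := by
    calc _ = ‖((1 + x) ^ n - 1 - n * x - n.choose 2 * x ^ 2) + n.choose 2 * x ^ 2‖ := by
          congr 1; ring
      _ ≤ C * ‖x‖ ^ 3 + n.choose 2 * ‖x‖ ^ 2 := by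
          refine (norm_add_le _ _).trans (add_le_add h1 ?_)
          rw [norm_mul, norm_pow, Complex.norm_natCast]
      _ ≤ _ := by nlinarith
  constructor
  · calc _ = ‖((1 + x) ^ n - 1 - n * x) + n * x‖ := by congr 1; ring
      _ ≤ (C + n.choose 2) * ‖x‖ ^ 2 + n * ‖x‖ := by
          refine (norm_add_le _ _).trans (add_le_add h2 ?_)
          rw [norm_mul, Complex.norm_natCast]
      _ ≤ _ := by
          have : 0 ≤ C + n.choose 2 := by positivity
          nlinarith
  · have : 0 ≤ (n : ℝ) * ‖x‖ ^ 2 := by positivity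
    nlinarith

theorem IsNormalized.derivative_lead {d : ℕ} {W : ℂ[X]} (hW : IsNormalized d W) :
    W.derivative.natDegree = d ∧ W.derivative.leadingCoeff = 1 := by
  have h1 : W.derivative.natDegree = d := by
    rw [natDegree_derivative, hW.natDegree]; rfl
  refine ⟨h1, ?_⟩
  have h2 := hW.leadingCoeff
  rw [Polynomial.leadingCoeff, hW.natDegree] at h2
  have : (d + 1 : ℂ) ≠ 0 := by exact_mod_cast d.succ_ne_zero
  rw [Polynomial.leadingCoeff, h1, coeff_derivative, h2]
  field_simp

/-- The saddle point equals its leading approximation up to a bounded error. -/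
theorem saddle_approx {d : ℕ} (hd : 1 ≤ d) {W : ℂ[X]} (hW : IsNormalized d W) :
    ∃ η₀ > (0 : ℝ), ∃ C : ℝ, 0 ≤ C ∧ ∀ (A s : ℝ) (t : ℂ), 1 ≤ A →
      W.derivative.eval t = A ^ d * Complex.exp (d * s * Complex.I) →
      ‖t - A * Complex.exp (s * Complex.I)‖ ≤ η₀ * A →
      ‖t - A * Complex.exp (s * Complex.I)‖ ≤ C ∧ ‖t‖ ≤ 2 * A ∧ A / 2 ≤ ‖t‖ ∧
      ‖(-(tilted d W A s).eval t) - A ^ (d + 1) * phase d s (Complex.exp (s * Complex.I))‖ ≤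
        C * A ^ d ∧
      ‖W.derivative.derivative.eval t / (d * (A * Complex.exp (s * Complex.I)) ^ (d - 1)) - 1‖ ≤
        C / A := by
  obtain ⟨C₁, hC₁, h₁⟩ := norm_one_add_pow_sub_one_le d
  obtain ⟨C₄, hC₄, h₄⟩ := norm_one_add_pow_sub_one_le (d - 1)
  obtain ⟨C₂, hC₂, h₂⟩ := exists_norm_eval_sub_leading_le W.derivative hW.derivative_lead.1
  obtain ⟨C₃, hC₃, h₃⟩ := eval_sub_phase_le hW
  obtain ⟨C₅, hC₅, h₅⟩ := phase_taylor d
  -- For `d = 1` the exponent `e - 1` of `exists_norm_eval_sub_leading_le` would be truncated to `0`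
  -- when applied to `W''`, and nothing would be gained. Multiplication by `X` gives degree `d ≥ 1`;
  -- the factor is divided out at the end, where `‖t‖ ≥ A / 2`.
  set V := (X * W.derivative.derivative : ℂ[X]) with hV
  have hder2 : W.derivative.derivative.natDegree = d - 1 := by
    rw [natDegree_derivative, hW.derivative_lead.1]
  have hW2lead : W.derivative.derivative.leadingCoeff = d := by
    have h2 := hW.derivative_lead.2
    rw [leadingCoeff, hW.derivative_lead.1] at h2
    rw [leadingCoeff, hder2, coeff_derivative, Nat.sub_add_cancel hd, h2, one_mul]
    push_cast [hd]
    ring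
  have hW2ne : W.derivative.derivative ≠ 0 := by
    intro h
    rw [h, leadingCoeff_zero] at hW2lead
    have : d = 0 := by exact_mod_cast hW2lead.symm
    omega
  have hVdeg : V.natDegree = d := by
    rw [hV, natDegree_X_mul hW2ne, hder2, Nat.sub_add_cancel hd]
  have hVlead : V.leadingCoeff = d := by rw [hV, leadingCoeff_mul, leadingCoeff_X, hW2lead, one_mul]
  obtain ⟨C₆, hC₆, h₆⟩ := exists_norm_eval_sub_leading_le V hVdeg
  set q := 2 * (C₂ * 3 ^ (d - 1)) with hq
  have hd0 : (0 : ℝ) < d := by exact_mod_cast hd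
  refine ⟨min (1 / 2) (1 / (2 * (C₁ + 1))), by positivity,
    q + (C₃ * 3 ^ d + (d / 2 + C₅) * q) + (2 * C₆ * 3 ^ (d - 1) * (1 + C₄) + C₄ * q),
    by positivity, fun A s t hA hX hclose => ?_⟩
  have hA0 : 0 < A := by linarith
  have hAc : (A : ℂ) ≠ 0 := by exact_mod_cast hA0.ne'
  set u := Complex.exp (s * Complex.I) with hu
  have hun : ‖u‖ = 1 := Complex.norm_exp_ofReal_mul_I s
  have hu0 : u ≠ 0 := Complex.exp_ne_zero _
  have hAun : ‖(A : ℂ) * u‖ = A := by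
    rw [norm_mul, hun, mul_one, Complex.norm_real, Real.norm_of_nonneg hA0.le]
  set x := t / (A * u) - 1 with hx
  have htx : t = A * u * (1 + x) := by rw [hx]; field_simp; ring
  have hxn : ‖t - A * u‖ = A * ‖x‖ := by
    rw [show t - A * u = A * u * x by rw [htx]; ring, norm_mul, hAun]
  rw [hxn] at hclose ⊢
  have hxη : ‖x‖ ≤ min (1 / 2) (1 / (2 * (C₁ + 1))) := by nlinarith
  have hx12 : ‖x‖ ≤ 1 / 2 := hxη.trans (min_le_left _ _)
  have hxC : ‖x‖ * (2 * (C₁ + 1)) ≤ 1 := by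
    have := hxη.trans (min_le_right _ _)
    rwa [le_div_iff₀ (by positivity)] at this
  have h1x := norm_add_le 1 x
  have h1x' := norm_sub_le (1 + x) x
  rw [add_sub_cancel_right] at h1x'
  rw [norm_one] at h1x h1x'
  have htn : ‖t‖ = A * ‖1 + x‖ := by rw [htx, norm_mul, hAun]
  have ht2 : ‖t‖ ≤ 2 * A := by rw [htn]; nlinarith
  have ht3 : A / 2 ≤ ‖t‖ := by rw [htn]; nlinarith
  have hpow3 : ∀ k, (1 + ‖t‖) ^ k ≤ 3 ^ k * A ^ k := fun k => by
    rw [← mul_pow]; gcongr; linarith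
  have hAd : A ^ d = A ^ (d - 1) * A := by rw [← pow_succ, Nat.sub_add_cancel hd]
  -- With `t = A u (1 + x)` the saddle equation gives `A^d ‖(1 + x)^d - 1‖ = O(A^{d-1})`. The
  -- assumed closeness implies `‖(1 + x)^d - 1‖ ≥ ‖x‖ / 2`, so `x` is in fact `O(1 / A)`.
  have hxA : A * ‖x‖ ≤ q := by
    have e1 := h₂ t
    rw [hX, hW.derivative_lead.2, one_mul, exp_mul_natCast_I, ← hu, htx,
      show (A : ℂ) ^ d * u ^ d - (A * u * (1 + x)) ^ d = -((A * u) ^ d * ((1 + x) ^ d - 1)) by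
        rw [mul_pow, mul_pow]; ring, norm_neg, norm_mul, norm_pow, hAun, ← htx] at e1
    have e2 := (h₁ x (by linarith)).2
    have e3 : ‖x‖ / 2 ≤ ‖(1 + x) ^ d - 1‖ := by
      have := norm_sub_le ((1 + x) ^ d - 1) ((1 + x) ^ d - 1 - d * x)
      rw [sub_sub_cancel, norm_mul, Complex.norm_natCast] at this
      have hd1 : (1 : ℝ) ≤ d := by exact_mod_cast hd
      nlinarith [norm_nonneg x]
    have e4 : A ^ d * (‖x‖ / 2) ≤ C₂ * (3 ^ (d - 1) * A ^ (d - 1)) :=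
      (mul_le_mul_of_nonneg_left e3 (by positivity)).trans
        (e1.trans (mul_le_mul_of_nonneg_left (hpow3 _) hC₂.le))
    rw [hAd] at e4
    have e5 : A ^ (d - 1) * (A * ‖x‖) ≤ A ^ (d - 1) * q := by rw [hq]; nlinarith
    exact le_of_mul_le_mul_left e5 (by positivity)
  have hq0 : 0 ≤ q := by positivity
  have hxq : ‖x‖ ≤ q / A := by rw [le_div_iff₀ hA0]; linarith
  have n1 : 0 ≤ C₃ * 3 ^ d + (d / 2 + C₅) * q := by positivity
  have n2 : 0 ≤ 2 * C₆ * 3 ^ (d - 1) * (1 + C₄) + C₄ * q := by positivity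
  refine ⟨by linarith, ht2, ht3, ?_, ?_⟩
  -- The change of the phase is quadratic in `x`, because `u` is critical; a bound linear in `x`
  -- already gives an error `O(A^d)`.
  · set τ := u * (1 + x) with hτ
    have e1 := h₃ A s τ hA
    have hAτ : (A : ℂ) * τ = t := by rw [htx, hτ]; ring
    rw [hAτ] at e1
    rw [neg_eval_tilted]
    have e2 := h₅ s (u * x) (by rw [norm_mul, hun]; linarith)
    rw [← hu, show u + u * x = τ by rw [hτ]; ring] at e2
    have hux : ‖u * x‖ = ‖x‖ := by rw [norm_mul, hun, one_mul]
    rw [hux] at e2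
    have hx3 : ‖x‖ ^ 3 ≤ ‖x‖ := pow_le_of_le_one (norm_nonneg _) (by linarith) (by norm_num)
    have hx2 : ‖x‖ ^ 2 ≤ ‖x‖ := pow_le_of_le_one (norm_nonneg _) (by linarith) (by norm_num)
    have e3 : ‖phase d s τ - phase d s u‖ ≤ (d / 2 + C₅) * ‖x‖ := by
      calc _ = ‖(phase d s τ - phase d s u - d / 2 * u ^ (d - 1) * (u * x) ^ 2) +
            d / 2 * u ^ (d - 1) * (u * x) ^ 2‖ := by congr 1; ring
        _ ≤ C₅ * ‖x‖ ^ 3 + d / 2 * ‖x‖ ^ 2 := by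
          refine (norm_add_le _ _).trans (add_le_add e2 (le_of_eq ?_))
          rw [norm_mul, norm_mul, norm_pow, norm_pow, hux, hun, one_pow, mul_one, norm_div,
            Complex.norm_natCast, Complex.norm_ofNat]
        _ ≤ C₅ * ‖x‖ + d / 2 * ‖x‖ := by gcongr
        _ = _ := by ring
    have hτn : 1 + ‖τ‖ ≤ 3 := by
      rw [hτ, norm_mul, hun]; linarith
    calc _ = ‖(W.eval t - A ^ d * Complex.exp (d * s * Complex.I) * t - A ^ (d + 1) * phase d s τ) +
          A ^ (d + 1) * (phase d s τ - phase d s u)‖ := by congr 1; ring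
      _ ≤ C₃ * A ^ d * 3 ^ d + A ^ (d + 1) * ((d / 2 + C₅) * (q / A)) := by
          refine (norm_add_le _ _).trans (add_le_add (e1.trans (by gcongr)) ?_)
          rw [norm_mul, norm_pow, Complex.norm_real, Real.norm_of_nonneg hA0.le]
          gcongr
          exact e3.trans (by gcongr)
      _ = (C₃ * 3 ^ d + (d / 2 + C₅) * q) * A ^ d := by rw [pow_succ]; field_simp
      _ ≤ _ := mul_le_mul_of_nonneg_right (by linarith) (by positivity)
  · have e1 := h₆ t
    rw [hVlead, hV, eval_mul, eval_X] at e1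
    set w := W.derivative.derivative.eval t with hw
    have hdc : (d : ℂ) ≠ 0 := by exact_mod_cast hd0.ne'
    have ht0 : t ≠ 0 := by
      rw [← norm_pos_iff]; linarith
    have hAd' : ((A : ℂ) * u) ^ d = (A * u) ^ (d - 1) * (A * u) := by
      rw [← pow_succ, Nat.sub_add_cancel hd]
    have htd : t ^ d = t ^ (d - 1) * t := by rw [← pow_succ, Nat.sub_add_cancel hd]
    have e2 := (h₄ x (by linarith)).1
    have hden : ‖(d : ℂ) * (A * u) ^ (d - 1)‖ = d * A ^ (d - 1) := by
      rw [norm_mul, norm_pow, hAun, Complex.norm_natCast]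
    have hden0 : (d : ℂ) * (A * u) ^ (d - 1) ≠ 0 := by
      rw [← norm_pos_iff, hden]; positivity
    have hd1 : (1 : ℝ) ≤ d := by exact_mod_cast hd
    have e3 : ‖w - d * t ^ (d - 1)‖ ≤ 2 * C₆ * 3 ^ (d - 1) * A ^ (d - 1) / A := by
      have : ‖t‖ * ‖w - d * t ^ (d - 1)‖ ≤ C₆ * (3 ^ (d - 1) * A ^ (d - 1)) := by
        rw [← norm_mul, show t * (w - d * t ^ (d - 1)) = t * w - d * t ^ d by rw [htd]; ring]
        exact e1.trans (by gcongr; exact hpow3 _)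
      rw [le_div_iff₀ hA0]
      nlinarith [norm_nonneg (w - d * t ^ (d - 1))]
    have e4 : w / (d * (A * u) ^ (d - 1)) - 1 =
        (w - d * t ^ (d - 1)) / (d * (A * u) ^ (d - 1)) + ((1 + x) ^ (d - 1) - 1) := by
      have : t ^ (d - 1) = (A * u) ^ (d - 1) * (1 + x) ^ (d - 1) := by rw [htx, mul_pow]
      rw [this]
      field_simp
      ring
    rw [e4]
    calc _ ≤ 2 * C₆ * 3 ^ (d - 1) * A ^ (d - 1) / A / (A ^ (d - 1)) + C₄ * (q / A) := by
          refine (norm_add_le _ _).trans (add_le_add ?_ (e2.trans (by gcongr)))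
          rw [norm_div, hden]
          refine div_le_div₀ (by positivity) e3 (by positivity) ?_
          exact le_mul_of_one_le_left (by positivity) hd1
      _ = (2 * C₆ * 3 ^ (d - 1) + C₄ * q) / A := by field_simp
      _ ≤ _ := by
          have : 0 ≤ 2 * C₆ * 3 ^ (d - 1) * C₄ := by positivity
          exact div_le_div_of_nonneg_right (by linarith) hA0.le

/-- The quantity under the root is `exp Z` for an explicit `Z`. The condition on `ψ` and `|arg μ| <
π / 2` place the imaginary part of `Z` strictly between `-π` and `π`. So the principal root is `exp
(Z / 2)`, and the direction `ψ` of the path drops out. -/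
theorem gaussian_factor {d : ℕ} (hd : 1 ≤ d) {A : ℝ} (hA : 0 < A) (s ψ : ℝ) {μ : ℂ}
    (hμ : ‖μ - 1‖ < 1) (hν : |2 * ψ + (d - 1) * s - Real.pi| ≤ Real.pi / 2) :
    A * Complex.exp (ψ * Complex.I) * (Real.pi / (-(d * (A * Complex.exp (s * Complex.I)) ^ (d - 1)
      * μ / 2 * (A * Complex.exp (ψ * Complex.I)) ^ 2))) ^ (1 / 2 : ℂ) =
    Complex.I * √(2 * Real.pi / d) * Complex.exp (-((d - 1) / 2) * (Real.log A + s * Complex.I)) *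
      μ ^ (-1 / 2 : ℂ) := by
  have hμre : 0 < μ.re := by
    have := (abs_lt.mp ((Complex.abs_re_le_norm _).trans_lt hμ)).1
    simp only [Complex.sub_re, Complex.one_re] at this
    linarith
  have hμ0 : μ ≠ 0 := by rintro rfl; simp at hμre
  have hd0 : (0 : ℝ) < d := by exact_mod_cast hd
  have h2 : 0 < 2 * Real.pi / d := by positivity
  set Z : ℂ := Real.log (2 * Real.pi / d) - (d + 1) * Real.log A -
    (2 * ψ + (d - 1) * s - Real.pi) * Complex.I - Complex.log μ with hZ
  have hexpA : Complex.exp (Real.log A) = A := by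
    rw [← Complex.ofReal_exp, Real.exp_log hA]
  have hZexp : Complex.exp Z = Real.pi / (-(d * (A * Complex.exp (s * Complex.I)) ^ (d - 1)
      * μ / 2 * (A * Complex.exp (ψ * Complex.I)) ^ 2)) := by
    obtain ⟨e, rfl⟩ : ∃ e, d = e + 1 := ⟨d - 1, by omega⟩
    rw [hZ]
    have h3 : (Real.log (2 * Real.pi / (e + 1 : ℕ)) - ((e + 1 : ℕ) + 1) * Real.log A -
      (2 * ψ + ((e + 1 : ℕ) - 1) * s - Real.pi) * Complex.I - Complex.log μ : ℂ) =
      Real.log (2 * Real.pi / (e + 1 : ℕ)) - ((e + 2 : ℕ) * Real.log A + (2 : ℕ) * (ψ * Complex.I)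
        + (e : ℕ) * (s * Complex.I) + Complex.log μ) + Real.pi * Complex.I := by
      push_cast; ring
    rw [h3, Complex.exp_add, Complex.exp_sub, Complex.exp_add, Complex.exp_add, Complex.exp_add,
      Complex.exp_nat_mul, Complex.exp_nat_mul, Complex.exp_nat_mul, Complex.exp_log hμ0, hexpA,
      Complex.exp_pi_mul_I, ← Complex.ofReal_exp, Real.exp_log h2]
    have hA' : (A : ℂ) ≠ 0 := by exact_mod_cast hA.ne'
    have he : ((e : ℂ) + 1) ≠ 0 := by exact_mod_cast e.succ_ne_zero
    have := Complex.exp_ne_zero (s * Complex.I)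
    have := Complex.exp_ne_zero (ψ * Complex.I)
    rw [Nat.add_sub_cancel]
    push_cast
    field_simp
    ring
  have hZim : Z.im = -(2 * ψ + (d - 1) * s - Real.pi) - μ.arg := by
    have : Z = ((Real.log (2 * Real.pi / d) - (d + 1) * Real.log A : ℝ) : ℂ) -
      ((2 * ψ + (d - 1) * s - Real.pi : ℝ) : ℂ) * Complex.I - Complex.log μ := by
      rw [hZ]; push_cast; ring
    rw [this, Complex.sub_im, Complex.sub_im, Complex.ofReal_im, Complex.im_ofReal_mul,
      Complex.I_im, Complex.log_im]
    ring
  have harg : |μ.arg| < Real.pi / 2 := Complex.abs_arg_lt_pi_div_two_iff.mpr (Or.inl hμre)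
  have hlog : Complex.log (Complex.exp Z) = Z := by
    apply Complex.log_exp
    · rw [hZim]; linarith [(abs_le.mp hν).2, (abs_lt.mp harg).2]
    · rw [hZim]; linarith [(abs_le.mp hν).1, (abs_lt.mp harg).1]
  rw [← hZexp, Complex.cpow_def_of_ne_zero (Complex.exp_ne_zero _), hlog,
    Complex.cpow_def_of_ne_zero hμ0, ← hexpA]
  have hsq : (√(2 * Real.pi / d) : ℂ) = Complex.exp (Real.log (2 * Real.pi / d) / 2) := by
    rw [Real.sqrt_eq_rpow, Real.rpow_def_of_pos h2, Complex.ofReal_exp]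
    congr 1; push_cast; ring
  have hI : Complex.I * Complex.exp (Real.log (2 * Real.pi / d) / 2) =
      Complex.exp (Real.pi / 2 * Complex.I + Real.log (2 * Real.pi / d) / 2) := by
    rw [Complex.exp_add, Complex.exp_pi_div_two_mul_I]
  rw [hsq, hI]
  simp only [← Complex.exp_add]
  congr 1
  rw [hZ]
  ring


/-! ### The contribution of one saddle, given paths of descent. -/

theorem taylor_coeff_two (f : ℂ[X]) (t : ℂ) :
    (taylor t f).coeff 2 = f.derivative.derivative.eval t / 2 := by
  rw [taylor_coeff, eq_div_iff two_ne_zero]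
  have h := congrArg (eval t) (congrFun (factorial_smul_hasseDeriv (R := ℂ) 2) f)
  simp only [Function.iterate_succ, Function.iterate_zero, Function.comp, id] at h
  rw [← h]
  simp [Nat.factorial, mul_comm]

theorem exp_neg_le_div (N : ℕ) {c : ℝ} (hc : 0 < c) : ∃ C : ℝ, 0 < C ∧ ∀ A : ℝ, 1 ≤ A →
    Real.exp (-c * A) ≤ C * (1 / (A ^ N * √(A ^ N))) := by
  obtain ⟨C, hC, h⟩ := exists_one_add_pow_le_exp (2 * N) hc
  refine ⟨C, hC, fun A hA => ?_⟩
  have hA0 : 0 < A := by linarith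
  have h1 : A ^ N * √(A ^ N) ≤ C * Real.exp (c * A) := by
    refine le_trans ?_ (h A hA0.le)
    have : √(A ^ N) ≤ A ^ N := by
      rw [Real.sqrt_le_left (by positivity)]
      exact le_self_pow₀ (one_le_pow₀ hA) two_ne_zero
    calc _ ≤ A ^ N * A ^ N := by gcongr
      _ = A ^ (2 * N) := by ring
      _ ≤ _ := by gcongr; linarith
  rw [neg_mul, Real.exp_neg, mul_one_div, inv_eq_one_div, div_le_div_iff₀ (Real.exp_pos _)
    (by positivity)]
  linarith

/-- Single saddle asymptotics of the difference of two limits of a primitive of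
`σ(t) exp (W(t) - x t)`, given curves of descent. -/
theorem saddle_asymptotics_of_descent {d m : ℕ} (hd : 1 ≤ d) {W σ : ℂ[X]} (hW : IsNormalized d W)
    (hσ : σ.natDegree ≤ m) {I : Set ℝ} {ψ : ℝ → ℝ} {ε : ℝ} (hε : 0 < ε) (hε' : ε ≤ Real.pi / 2)
    (hν : ∀ s ∈ I, |2 * ψ s + (d - 1) * s - Real.pi| ≤ Real.pi / 2 - ε) {w₁ w₂ : ℂ}
    (h₁ : HasDescent d I (fun s => Complex.exp (ψ s * Complex.I)) w₁)
    (h₂ : HasDescent d I (fun s => -Complex.exp (ψ s * Complex.I)) w₂) :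
    ∃ η₀ > (0 : ℝ), ∃ K : ℝ, ∃ A₀ ≥ (1 : ℝ), ∀ A : ℝ, A₀ ≤ A → ∀ s ∈ I, ∀ t : ℂ,
      W.derivative.eval t = A ^ d * Complex.exp (d * s * Complex.I) →
      ‖t - A * Complex.exp (s * Complex.I)‖ ≤ η₀ * A →
      ∀ Φ : ℂ → ℂ, (∀ z, HasDerivAt Φ
          (σ.eval z * Complex.exp (-(tilted d W A s).eval z)) z) →
      ∀ L₁ L₂ : ℂ, Tendsto (fun v : ℝ => Φ (v * w₁)) atTop (𝓝 L₁) →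
      Tendsto (fun v : ℝ => Φ (v * w₂)) atTop (𝓝 L₂) →
      ‖(L₁ - L₂) * Complex.exp ((tilted d W A s).eval t) -
        σ.eval t * (Complex.I * √(2 * Real.pi / d) *
          Complex.exp (-((d - 1) / 2) * (Real.log A + s * Complex.I)) *
          (W.derivative.derivative.eval t /
            (d * (A * Complex.exp (s * Complex.I)) ^ (d - 1))) ^ (-1 / 2 : ℂ))‖ ≤
        K * (A ^ (m + 1) / (A ^ (d + 1) * √(A ^ (d + 1)))) := by
  set c₀ := Real.sin ε with hc₀def
  have hc₀ : 0 < c₀ := Real.sin_pos_of_pos_of_lt_pi hε (by linarith [Real.pi_pos])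
  have hc₁ : c₀ ≤ 1 := Real.sin_le_one _
  -- The argument of `e^{i(d-1)s} κ²`, where `κ = e^{iψ}`, is within `π / 2 - ε` of `π`, so its real
  -- part is at most `-sin ε`: `κ` is a direction of descent.
  have hcos : ∀ s ∈ I, c₀ ≤ Real.cos (2 * ψ s + (d - 1) * s - Real.pi) := fun s hs => by
    rw [← Real.cos_abs, hc₀def, ← Real.cos_pi_div_two_sub]
    exact Real.cos_le_cos_of_nonneg_of_le_pi (abs_nonneg _) (by linarith [Real.pi_pos]) (hν s hs)
  have hdir : ∀ s : ℝ, Complex.exp (s * Complex.I) ^ (d - 1) * Complex.exp (ψ s * Complex.I) ^ 2 =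
      -Complex.exp ((2 * ψ s + (d - 1) * s - Real.pi : ℝ) * Complex.I) := fun s => by
    rw [← Complex.exp_nat_mul, ← Complex.exp_nat_mul, ← Complex.exp_add]
    have : (((2 * ψ s + (d - 1) * s - Real.pi : ℝ) : ℂ) * Complex.I) =
      ((d - 1 : ℕ) * (s * Complex.I) + (2 : ℕ) * (ψ s * Complex.I)) - Real.pi * Complex.I := by
      push_cast [hd]; ring
    rw [this, Complex.exp_sub, Complex.exp_pi_mul_I, div_neg, div_one, neg_neg]
  have hre : ∀ s ∈ I, (Complex.exp (s * Complex.I) ^ (d - 1) *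
      Complex.exp (ψ s * Complex.I) ^ 2).re ≤ -c₀ := fun s hs => by
    rw [hdir, Complex.neg_re, Complex.exp_ofReal_mul_I_re]
    exact neg_le_neg (hcos s hs)
  obtain ⟨η₀, hη₀, C, hC, happ⟩ := saddle_approx hd hW
  obtain ⟨δ₁, hδ₁, H₁⟩ := descent_bound hd hW hσ C h₁ hc₀ hc₁
    (fun s _ => Complex.norm_exp_ofReal_mul_I _) hre
  obtain ⟨δ₂, hδ₂, H₂⟩ := descent_bound hd hW hσ C h₂ hc₀ hc₁
    (fun s _ => by rw [norm_neg]; exact Complex.norm_exp_ofReal_mul_I _)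
    (fun s hs => by rw [neg_sq]; exact hre s hs)
  obtain ⟨δ₃, hδ₃, H₃⟩ := local_laplace hW hσ (show 0 < c₀ / 4 by positivity)
  set δ := min δ₁ (min δ₂ δ₃) with hδdef
  have hδ : 0 < δ := by positivity
  obtain ⟨c, hc, K₁, hK₁, A₁, hA₁, H₁⟩ := H₁ δ hδ (min_le_left _ _)
  obtain ⟨c', hc', K₂, hK₂, A₂, hA₂, H₂⟩ := H₂ δ hδ ((min_le_right _ _).trans (min_le_left _ _))
  obtain ⟨K₃, H₃⟩ := H₃ δ hδ ((min_le_right _ _).trans (min_le_right _ _))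
  obtain ⟨C₁, hC₁, hexp₁⟩ := exp_neg_le_div (d + 1) hc
  obtain ⟨C₂, hC₂, hexp₂⟩ := exp_neg_le_div (d + 1) hc'
  refine ⟨η₀, hη₀, K₁ * C₁ + K₃ + K₂ * C₂,
    max (max A₁ A₂) (max (C / (c₀ / 12 * δ)) (C / (c₀ / 2))),
    hA₁.trans ((le_max_left _ _).trans (le_max_left _ _)), ?_⟩
  intro A hA s hs t hX hclose Φ hΦ L₁ L₂ hL₁ hL₂
  have hAA₁ : A₁ ≤ A := ((le_max_left _ _).trans (le_max_left _ _)).trans hA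
  have hAA₂ : A₂ ≤ A := ((le_max_right _ _).trans (le_max_left _ _)).trans hA
  have hA1 : 1 ≤ A := hA₁.trans hAA₁
  have hA0 : 0 < A := by linarith
  have hAc : (A : ℂ) ≠ 0 := by exact_mod_cast hA0.ne'
  have hCA : C / A ≤ c₀ / 12 * δ := by
    have : C / (c₀ / 12 * δ) ≤ A := ((le_max_left _ _).trans (le_max_right _ _)).trans hA
    rw [div_le_iff₀ (by positivity)] at this ⊢
    linarith
  have hCA' : C / A ≤ c₀ / 2 := by
    have : C / (c₀ / 2) ≤ A := ((le_max_right _ _).trans (le_max_right _ _)).trans hA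
    rw [div_le_iff₀ (by positivity)] at this ⊢
    linarith
  obtain ⟨a1, a2, -, a4, a5⟩ := happ A s t hA1 hX hclose
  set u := Complex.exp (s * Complex.I) with hu
  have hun : ‖u‖ = 1 := Complex.norm_exp_ofReal_mul_I s
  set κ := Complex.exp (ψ s * Complex.I) with hκ
  have hκn : ‖κ‖ = 1 := Complex.norm_exp_ofReal_mul_I _
  set μ := W.derivative.derivative.eval t / (d * (A * u) ^ (d - 1)) with hμ
  have hμ1 : ‖μ - 1‖ ≤ c₀ / 2 := a5.trans hCA'
  have hd0 : (d : ℂ) ≠ 0 := by exact_mod_cast (by omega : d ≠ 0)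
  have hu0 : u ≠ 0 := Complex.exp_ne_zero _
  have hcoef : (taylor t W).coeff 2 = d * (A * u) ^ (d - 1) * μ / 2 := by
    rw [taylor_coeff_two, hμ]
    field_simp
  have hclose' : ‖t / A - u‖ ≤ c₀ / 12 * δ := by
    rw [show t / A - u = (t - A * u) / A by field_simp, norm_div, Complex.norm_real,
      Real.norm_of_nonneg hA0.le]
    exact (div_le_div_of_nonneg_right a1 hA0.le).trans hCA
  have hneg : ∀ z : ℂ, ‖z‖ * ‖Complex.exp ((tilted d W A s).eval t)‖ =
      ‖z‖ / Real.exp (-(tilted d W A s).eval t).re := fun z => by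
    rw [Complex.norm_exp, Complex.neg_re, Real.exp_neg, div_inv_eq_mul]
  have g1 := H₁ A hAA₁ s hs _ a4 Φ hΦ L₁ hL₁ (t / A + δ * κ) (by
    rwa [show t / A + δ * κ - (u + δ * κ) = t / A - u by ring])
  have g2 := H₂ A hAA₂ s hs _ a4 Φ hΦ L₂ hL₂ (t / A - δ * κ) (by
    rwa [show t / A - δ * κ - (u + δ * -κ) = t / A - u by ring])
  have hre2 : ((taylor t W).coeff 2 * (A * κ) ^ 2 / A ^ (d + 1)).re ≤ -(c₀ / 4) := by
    have e1 : (taylor t W).coeff 2 * (A * κ) ^ 2 / A ^ (d + 1) =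
        ((d / 2 : ℝ) : ℂ) * ((u ^ (d - 1) * κ ^ 2) + (u ^ (d - 1) * κ ^ 2) * (μ - 1)) := by
      rw [hcoef]
      obtain ⟨e, rfl⟩ : ∃ e, d = e + 1 := ⟨d - 1, by omega⟩
      rw [Nat.add_sub_cancel]
      push_cast
      field_simp
      ring
    rw [e1, Complex.re_ofReal_mul, Complex.add_re]
    have e2 := hre s hs
    have e3 : ‖(u ^ (d - 1) * κ ^ 2) * (μ - 1)‖ ≤ c₀ / 2 := by
      rw [norm_mul, norm_mul, norm_pow, norm_pow, hun, hκn, one_pow, one_pow, one_mul, one_mul]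
      exact hμ1
    have e4 := (abs_le.mp ((Complex.abs_re_le_norm _).trans e3)).2
    have hd1 : (1 : ℝ) ≤ d := by exact_mod_cast hd
    nlinarith
  have g3 := H₃ A s t κ hA1 hκn a2 hX hre2 Φ hΦ
  rw [hcoef, show A * κ * σ.eval t * (Real.pi / (-(d * (A * u) ^ (d - 1) * μ / 2 * (A * κ) ^ 2)))
      ^ (1 / 2 : ℂ) = σ.eval t * (A * κ * (Real.pi / (-(d * (A * u) ^ (d - 1) * μ / 2 *
      (A * κ) ^ 2))) ^ (1 / 2 : ℂ)) by ring, hu, hκ,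
    gaussian_factor hd hA0 s (ψ s) (by linarith) ((hν s hs).trans (by linarith)), ← hκ] at g3
  have e1 : (A : ℂ) * (t / A + δ * κ) = t + A * (δ * κ) := by field_simp
  have e2 : (A : ℂ) * (t / A - δ * κ) = t - A * (δ * κ) := by field_simp
  rw [e1] at g1
  rw [e2] at g2
  set R := A ^ (m + 1) / (A ^ (d + 1) * √(A ^ (d + 1))) with hR
  have hR1 : 1 / (A ^ (d + 1) * √(A ^ (d + 1))) ≤ R := by
    rw [hR]; gcongr; exact one_le_pow₀ hA1
  set Ex := Complex.exp ((tilted d W A s).eval t) with hEx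
  have f1 : ‖(L₁ - Φ (t + A * (δ * κ))) * Ex‖ ≤ K₁ * C₁ * R := by
    rw [norm_mul, hneg, div_le_iff₀ (Real.exp_pos _)]
    refine g1.trans ?_
    have := (hexp₁ A hA1).trans (mul_le_mul_of_nonneg_left hR1 hC₁.le)
    calc _ ≤ Real.exp (-(tilted d W A s).eval t).re * K₁ * (C₁ * R) := by gcongr
      _ = _ := by ring
  have f2 : ‖(L₂ - Φ (t - A * (δ * κ))) * Ex‖ ≤ K₂ * C₂ * R := by
    rw [norm_mul, hneg, div_le_iff₀ (Real.exp_pos _)]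
    refine g2.trans ?_
    have := (hexp₂ A hA1).trans (mul_le_mul_of_nonneg_left hR1 hC₂.le)
    calc _ ≤ Real.exp (-(tilted d W A s).eval t).re * K₂ * (C₂ * R) := by gcongr
      _ = _ := by ring
  -- Two exponentially small tails, and the Laplace integral over the short segment through the
  -- saddle.
  rw [show ∀ M : ℂ, (L₁ - L₂) * Ex - M = (L₁ - Φ (t + A * (δ * κ))) * Ex +
      ((Φ (t + A * (δ * κ)) - Φ (t - A * (δ * κ))) * Ex - M) -
      (L₂ - Φ (t - A * (δ * κ))) * Ex from fun M => by ring]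
  refine (norm_sub_le _ _).trans ?_
  have := norm_add_le ((L₁ - Φ (t + A * (δ * κ))) * Ex) (((Φ (t + A * (δ * κ)) -
    Φ (t - A * (δ * κ))) * Ex - σ.eval t * (Complex.I * √(2 * Real.pi / d) *
          Complex.exp (-((d - 1) / 2) * (Real.log A + s * Complex.I)) * μ ^ (-1 / 2 : ℂ))))
  calc _ ≤ (K₁ * C₁ * R + K₃ * R) + K₂ * C₂ * R :=
        add_le_add (this.trans (add_le_add f1 g3)) f2
    _ = _ := by ring


/-! ### Sectors and explicit paths of descent. -/

/-- The open sector of half-opening `h` around the direction of argument `θ`. -/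
def openSector (θ h : ℝ) : Set ℂ :=
  {x | ∃ r : ℝ, 0 < r ∧ ∃ φ : ℝ, |φ - θ| < h ∧ x = r * Complex.exp (φ * Complex.I)}

theorem exp_mem_openSector {θ h φ : ℝ} (hφ : |φ - θ| < h) :
    Complex.exp (φ * Complex.I) ∈ openSector θ h := ⟨1, one_pos, φ, hφ, by simp⟩

/-- A sector of opening at most `π` is an intersection of two open half-planes; convexity is read
off from this description. -/
theorem mem_openSector_iff {θ h : ℝ} (hh : 0 < h) (hh' : h ≤ Real.pi / 2) (x : ℂ) :
    x ∈ openSector θ h ↔ 0 < (x * Complex.exp ((h - θ : ℝ) * Complex.I)).im ∧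
      (x * Complex.exp ((-h - θ : ℝ) * Complex.I)).im < 0 := by
  have him : ∀ r a b : ℝ, ((r : ℂ) * Complex.exp (a * Complex.I) *
      Complex.exp (b * Complex.I)).im = r * Real.sin (a + b) := fun r a b => by
    rw [mul_assoc, ← Complex.exp_add, Complex.im_ofReal_mul, ← add_mul, ← Complex.ofReal_add,
      Complex.exp_ofReal_mul_I_im]
  constructor
  · rintro ⟨r, hr, φ, hφ, rfl⟩
    have h1 := (abs_lt.mp hφ).1
    have h2 := (abs_lt.mp hφ).2
    rw [him, him]
    constructor
    · exact mul_pos hr (Real.sin_pos_of_pos_of_lt_pi (by linarith) (by linarith))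
    · exact mul_neg_of_pos_of_neg hr (Real.sin_neg_of_neg_of_neg_pi_lt (by linarith) (by linarith))
  · rintro ⟨h1, h2⟩
    set y := x * Complex.exp ((-θ : ℝ) * Complex.I) with hy
    have hx : ∀ a : ℝ, x * Complex.exp ((a - θ : ℝ) * Complex.I) =
        (‖y‖ : ℂ) * Complex.exp (y.arg * Complex.I) * Complex.exp (a * Complex.I) := fun a => by
      rw [Complex.norm_mul_exp_arg_mul_I, hy, mul_assoc, ← Complex.exp_add]
      congr 2; push_cast; ring
    rw [hx, him] at h1 h2
    have hy0 : 0 < ‖y‖ := by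
      rcases (norm_nonneg y).eq_or_lt with h | h
      · rw [← h] at h1; simp at h1
      · exact h
    have s1 : 0 < Real.sin (y.arg + h) := (mul_pos_iff_of_pos_left hy0).mp h1
    have s2 : Real.sin (y.arg + -h) < 0 := by
      by_contra hcon
      exact absurd h2 (not_lt.mpr (mul_nonneg hy0.le (not_lt.mp hcon)))
    have hc : 0 < Real.cos y.arg := by
      rw [Real.sin_add] at s1 s2
      rw [Real.cos_neg, Real.sin_neg] at s2
      have hs : 0 < Real.sin h := Real.sin_pos_of_pos_of_lt_pi hh (by linarith [Real.pi_pos])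
      by_contra hcon
      nlinarith
    have ha : |y.arg| < Real.pi / 2 := by
      by_contra hcon
      rw [← Real.cos_abs] at hc
      exact absurd hc (not_lt.mpr (Real.cos_nonpos_of_pi_div_two_le_of_le (not_lt.mp hcon)
        ((Complex.abs_arg_le_pi y).trans (by linarith [Real.pi_pos]))))
    have ha' := abs_lt.mp ha
    refine ⟨‖y‖, hy0, y.arg + θ, ?_, ?_⟩
    · rw [add_sub_cancel_right, abs_lt]
      constructor
      · by_contra hcon
        exact absurd s1 (not_lt.mpr (Real.sin_nonpos_of_nonpos_of_neg_pi_le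
          (by linarith) (by linarith)))
      · by_contra hcon
        exact absurd s2 (not_lt.mpr (Real.sin_nonneg_of_nonneg_of_le_pi
          (by linarith) (by linarith)))
    · have := hx θ
      rw [sub_self, Complex.ofReal_zero, zero_mul, Complex.exp_zero, mul_one] at this
      rw [this, mul_assoc, ← Complex.exp_add]
      push_cast
      ring_nf

theorem convex_openSector {θ h : ℝ} (hh : 0 < h) (hh' : h ≤ Real.pi / 2) :
    Convex ℝ (openSector θ h) := by
  intro x hx y hy a b ha hb hab
  rw [mem_openSector_iff hh hh'] at *
  simp only [Complex.real_smul, add_mul, Complex.add_im, mul_assoc, Complex.im_ofReal_mul]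
  rcases ha.eq_or_lt with rfl | ha'
  · have hb1 : b = 1 := by linarith
    subst hb1
    simpa using hy
  · exact ⟨add_pos_of_pos_of_nonneg (mul_pos ha' hx.1) (mul_nonneg hb hy.1.le),
      add_neg_of_neg_of_nonpos (mul_neg_of_pos_of_neg ha' hx.2)
        (mul_nonpos_of_nonneg_of_nonpos hb hy.2.le)⟩

theorem re_pow_openSector {k : ℕ} {θ h : ℝ} {x : ℂ} (hx : x ∈ openSector θ h) :
    ∃ r : ℝ, 0 < r ∧ ∃ φ : ℝ, |φ - θ| < h ∧ (x ^ k).re = r * Real.cos (k * φ) := by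
  obtain ⟨r, hr, φ, hφ, rfl⟩ := hx
  refine ⟨r ^ k, by positivity, φ, hφ, ?_⟩
  rw [mul_pow, ← Complex.exp_nat_mul, ← Complex.ofReal_pow, Complex.re_ofReal_mul,
    ← mul_assoc, ← Complex.ofReal_natCast, ← Complex.ofReal_mul, Complex.exp_ofReal_mul_I_re]

/-- Segments inside the decaying sectors around the directions of argument `± π / (d + 1)`. -/
theorem re_pow_neg_of_segment {d : ℕ} (hd : 1 ≤ d) {ς φ : ℝ} (hς : ς = 1 ∨ ς = -1)
    (hφ : |φ - ς * (Real.pi / (d + 1))| < Real.pi / (2 * (d + 1))) :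
    ∀ x ∈ segment ℝ (Complex.exp (φ * Complex.I))
      (Complex.exp ((ς * (Real.pi / (d + 1)) : ℝ) * Complex.I)), (x ^ (d + 1)).re < 0 := by
  intro x hx
  have hd1 : (1 : ℝ) ≤ d := by exact_mod_cast hd
  have hpos : 0 < Real.pi / (2 * (d + 1)) := by positivity
  have hmem := (convex_openSector hpos (by
    rw [div_le_div_iff_of_pos_left Real.pi_pos (by positivity) two_pos]; linarith)).segment_subset
    (exp_mem_openSector hφ) (exp_mem_openSector (by rwa [sub_self, abs_zero])) hx
  obtain ⟨r, hr, φ', hφ', he⟩ := re_pow_openSector (k := d + 1) hmem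
  rw [he]
  refine mul_neg_of_pos_of_neg hr ?_
  rw [abs_lt] at hφ'
  have e1 : ((d + 1 : ℕ) : ℝ) * (Real.pi / (2 * (d + 1))) = Real.pi / 2 := by
    push_cast; field_simp
  have e2 : ((d + 1 : ℕ) : ℝ) * (ς * (Real.pi / (d + 1))) = ς * Real.pi := by
    push_cast; field_simp
  have hk : (0 : ℝ) < ((d + 1 : ℕ) : ℝ) := by positivity
  have h1 := mul_lt_mul_of_pos_left hφ'.1 hk
  have h2 := mul_lt_mul_of_pos_left hφ'.2 hk
  rw [mul_neg, e1, mul_sub, e2] at h1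
  rw [e1, mul_sub, e2] at h2
  rcases hς with rfl | rfl
  · exact Real.cos_neg_of_pi_div_two_lt_of_lt (by linarith) (by linarith)
  · rw [← Real.cos_neg]
    exact Real.cos_neg_of_pi_div_two_lt_of_lt (by linarith) (by linarith)

theorem phase_ray_re (d : ℕ) (s ρ φ : ℝ) :
    (phase d s (ρ * Complex.exp (φ * Complex.I))).re =
      ρ ^ (d + 1) * Real.cos ((d + 1) * φ) / (d + 1) - ρ * Real.cos (d * s + φ) := by
  have h : phase d s (ρ * Complex.exp (φ * Complex.I)) =
      ((ρ ^ (d + 1) / (d + 1) : ℝ) : ℂ) * Complex.exp (((d + 1) * φ : ℝ) * Complex.I) -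
      (ρ : ℂ) * Complex.exp ((d * s + φ : ℝ) * Complex.I) := by
    rw [phase, mul_pow, ← Complex.exp_nat_mul]
    have : Complex.exp ((d * s + φ : ℝ) * Complex.I) =
        Complex.exp (d * s * Complex.I) * Complex.exp (φ * Complex.I) := by
      rw [← Complex.exp_add]; congr 1; push_cast; ring
    rw [this]
    push_cast
    ring_nf
  rw [h, Complex.sub_re, Complex.re_ofReal_mul, Complex.re_ofReal_mul,
    Complex.exp_ofReal_mul_I_re, Complex.exp_ofReal_mul_I_re]
  ring

theorem phase_saddle_re (d : ℕ) (s : ℝ) :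
    (phase d s (Complex.exp (s * Complex.I))).re =
      -(d / (d + 1) * Real.cos ((d + 1) * s)) := by
  have := phase_ray_re d s 1 s
  rw [Complex.ofReal_one, one_mul] at this
  rw [this, show (d : ℝ) * s + s = (d + 1) * s by ring]
  field_simp
  ring

/-- On the ray through the saddle the drop of the phase is a multiple of this polynomial, which has
a double zero at `ρ = 1`. The polynomial for `d + 1` is `ρ` times the one for `d` plus `(d + 1) (ρ -
1)²`, and this drives the induction. -/
theorem sq_mul_le_pow_sub (d : ℕ) (hd : 2 ≤ d) {ρ : ℝ} (hρ : 0 ≤ ρ) :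
    (ρ - 1) ^ 2 * (1 + ρ ^ (d - 1)) ≤ ρ ^ (d + 1) - (d + 1) * ρ + d := by
  induction d, hd using Nat.le_induction with
  | base => norm_num; nlinarith [sq_nonneg (ρ - 1)]
  | succ d hd ih =>
    have h1 : ρ ^ (d + 1 - 1) = ρ * ρ ^ (d - 1) := by
      rw [← pow_succ']; congr 1; omega
    have h2 : ρ ^ (d + 1 + 1) - ((d + 1 : ℕ) + 1) * ρ + (d + 1 : ℕ) =
        ρ * (ρ ^ (d + 1) - (d + 1) * ρ + d) + (d + 1) * (ρ - 1) ^ 2 := by push_cast; ring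
    rw [h1, h2]
    have h3 := mul_le_mul_of_nonneg_left ih hρ
    have h4 : 0 ≤ (ρ - 1) ^ 2 := sq_nonneg _
    have h5 : (0 : ℝ) ≤ d := by positivity
    nlinarith [mul_nonneg h4 hρ, mul_nonneg h4 h5]

/-- Away from the double zero, `sq_mul_le_pow_sub` is comparable with `1 + ρ^{d+1}`. This yields a
definite gap near the saddle and the full growth at infinity at once. -/
theorem le_pow_sub_of_le_abs {d : ℕ} (hd : 2 ≤ d) {ρ δ : ℝ} (hρ : 0 ≤ ρ) (hδ : 0 < δ)
    (h : δ ≤ |ρ - 1|) :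
    (δ / (2 + δ)) ^ 2 * (1 + ρ ^ (d + 1)) ≤ ρ ^ (d + 1) - (d + 1) * ρ + d := by
  refine le_trans ?_ (sq_mul_le_pow_sub d hd hρ)
  have h1 : δ / (2 + δ) * (1 + ρ) ≤ |ρ - 1| := by
    rw [div_mul_eq_mul_div, div_le_iff₀ (by positivity)]
    rcases le_total ρ 1 with h' | h'
    · rw [abs_of_nonpos (by linarith)] at *; nlinarith
    · rw [abs_of_nonneg (by linarith)] at *; nlinarith
  have h2 : (δ / (2 + δ)) ^ 2 * (1 + ρ) ^ 2 ≤ (ρ - 1) ^ 2 := by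
    rw [← mul_pow, ← sq_abs (ρ - 1)]; gcongr
  have h3 : 1 + ρ ^ (d + 1) ≤ (1 + ρ) ^ 2 * (1 + ρ ^ (d - 1)) := by
    have : ρ ^ (d + 1) = ρ ^ (d - 1) * ρ ^ 2 := by rw [← pow_add]; congr 1; omega
    rw [this]
    have := pow_nonneg hρ (d - 1)
    nlinarith [mul_nonneg this hρ]
  calc _ ≤ (δ / (2 + δ)) ^ 2 * ((1 + ρ) ^ 2 * (1 + ρ ^ (d - 1))) := by gcongr
    _ = (δ / (2 + δ)) ^ 2 * (1 + ρ) ^ 2 * (1 + ρ ^ (d - 1)) := by ring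
    _ ≤ _ := by gcongr

theorem one_add_pow_le_two_pow (d : ℕ) {v : ℝ} (hv : 0 ≤ v) :
    (1 + v) ^ (d + 1) ≤ 2 ^ (d + 1) * (1 + v ^ (d + 1)) := by
  have := add_pow_le zero_le_one hv (d + 1)
  rw [one_pow, Nat.add_sub_cancel] at this
  refine this.trans ?_
  have : (2 : ℝ) ^ d ≤ 2 ^ (d + 1) := pow_le_pow_right₀ one_le_two (by omega)
  gcongr

theorem hasDerivAt_ofReal_mul (u : ℂ) (v : ℝ) : HasDerivAt (fun v : ℝ => (v : ℂ) * u) u v := by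
  simpa using (Complex.ofRealCLM.hasDerivAt (x := v)).mul_const u

theorem tendsto_ofReal_mul_div (u : ℂ) :
    Tendsto (fun v : ℝ => (v : ℂ) * u / ((id v : ℝ) : ℂ)) atTop (𝓝 u) := by
  refine tendsto_const_nhds.congr' ?_
  filter_upwards [eventually_gt_atTop 0] with v hv
  have : (v : ℂ) ≠ 0 := by exact_mod_cast hv.ne'
  simp only [id]
  field_simp

/-- Descent along the ray through the saddle point. -/
theorem hasDescent_ray {d : ℕ} (hd : 2 ≤ d) {I : Set ℝ} {c₀ : ℝ} (hc₀ : 0 < c₀)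
    (hcos : ∀ s ∈ I, Real.cos ((d + 1) * s) ≤ -c₀) {ς : ℝ} (hς : ς = 1 ∨ ς = -1)
    (hI : ∀ s ∈ I, |s - ς * (Real.pi / (d + 1))| < Real.pi / (2 * (d + 1))) :
    HasDescent d I (fun s => Complex.exp (s * Complex.I))
      (Complex.exp ((ς * (Real.pi / (d + 1)) : ℝ) * Complex.I)) := by
  intro η hη
  refine ⟨1, one_pos, fun δ hδ hδ1 => ?_⟩
  set k := (δ / (2 + δ)) ^ 2 with hk
  have hk0 : 0 < k := by positivity
  set c := c₀ * k / (d + 1) / 2 ^ (d + 1) with hc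
  have hc0 : 0 < c := by positivity
  refine ⟨c, hc0, 2, two_pos, fun s hs => ?_⟩
  set u := Complex.exp (s * Complex.I) with hu
  have hun : ‖u‖ = 1 := Complex.norm_exp_ofReal_mul_I s
  have hnorm : ∀ v : ℝ, 0 ≤ v → ‖(v : ℂ) * u‖ = v := fun v hv => by
    rw [norm_mul, hun, mul_one, Complex.norm_real, Real.norm_of_nonneg hv]
  -- On this ray the change of the phase is `cos ((d + 1) s)` times a nonnegative polynomial, so a
  -- negative cosine is all that is needed.
  have hbound : ∀ v : ℝ, 1 + δ ≤ v → (phase d s (v * u) - phase d s u).re ≤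
      -(c * (1 + v) ^ (d + 1)) := fun v hv => by
    have hv0 : 0 ≤ v := by linarith
    rw [Complex.sub_re, hu, phase_ray_re, phase_saddle_re, show (d : ℝ) * s + s = (d + 1) * s by ring]
    have h1 := le_pow_sub_of_le_abs hd hv0 hδ (by rw [abs_of_nonneg (by linarith)]; linarith)
    have h2 := hcos s hs
    have h3 := one_add_pow_le_two_pow d hv0
    have e1 : v ^ (d + 1) * Real.cos ((d + 1) * s) / (d + 1) - v * Real.cos ((d + 1) * s) -
        -(d / (d + 1) * Real.cos ((d + 1) * s)) =
        Real.cos ((d + 1) * s) * ((v ^ (d + 1) - (d + 1) * v + d) / (d + 1)) := by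
      field_simp
      ring
    rw [e1]
    have e2 : c * (1 + v) ^ (d + 1) ≤ c₀ * (k * (1 + v ^ (d + 1)) / (d + 1)) := by
      calc _ ≤ c * (2 ^ (d + 1) * (1 + v ^ (d + 1))) := by gcongr
        _ = _ := by rw [hc]; field_simp
    have e3 : k * (1 + v ^ (d + 1)) / (d + 1) ≤ (v ^ (d + 1) - (d + 1) * v + d) / (d + 1) := by
      gcongr
    have e4 : 0 ≤ k * (1 + v ^ (d + 1)) / (d + 1) := by positivity
    nlinarith
  have hpow : ∀ v : ℝ, 0 ≤ v → 1 + v ≤ (1 + v) ^ (d + 1) := fun v hv =>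
    le_self_pow₀ (by linarith) (by omega)
  refine ⟨((1 + δ : ℝ) : ℂ) * u, fun v => v * u, fun _ => u, 1 + δ, u, id, by linarith, ?_, ?_, ?_,
    tendsto_id, tendsto_ofReal_mul_div u, re_pow_neg_of_segment (by omega) hς (hI s hs)⟩
  · rw [show ((1 + δ : ℝ) : ℂ) * u - (u + δ * u) = 0 by push_cast; ring, norm_zero]
    positivity
  · intro τ hτ
    rw [segment_same, Set.mem_singleton_iff] at hτ
    rw [hτ, hnorm _ (by linarith)]
    refine ⟨by linarith, (hbound _ le_rfl).trans ?_⟩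
    have : (1 : ℝ) ≤ (1 + (1 + δ)) ^ (d + 1) := one_le_pow₀ (by linarith)
    nlinarith
  · intro v hv
    have hv0 : 0 ≤ v := by linarith
    refine ⟨hasDerivAt_ofReal_mul u v, by rw [hun]; norm_num, (hbound v hv).trans ?_, ?_⟩
    · have := hpow v hv0
      nlinarith
    · rw [hnorm v hv0]; exact hbound v hv

/-- Descent from the saddle point to the origin and along the mirror image of its ray. -/
theorem hasDescent_mirror {d : ℕ} (hd : 2 ≤ d) {I : Set ℝ} {c₀ : ℝ} (hc₀ : 0 < c₀)
    (hcos : ∀ s ∈ I, Real.cos ((d + 1) * s) ≤ -c₀)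
    (hgap : ∀ s ∈ I, Real.cos ((d + 1) * s) + c₀ ≤ Real.cos ((d - 1) * s)) {ς : ℝ}
    (hς : ς = 1 ∨ ς = -1)
    (hI : ∀ s ∈ I, |(-s) - ς * (Real.pi / (d + 1))| < Real.pi / (2 * (d + 1))) :
    HasDescent d I (fun s => -Complex.exp (s * Complex.I))
      (Complex.exp ((ς * (Real.pi / (d + 1)) : ℝ) * Complex.I)) := by
  intro η hη
  refine ⟨1, one_pos, fun δ hδ hδ1 => ?_⟩
  set k := (δ / (2 + δ)) ^ 2 with hk
  have hk0 : 0 < k := by positivity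
  have hk1 : k ≤ 1 := by
    rw [hk]
    exact pow_le_one₀ (by positivity) (by rw [div_le_one (by positivity)]; linarith)
  set c := c₀ * k / (d + 1) / 2 ^ (d + 1) with hc
  have hc0 : 0 < c := by positivity
  have hcc : c ≤ c₀ * k / (d + 1) := div_le_self (by positivity) (one_le_pow₀ one_le_two)
  refine ⟨c, hc0, 1, one_pos, fun s hs => ?_⟩
  set u := Complex.exp (s * Complex.I) with hu
  have hun : ‖u‖ = 1 := Complex.norm_exp_ofReal_mul_I s
  set w := Complex.exp ((-s : ℝ) * Complex.I) with hw
  have hwn : ‖w‖ = 1 := Complex.norm_exp_ofReal_mul_I (-s)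
  have hnorm : ∀ v : ℝ, 0 ≤ v → ‖(v : ℂ) * w‖ = v := fun v hv => by
    rw [norm_mul, hwn, mul_one, Complex.norm_real, Real.norm_of_nonneg hv]
  have h2 := hcos s hs
  have hd0 : (0 : ℝ) < d + 1 := by positivity
  -- On the ray of argument `-s` the linear term carries `cos ((d - 1) s)` in place of `cos ((d + 1)
  -- s)`. By `hgap` the phase is lower than at the same distance on the ray of the saddle by at
  -- least `c₀ v`, which covers the point `v = 1` where the polynomial vanishes.
  have hbound : ∀ v : ℝ, 0 ≤ v → (phase d s (v * w) - phase d s u).re ≤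
      -(c * (1 + v) ^ (d + 1)) := fun v hv0 => by
    rw [Complex.sub_re, hu, hw, phase_ray_re, phase_saddle_re,
      show (d : ℝ) * s + -s = (d - 1) * s by ring, mul_neg, Real.cos_neg]
    have h3 := one_add_pow_le_two_pow d hv0
    have h4 := hgap s hs
    have h5 : 0 ≤ v ^ (d + 1) - (d + 1) * v + d :=
      le_trans (by positivity) (sq_mul_le_pow_sub d hd hv0)
    have e2 : c * (1 + v) ^ (d + 1) ≤ c₀ * ((v ^ (d + 1) + d) / (d + 1)) := by
      calc _ ≤ c * (2 ^ (d + 1) * (1 + v ^ (d + 1))) := by gcongr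
        _ = c₀ * (k * ((1 + v ^ (d + 1)) / (d + 1))) := by rw [hc]; field_simp
        _ ≤ c₀ * (1 * ((v ^ (d + 1) + d) / (d + 1))) := by
          have : (1 : ℝ) ≤ d := by exact_mod_cast (by omega : 1 ≤ d)
          gcongr ?_ * (?_ * (?_ / _))
          linarith
        _ = _ := by ring
    set A := -Real.cos ((d + 1) * s) with hA
    have e3 : v ^ (d + 1) * Real.cos ((d + 1) * s) / (d + 1) - v * Real.cos ((d - 1) * s) -
        -(d / (d + 1) * Real.cos ((d + 1) * s)) =
        -(A * ((v ^ (d + 1) + d) / (d + 1))) - v * Real.cos ((d - 1) * s) := by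
      rw [hA]; ring
    rw [e3]
    have e4 : (v ^ (d + 1) + d) / (d + 1) = (v ^ (d + 1) - (d + 1) * v + d) / (d + 1) + v := by
      field_simp; ring
    have e5 : 0 ≤ (v ^ (d + 1) - (d + 1) * v + d) / (d + 1) := by positivity
    rw [e4] at e2 ⊢
    have e6 : v * (-A + c₀) ≤ v * Real.cos ((d - 1) * s) :=
      mul_le_mul_of_nonneg_left (by rw [hA]; linarith) hv0
    have e7 : c₀ * ((v ^ (d + 1) - (d + 1) * v + d) / (d + 1)) ≤
      A * ((v ^ (d + 1) - (d + 1) * v + d) / (d + 1)) :=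
      mul_le_mul_of_nonneg_right (by rw [hA]; linarith) e5
    linarith
  have hpow : ∀ v : ℝ, 0 ≤ v → 1 + v ≤ (1 + v) ^ (d + 1) := fun v hv =>
    le_self_pow₀ (by linarith) (by omega)
  refine ⟨((1 - δ : ℝ) : ℂ) * u, fun v => v * w, fun _ => w, 0, w, id, le_rfl, ?_, ?_, ?_,
    tendsto_id, tendsto_ofReal_mul_div w, re_pow_neg_of_segment (by omega) hς (hI s hs)⟩
  · rw [show ((1 - δ : ℝ) : ℂ) * u - (u + δ * -u) = 0 by push_cast; ring, norm_zero]
    positivity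
  · rintro τ ⟨a, b, ha, hb, hab, rfl⟩
    have hρ : a • (((1 - δ : ℝ) : ℂ) * u) + b • (((0 : ℝ) : ℂ) * w) =
        ((a * (1 - δ) : ℝ) : ℂ) * u := by
      simp only [Complex.real_smul]; push_cast; ring
    have hρ0 : 0 ≤ a * (1 - δ) := mul_nonneg ha (by linarith)
    have hρ1 : a * (1 - δ) ≤ 1 - δ := by nlinarith
    rw [hρ]
    set ρ := a * (1 - δ)
    constructor
    · rw [norm_mul, hun, mul_one, Complex.norm_real, Real.norm_of_nonneg hρ0]; linarith
    · rw [Complex.sub_re, hu, phase_ray_re, phase_saddle_re,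
        show (d : ℝ) * s + s = (d + 1) * s by ring]
      have h1 := le_pow_sub_of_le_abs hd hρ0 hδ (by rw [abs_of_nonpos (by linarith)]; linarith)
      have e1 : ρ ^ (d + 1) * Real.cos ((d + 1) * s) / (d + 1) - ρ * Real.cos ((d + 1) * s) -
          -(d / (d + 1) * Real.cos ((d + 1) * s)) =
          Real.cos ((d + 1) * s) * ((ρ ^ (d + 1) - (d + 1) * ρ + d) / (d + 1)) := by
        field_simp
        ring
      rw [e1]
      have e2 : k / (d + 1) ≤ (ρ ^ (d + 1) - (d + 1) * ρ + d) / (d + 1) := by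
        gcongr
        refine le_trans ?_ h1
        exact le_mul_of_one_le_right hk0.le (by have := pow_nonneg hρ0 (d + 1); linarith)
      have e3 : c₀ * k / (d + 1) = c₀ * (k / (d + 1)) := by ring
      have e4 : 0 ≤ k / (d + 1) := by positivity
      nlinarith
  · intro v hv
    refine ⟨hasDerivAt_ofReal_mul w v, by rw [hwn], (hbound v hv).trans ?_, ?_⟩
    · have := hpow v hv
      nlinarith
    · rw [hnorm v hv]; exact hbound v hv


/-- The curved paths below leave in the directions `± π / (2 d)`; these are still in the sectors
centred at `± π / (d + 1)`. -/
theorem abs_segment_direction {d : ℕ} (hd : 1 ≤ d) {ς : ℝ} (hς : ς = 1 ∨ ς = -1) :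
    |ς * (Real.pi / (2 * d)) - ς * (Real.pi / (d + 1))| < Real.pi / (2 * (d + 1)) := by
  have hd1 : (1 : ℝ) ≤ d := by exact_mod_cast hd
  have hς1 : |ς| = 1 := by rcases hς with rfl | rfl <;> simp
  rw [← mul_sub, abs_mul, hς1, one_mul, abs_lt]
  have e1 : Real.pi / (2 * d) - Real.pi / (d + 1) + Real.pi / (2 * (d + 1)) =
      Real.pi / (2 * d * (d + 1)) := by field_simp; ring
  have e2 : Real.pi / (2 * (d + 1)) - (Real.pi / (2 * d) - Real.pi / (d + 1)) =
      Real.pi * (2 * d - 1) / (2 * d * (d + 1)) := by field_simp; ring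
  have h1 : 0 < Real.pi / (2 * d * (d + 1)) := by positivity
  have h2 : 0 < Real.pi * (2 * d - 1) / (2 * d * (d + 1)) :=
    div_pos (mul_pos Real.pi_pos (by linarith)) (by positivity)
  constructor <;> linarith

/-- For `d = 1` the phase is quadratic and drops by exactly `v² / 2` along the vertical line through
the saddle, wherever the saddle is; hence no condition on `s`. -/
theorem hasDescent_line {ς : ℝ} (hς : ς = 1 ∨ ς = -1) (I : Set ℝ) :
    HasDescent 1 I (fun _ => (ς : ℂ) * Complex.I)
      (Complex.exp ((ς * (Real.pi / ((1 : ℕ) + 1)) : ℝ) * Complex.I)) := by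
  have hς2 : (ς : ℂ) ^ 2 = 1 := by rcases hς with rfl | rfl <;> simp
  have hςI : Complex.exp ((ς * (Real.pi / 2) : ℝ) * Complex.I) = ς * Complex.I := by
    rcases hς with rfl | rfl
    · simp [Complex.exp_pi_div_two_mul_I]
    · simp [Complex.exp_neg, Complex.exp_pi_div_two_mul_I]
  have hn : ‖(ς : ℂ) * Complex.I‖ = 1 := by rw [← hςI, Complex.norm_exp_ofReal_mul_I]
  intro η hη
  refine ⟨1, one_pos, fun δ hδ hδ1 => ?_⟩
  set c := (δ / (2 + δ)) ^ 2 / 2 with hc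
  have hc0 : 0 < c := by positivity
  have hbound : ∀ v : ℝ, δ ≤ v → c * (2 + v) ^ 2 ≤ v ^ 2 / 2 := fun v hv => by
    have h1 : δ / (2 + δ) * (2 + v) ≤ v := by
      rw [div_mul_eq_mul_div, div_le_iff₀ (by positivity)]; nlinarith
    have h2 : (δ / (2 + δ) * (2 + v)) ^ 2 ≤ v ^ 2 :=
      pow_le_pow_left₀ (mul_nonneg (by positivity) (by linarith)) h1 2
    rw [hc]; nlinarith
  have hre : ∀ (s v : ℝ), (phase 1 s (Complex.exp (s * Complex.I) + v * (ς * Complex.I)) -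
      phase 1 s (Complex.exp (s * Complex.I))).re = -(v ^ 2 / 2) := fun s v => by
    have : phase 1 s (Complex.exp (s * Complex.I) + v * (ς * Complex.I)) -
      phase 1 s (Complex.exp (s * Complex.I)) = ((-(v ^ 2 / 2) : ℝ) : ℂ) := by
      rw [phase, phase, exp_mul_natCast_I]
      push_cast
      linear_combination (v ^ 2 * ς ^ 2 / 2 : ℂ) * Complex.I_sq - (v ^ 2 / 2 : ℂ) * hς2
    rw [this, Complex.ofReal_re]
  refine ⟨c, hc0, 3, by norm_num, fun s _ => ?_⟩
  set u := Complex.exp (s * Complex.I) with hu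
  have hun : ‖u‖ = 1 := Complex.norm_exp_ofReal_mul_I s
  refine ⟨u + δ * (ς * Complex.I), fun v => u + v * (ς * Complex.I), fun _ => ς * Complex.I, δ,
    ς * Complex.I, id, hδ.le, ?_, ?_, ?_, tendsto_id, ?_, ?_⟩
  · rw [sub_self, norm_zero]; positivity
  · intro τ hτ
    rw [segment_same, Set.mem_singleton_iff] at hτ
    rw [hτ, hre]
    refine ⟨(norm_add_le _ _).trans ?_, ?_⟩
    · rw [hun, norm_mul, hn, Complex.norm_real, Real.norm_of_nonneg hδ.le]; linarith
    · have := hbound δ le_rfl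
      nlinarith
  · intro v hv
    have h1 := hbound v hv
    refine ⟨(hasDerivAt_ofReal_mul _ v).const_add u, by rw [hn]; norm_num, ?_, ?_⟩
    · rw [hre]; nlinarith
    · rw [hre, neg_le_neg_iff]
      refine le_trans ?_ h1
      have : ‖u + v * (ς * Complex.I)‖ ≤ 1 + v := by
        refine (norm_add_le _ _).trans ?_
        rw [hun, norm_mul, hn, Complex.norm_real, Real.norm_of_nonneg (by linarith)]
        linarith
      have h3 : (1 + ‖u + v * (ς * Complex.I)‖) ^ 2 ≤ (2 + v) ^ 2 :=
        pow_le_pow_left₀ (by positivity) (by linarith) 2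
      exact mul_le_mul_of_nonneg_left h3 hc0.le
  · have h1 : Tendsto (fun v : ℝ => u * ((v⁻¹ : ℝ) : ℂ)) atTop (𝓝 0) := by
      have := (Complex.continuous_ofReal.tendsto 0).comp tendsto_inv_atTop_zero
      simpa using this.const_mul u
    have h2 := h1.add (tendsto_ofReal_mul_div (ς * Complex.I))
    rw [zero_add] at h2
    refine h2.congr fun v => ?_
    simp only [id]; push_cast; ring
  · have := re_pow_neg_of_segment (d := 1) le_rfl hς (abs_segment_direction le_rfl hς)
    rw [show ς * (Real.pi / (2 * ((1 : ℕ) : ℝ))) = ς * (Real.pi / 2) by simp, hςI] at this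
    exact this

theorem norm_sub_sub_le_of_deriv {f f' f'' : ℝ → ℂ} {a C : ℝ} (ha : 0 ≤ a)
    (h1 : ∀ v, 0 ≤ v → HasDerivAt f (f' v) v) (h2 : ∀ v, 0 ≤ v → HasDerivAt f' (f'' v) v)
    (hC : ∀ v, 0 ≤ v → ‖f'' v‖ ≤ C) : ‖f a - f 0 - a * f' 0‖ ≤ C * a ^ 2 := by
  have hC0 : 0 ≤ C := (norm_nonneg _).trans (hC 0 le_rfl)
  have h3 : ∀ v ∈ Set.Icc 0 a, ‖f' v - f' 0‖ ≤ C * a := fun v hv => by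
    refine ((convex_Icc 0 a).norm_image_sub_le_of_norm_hasDerivWithin_le (f := f') (f' := f'')
      (fun x hx => (h2 x hx.1).hasDerivWithinAt) (fun x hx => hC x hx.1)
      (Set.left_mem_Icc.mpr ha) hv).trans ?_
    rw [sub_zero, Real.norm_of_nonneg hv.1]
    exact mul_le_mul_of_nonneg_left hv.2 hC0
  have h4 := (convex_Icc 0 a).norm_image_sub_le_of_norm_hasDerivWithin_le
    (f := fun v => f v - v * f' 0) (f' := fun v => f' v - f' 0)
    (fun x hx => ((h1 x hx.1).sub (hasDerivAt_ofReal_mul (f' 0) x)).hasDerivWithinAt) h3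
    (Set.left_mem_Icc.mpr ha) (Set.right_mem_Icc.mpr ha)
  simp only [Complex.ofReal_zero, zero_mul, sub_zero, Real.norm_of_nonneg ha] at h4
  calc _ = ‖f a - a * f' 0 - f 0‖ := by congr 1; ring
    _ ≤ _ := h4
    _ = _ := by ring

set_option maxHeartbeats 1000000 in
/-- Descent along the curve on which `τ ^ d - e^{ids}` is imaginary. -/
theorem hasDescent_middle {d : ℕ} (hd : 2 ≤ d) {I : Set ℝ} {c₂ : ℝ} (hc₂ : 0 < c₂)
    (hcos : ∀ s ∈ I, c₂ ≤ Real.cos (d * s)) (hI : ∀ s ∈ I, |d * s| ≤ Real.pi / 2)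
    {ς : ℝ} (hς : ς = 1 ∨ ς = -1) :
    HasDescent d I (fun s => (ς : ℂ) * Complex.I * Complex.exp (-((d - 1) * s : ℝ) * Complex.I))
      (Complex.exp ((ς * (Real.pi / (d + 1)) : ℝ) * Complex.I)) := by
  have hd1 : (2 : ℝ) ≤ d := by exact_mod_cast hd
  have hd0 : (0 : ℝ) < d := by linarith
  have hdC : (d : ℂ) ≠ 0 := by exact_mod_cast hd0.ne'
  have hς2 : (ς : ℂ) ^ 2 = 1 := by rcases hς with rfl | rfl <;> simp
  have hn : ‖(ς : ℂ) * Complex.I‖ = 1 := by rcases hς with rfl | rfl <;> simp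
  set y : ℝ := (d : ℝ)⁻¹ - 1 with hy
  have hdinv : (d : ℝ)⁻¹ ≤ 1 / 2 := by
    rw [one_div]; exact inv_anti₀ two_pos hd1
  have hdinv0 : 0 < (d : ℝ)⁻¹ := by positivity
  set c₃ := Real.cos (y * (Real.pi / 2)) with hc₃
  have hc₃0 : 0 < c₃ := by
    apply Real.cos_pos_of_mem_Ioo
    constructor <;> nlinarith [Real.pi_pos]
  set X : ℝ → ℝ → ℂ := fun s v => Complex.exp ((d * s : ℝ) * Complex.I) + v * (ς * Complex.I)
    with hX
  have hXre : ∀ s v, (X s v).re = Real.cos (d * s) := fun s v => by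
    rw [hX]
    simp only [Complex.add_re, Complex.exp_ofReal_mul_I_re]
    simp
  have hXle : ∀ s v, 0 ≤ v → ‖X s v‖ ≤ 1 + v := fun s v hv => by
    refine (norm_add_le _ _).trans ?_
    rw [Complex.norm_exp_ofReal_mul_I, norm_mul, hn, Complex.norm_real, Real.norm_of_nonneg hv,
      mul_one]
  have hXge : ∀ s ∈ I, ∀ v, c₂ ≤ ‖X s v‖ := fun s hs v =>
    (hcos s hs).trans (by rw [← hXre s v]; exact Complex.re_le_norm _)
  have hslit : ∀ s ∈ I, ∀ v, X s v ∈ Complex.slitPlane := fun s hs v => Or.inl (by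
    rw [hXre]; exact hc₂.trans_le (hcos s hs))
  have hX0 : ∀ s ∈ I, ∀ v, X s v ≠ 0 := fun s hs v => Complex.slitPlane_ne_zero (hslit s hs v)
  have hXd : ∀ s v, HasDerivAt (X s) (ς * Complex.I) v := fun s v =>
    (hasDerivAt_ofReal_mul _ v).const_add _
  have hcp : ∀ (z : ℂ) s, s ∈ I → ∀ v, HasDerivAt (fun v => X s v ^ z)
      (z * X s v ^ (z - 1) * (ς * Complex.I)) v := fun z s hs v => by
    have h1 := (Complex.hasStrictDerivAt_cpow_const (c := z) (hslit s hs v)).hasDerivAt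
    exact h1.comp v (hXd s v)
  -- As `X` stays in the right half-plane and `|y| < 1`, the argument of `X^y` is at most `|y| π / 2
  -- < π / 2`. The positive real part obtained here is the rate at which the phase decreases.
  have hre : ∀ s ∈ I, ∀ v, 0 ≤ v → c₃ * (1 + v) ^ y ≤ (X s v ^ ((d : ℂ)⁻¹ - 1)).re :=
    fun s hs v hv => by
      have e : ((d : ℂ)⁻¹ - 1) = (y : ℂ) := by rw [hy]; push_cast; ring
      have hre0 : 0 ≤ (X s v).re := by rw [hXre]; exact hc₂.le.trans (hcos s hs)
      have harg : |(X s v).arg| ≤ Real.pi / 2 := Complex.abs_arg_le_pi_div_two_iff.mpr hre0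
      rw [e, Complex.cpow_ofReal_re, mul_comm]
      have h1 : (1 + v) ^ y ≤ ‖X s v‖ ^ y :=
        Real.rpow_le_rpow_of_nonpos (norm_pos_iff.mpr (hX0 s hs v)) (hXle s v hv) (by linarith)
      refine mul_le_mul h1 ?_ hc₃0.le (by positivity)
      rw [hc₃, ← Real.cos_abs, ← Real.cos_abs ((X s v).arg * y), abs_mul, abs_mul, mul_comm |y|,
        abs_of_pos (by positivity : 0 < Real.pi / 2)]
      refine Real.cos_le_cos_of_nonneg_of_le_pi (by positivity) ?_ (by gcongr)
      rw [abs_of_neg (by linarith)]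
      nlinarith [Real.pi_pos]
  set p : ℝ → ℝ → ℂ := fun s v => X s v ^ ((d : ℂ)⁻¹) with hp
  have hp0 : ∀ s ∈ I, p s 0 = Complex.exp (s * Complex.I) := fun s hs => by
    have h1 := abs_le.mp (hI s hs)
    have hpi := Real.pi_pos
    simp only [hp, hX, Complex.ofReal_zero, zero_mul, add_zero]
    rw [Complex.cpow_def_of_ne_zero (Complex.exp_ne_zero _), Complex.log_exp]
    · congr 1; push_cast; field_simp
    · rw [Complex.mul_I_im, Complex.ofReal_re]; linarith
    · rw [Complex.mul_I_im, Complex.ofReal_re]; linarith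
  have hpd : ∀ s ∈ I, ∀ v, p s v ^ d = X s v := fun s hs v => by
    rw [hp]
    simp only
    rw [← Complex.cpow_mul_nat, inv_mul_cancel₀ hdC, Complex.cpow_one]
  have hpn : ∀ s ∈ I, ∀ v, 0 ≤ v → ‖p s v‖ ≤ (1 + v) ^ (d : ℝ)⁻¹ := fun s hs v hv => by
    have e : ((d : ℂ)⁻¹) = (((d : ℝ)⁻¹ : ℝ) : ℂ) := by push_cast; ring
    simp only [hp]
    rw [e, Complex.norm_cpow_real]
    exact Real.rpow_le_rpow (norm_nonneg _) (hXle s v hv) hdinv0.le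
  have hp' : ∀ s ∈ I, ∀ v, HasDerivAt (p s)
      ((d : ℂ)⁻¹ * X s v ^ ((d : ℂ)⁻¹ - 1) * (ς * Complex.I)) v := fun s hs v => hcp _ s hs v
  set B : ℝ := c₂ ^ y + c₂ ^ (y - 1) with hB
  have hB0 : 0 < B := by positivity
  have hnorm : ∀ s ∈ I, ∀ v, 0 ≤ v → ‖X s v ^ ((d : ℂ)⁻¹ - 1)‖ ≤ B ∧
      ‖X s v ^ ((d : ℂ)⁻¹ - 1 - 1)‖ ≤ B := fun s hs v hv => by
    have e : ((d : ℂ)⁻¹ - 1) = (y : ℂ) := by rw [hy]; push_cast; ring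
    have e1 : ((d : ℂ)⁻¹ - 1 - 1) = ((y - 1 : ℝ) : ℂ) := by rw [hy]; push_cast; ring
    rw [e1, e, Complex.norm_cpow_real, Complex.norm_cpow_real]
    have h1 := Real.rpow_le_rpow_of_nonpos hc₂ (hXge s hs v) (by linarith : y ≤ 0)
    have h2 := Real.rpow_le_rpow_of_nonpos hc₂ (hXge s hs v) (by linarith : y - 1 ≤ 0)
    have h3 : 0 < c₂ ^ y := by positivity
    have h4 : 0 < c₂ ^ (y - 1) := by positivity
    constructor <;> linarith
  have hp'n : ∀ s ∈ I, ∀ v, 0 ≤ v →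
      ‖(d : ℂ)⁻¹ * X s v ^ ((d : ℂ)⁻¹ - 1) * (ς * Complex.I)‖ ≤ B := fun s hs v hv => by
    rw [norm_mul, hn, mul_one, norm_mul, norm_inv, Complex.norm_natCast]
    have := (hnorm s hs v hv).1
    nlinarith [norm_nonneg (X s v ^ ((d : ℂ)⁻¹ - 1))]
  have hsecond : ∀ s ∈ I, ∀ a, 0 ≤ a → ‖p s a - p s 0 -
      a * ((d : ℂ)⁻¹ * X s 0 ^ ((d : ℂ)⁻¹ - 1) * (ς * Complex.I))‖ ≤ B * a ^ 2 := by
    intro s hs a ha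
    refine norm_sub_sub_le_of_deriv ha (fun v _ => hp' s hs v)
      (fun v _ => ((hcp _ s hs v).const_mul _).mul_const _) fun v hv => ?_
    have h1 := (hnorm s hs v hv).2
    have e : ((d : ℂ)⁻¹ - 1) = (y : ℂ) := by rw [hy]; push_cast; ring
    rw [norm_mul, norm_mul, norm_mul, norm_mul, hn, norm_inv, Complex.norm_natCast, mul_one,
      mul_one]
    have h2 : ‖((d : ℂ)⁻¹ - 1)‖ ≤ 1 := by
      rw [e, Complex.norm_real, Real.norm_eq_abs, abs_le]; constructor <;> linarith
    have h3 : ‖((d : ℂ)⁻¹ - 1)‖ * ‖X s v ^ ((d : ℂ)⁻¹ - 1 - 1)‖ ≤ 1 * B := by gcongr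
    have h4 : 0 ≤ ‖((d : ℂ)⁻¹ - 1)‖ * ‖X s v ^ ((d : ℂ)⁻¹ - 1 - 1)‖ := by positivity
    nlinarith
  have hX0s : ∀ s ∈ I, X s 0 ^ ((d : ℂ)⁻¹ - 1) = Complex.exp (-((d - 1) * s : ℝ) * Complex.I) := by
    intro s hs
    have h1 := abs_le.mp (hI s hs)
    have hpi := Real.pi_pos
    simp only [hX, Complex.ofReal_zero, zero_mul, add_zero]
    rw [Complex.cpow_def_of_ne_zero (Complex.exp_ne_zero _), Complex.log_exp]
    · congr 1; push_cast; field_simp; ring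
    · rw [Complex.mul_I_im, Complex.ofReal_re]; linarith
    · rw [Complex.mul_I_im, Complex.ofReal_re]; linarith
  -- The derivative is `(p^d - e^{ids}) p'`. The first factor is `i ς v` by construction of the path
  -- and the second is `i ς X^y / d`, so the product is `-(v / d) X^y`.
  have hphase : ∀ s ∈ I, ∀ v, HasDerivAt (fun v => phase d s (p s v))
      (-((v / d : ℝ) * X s v ^ ((d : ℂ)⁻¹ - 1))) v := fun s hs v => by
    have h1 := hp' s hs v
    have h2 := ((h1.pow (d + 1)).div_const ((d : ℂ) + 1)).sub
      (h1.const_mul (Complex.exp (d * s * Complex.I)))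
    refine h2.congr_deriv ?_
    have hd1C : (d : ℂ) + 1 ≠ 0 := by exact_mod_cast (by linarith : (d : ℝ) + 1 ≠ 0)
    rw [Nat.add_sub_cancel, hpd s hs v]
    generalize X s v ^ ((d : ℂ)⁻¹ - 1) = Z
    simp only [hX]
    push_cast
    field_simp
    linear_combination (v * ς ^ 2 * Z : ℂ) * Complex.I_sq - (v * Z : ℂ) * hς2
  have hdecay : ∀ s ∈ I, ∀ v, 0 ≤ v → (phase d s (p s v) -
      phase d s (Complex.exp (s * Complex.I))).re ≤ -(c₃ / (2 * d) * (1 + v) ^ y * v ^ 2) := by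
    intro s hs v hv
    -- The factor is frozen at the end point `v`, where it is smallest as `y < 0`. Then the real
    -- part of the phase plus `k u²` decreases on `[0, v]`.
    set k := c₃ / (2 * d) * (1 + v) ^ y with hk
    have hderiv : ∀ u, HasDerivAt (fun u => (phase d s (p s u)).re + k * u ^ 2)
        (-(u / d * (X s u ^ ((d : ℂ)⁻¹ - 1)).re) + k * (2 * u)) u := fun u => by
      have h1 := (Complex.reCLM.hasFDerivAt.comp_hasDerivAt u (hphase s hs u))
      simp only [Complex.reCLM_apply, Complex.neg_re, Complex.re_ofReal_mul] at h1
      refine (h1.add ((hasDerivAt_pow 2 u).const_mul k)).congr_deriv ?_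
      simp
    have hanti : AntitoneOn (fun u => (phase d s (p s u)).re + k * u ^ 2) (Set.Icc 0 v) := by
      refine antitoneOn_of_deriv_nonpos (convex_Icc 0 v)
        (fun u _ => (hderiv u).continuousAt.continuousWithinAt)
        (fun u _ => (hderiv u).differentiableAt.differentiableWithinAt) fun u hu => ?_
      rw [interior_Icc] at hu
      rw [(hderiv u).deriv]
      have h1 := hre s hs u hu.1.le
      have h2 : (1 + v) ^ y ≤ (1 + u) ^ y := Real.rpow_le_rpow_of_nonpos (by linarith [hu.1])
        (by linarith [hu.2]) (by linarith)
      have h3 : k * (2 * u) = u / d * (c₃ * (1 + v) ^ y) := by rw [hk]; field_simp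
      have h4 : u / d * (c₃ * (1 + v) ^ y) ≤ u / d * (X s u ^ ((d : ℂ)⁻¹ - 1)).re := by
        have := hu.1
        refine mul_le_mul_of_nonneg_left ?_ (by positivity)
        exact (mul_le_mul_of_nonneg_left h2 hc₃0.le).trans h1
      linarith
    have h5 := hanti (Set.left_mem_Icc.mpr hv) (Set.right_mem_Icc.mpr hv) hv
    simp only [hp0 s hs] at h5
    rw [Complex.sub_re]
    linarith
  intro η hη
  set δ₁ := min 1 (η / (B * d ^ 2)) with hδ₁
  refine ⟨δ₁, by positivity, fun δ hδ hδ1 => ?_⟩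
  -- The velocity at the saddle has modulus `1 / d`, so the parameter `d δ` is at distance about
  -- `δ`.
  set a := d * δ with ha
  have ha0 : 0 < a := by positivity
  set c := c₃ / (2 * d) * (a / (1 + a)) ^ 2 / 2 ^ (d + 1) with hc
  have hc0 : 0 < c := by positivity
  have hmain : ∀ s ∈ I, ∀ v, a ≤ v → (phase d s (p s v) -
      phase d s (Complex.exp (s * Complex.I))).re ≤
        -(c * 2 ^ (d + 1) * (1 + v) ^ ((d : ℝ)⁻¹ + 1)) := fun s hs v hv => by
    have hv0 : 0 < v := by linarith
    refine (hdecay s hs v hv0.le).trans (neg_le_neg ?_)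
    have h1 : a / (1 + a) * (1 + v) ≤ v := by
      rw [div_mul_eq_mul_div, div_le_iff₀ (by positivity)]; nlinarith
    have h2 : (a / (1 + a) * (1 + v)) ^ 2 ≤ v ^ 2 := pow_le_pow_left₀ (by positivity) h1 2
    have h3 : (1 + v) ^ ((d : ℝ)⁻¹ + 1) = (1 + v) ^ y * (1 + v) ^ 2 := by
      rw [← Real.rpow_natCast, ← Real.rpow_add (by linarith), hy]
      congr 1; push_cast; ring
    calc _ = c₃ / (2 * d) * (1 + v) ^ y * (a / (1 + a) * (1 + v)) ^ 2 := by
          rw [h3, hc]; field_simp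
      _ ≤ _ := by gcongr
  have hone : ∀ v : ℝ, 0 ≤ v → 1 + v ≤ (1 + v) ^ ((d : ℝ)⁻¹ + 1) := fun v hv => by
    conv_lhs => rw [← Real.rpow_one (1 + v)]
    exact Real.rpow_le_rpow_of_exponent_le (by linarith) (by linarith)
  have h2pow : (1 : ℝ) ≤ 2 ^ (d + 1) := one_le_pow₀ one_le_two
  refine ⟨c, hc0, B + (1 + a), by positivity, fun s hs => ?_⟩
  refine ⟨p s a, p s, fun v => (d : ℂ)⁻¹ * X s v ^ ((d : ℂ)⁻¹ - 1) * (ς * Complex.I), a,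
    Complex.exp ((ς * (Real.pi / (2 * d)) : ℝ) * Complex.I), fun v => v ^ (d : ℝ)⁻¹, ha0.le, ?_,
    ?_, ?_, tendsto_rpow_atTop hdinv0, ?_, re_pow_neg_of_segment (by omega) hς
      (abs_segment_direction (by omega) hς)⟩
  · have h1 := hsecond s hs a ha0.le
    rw [hp0 s hs, hX0s s hs] at h1
    have e : p s a - (Complex.exp (s * Complex.I) +
        δ * (ς * Complex.I * Complex.exp (-((d - 1) * s : ℝ) * Complex.I))) =
        p s a - Complex.exp (s * Complex.I) - a * ((d : ℂ)⁻¹ *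
          Complex.exp (-((d - 1) * s : ℝ) * Complex.I) * (ς * Complex.I)) := by
      rw [ha]; push_cast; field_simp; ring
    rw [e]
    refine h1.trans ?_
    have h2 : δ ≤ η / (B * d ^ 2) := hδ1.trans (min_le_right _ _)
    rw [le_div_iff₀ (by positivity)] at h2
    rw [ha]
    nlinarith
  · intro τ hτ
    rw [segment_same, Set.mem_singleton_iff] at hτ
    rw [hτ]
    constructor
    · refine (hpn s hs a ha0.le).trans ?_
      have : (1 + a) ^ (d : ℝ)⁻¹ ≤ (1 + a) ^ (1 : ℝ) :=
        Real.rpow_le_rpow_of_exponent_le (by linarith) (by linarith)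
      rw [Real.rpow_one] at this
      linarith
    · refine (hmain s hs a le_rfl).trans (neg_le_neg ?_)
      have h1 := hone a ha0.le
      have h2 : c * 1 * 1 ≤ c * 2 ^ (d + 1) * (1 + a) ^ ((d : ℝ)⁻¹ + 1) := by
        gcongr; linarith
      linarith
  · intro v hv
    have hv0 : 0 ≤ v := by linarith
    refine ⟨hp' s hs v, (hp'n s hs v hv0).trans (by linarith), (hmain s hs v hv).trans
      (neg_le_neg ?_), (hmain s hs v hv).trans (neg_le_neg ?_)⟩
    · calc c * (1 + v) = c * 1 * (1 + v) := by ring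
        _ ≤ _ := by gcongr; exact hone v hv0
    · have h1 : (1 : ℝ) ≤ (1 + v) ^ (d : ℝ)⁻¹ :=
        Real.one_le_rpow (by linarith) hdinv0.le
      have h2 : (1 + ‖p s v‖) ^ (d + 1) ≤ (2 * (1 + v) ^ (d : ℝ)⁻¹) ^ (d + 1) := by
        have := hpn s hs v hv0
        gcongr
        linarith
      rw [mul_pow, ← Real.rpow_natCast ((1 + v) ^ (d : ℝ)⁻¹), ← Real.rpow_mul (by linarith),
        show (d : ℝ)⁻¹ * ((d + 1 : ℕ) : ℝ) = (d : ℝ)⁻¹ + 1 by push_cast; field_simp; ring] at h2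
      calc _ ≤ c * (2 ^ (d + 1) * (1 + v) ^ ((d : ℝ)⁻¹ + 1)) := by gcongr
        _ = _ := by ring
  · have hςI : (ς : ℂ) * Complex.I ∈ Complex.slitPlane := by
      rcases hς with rfl | rfl <;> exact Or.inr (by simp)
    have h1 : Tendsto (fun v : ℝ => Complex.exp ((d * s : ℝ) * Complex.I) * ((v⁻¹ : ℝ) : ℂ) +
        ς * Complex.I) atTop (𝓝 (ς * Complex.I)) := by
      have := (Complex.continuous_ofReal.tendsto 0).comp tendsto_inv_atTop_zero
      simpa using (this.const_mul (Complex.exp ((d * s : ℝ) * Complex.I))).add_const (ς * Complex.I)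
    have h2 := (continuousAt_cpow_const (b := (d : ℂ)⁻¹) hςI).tendsto.comp h1
    have h3 : ((ς : ℂ) * Complex.I) ^ ((d : ℂ)⁻¹) =
        Complex.exp ((ς * (Real.pi / (2 * d)) : ℝ) * Complex.I) := by
      rw [Complex.cpow_def_of_ne_zero (Complex.slitPlane_ne_zero hςI)]
      congr 1
      rcases hς with rfl | rfl
      · rw [Complex.ofReal_one, one_mul, Complex.log_I]; push_cast; field_simp
      · rw [Complex.ofReal_neg, Complex.ofReal_one, neg_one_mul, Complex.log_neg_I]
        push_cast; field_simp
    rw [h3] at h2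
    refine h2.congr' ?_
    filter_upwards [eventually_gt_atTop 0] with v hv
    have hvC : (v : ℂ) ≠ 0 := by exact_mod_cast hv.ne'
    have e1 : X s v = (v : ℂ) * (Complex.exp ((d * s : ℝ) * Complex.I) * ((v⁻¹ : ℝ) : ℂ) +
        ς * Complex.I) := by
      simp only [hX]; push_cast; field_simp
    set Z := Complex.exp ((d * s : ℝ) * Complex.I) * ((v⁻¹ : ℝ) : ℂ) + ς * Complex.I with hZ
    have hZ0 : Z ≠ 0 := fun h => hX0 s hs v (by rw [e1, h, mul_zero])
    have hr : ((v ^ (d : ℝ)⁻¹ : ℝ) : ℂ) ≠ 0 := by exact_mod_cast (by positivity)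
    simp only [Function.comp, hp]
    rw [← hZ, e1, eq_div_iff hr, Complex.ofReal_cpow hv.le, Complex.cpow_def_of_ne_zero hZ0,
      Complex.cpow_def_of_ne_zero (mul_ne_zero hvC hZ0), Complex.cpow_def_of_ne_zero hvC,
      Complex.log_ofReal_mul hv hZ0, ← Complex.exp_add, ← Complex.ofReal_log hv.le]
    congr 1
    push_cast
    ring


/-! ### The full range of arguments of a contributing saddle. -/

/-- The contribution of one saddle point `t` of `W(t) - A^d e^{ids} t`, uniformly for `s ∈ I`, to the
integral of `σ e^{W(t) - A^d e^{ids} t}` from `∞ w₂` to `∞ w₁`. -/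
def SaddleAsymptotics (d m : ℕ) (W σ : ℂ[X]) (I : Set ℝ) (w₁ w₂ : ℂ) : Prop :=
  ∃ η₀ > (0 : ℝ), ∃ K : ℝ, ∃ A₀ ≥ (1 : ℝ), ∀ A : ℝ, A₀ ≤ A → ∀ s ∈ I, ∀ t : ℂ,
    W.derivative.eval t = A ^ d * Complex.exp (d * s * Complex.I) →
    ‖t - A * Complex.exp (s * Complex.I)‖ ≤ η₀ * A →
    ∀ Φ : ℂ → ℂ, (∀ z, HasDerivAt Φ
        (σ.eval z * Complex.exp (-(tilted d W A s).eval z)) z) →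
    ∀ L₁ L₂ : ℂ, Tendsto (fun v : ℝ => Φ (v * w₁)) atTop (𝓝 L₁) →
    Tendsto (fun v : ℝ => Φ (v * w₂)) atTop (𝓝 L₂) →
    ‖(L₁ - L₂) * Complex.exp ((tilted d W A s).eval t) -
      σ.eval t * (Complex.I * √(2 * Real.pi / d) *
        Complex.exp (-((d - 1) / 2) * (Real.log A + s * Complex.I)) *
        (W.derivative.derivative.eval t /
          (d * (A * Complex.exp (s * Complex.I)) ^ (d - 1))) ^ (-1 / 2 : ℂ))‖ ≤
      K * (A ^ (m + 1) / (A ^ (d + 1) * √(A ^ (d + 1))))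

theorem SaddleAsymptotics.union {d m : ℕ} {W σ : ℂ[X]} {I J : Set ℝ} {w₁ w₂ : ℂ}
    (hI : SaddleAsymptotics d m W σ I w₁ w₂) (hJ : SaddleAsymptotics d m W σ J w₁ w₂) :
    SaddleAsymptotics d m W σ (I ∪ J) w₁ w₂ := by
  obtain ⟨η, hη, K, A, hA, h⟩ := hI
  obtain ⟨η', hη', K', A', hA', h'⟩ := hJ
  refine ⟨min η η', lt_min hη hη', max K K', max A A', hA.trans (le_max_left _ _), ?_⟩
  intro B hB s hs t ht hts Φ hΦ L₁ L₂ hL₁ hL₂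
  have hB0 : 0 < B := by linarith [le_max_left A A']
  have hpos : 0 ≤ B ^ (m + 1) / (B ^ (d + 1) * √(B ^ (d + 1))) := by positivity
  rcases hs with hs | hs
  · exact (h B ((le_max_left _ _).trans hB) s hs t ht
      (hts.trans (mul_le_mul_of_nonneg_right (min_le_left _ _) hB0.le)) Φ hΦ L₁ L₂ hL₁ hL₂).trans
      (mul_le_mul_of_nonneg_right (le_max_left _ _) hpos)
  · exact (h' B ((le_max_right _ _).trans hB) s hs t ht
      (hts.trans (mul_le_mul_of_nonneg_right (min_le_right _ _) hB0.le)) Φ hΦ L₁ L₂ hL₁ hL₂).trans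
      (mul_le_mul_of_nonneg_right (le_max_right _ _) hpos)

theorem SaddleAsymptotics.mono {d m : ℕ} {W σ : ℂ[X]} {I J : Set ℝ} {w₁ w₂ : ℂ}
    (hJ : SaddleAsymptotics d m W σ J w₁ w₂) (h : I ⊆ J) :
    SaddleAsymptotics d m W σ I w₁ w₂ := by
  obtain ⟨η, hη, K, A, hA, hJ⟩ := hJ
  exact ⟨η, hη, K, A, hA, fun B hB s hs => hJ B hB s (h hs)⟩

theorem sin_le_sin_of_mem_Icc {a x : ℝ} (ha : 0 ≤ a) (h : a ≤ Real.pi / 2)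
    (hx : x ∈ Set.Icc a (Real.pi - a)) : Real.sin a ≤ Real.sin x := by
  rw [← Real.cos_pi_div_two_sub, ← Real.cos_pi_div_two_sub, ← Real.cos_abs (Real.pi / 2 - x)]
  refine Real.cos_le_cos_of_nonneg_of_le_pi (abs_nonneg _) (by linarith [Real.pi_pos]) ?_
  rw [abs_le]
  constructor <;> linarith [hx.1, hx.2]

/-- `ς` is the sign of `s`, and `cos ((d + 1) s) < 0` in this range. The ray through the saddle
leads to the sector on its own side, and the detour through the origin leads to the opposite one.
For `ς = -1` the two ends exchange their roles, which turns the direction `ψ` by `π`. -/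
theorem saddleAsymptotics_of_pos {d m : ℕ} (hd : 2 ≤ d) {W σ : ℂ[X]} (hW : IsNormalized d W)
    (hσ : σ.natDegree ≤ m) {ε : ℝ} (hε : 0 < ε) (hε' : ε ≤ Real.pi / (4 * d)) {ς : ℝ}
    (hς : ς = 1 ∨ ς = -1) :
    SaddleAsymptotics d m W σ
      {s | (Real.pi / 2 + ε) / (d + 1) ≤ ς * s ∧ ς * s ≤ Real.pi / d - ε}
      (Complex.exp ((Real.pi / (d + 1) : ℝ) * Complex.I))
      (Complex.exp ((-(Real.pi / (d + 1)) : ℝ) * Complex.I)) := by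
  set I := {s | (Real.pi / 2 + ε) / (d + 1) ≤ ς * s ∧ ς * s ≤ Real.pi / d - ε} with hI
  have hpi := Real.pi_pos
  have hd1 : (2 : ℝ) ≤ d := by exact_mod_cast hd
  have hd0 : (0 : ℝ) < d + 1 := by linarith
  have hεd : ε * (4 * d) ≤ Real.pi := by rwa [le_div_iff₀ (by positivity)] at hε'
  have hε8 : ε ≤ Real.pi / 8 := by nlinarith
  have hss : ς * ς = 1 := by rcases hς with rfl | rfl <;> norm_num
  have hpd : Real.pi / d * d = Real.pi := by field_simp
  have hpd2 : Real.pi / d ≤ Real.pi / 2 := by gcongr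
  have hb : ∀ s ∈ I, |(d + 1) * (ς * s) - Real.pi| ≤ Real.pi / 2 - ε := fun s hs => by
    have h1 := hs.1
    have h2 := hs.2
    rw [div_le_iff₀ hd0] at h1
    have h3 := mul_le_mul_of_nonneg_right h2 hd0.le
    rw [abs_le]
    constructor <;> nlinarith
  have hcosς : ∀ (k s : ℝ), Real.cos (k * (ς * s)) = Real.cos (k * s) := fun k s => by
    rcases hς with rfl | rfl
    · rw [one_mul]
    · rw [neg_one_mul, mul_neg, Real.cos_neg]
  -- One constant for two bounds: `-cos ((d + 1) s) ≥ sin ε`, and `cos ((d - 1) s) - cos ((d + 1) s)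
  -- = 2 sin (d s) sin s ≥ 2 sin² ε`.
  set c₀ := Real.sin ε ^ 2 with hc₀
  have hsin : 0 < Real.sin ε := Real.sin_pos_of_pos_of_lt_pi hε (by linarith)
  have hsin1 : Real.sin ε ≤ 1 := Real.sin_le_one ε
  have hc₀0 : 0 < c₀ := by positivity
  have hcos : ∀ s ∈ I, Real.cos ((d + 1) * s) ≤ -c₀ := fun s hs => by
    have h1 : Real.sin ε ≤ Real.cos ((d + 1) * (ς * s) - Real.pi) := by
      rw [← Real.cos_pi_div_two_sub, ← Real.cos_abs ((d + 1) * (ς * s) - Real.pi)]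
      exact Real.cos_le_cos_of_nonneg_of_le_pi (abs_nonneg _) (by linarith) (hb s hs)
    rw [Real.cos_sub_pi, hcosς] at h1
    nlinarith
  have hgap : ∀ s ∈ I, Real.cos ((d + 1) * s) + c₀ ≤ Real.cos ((d - 1) * s) := fun s hs => by
    have h1 := hs.1
    have h2 := hs.2
    rw [div_le_iff₀ hd0] at h1
    have h4 : Real.pi / 2 ≤ ς * s * (d + 1) := by linarith
    have hε2 : ε ≤ ς * s := by nlinarith
    have h3 : Real.sin ε ≤ Real.sin (ς * s) :=
      sin_le_sin_of_mem_Icc hε.le (by linarith) ⟨hε2, by linarith⟩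
    have h5 : Real.sin ε ≤ Real.sin (d * (ς * s)) := by
      refine sin_le_sin_of_mem_Icc hε.le (by linarith) ⟨by nlinarith, ?_⟩
      have := mul_le_mul_of_nonneg_right h2 (by linarith : (0 : ℝ) ≤ d)
      nlinarith
    rw [← hcosς (d + 1), ← hcosς (d - 1), show ((d : ℝ) + 1) * (ς * s) = d * (ς * s) + ς * s by ring,
      show ((d : ℝ) - 1) * (ς * s) = d * (ς * s) - ς * s by ring, Real.cos_add, Real.cos_sub]
    nlinarith [mul_le_mul h5 h3 hsin.le (hsin.le.trans h5)]
  have hray : ∀ s ∈ I, |s - ς * (Real.pi / (d + 1))| < Real.pi / (2 * (d + 1)) := fun s hs => by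
    have h1 := hb s hs
    have h2 : (d + 1) * (ς * s) - Real.pi = (d + 1) * ς * (s - ς * (Real.pi / (d + 1))) := by
      have : (d + 1) * ς * (s - ς * (Real.pi / (d + 1))) =
        (d + 1) * (ς * s) - (ς * ς) * Real.pi := by field_simp
      rw [this, hss, one_mul]
    have hς1 : |ς| = 1 := by rcases hς with rfl | rfl <;> simp
    rw [h2, abs_mul, abs_mul, hς1, abs_of_pos hd0, mul_one] at h1
    rw [lt_div_iff₀ (by positivity)]
    nlinarith
  have hmir : ∀ s ∈ I, |(-s) - (-ς) * (Real.pi / (d + 1))| < Real.pi / (2 * (d + 1)) :=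
    fun s hs => by
      rw [show (-s) - (-ς) * (Real.pi / (d + 1)) = -(s - ς * (Real.pi / (d + 1))) by ring, abs_neg]
      exact hray s hs
  have hς' : -ς = 1 ∨ -ς = -1 := by rcases hς with rfl | rfl <;> simp
  have H₁ := hasDescent_ray hd hc₀0 hcos hς hray
  have H₂ := hasDescent_mirror hd hc₀0 hcos hgap hς' hmir
  rcases hς with rfl | rfl
  · simp only [one_mul, neg_mul] at H₁ H₂
    refine saddle_asymptotics_of_descent (ψ := fun s => s) (by omega) hW hσ hε (by linarith)
      (fun s hs => ?_) H₁ H₂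
    have := hb s hs
    rwa [show 2 * s + (d - 1) * s - Real.pi = (d + 1) * (1 * s) - Real.pi by ring]
  · simp only [one_mul, neg_mul, neg_neg] at H₁ H₂
    have hψ : ∀ s : ℝ, Complex.exp (((s + Real.pi : ℝ) : ℂ) * Complex.I) =
        -Complex.exp (s * Complex.I) := fun s => by
      rw [Complex.ofReal_add, add_mul, Complex.exp_add, Complex.exp_pi_mul_I, mul_neg_one]
    refine saddle_asymptotics_of_descent (ψ := fun s => s + Real.pi) (by omega) hW hσ hε
      (by linarith) (fun s hs => ?_) ?_ ?_
    · have := hb s hs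
      rw [← abs_neg] at this
      rwa [show 2 * (s + Real.pi) + (d - 1) * s - Real.pi =
        -((d + 1) * (-1 * s) - Real.pi) by ring]
    · simpa only [hψ] using H₂
    · simpa only [hψ, neg_neg] using H₁

/-- For small `|s|` the cosine that governs the rays need not be negative. But the bound on `ε`
gives `d |s| < π / 2`, which is what the curved paths of `hasDescent_middle` need. The range ends
where that of `saddleAsymptotics_of_pos` begins. -/
theorem saddleAsymptotics_middle {d m : ℕ} (hd : 2 ≤ d) {W σ : ℂ[X]} (hW : IsNormalized d W)
    (hσ : σ.natDegree ≤ m) {ε : ℝ} (hε : 0 < ε) (hε' : ε ≤ Real.pi / (4 * d)) :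
    SaddleAsymptotics d m W σ
      {s | |s| ≤ (Real.pi / 2 + ε) / (d + 1)}
      (Complex.exp ((Real.pi / (d + 1) : ℝ) * Complex.I))
      (Complex.exp ((-(Real.pi / (d + 1)) : ℝ) * Complex.I)) := by
  set I := {s : ℝ | |s| ≤ (Real.pi / 2 + ε) / (d + 1)} with hI
  have hpi := Real.pi_pos
  have hd1 : (2 : ℝ) ≤ d := by exact_mod_cast hd
  have hd0 : (0 : ℝ) < d + 1 := by linarith
  have hεd : ε * (4 * d) ≤ Real.pi := by rwa [le_div_iff₀ (by positivity)] at hε'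
  have hb : ∀ s ∈ I, |s| * (d + 1) ≤ Real.pi / 2 + ε := fun s hs => by
    have : |s| ≤ (Real.pi / 2 + ε) / (d + 1) := hs
    rwa [le_div_iff₀ hd0] at this
  set b := d * ((Real.pi / 2 + ε) / (d + 1)) with hbdef
  have hb2 : b < Real.pi / 2 := by
    rw [hbdef, ← mul_div_assoc, div_lt_iff₀ hd0]; nlinarith
  have hb0 : 0 < b := by positivity
  have hds : ∀ s ∈ I, |d * s| ≤ b := fun s hs => by
    rw [abs_mul, Nat.abs_cast]
    exact mul_le_mul_of_nonneg_left hs (by linarith)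
  have hcos : ∀ s ∈ I, Real.cos b ≤ Real.cos (d * s) := fun s hs => by
    rw [← Real.cos_abs (d * s)]
    exact Real.cos_le_cos_of_nonneg_of_le_pi (abs_nonneg _) (by linarith) (hds s hs)
  have hcb : 0 < Real.cos b := Real.cos_pos_of_mem_Ioo ⟨by linarith, hb2⟩
  have H := fun (ς : ℝ) (hς : ς = 1 ∨ ς = -1) => hasDescent_middle hd (I := I) hcb hcos
    (fun s hs => (hds s hs).trans hb2.le) hς
  have hψ : ∀ s : ℝ, Complex.exp (((Real.pi / 2 - (d - 1) * s : ℝ) : ℂ) * Complex.I) =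
      Complex.I * Complex.exp (-((d - 1) * s : ℝ) * Complex.I) := fun s => by
    rw [sub_eq_add_neg, Complex.ofReal_add, add_mul, Complex.exp_add, Complex.ofReal_neg]
    congr 1
    push_cast
    exact Complex.exp_pi_div_two_mul_I
  refine saddle_asymptotics_of_descent (ψ := fun s => Real.pi / 2 - (d - 1) * s) (by omega) hW hσ hε
      (by nlinarith) (fun s hs => ?_) ?_ ?_
  · rw [show 2 * (Real.pi / 2 - (d - 1) * s) + (d - 1) * s - Real.pi = -((d - 1) * s) by ring,
      abs_neg, abs_mul, abs_of_pos (by linarith : (0 : ℝ) < d - 1)]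
    have := hb s hs
    have h3 : |s| * (d + 1) * (d - 1) ≤ (Real.pi / 2 + ε) * (d - 1) :=
      mul_le_mul_of_nonneg_right this (by linarith)
    have h4 : ((d : ℝ) - 1) * |s| * (d + 1) ≤ (Real.pi / 2 - ε) * (d + 1) := by nlinarith
    exact le_of_mul_le_mul_right h4 hd0
  · simpa only [hψ, one_mul, Complex.ofReal_one] using H 1 (Or.inl rfl)
  · simpa only [hψ, neg_mul, one_mul, Complex.ofReal_one, Complex.ofReal_neg] using
      H (-1) (Or.inr rfl)

/-- The saddle point with argument `s` is the only one contributing to the integral between the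
sectors around `± π / (d + 1)`, as long as `|s| < π / d`. -/
theorem saddleAsymptotics {d m : ℕ} (hd : 1 ≤ d) {W σ : ℂ[X]} (hW : IsNormalized d W)
    (hσ : σ.natDegree ≤ m) {ε : ℝ} (hε : 0 < ε) :
    SaddleAsymptotics d m W σ {s | 2 ≤ d → |s| ≤ Real.pi / d - ε}
      (Complex.exp ((Real.pi / (d + 1) : ℝ) * Complex.I))
      (Complex.exp ((-(Real.pi / (d + 1)) : ℝ) * Complex.I)) := by
  have hpi := Real.pi_pos
  rcases hd.eq_or_lt with rfl | hd'
  · have hψ : Complex.exp (((Real.pi / 2 : ℝ) : ℂ) * Complex.I) = Complex.I := by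
      push_cast; exact Complex.exp_pi_div_two_mul_I
    refine SaddleAsymptotics.mono (J := Set.univ) ?_ (Set.subset_univ _)
    refine saddle_asymptotics_of_descent (ψ := fun s => Real.pi / 2) le_rfl hW hσ
      (ε := Real.pi / 2) (by positivity) le_rfl (fun s _ => ?_) ?_ ?_
    · rw [abs_of_nonneg] <;> · push_cast; linarith
    · simpa only [hψ, one_mul, Complex.ofReal_one] using hasDescent_line (Or.inl rfl) Set.univ
    · simpa only [hψ, neg_mul, one_mul, Complex.ofReal_one, Complex.ofReal_neg] using
        hasDescent_line (Or.inr rfl) Set.univ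
  · set ε' := min ε (Real.pi / (4 * d)) with hε'
    have hε'0 : 0 < ε' := by positivity
    have H1 := saddleAsymptotics_of_pos hd' hW hσ hε'0 (min_le_right _ _) (Or.inl rfl)
    have H2 := saddleAsymptotics_of_pos hd' hW hσ hε'0 (min_le_right _ _) (Or.inr rfl)
    have H3 := saddleAsymptotics_middle hd' hW hσ hε'0 (min_le_right _ _)
    refine (H3.union (H1.union H2)).mono fun s hs => ?_
    have hs' : |s| ≤ Real.pi / d - ε' := (hs hd').trans (by linarith [min_le_left ε (Real.pi / (4 * d))])
    rcases le_total |s| ((Real.pi / 2 + ε') / (d + 1)) with h | h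
    · exact Or.inl h
    · right
      rcases le_total 0 s with h0 | h0
      · left
        rw [abs_of_nonneg h0] at *
        exact ⟨by linarith, by linarith⟩
      · right
        rw [abs_of_nonpos h0] at *
        exact ⟨by linarith, by linarith⟩


/-! ### Expansion of the leading factor of a saddle contribution. -/

/-- Taylor expansion of `f` in powers of another local coordinate `u * b u`. -/
theorem exists_expansion_in_coordinate {b : ℂ → ℂ} (hb : AnalyticAt ℂ b 0) (hb0 : b 0 ≠ 0) (n : ℕ) :
    ∀ f : ℂ → ℂ, AnalyticAt ℂ f 0 → ∃ a : ℕ → ℂ, (0 < n → a 0 = f 0) ∧ ∃ K : ℝ, ∀ᶠ u in 𝓝 (0 : ℂ),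
      ‖f u - ∑ l ∈ Finset.range n, a l * (u * b u) ^ l‖ ≤ K * ‖u * b u‖ ^ n := by
  induction n with
  | zero =>
    intro f hf
    refine ⟨fun _ => 0, by simp, ‖f 0‖ + 1, ?_⟩
    have h := hf.continuousAt.norm.eventually_lt_const (lt_add_one ‖f 0‖)
    filter_upwards [h] with u hu
    simpa using hu.le
  | succ n ih =>
    intro f hf
    -- One step of the expansion: `f u = f 0 + (u b u) (dslope f 0 u / b u)`, and the last quotient
    -- is again analytic.
    have hg : AnalyticAt ℂ (fun u => dslope f 0 u / b u) 0 := by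
      refine AnalyticAt.div ?_ hb hb0
      obtain ⟨p, hp⟩ := hf
      exact ⟨_, hp.has_fpower_series_dslope_fslope⟩
    obtain ⟨a, -, K, h⟩ := ih _ hg
    refine ⟨fun l => if l = 0 then f 0 else a (l - 1), fun _ => by simp, K, ?_⟩
    filter_upwards [h, hb.continuousAt.eventually_ne hb0] with u hu hbu
    rw [Finset.sum_range_succ']
    have e : f u = f 0 + u * b u * (dslope f 0 u / b u) := by
      have := sub_smul_dslope f 0 u
      rw [sub_zero, smul_eq_mul] at this
      field_simp
      rw [this]; ring
    have e2 : f u - (∑ l ∈ Finset.range n, (if l + 1 = 0 then f 0 else a (l + 1 - 1)) *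
        (u * b u) ^ (l + 1) + (if (0 : ℕ) = 0 then f 0 else a (0 - 1)) * (u * b u) ^ 0) =
        u * b u * (dslope f 0 u / b u - ∑ l ∈ Finset.range n, a l * (u * b u) ^ l) := by
      rw [e, mul_sub, Finset.mul_sum]
      simp only [Nat.succ_ne_zero, if_false, if_true, Nat.add_sub_cancel, pow_zero, mul_one]
      rw [Finset.sum_congr rfl fun l _ => (by ring : a l * (u * b u) ^ (l + 1) =
        u * b u * (a l * (u * b u) ^ l))]
      ring
    rw [e2, norm_mul]
    calc _ ≤ ‖u * b u‖ * (K * ‖u * b u‖ ^ n) := by gcongr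
      _ = _ := by ring

theorem eval_eq_pow_mul_reverse (P : ℂ[X]) {y : ℂ} (hy : y ≠ 0) :
    P.eval y = y ^ P.natDegree * P.reverse.eval y⁻¹ := by
  have := invertibleOfNonzero hy
  have h := eval₂_reverse_mul_pow (RingHom.id ℂ) y P
  rw [invOf_eq_inv] at h
  rw [mul_comm]
  exact h.symm

theorem analyticAt_eval (P : ℂ[X]) (z : ℂ) : AnalyticAt ℂ (fun u => P.eval u) z :=
  P.differentiable.analyticAt z

theorem eval_reverse_zero (P : ℂ[X]) : P.reverse.eval 0 = P.leadingCoeff := by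
  rw [← coeff_zero_eq_eval_zero, coeff_zero_reverse]

/-- Expansion, in powers of `1 / z` with `V' y = g z ^ d`, of the leading factor of the contribution
of the saddle point `y`. -/
theorem exists_saddle_expansion {d m : ℕ} (hd : 1 ≤ d) {V σ : ℂ[X]} (hV : V.natDegree = d + 1)
    (hσ : σ.Monic) (hm : σ.natDegree = m) {g : ℂ} (hg : g = V.derivative.leadingCoeff) :
    ∃ a : ℕ → ℂ, a 0 = 1 ∧ ∃ η > (0 : ℝ), ∃ K R : ℝ, ∀ y z : ℂ, z ≠ 0 → R ≤ ‖y‖ →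
      ‖y / z - 1‖ ≤ η → V.derivative.eval y = g * z ^ d →
      ‖σ.eval y / z ^ m * (V.derivative.derivative.eval y / (g * d * z ^ (d - 1))) ^ (-1 / 2 : ℂ) -
        ∑ l ∈ Finset.range d, a l * z⁻¹ ^ l‖ ≤ K * ‖z⁻¹‖ ^ d := by
  have hdC : (d : ℂ) ≠ 0 := by exact_mod_cast (by omega : d ≠ 0)
  have hV'd : V.derivative.natDegree = d := by rw [natDegree_derivative, hV]; omega
  have hV''d : V.derivative.derivative.natDegree = d - 1 := by
    rw [natDegree_derivative, hV'd]
  have hV' : V.derivative ≠ 0 := fun h => by rw [h] at hV'd; simp at hV'd; omega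
  have hg0 : g ≠ 0 := by rw [hg]; exact leadingCoeff_ne_zero.mpr hV'
  have hV''l : V.derivative.derivative.leadingCoeff = g * d := by
    rw [leadingCoeff, hV''d, coeff_derivative, hg, leadingCoeff, hV'd, Nat.sub_add_cancel hd]
    push_cast [hd]; ring
  set B : ℂ → ℂ := fun u => V.derivative.reverse.eval u / g with hB
  have hB0 : B 0 = 1 := by
    simp only [hB]; rw [eval_reverse_zero, ← hg, div_self hg0]
  have hBa : AnalyticAt ℂ B 0 := (analyticAt_eval _ _).div_const
  -- At `u = 1 / y` the equation `V' y = g z^d` reads `(y / z)^d = 1 / B u`, so `1 / z = u b(u)`.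
  -- Hence `1 / z` is an analytic coordinate at `y = ∞`.
  set b : ℂ → ℂ := fun u => (1 / B u) ^ ((d : ℂ)⁻¹) with hb
  have hb0 : b 0 = 1 := by simp [hb, hB0]
  have hba : AnalyticAt ℂ b 0 :=
    (analyticAt_const.div hBa (by rw [hB0]; exact one_ne_zero)).cpow analyticAt_const
      (by simp [hB0])
  set f : ℂ → ℂ := fun u => σ.reverse.eval u * b u ^ m *
    (V.derivative.derivative.reverse.eval u / (g * d) * b u ^ (d - 1)) ^ (-1 / 2 : ℂ) with hf
  have hin0 : V.derivative.derivative.reverse.eval 0 / (g * d) * b 0 ^ (d - 1) = 1 := by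
    rw [eval_reverse_zero, hV''l, hb0, one_pow, mul_one, div_self (mul_ne_zero hg0 hdC)]
  have hf0 : f 0 = 1 := by
    simp only [hf, hin0]
    rw [eval_reverse_zero, hσ.leadingCoeff, hb0]; simp
  have hfa : AnalyticAt ℂ f 0 := by
    refine ((analyticAt_eval _ _).mul (hba.pow m)).mul (AnalyticAt.cpow
      ((analyticAt_eval _ _).div_const.mul (hba.pow (d - 1))) analyticAt_const ?_)
    rw [hin0]; simp
  obtain ⟨a, ha, K, h⟩ := exists_expansion_in_coordinate hba (by rw [hb0]; exact one_ne_zero) d f hfa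
  -- This selects the root: if `|arg (y / z)| < π / d`, the principal `d`-th root of `(y / z)^d` is
  -- `y / z`.
  have harg : ∀ᶠ q in 𝓝 (1 : ℂ), |q.arg| < Real.pi / d := by
    have h1 : Tendsto (fun q : ℂ => |q.arg|) (𝓝 1) (𝓝 |(1 : ℂ).arg|) :=
      ((Complex.continuousAt_arg (by simp)).abs)
    rw [Complex.arg_one, abs_zero] at h1
    exact h1.eventually_lt_const (by positivity)
  obtain ⟨η, hη, hηarg⟩ := Metric.eventually_nhds_iff.mp harg
  obtain ⟨δ, hδ, hδf⟩ := Metric.eventually_nhds_iff.mp h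
  refine ⟨a, by rw [ha hd, hf0], η / 2, by positivity, K, 2 / δ, fun y z hz hy hyz hV'y => ?_⟩
  have hy0' : 0 < ‖y‖ := lt_of_lt_of_le (by positivity) hy
  have hy0 : y ≠ 0 := norm_pos_iff.mp hy0'
  have hu : ‖y⁻¹‖ < δ := by
    rw [norm_inv, inv_lt_comm₀ hy0' hδ]
    refine lt_of_lt_of_le ?_ hy
    rw [inv_eq_one_div]
    exact div_lt_div_of_pos_right one_lt_two hδ
  have hq : |(y / z).arg| < Real.pi / d := hηarg (by rw [dist_eq_norm]; linarith)
  have hbq : b y⁻¹ = y / z := by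
    have e : 1 / B y⁻¹ = (y / z) ^ d := by
      simp only [hB]
      have h1 := eval_eq_pow_mul_reverse V.derivative hy0
      rw [hV'y, hV'd] at h1
      have h2 : V.derivative.reverse.eval y⁻¹ = g * z ^ d / y ^ d := by
        rw [h1]; field_simp
      rw [h2, div_pow]; field_simp
    simp only [hb]
    rw [e]
    exact Complex.pow_cpow_nat_inv (by omega) (abs_lt.mp hq).1 (abs_lt.mp hq).2.le
  have hub : y⁻¹ * b y⁻¹ = z⁻¹ := by rw [hbq]; field_simp
  have hfin := hδf (y := y⁻¹) (by rwa [dist_zero_right])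
  rw [hub] at hfin
  refine le_trans (le_of_eq ?_) hfin
  congr 2
  simp only [hf]
  rw [hbq, eval_eq_pow_mul_reverse σ hy0, eval_eq_pow_mul_reverse V.derivative.derivative hy0,
    hV''d, hm]
  have hpy := pow_ne_zero (d - 1) hy0
  congr 1
  · rw [div_pow]; field_simp
  · congr 1; rw [div_pow]; field_simp


/-! ### The contribution of a saddle for a general potential. -/

/-- A logarithm of the scale `μ` such that `-c V (μ t)` has leading coefficient `1 / (d + 1)`, where
`g` is the leading coefficient of `V'`. -/
noncomputable def logScale (d : ℕ) (c g : ℂ) (β : ℝ) (p : ℤ) : ℂ :=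
  ((-(Real.log ‖c * g‖ / (d + 1)) : ℝ) : ℂ) +
    ((β + 2 * Real.pi * (p + 1 / 2) / (d + 1) : ℝ) : ℂ) * Complex.I

/-- `hβ` says that `β` is the central direction of a decay sector. The half in `p + 1 / 2` produces
the minus sign: the scale points midway between the sectors `p` and `p + 1`, which become the
directions `∓ π / (d + 1)` of the normalized problem. -/
theorem neg_mul_exp_logScale {d : ℕ} {c g : ℂ} (hc : c ≠ 0) (hg : g ≠ 0) {β : ℝ}
    (hβ : c * g * Complex.exp (((d + 1) * β : ℝ) * Complex.I) = ‖c * g‖) (p : ℤ) :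
    -(c * g) * Complex.exp (logScale d c g β p) ^ (d + 1) = 1 := by
  have hd : (d : ℂ) + 1 ≠ 0 := by exact_mod_cast (by positivity : (d : ℝ) + 1 ≠ 0)
  have hcg : 0 < ‖c * g‖ := norm_pos_iff.mpr (mul_ne_zero hc hg)
  have hcgC : ((‖c * g‖ : ℝ) : ℂ) ≠ 0 := by exact_mod_cast hcg.ne'
  rw [← Complex.exp_nat_mul]
  have e : ((d + 1 : ℕ) : ℂ) * logScale d c g β p = -(Real.log ‖c * g‖ : ℂ) +
      ((d + 1) * β : ℝ) * Complex.I + Real.pi * Complex.I + p * (2 * Real.pi * Complex.I) := by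
    rw [logScale]; push_cast; field_simp; ring
  rw [e, Complex.exp_add, Complex.exp_int_mul_two_pi_mul_I, mul_one, Complex.exp_add,
    Complex.exp_pi_mul_I, Complex.exp_add, Complex.exp_neg, ← Complex.ofReal_exp, Real.exp_log hcg]
  calc _ = (((‖c * g‖ : ℝ) : ℂ))⁻¹ * (c * g * Complex.exp (((d + 1) * β : ℝ) * Complex.I)) := by ring
    _ = 1 := by rw [hβ, inv_mul_cancel₀ hcgC]

/-- The leading behaviour of the saddle point with index `j`. -/
noncomputable def saddleApprox (d : ℕ) (r : ℂ) (j : ℤ) (ζ : ℂ) : ℂ :=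
  Complex.exp (ζ / d + 2 * Real.pi * j / d * Complex.I - Complex.log r)

/-- The constant in the contribution of a saddle point. -/
noncomputable def saddleConst (d : ℕ) (c g r : ℂ) (β : ℝ) (p j : ℤ) : ℂ :=
  Complex.I * √(2 * Real.pi / d) * Complex.exp ((d + 1) / 2 * logScale d c g β p -
    Real.pi * (d - 1) * j / d * Complex.I + (d - 1) / 2 * Complex.log r)

theorem saddleConst_ne_zero {d : ℕ} (hd : 1 ≤ d) (c g r : ℂ) (β : ℝ) (p j : ℤ) :
    saddleConst d c g r β p j ≠ 0 := by
  have : (0 : ℝ) < d := by exact_mod_cast hd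
  refine mul_ne_zero (mul_ne_zero Complex.I_ne_zero ?_) (Complex.exp_ne_zero _)
  exact_mod_cast (Real.sqrt_pos.mpr (by positivity)).ne'

theorem norm_saddleApprox {d : ℕ} {r : ℂ} (j : ℤ) (ζ : ℂ) :
    ‖saddleApprox d r j ζ‖ = Real.exp (ζ.re / d - Real.log ‖r‖) := by
  rw [saddleApprox, Complex.norm_exp]
  congr 1
  rw [Complex.sub_re, Complex.add_re, Complex.div_natCast_re, Complex.log_re]
  have : (2 * Real.pi * j / d * Complex.I : ℂ) = ((2 * Real.pi * j / d : ℝ) : ℂ) * Complex.I := by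
    push_cast; ring
  rw [this, Complex.re_ofReal_mul, Complex.I_re, mul_zero, add_zero]

theorem saddleApprox_pow {d : ℕ} (hd : 1 ≤ d) {r g : ℂ} (hr : r ^ d = g) (hg : g ≠ 0) (j : ℤ) (ζ : ℂ) :
    g * saddleApprox d r j ζ ^ d = Complex.exp ζ := by
  have hdC : (d : ℂ) ≠ 0 := by exact_mod_cast (by omega : d ≠ 0)
  have hr0 : r ≠ 0 := fun h => hg (by rw [← hr, h, zero_pow (by omega)])
  rw [saddleApprox, ← Complex.exp_nat_mul]
  have e : (d : ℂ) * (ζ / d + 2 * Real.pi * j / d * Complex.I - Complex.log r) =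
      ζ - d * Complex.log r + j * (2 * Real.pi * Complex.I) := by field_simp; ring
  rw [e, Complex.exp_add, Complex.exp_int_mul_two_pi_mul_I, mul_one, Complex.exp_sub,
    Complex.exp_nat_mul, Complex.exp_log hr0, hr]
  field_simp

theorem isNormalized_rescaled {d : ℕ} {V : ℂ[X]} (hV : V.natDegree = d + 1) {c μ : ℂ}
    (hμ : -(c * V.derivative.leadingCoeff) * μ ^ (d + 1) = 1) :
    IsNormalized d (C (-c) * V.comp (C μ * X)) := by
  have hμ0 : μ ≠ 0 := fun h => by rw [h] at hμ; simp at hμ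
  have hc0 : c ≠ 0 := fun h => by rw [h] at hμ; simp at hμ
  have hlin : (C μ * X : ℂ[X]).natDegree = 1 := natDegree_C_mul_X μ hμ0
  have hVl : V.derivative.leadingCoeff = V.leadingCoeff * (d + 1) := by
    rw [leadingCoeff, leadingCoeff, natDegree_derivative, coeff_derivative, hV, Nat.add_sub_cancel]
  have hd : (d : ℂ) + 1 ≠ 0 := by exact_mod_cast (by positivity : (d : ℝ) + 1 ≠ 0)
  constructor
  · rw [natDegree_C_mul (neg_ne_zero.mpr hc0), natDegree_comp, hlin, hV, mul_one]
  · rw [leadingCoeff_mul, leadingCoeff_C, leadingCoeff_comp (by rw [hlin]; exact one_ne_zero),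
      leadingCoeff_mul, leadingCoeff_C, leadingCoeff_X, hV, mul_one]
    rw [hVl] at hμ
    rw [eq_div_iff hd]
    linear_combination hμ

/-- With `A = exp a`, the last factor is the size of the leading term up to constants, so
`A^{-(d+1)}` is the relative error. This is more than enough, since `A^d` is already of the order of
`|x|`. -/
theorem saddle_error_eq (d m : ℕ) (a : ℝ) :
    Real.exp a ^ (m + 1) / (Real.exp a ^ (d + 1) * √(Real.exp a ^ (d + 1))) =
      Real.exp (-((d + 1) * a)) * (Real.exp (-((d - 1) / 2 * a)) * Real.exp a ^ m) := by
  rw [← Real.exp_nat_mul, ← Real.exp_nat_mul, ← Real.exp_nat_mul, Real.sqrt_eq_rpow,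
    ← Real.exp_mul, ← Real.exp_add, ← Real.exp_sub, ← Real.exp_add, ← Real.exp_add]
  congr 1
  push_cast
  ring

/-- Asymptotics of the integral of `σ e^{c (x y - V(y))}` between two neighbouring sectors, dominated
by a single saddle point. -/
theorem saddle_contribution {d m : ℕ} (hd : 1 ≤ d) {V σ : ℂ[X]} (hV : V.natDegree = d + 1)
    (hσ : σ.Monic) (hm : σ.natDegree = m) {c g r : ℂ} (hc : c ≠ 0)
    (hg : g = V.derivative.leadingCoeff) {β : ℝ}
    (hβ : c * g * Complex.exp (((d + 1) * β : ℝ) * Complex.I) = ‖c * g‖) (hr : r ^ d = g) :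
    ∃ a : ℕ → ℂ, a 0 = 1 ∧ ∀ (p j : ℤ), ∀ ε > (0 : ℝ), ∃ η > (0 : ℝ), ∃ K R : ℝ, ∀ ζ : ℂ, R ≤ ζ.re →
      (2 ≤ d → |ζ.im / d + 2 * Real.pi * j / d - (Complex.log r).im -
        (β + 2 * Real.pi * (p + 1 / 2) / (d + 1))| ≤ Real.pi / d - ε) →
      ∀ y : ℂ, V.derivative.eval y = Complex.exp ζ → ‖y / saddleApprox d r j ζ - 1‖ ≤ η →
      ∀ Ψ : ℂ → ℂ, (∀ y, HasDerivAt Ψ (σ.eval y * Complex.exp (c * (Complex.exp ζ * y - V.eval y))) y) →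
      ∀ R₀ R₁ : ℂ,
        Tendsto (fun v : ℝ => Ψ (v * Complex.exp ((β + 2 * Real.pi * p / (d + 1) : ℝ) * Complex.I)))
          atTop (𝓝 R₀) →
        Tendsto (fun v : ℝ => Ψ (v * Complex.exp
          ((β + 2 * Real.pi * (p + 1 : ℤ) / (d + 1) : ℝ) * Complex.I))) atTop (𝓝 R₁) →
        ‖(R₁ - R₀) * Complex.exp (-(c * (Complex.exp ζ * y - V.eval y))) /
            (saddleConst d c g r β p j * Complex.exp (-((d - 1) / (2 * d) * ζ)) *
              saddleApprox d r j ζ ^ m) -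
          ∑ l ∈ Finset.range d, a l * (saddleApprox d r j ζ)⁻¹ ^ l‖ ≤ K * Real.exp (-ζ.re) := by
  obtain ⟨a, ha0, η₁, hη₁, K₁, R₁', hexp⟩ := exists_saddle_expansion hd hV hσ hm hg
  refine ⟨a, ha0, fun p j ε hε => ?_⟩
  have hd0 : (0 : ℝ) < d := by exact_mod_cast hd
  have hdC : (d : ℂ) ≠ 0 := by exact_mod_cast hd0.ne'
  have hg0 : g ≠ 0 := by
    rw [hg]
    refine leadingCoeff_ne_zero.mpr fun h => ?_
    have := natDegree_derivative V
    rw [h, hV, natDegree_zero] at this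
    omega
  have hr0 : r ≠ 0 := fun h => hg0 (by rw [← hr, h, zero_pow (by omega)])
  have hrn : 0 < ‖r‖ := norm_pos_iff.mpr hr0
  set Λ := logScale d c g β p with hΛ
  set μ := Complex.exp Λ with hμdef
  have hμ0 : μ ≠ 0 := Complex.exp_ne_zero _
  have hμ : -(c * g) * μ ^ (d + 1) = 1 := neg_mul_exp_logScale hc hg0 hβ p
  set W := C (-c) * V.comp (C μ * X) with hW
  have hWn : IsNormalized d W := isNormalized_rescaled hV (by rw [← hg]; exact hμ)
  set σ' := σ.comp (C μ * X) with hσ'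
  have hσ'm : σ'.natDegree ≤ m := by
    rw [hσ', natDegree_comp, natDegree_C_mul_X μ hμ0, hm, mul_one]
  obtain ⟨η₀, hη₀, K₀, A₀, hA₀, hmain⟩ := saddleAsymptotics hd hWn hσ'm hε
  set b := Real.log ‖r‖ + Λ.re with hb
  -- The three thresholds ensure `A ≥ A₀`, `A ≥ 1` and `‖y‖ ≥ R₁'`, in this order.
  set R := max (d * (Real.log A₀ + b)) (max (d * b) (d * (Real.log (2 * (|R₁'| + 1)) + Real.log ‖r‖)))
    with hR
  set k₀ := |K₀| / (√(2 * Real.pi / d) * ‖μ‖ ^ m) * Real.exp (d * b) with hk₀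
  refine ⟨min (min η₀ η₁) (1 / 2), by positivity, k₀ + |K₁| * ‖r‖ ^ d, R, ?_⟩
  intro ζ hζ hs y hy hyz Ψ hΨ L₀ L₁ hL₀ hL₁
  set z := saddleApprox d r j ζ with hz
  have hz0 : z ≠ 0 := Complex.exp_ne_zero _
  have hzn : ‖z‖ = Real.exp (ζ.re / d - Real.log ‖r‖) := norm_saddleApprox j ζ
  have hzd : g * z ^ d = Complex.exp ζ := saddleApprox_pow hd hr hg0 j ζ
  -- A logarithm of the normalized saddle `A e^{is} = z / μ`. It fixes the branches of the
  -- fractional powers, and its imaginary part is the `s` restricted by `saddleAsymptotics`.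
  set ℓ := ζ / d + 2 * Real.pi * j / d * Complex.I - Complex.log r - Λ with hℓ
  have hexpℓ : Complex.exp ℓ = z / μ := by rw [hℓ, Complex.exp_sub]; rfl
  have hℓre : ℓ.re = ζ.re / d - b := by
    rw [hℓ, hb, Complex.sub_re, Complex.sub_re, Complex.add_re, Complex.div_natCast_re,
      Complex.log_re]
    have : (2 * Real.pi * j / d * Complex.I : ℂ) = ((2 * Real.pi * j / d : ℝ) : ℂ) * Complex.I := by
      push_cast; ring
    rw [this, Complex.re_ofReal_mul, Complex.I_re, mul_zero]
    ring
  have hℓim : ℓ.im = ζ.im / d + 2 * Real.pi * j / d - (Complex.log r).im -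
        (β + 2 * Real.pi * (p + 1 / 2) / (d + 1)) := by
    rw [hℓ, Complex.sub_im, Complex.sub_im, Complex.add_im, Complex.div_natCast_im]
    have : (2 * Real.pi * j / d * Complex.I : ℂ) = ((2 * Real.pi * j / d : ℝ) : ℂ) * Complex.I := by
      push_cast; ring
    rw [this, Complex.im_ofReal_mul, Complex.I_im, mul_one]
    have : Λ.im = β + 2 * Real.pi * (p + 1 / 2) / (d + 1) := by
      rw [hΛ, logScale, Complex.add_im, Complex.ofReal_im, Complex.im_ofReal_mul, Complex.I_im]
      ring
    rw [this]
  set A := Real.exp ℓ.re with hA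
  have hA0 : 0 < A := Real.exp_pos _
  set s := ℓ.im with hsdef
  have hlogA : (Real.log A : ℂ) + s * Complex.I = ℓ := by
    rw [hA, Real.log_exp, hsdef, Complex.re_add_im]
  have hAs : (A : ℂ) * Complex.exp (s * Complex.I) = z / μ := by
    rw [← hexpℓ, hA, Complex.ofReal_exp, ← Complex.exp_add, hsdef, Complex.re_add_im]
  have hAn : A = ‖z / μ‖ := by
    rw [← hAs, norm_mul, Complex.norm_exp_ofReal_mul_I, mul_one, Complex.norm_real,
      Real.norm_of_nonneg hA0.le]
  have hXeq : (A : ℂ) ^ d * Complex.exp (d * s * Complex.I) = -c * μ * Complex.exp ζ := by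
    rw [exp_mul_natCast_I, ← mul_pow, hAs, ← hzd, div_pow, div_eq_iff (pow_ne_zero _ hμ0)]
    linear_combination (-(z ^ d)) * hμ
  have hAA : A₀ ≤ A := by
    have h1 : d * (Real.log A₀ + b) ≤ ζ.re := (le_max_left _ _).trans hζ
    rw [hA, ← Real.log_le_iff_le_exp (by linarith), hℓre, le_sub_iff_add_le, le_div_iff₀ hd0]
    linarith
  have hsI : s ∈ {s : ℝ | 2 ≤ d → |s| ≤ Real.pi / d - ε} := fun h => by
    rw [hℓim]; exact hs h
  have hWe : ∀ t, W.eval t = -c * V.eval (μ * t) := fun t => by simp [hW]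
  have hWd : ∀ t, W.derivative.eval t = -c * μ * V.derivative.eval (μ * t) := fun t => by
    simp [hW, derivative_comp]; ring
  have hWdd : ∀ t, W.derivative.derivative.eval t =
      -c * μ ^ 2 * V.derivative.derivative.eval (μ * t) := fun t => by
    simp [hW, derivative_comp]; ring
  have hμt : μ * (y / μ) = y := by field_simp
  have hyη : ‖y / z - 1‖ ≤ η₀ ∧ ‖y / z - 1‖ ≤ η₁ ∧ ‖y / z - 1‖ ≤ 1 / 2 :=
    ⟨hyz.trans ((min_le_left _ _).trans (min_le_left _ _)),
      hyz.trans ((min_le_left _ _).trans (min_le_right _ _)), hyz.trans (min_le_right _ _)⟩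
  have htilt : ∀ t, -(tilted d W A s).eval t =
      c * (Complex.exp ζ * (μ * t) - V.eval (μ * t)) := fun t => by
    rw [neg_eval_tilted, hWe, hXeq]; ring
  have hlim : ∀ (q : ℤ) (x : ℝ) (L : ℂ), (x + (β + 2 * Real.pi * (p + 1 / 2) / (d + 1)) =
        β + 2 * Real.pi * q / (d + 1)) →
      Tendsto (fun v : ℝ => Ψ (v * Complex.exp ((β + 2 * Real.pi * q / (d + 1) : ℝ) * Complex.I)))
          atTop (𝓝 L) →
      Tendsto (fun v : ℝ => Ψ (μ * (v * Complex.exp ((x : ℝ) * Complex.I))) / μ) atTop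
        (𝓝 (L / μ)) := fun q x L hx hL => by
    have hρ : Tendsto (fun v : ℝ => Real.exp Λ.re * v) atTop atTop :=
      tendsto_id.const_mul_atTop (Real.exp_pos _)
    refine ((hL.comp hρ).div_const μ).congr fun v => ?_
    simp only [Function.comp]
    congr 2
    have e1 : μ = Real.exp Λ.re *
        Complex.exp ((β + 2 * Real.pi * (p + 1 / 2) / (d + 1) : ℝ) * Complex.I) := by
      rw [Complex.ofReal_exp, ← Complex.exp_add, hμdef]
      congr 1
      conv_lhs => rw [← Complex.re_add_im Λ]
      congr 3
      rw [hΛ, logScale, Complex.add_im, Complex.ofReal_im, Complex.im_ofReal_mul, Complex.I_im]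
      ring
    rw [e1, ← hx, Complex.ofReal_add, add_mul, Complex.exp_add]
    push_cast
    ring
  have key := hmain A hAA s hsI (y / μ) (by rw [hWd, hμt, hy, hXeq])
    (by
      rw [hAs, ← sub_div, norm_div]
      have : ‖y - z‖ ≤ η₀ * ‖z‖ := by
        have h1 : y - z = (y / z - 1) * z := by field_simp
        rw [h1, norm_mul]
        exact mul_le_mul_of_nonneg_right hyη.1 (norm_nonneg _)
      rw [hAn, norm_div, ← mul_div_assoc]
      gcongr)
    (fun t => Ψ (μ * t) / μ)
    (fun t => by
      have h1 := ((hΨ (μ * t)).comp t ((hasDerivAt_id t).const_mul μ)).div_const μ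
      refine h1.congr_deriv ?_
      rw [htilt, hσ']
      simp only [eval_comp, eval_mul, eval_C, eval_X]
      field_simp)
    (L₁ / μ) (L₀ / μ)
    (hlim (p + 1) _ L₁ (by push_cast; field_simp; ring) hL₁)
    (hlim p _ L₀ (by push_cast; field_simp; ring) hL₀)
  have htl : (tilted d W A s).eval (y / μ) = -(c * (Complex.exp ζ * y - V.eval y)) := by
    have := htilt (y / μ)
    rw [hμt] at this
    rw [← this, neg_neg]
  set M := V.derivative.derivative.eval y / (g * d * z ^ (d - 1)) with hM
  have hMeq : W.derivative.derivative.eval (y / μ) / (d * (A * Complex.exp (s * Complex.I)) ^ (d - 1)) =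
      M := by
    rw [hWdd, hμt, hAs, hM, div_pow]
    have hp : μ ^ (d + 1) = μ ^ (d - 1) * μ ^ 2 := by rw [← pow_add]; congr 1; omega
    rw [hp] at hμ
    have hz1 := pow_ne_zero (d - 1) hz0
    have hμ1 := pow_ne_zero (d - 1) hμ0
    rw [div_eq_div_iff (by positivity) (by positivity)]
    field_simp
    linear_combination (V.derivative.derivative.eval y) * hμ
  rw [htl, hMeq, hlogA] at key
  set Q := (L₁ - L₀) * Complex.exp (-(c * (Complex.exp ζ * y - V.eval y))) with hQ
  set G := Complex.I * √(2 * Real.pi / d) * Complex.exp (-((d - 1) / 2) * ℓ) with hG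
  have hsq : 0 < √(2 * Real.pi / d) := Real.sqrt_pos.mpr (by positivity)
  have hGn : ‖G‖ = √(2 * Real.pi / d) * Real.exp (-((d - 1) / 2 * ℓ.re)) := by
    have : (-((d - 1) / 2) * ℓ : ℂ) = ((-((d - 1) / 2) : ℝ) : ℂ) * ℓ := by push_cast; ring
    rw [hG, norm_mul, norm_mul, Complex.norm_I, one_mul, Complex.norm_real,
      Real.norm_of_nonneg hsq.le, Complex.norm_exp, this, Complex.re_ofReal_mul, neg_mul]
  have hG0 : G ≠ 0 := norm_pos_iff.mp (by rw [hGn]; positivity)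
  have hGμ : μ * G = saddleConst d c g r β p j * Complex.exp (-((d - 1) / (2 * d) * ζ)) := by
    rw [hG, saddleConst, hμdef, mul_comm, mul_assoc, mul_assoc, mul_assoc, mul_assoc,
      ← Complex.exp_add, ← Complex.exp_add]
    congr 3
    rw [hℓ]
    field_simp
    ring
  have hσe : σ'.eval (y / μ) = σ.eval y := by
    rw [hσ']; simp only [eval_comp, eval_mul, eval_C, eval_X, hμt]
  rw [hσe] at key
  have hzm : z ^ m ≠ 0 := pow_ne_zero m hz0
  -- The error of Laplace's method, then that of the expansion of the leading factor.
  have hsplit : Q / (saddleConst d c g r β p j * Complex.exp (-((d - 1) / (2 * d) * ζ)) * z ^ m) -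
      ∑ l ∈ Finset.range d, a l * z⁻¹ ^ l =
      ((L₁ / μ - L₀ / μ) * Complex.exp (-(c * (Complex.exp ζ * y - V.eval y))) -
        σ.eval y * (G * M ^ (-1 / 2 : ℂ))) / (G * z ^ m) +
      (σ.eval y / z ^ m * M ^ (-1 / 2 : ℂ) - ∑ l ∈ Finset.range d, a l * z⁻¹ ^ l) := by
    rw [← hGμ, hQ]
    field_simp
    ring
  rw [hsplit]
  have hy2 : R₁' ≤ ‖y‖ := by
    have h1 : d * (Real.log (2 * (|R₁'| + 1)) + Real.log ‖r‖) ≤ ζ.re :=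
      ((le_max_right _ _).trans (le_max_right _ _)).trans hζ
    have h2 : 2 * (|R₁'| + 1) ≤ ‖z‖ := by
      rw [hzn, ← Real.log_le_iff_le_exp (by positivity), le_sub_iff_add_le, le_div_iff₀ hd0]
      linarith
    have h3 : ‖z‖ - ‖y‖ ≤ 1 / 2 * ‖z‖ := by
      calc _ ≤ ‖z - y‖ := norm_sub_norm_le _ _
        _ = ‖y / z - 1‖ * ‖z‖ := by
          rw [← norm_mul, ← norm_neg]; congr 1; field_simp; ring
        _ ≤ _ := mul_le_mul_of_nonneg_right hyη.2.2 (norm_nonneg _)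
    linarith [le_abs_self R₁']
  have key2 := hexp y z hz0 hy2 hyη.2.1 (by rw [hy, hzd])
  have hzinv : ‖z⁻¹‖ ^ d = ‖r‖ ^ d * Real.exp (-ζ.re) := by
    rw [norm_inv, hzn, ← Real.exp_neg, ← Real.exp_nat_mul,
      show (d : ℝ) * -(ζ.re / d - Real.log ‖r‖) = d * Real.log ‖r‖ + -ζ.re by field_simp; ring,
      Real.exp_add, Real.exp_nat_mul, Real.exp_log hrn]
  rw [hzinv] at key2
  have hzA : ‖z‖ = ‖μ‖ * A := by
    rw [hAn, norm_div, mul_div_cancel₀]; exact norm_ne_zero_iff.mpr hμ0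
  have hμn : 0 < ‖μ‖ := norm_pos_iff.mpr hμ0
  have hfirst : ‖((L₁ / μ - L₀ / μ) * Complex.exp (-(c * (Complex.exp ζ * y - V.eval y))) -
        σ.eval y * (G * M ^ (-1 / 2 : ℂ))) / (G * z ^ m)‖ ≤ k₀ * Real.exp (-ζ.re) := by
    rw [norm_div, norm_mul, norm_pow, hGn, hzA, div_le_iff₀ (by positivity)]
    refine key.trans ?_
    rw [hA, saddle_error_eq]
    have h1 : Real.exp (-((d + 1) * ℓ.re)) ≤ Real.exp (d * b) * Real.exp (-ζ.re) := by
      rw [← Real.exp_add]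
      apply Real.exp_le_exp.mpr
      have h2 : d * b ≤ ζ.re := ((le_max_left _ _).trans (le_max_right _ _)).trans hζ
      have h3 : 0 ≤ ℓ.re := by
        rw [hℓre, sub_nonneg, le_div_iff₀ hd0]; linarith
      have h4 : d * ℓ.re = ζ.re - d * b := by rw [hℓre]; field_simp
      linarith
    have h5 : 0 ≤ Real.exp (-((d - 1) / 2 * ℓ.re)) * Real.exp ℓ.re ^ m := by positivity
    calc _ ≤ |K₀| * (Real.exp (d * b) * Real.exp (-ζ.re) *
            (Real.exp (-((d - 1) / 2 * ℓ.re)) * Real.exp ℓ.re ^ m)) := by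
          refine mul_le_mul (le_abs_self _) ?_ (by positivity) (abs_nonneg _)
          exact mul_le_mul_of_nonneg_right h1 h5
      _ = _ := by rw [hk₀, mul_pow]; field_simp
  calc _ ≤ _ := norm_add_le _ _
    _ ≤ k₀ * Real.exp (-ζ.re) + |K₁| * (‖r‖ ^ d * Real.exp (-ζ.re)) := by
      refine add_le_add hfirst (key2.trans ?_)
      exact mul_le_mul_of_nonneg_right (le_abs_self _) (by positivity)
    _ = _ := by ring


/-! ### Labels of sectors, windows of sectors, and homology. -/

/-- The index of the sector containing the direction `v`, relative to the one containing `u`. -/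
noncomputable def sectorLabel (d : ℕ) (u v : ℂ) : ℤ :=
  round ((d + 1) * Complex.arg (v / u) / (2 * Real.pi))

/-- The argument of `u` minus its deviation from the centre of its sector. -/
noncomputable def centreAngle (d : ℕ) (V : ℂ[X]) (T u : ℂ) : ℝ :=
  u.arg - Complex.arg (V.derivative.leadingCoeff * u ^ (d + 1) / T) / (d + 1)

theorem leadingCoeff_derivative_eq {d : ℕ} {V : ℂ[X]} (hV : V.natDegree = d + 1) :
    V.derivative.leadingCoeff = (d + 1) * V.leadingCoeff := by
  rw [leadingCoeff, leadingCoeff, natDegree_derivative, coeff_derivative, hV, Nat.add_sub_cancel]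
  ring

theorem mem_decaySectors_iff {d : ℕ} {V : ℂ[X]} (hV : V.natDegree = d + 1) {T v : ℂ} :
    v ∈ decaySectors V T ↔ 0 < (V.derivative.leadingCoeff * v ^ (d + 1) / T).re := by
  have h : V.derivative.leadingCoeff * v ^ (d + 1) / T =
      ((d + 1 : ℝ) : ℂ) * (V.leadingCoeff * v ^ V.natDegree / T) := by
    rw [leadingCoeff_derivative_eq hV, hV]; push_cast; ring
  rw [h, Complex.re_ofReal_mul]
  exact (mul_pos_iff_of_pos_left (by positivity : (0 : ℝ) < d + 1)).symm

/-- Correcting `arg u` by a `(d + 1)`-th of the argument of `V'_{lead} u^{d+1} / T` leads to a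
direction where this expression is positive. -/
theorem exp_centreAngle {d : ℕ} {V : ℂ[X]} {T u : ℂ}
    (hu : V.derivative.leadingCoeff * u ^ (d + 1) / T ≠ 0) :
    V.derivative.leadingCoeff / T * Complex.exp (((d + 1) * centreAngle d V T u : ℝ) * Complex.I) =
      ‖V.derivative.leadingCoeff / T‖ := by
  set G := V.derivative.leadingCoeff with hG
  set w := G * u ^ (d + 1) / T with hw
  have hu0 : u ≠ 0 := fun h => hu (by rw [hw, h]; simp)
  have hun : (‖u‖ : ℂ) ≠ 0 := by exact_mod_cast norm_ne_zero_iff.mpr hu0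
  have hd : (d : ℝ) + 1 ≠ 0 := by positivity
  have hwn : (‖w‖ : ℂ) ≠ 0 := by exact_mod_cast norm_ne_zero_iff.mpr hu
  have e1 : (d + 1) * centreAngle d V T u = (d + 1) * u.arg - w.arg := by
    rw [centreAngle, ← hG, ← hw]; field_simp
  have e2 : Complex.exp (((d + 1) * u.arg : ℝ) * Complex.I) = u ^ (d + 1) / (‖u‖ : ℂ) ^ (d + 1) := by
    conv_rhs => rw [← Complex.norm_mul_exp_arg_mul_I u]
    rw [mul_pow, ← Complex.exp_nat_mul]
    have : ‖(‖u‖ : ℂ) * Complex.exp (u.arg * Complex.I)‖ = ‖u‖ := by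
      rw [Complex.norm_mul_exp_arg_mul_I]
    rw [this, mul_div_cancel_left₀ _ (pow_ne_zero _ hun)]
    push_cast; ring_nf
  have e3 : Complex.exp ((w.arg : ℂ) * Complex.I) = w / ‖w‖ := by
    conv_rhs => rw [← Complex.norm_mul_exp_arg_mul_I w]
    have : ‖(‖w‖ : ℂ) * Complex.exp (w.arg * Complex.I)‖ = ‖w‖ := by
      rw [Complex.norm_mul_exp_arg_mul_I]
    rw [this, mul_div_cancel_left₀ _ hwn]
  have e4 : ‖w‖ = ‖G / T‖ * ‖u‖ ^ (d + 1) := by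
    rw [hw, mul_div_right_comm, norm_mul, norm_pow]
  have e5 : w = G / T * u ^ (d + 1) := by rw [hw]; ring
  rw [e1, Complex.ofReal_sub, sub_mul, Complex.exp_sub, e2, e3]
  rw [e4] at hwn ⊢
  push_cast at hwn ⊢
  have h1 := left_ne_zero_of_mul hwn
  have hu' := pow_ne_zero (d + 1) hu0
  rw [e5] at hu ⊢
  have h2 := left_ne_zero_of_mul hu
  generalize G / T = G' at *
  field_simp

theorem mem_decaySectors_of_openSector {d : ℕ} {V : ℂ[X]} (hV : V.natDegree = d + 1) {T : ℂ} {β : ℝ}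
    (h0 : V.derivative.leadingCoeff / T ≠ 0)
    (hβ : V.derivative.leadingCoeff / T * Complex.exp (((d + 1) * β : ℝ) * Complex.I) =
      ‖V.derivative.leadingCoeff / T‖) (p : ℤ) :
    openSector (β + 2 * Real.pi * p / (d + 1)) (Real.pi / (2 * (d + 1))) ⊆ decaySectors V T := by
  rintro x ⟨r, hr, φ, hφ, rfl⟩
  rw [mem_decaySectors_iff hV]
  have hd : (0 : ℝ) < d + 1 := by positivity
  set ψ := (d + 1) * (φ - (β + 2 * Real.pi * p / (d + 1))) with hψ
  have e : V.derivative.leadingCoeff * (r * Complex.exp (φ * Complex.I)) ^ (d + 1) / T =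
      ((‖V.derivative.leadingCoeff / T‖ * r ^ (d + 1) : ℝ) : ℂ) * Complex.exp (ψ * Complex.I) := by
    have e1 : Complex.exp (φ * Complex.I) ^ (d + 1) =
        Complex.exp (((d + 1) * β : ℝ) * Complex.I) * Complex.exp (ψ * Complex.I) := by
      rw [← Complex.exp_nat_mul, ← Complex.exp_add]
      have : ((d + 1 : ℕ) : ℂ) * (φ * Complex.I) = ((d + 1) * β : ℝ) * Complex.I + ψ * Complex.I +
          p * (2 * Real.pi * Complex.I) := by
        rw [hψ]
        have : (d : ℂ) + 1 ≠ 0 := by exact_mod_cast hd.ne'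
        push_cast
        field_simp
        ring
      rw [this, Complex.exp_add _ (p * (2 * Real.pi * Complex.I)),
        Complex.exp_int_mul_two_pi_mul_I, mul_one]
    rw [mul_pow, e1, Complex.ofReal_mul ‖_‖, ← hβ, Complex.ofReal_pow]
    ring
  rw [e, Complex.re_ofReal_mul, Complex.exp_ofReal_mul_I_re]
  refine mul_pos (mul_pos (norm_pos_iff.mpr h0) (by positivity)) (Real.cos_pos_of_mem_Ioo ?_)
  rw [abs_lt] at hφ
  have h1 := mul_lt_mul_of_pos_left hφ.1 hd
  have h2 := mul_lt_mul_of_pos_left hφ.2 hd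
  have e2 : (d + 1 : ℝ) * (Real.pi / (2 * (d + 1))) = Real.pi / 2 := by field_simp
  rw [mul_neg, e2] at h1
  rw [e2] at h2
  exact ⟨h1, h2⟩

/-- Let `φ` be an argument of `v`, `β` the centre of the sector of `u`, `q` the label and `x = (d +
1) (φ - β)`. Then `x` is within `3 π / 2` of `2 π q`: `π` comes from the rounding and `π / 2` from
the position of `u` in its sector. Since `cos x > 0`, the distance must be below `π / 2`. -/
theorem mem_openSector_sectorLabel {d : ℕ} {V : ℂ[X]} (hV : V.natDegree = d + 1) {T u v : ℂ}
    (hu : u ∈ decaySectors V T) (hv : v ∈ decaySectors V T) :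
    v ∈ openSector (centreAngle d V T u + 2 * Real.pi * sectorLabel d u v / (d + 1))
      (Real.pi / (2 * (d + 1))) := by
  rw [mem_decaySectors_iff hV] at hu hv
  have hd : (0 : ℝ) < d + 1 := by positivity
  have hu1 : V.derivative.leadingCoeff * u ^ (d + 1) / T ≠ 0 := fun h => by
    rw [h, Complex.zero_re] at hu; exact hu.false
  have hβ := exp_centreAngle (d := d) (V := V) (T := T) (u := u) hu1
  set β := centreAngle d V T u with hβdef
  have hu0 : u ≠ 0 := fun h => hu1 (by rw [h]; simp)
  have hv0 : v ≠ 0 := fun h => by rw [h] at hv; simp at hv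
  set G := V.derivative.leadingCoeff with hG
  set φ := u.arg + Complex.arg (v / u) with hφ
  have hvφ : v = ‖v‖ * Complex.exp (φ * Complex.I) := by
    have h1 : v = u * (v / u) := by field_simp
    have h2 : ‖v‖ = ‖u‖ * ‖v / u‖ := by rw [← norm_mul, ← h1]
    have h3 := Complex.norm_mul_exp_arg_mul_I u
    have h4 := Complex.norm_mul_exp_arg_mul_I (v / u)
    rw [h2, hφ, Complex.ofReal_add, add_mul, Complex.exp_add, Complex.ofReal_mul]
    linear_combination h1 - (‖v / u‖ * Complex.exp (Complex.arg (v / u) * Complex.I)) * h3 - u * h4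
  set x := (d + 1) * (φ - β) with hx
  have hcos : 0 < Real.cos x := by
    have e : G * v ^ (d + 1) / T =
        ((‖G / T‖ * ‖v‖ ^ (d + 1) : ℝ) : ℂ) * Complex.exp (x * Complex.I) := by
      have e1 : Complex.exp (φ * Complex.I) ^ (d + 1) =
          Complex.exp (((d + 1) * β : ℝ) * Complex.I) * Complex.exp (x * Complex.I) := by
        rw [← Complex.exp_nat_mul, ← Complex.exp_add, hx]
        congr 1
        push_cast
        ring
      conv_lhs => rw [hvφ]
      rw [mul_pow, e1, Complex.ofReal_mul ‖_‖, ← hβ, Complex.ofReal_pow]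
      ring
    rw [e, Complex.re_ofReal_mul, Complex.exp_ofReal_mul_I_re] at hv
    exact pos_of_mul_pos_right hv (by positivity)
  set θ := Complex.arg (G * u ^ (d + 1) / T) with hθ
  have hθ2 : |θ| < Real.pi / 2 := Complex.abs_arg_lt_pi_div_two_iff.mpr (Or.inl hu)
  set q := sectorLabel d u v with hq
  have hround : |(d + 1) * Complex.arg (v / u) / (2 * Real.pi) - q| ≤ 1 / 2 :=
    abs_sub_round _
  have hpi := Real.pi_pos
  have hyq : |(d + 1) * Complex.arg (v / u) - 2 * Real.pi * q| ≤ Real.pi := by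
    have : (d + 1) * Complex.arg (v / u) - 2 * Real.pi * q =
      ((d + 1) * Complex.arg (v / u) / (2 * Real.pi) - q) * (2 * Real.pi) := by field_simp
    rw [this, abs_mul, abs_of_pos (by positivity : 0 < 2 * Real.pi)]
    nlinarith
  have hxe : x - 2 * Real.pi * q = ((d + 1) * Complex.arg (v / u) - 2 * Real.pi * q) + θ := by
    rw [hx, hφ, hβdef, centreAngle, ← hG, ← hθ]
    field_simp
    ring
  have hlt : |x - 2 * Real.pi * q| < Real.pi / 2 := by
    by_contra hcon
    rw [not_lt] at hcon
    have h1 : |x - 2 * Real.pi * q| ≤ Real.pi + Real.pi / 2 := by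
      rw [hxe]
      exact (abs_add_le _ _).trans (by linarith)
    have h2 : Real.cos x = Real.cos |x - 2 * Real.pi * q| := by
      rw [Real.cos_abs, show x - 2 * Real.pi * q = x - q * (2 * Real.pi) by ring,
        Real.cos_sub_int_mul_two_pi]
    rw [h2] at hcos
    exact absurd hcos (not_lt.mpr (Real.cos_nonpos_of_pi_div_two_le_of_le hcon h1))
  refine ⟨‖v‖, norm_pos_iff.mpr hv0, φ, ?_, hvφ⟩
  have e3 : φ - (β + 2 * Real.pi * q / (d + 1)) = (x - 2 * Real.pi * q) / (d + 1) := by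
    rw [hx]; field_simp; ring
  rw [e3, abs_div, abs_of_pos hd, div_lt_div_iff₀ hd (by positivity)]
  nlinarith

/-- The representative of `q` modulo `d + 1` in the window of length `d + 1` starting at `z`. -/
def windowRep (d : ℕ) (z q : ℤ) : ℤ := z + (q - z) % (d + 1)

/-- The representative of `ρ` modulo `d` in the window of length `d` starting at `z`. -/
def windowIndex (d : ℕ) (z ρ : ℤ) : ℤ := z + (ρ - z) % d

theorem windowRep_mem (d : ℕ) (z q : ℤ) : z ≤ windowRep d z q ∧ windowRep d z q ≤ z + d := by
  have h1 := Int.emod_nonneg (q - z) (by omega : (d + 1 : ℤ) ≠ 0)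
  have h2 := Int.emod_lt_of_pos (q - z) (by omega : (0 : ℤ) < d + 1)
  unfold windowRep
  constructor <;> omega

theorem exists_windowRep_eq (d : ℕ) (z q : ℤ) : ∃ k : ℤ, windowRep d z q = q + k * (d + 1) :=
  ⟨-((q - z) / (d + 1)), by
    have := Int.mul_ediv_add_emod (q - z) (d + 1)
    unfold windowRep
    linear_combination this⟩

theorem exists_windowIndex_eq (d : ℕ) (z q : ℤ) : ∃ k : ℤ, windowIndex d z q = q + k * d :=
  ⟨-((q - z) / d), by
    have := Int.mul_ediv_add_emod (q - z) d
    unfold windowIndex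
    linear_combination this⟩

theorem windowIndex_mem {d : ℕ} (hd : 1 ≤ d) (z q : ℤ) :
    z ≤ windowIndex d z q ∧ windowIndex d z q ≤ z + (d - 1) := by
  have h1 := Int.emod_nonneg (q - z) (by omega : (d : ℤ) ≠ 0)
  have h2 := Int.emod_lt_of_pos (q - z) (by omega : (0 : ℤ) < d)
  unfold windowIndex
  constructor <;> omega

/-- Residues modulo `d` are in bijection with the integers of any window of length `d`. -/
theorem sum_windowIndex {d : ℕ} (hd : 1 ≤ d) (z : ℤ) {G : Type*} [AddCommMonoid G] (F : ℤ → G) :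
    ∑ ρ : Fin d, F (windowIndex d z (ρ : ℕ)) = ∑ i ∈ Finset.range d, F (z + i) := by
  have hd0 : (d : ℤ) ≠ 0 := by omega
  have hdp : (0 : ℤ) < d := by omega
  refine Finset.sum_bij (fun ρ _ => ((((ρ : ℕ) : ℤ) - z) % d).toNat) ?_ ?_ ?_ ?_
  · intro ρ _
    have h1 := Int.emod_nonneg (((ρ : ℕ) : ℤ) - z) hd0
    have h2 := Int.emod_lt_of_pos (((ρ : ℕ) : ℤ) - z) hdp
    rw [Finset.mem_range]; omega
  · intro ρ _ ρ' _ h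
    have h1 := Int.emod_nonneg (((ρ : ℕ) : ℤ) - z) hd0
    have h2 := Int.emod_nonneg (((ρ' : ℕ) : ℤ) - z) hd0
    have h3 : (((ρ : ℕ) : ℤ) - z) % d = (((ρ' : ℕ) : ℤ) - z) % d := by omega
    have h5 := (Int.ModEq.add_right z h3).eq
    simp only [sub_add_cancel] at h5
    rw [Int.emod_eq_of_lt (by omega) (by have := ρ.2; omega),
      Int.emod_eq_of_lt (by omega) (by have := ρ'.2; omega)] at h5
    exact Fin.ext (by omega)
  · intro i hi
    rw [Finset.mem_range] at hi
    have h1 := Int.emod_nonneg (z + i) hd0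
    have h2 := Int.emod_lt_of_pos (z + i) hdp
    refine ⟨⟨((z + i) % d).toNat, by omega⟩, Finset.mem_univ _, ?_⟩
    simp only [Int.toNat_of_nonneg h1]
    rw [Int.emod_sub_emod, add_sub_cancel_left, Int.emod_eq_of_lt (by omega) (by omega)]
    simp
  · intro ρ _
    have h1 := Int.emod_nonneg (((ρ : ℕ) : ℤ) - z) hd0
    rw [Int.toNat_of_nonneg h1]
    rfl

/-- Telescoping over a window. -/
theorem sub_eq_sum_window {d : ℕ} (hd : 1 ≤ d) {G : Type*} [AddCommGroup G] (f : ℤ → G) {z q : ℤ}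
    (h1 : z ≤ q) (h2 : q ≤ z + d) :
    f q - f z = ∑ ρ : Fin d, (if windowIndex d z (ρ : ℕ) < q then (1 : ℤ) else 0) •
      (f (windowIndex d z (ρ : ℕ) + 1) - f (windowIndex d z (ρ : ℕ))) := by
  rw [sum_windowIndex hd z (fun p => (if p < q then (1 : ℤ) else 0) • (f (p + 1) - f p))]
  obtain ⟨k, rfl⟩ : ∃ k : ℕ, q = z + k := ⟨(q - z).toNat, by omega⟩
  have hk : k ≤ d := by omega
  have h3 : ∀ i ∈ Finset.range d, (if z + (i : ℤ) < z + k then (1 : ℤ) else 0) •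
      (f (z + i + 1) - f (z + i)) = if i < k then f (z + i + 1) - f (z + i) else 0 := fun i _ => by
    by_cases h : i < k
    · rw [if_pos (by omega), if_pos h, one_smul]
    · rw [if_neg (by omega), if_neg h, zero_smul]
  rw [Finset.sum_congr rfl h3, ← Finset.sum_filter]
  have h4 : (Finset.range d).filter (fun i => i < k) = Finset.range k := by
    ext i; simp only [Finset.mem_filter, Finset.mem_range]; omega
  rw [h4]
  have h5 := Finset.sum_range_sub (fun i : ℕ => f (z + i)) k
  push_cast at h5
  rw [add_zero] at h5
  rw [← h5]
  exact Finset.sum_congr rfl fun i _ => by rw [add_assoc]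

/-- The coefficients of the contours on the basis of paths between neighbouring sectors of a window. -/
noncomputable def crossing (d : ℕ) (u : ℂ) (z : ℤ) (Γ : Fin d → Contour) : Matrix (Fin d) (Fin d) ℤ :=
  fun ρ k =>
    (if windowIndex d z (ρ : ℕ) < windowRep d z (sectorLabel d u (Γ k).endDir) then 1 else 0) -
    (if windowIndex d z (ρ : ℕ) < windowRep d z (sectorLabel d u (Γ k).startDir) then 1 else 0)

/-- The `d` steps of a window connect all the `d + 1` sectors. The function is arbitrary up to its
period because two are needed: the limits of a primitive, and the generators of the group that
contains the homology classes. -/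
theorem sub_eq_sum_crossing {d : ℕ} (hd : 1 ≤ d) {G : Type*} [AddCommGroup G] {f : ℤ → G}
    (hf : ∀ q k : ℤ, f (q + k * (d + 1)) = f q) (u : ℂ) (z : ℤ) (Γ : Fin d → Contour) (k : Fin d) :
    f (sectorLabel d u (Γ k).endDir) - f (sectorLabel d u (Γ k).startDir) =
      ∑ ρ : Fin d, crossing d u z Γ ρ k •
        (f (windowIndex d z (ρ : ℕ) + 1) - f (windowIndex d z (ρ : ℕ))) := by
  have h : ∀ q, f q = f (windowRep d z q) := fun q => by
    obtain ⟨k, hk⟩ := exists_windowRep_eq d z q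
    rw [hk, hf]
  rw [h (sectorLabel d u (Γ k).endDir), h (sectorLabel d u (Γ k).startDir)]
  have h1 := fun q => sub_eq_sum_window hd f (windowRep_mem d z q).1 (windowRep_mem d z q).2
  rw [← sub_sub_sub_cancel_right _ _ (f z), h1, h1, ← Finset.sum_sub_distrib]
  exact Finset.sum_congr rfl fun ρ _ => by rw [← sub_smul]; rfl

/-- The columns of `crossing` are the coordinates of the homology classes on the steps of the
window. A nonzero integral vector in the kernel would be a linear relation between the classes. -/
theorem det_crossing_ne_zero {d : ℕ} (hd : 1 ≤ d) {V : ℂ[X]} (hV : V.natDegree = d + 1) {T : ℂ}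
    {Γ : Fin d → Contour} (hΓ : IsContourBasis Γ V T) {u : ℂ} (hu : u ∈ decaySectors V T) (z : ℤ) :
    (crossing d u z Γ).det ≠ 0 := by
  intro hdet
  obtain ⟨a, ha, hca⟩ := Matrix.exists_mulVec_eq_zero_iff.mpr hdet
  have hu1 : V.derivative.leadingCoeff * u ^ (d + 1) / T ≠ 0 := fun h => by
    rw [mem_decaySectors_iff hV, h, Complex.zero_re] at hu; exact hu.false
  have h0 : V.derivative.leadingCoeff / T ≠ 0 := fun h => hu1 (by rw [mul_div_right_comm, h, zero_mul])
  have hsub := fun p => mem_decaySectors_of_openSector hV h0 (exp_centreAngle hu1) p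
  set β := centreAngle d V T u with hβ
  set D : ℤ → ℂ := fun p => Complex.exp ((β + 2 * Real.pi * p / (d + 1) : ℝ) * Complex.I) with hD
  have hper : ∀ q k : ℤ, D (q + k * (d + 1)) = D q := fun q k => by
    have hd1 : (d : ℂ) + 1 ≠ 0 := by exact_mod_cast (by positivity : (d : ℝ) + 1 ≠ 0)
    simp only [hD]
    have : ((β + 2 * Real.pi * ((q + k * (d + 1) : ℤ) : ℝ) / (d + 1) : ℝ) : ℂ) * Complex.I =
        (β + 2 * Real.pi * q / (d + 1) : ℝ) * Complex.I + k * (2 * Real.pi * Complex.I) := by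
      push_cast; field_simp; ring
    rw [this, Complex.exp_add, Complex.exp_int_mul_two_pi_mul_I, mul_one]
  set f : ℤ → (Set ℂ →₀ ℤ) := fun p =>
    Finsupp.single (connectedComponentIn (decaySectors V T) (D p)) 1 with hf
  have hfper : ∀ q k : ℤ, f (q + k * (d + 1)) = f q := fun q k => by simp only [hf, hper]
  have hpos : 0 < Real.pi / (2 * (d + 1)) := by positivity
  -- A direction and the centre of its sector belong to the same convex subset of the decay region,
  -- hence to the same component.
  have hcomp : ∀ v ∈ decaySectors V T, connectedComponentIn (decaySectors V T) v =
      connectedComponentIn (decaySectors V T) (D (sectorLabel d u v)) := fun v hv => by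
    have hmem := mem_openSector_sectorLabel hV hu hv
    have hconv := convex_openSector (θ := β + 2 * Real.pi * sectorLabel d u v / (d + 1)) hpos (by
      rw [div_le_div_iff_of_pos_left Real.pi_pos (by positivity) two_pos]
      have : (0 : ℝ) ≤ d := by positivity
      linarith)
    refine (connectedComponentIn_eq ?_)
    refine hconv.isPreconnected.subset_connectedComponentIn hmem (hsub _) ?_
    exact exp_mem_openSector (by rwa [sub_self, abs_zero])
  have hcls : ∀ k, (Γ k).homologyClass V T = ∑ ρ : Fin d, crossing d u z Γ ρ k •
        (f (windowIndex d z (ρ : ℕ) + 1) - f (windowIndex d z (ρ : ℕ))) := fun k => by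
    rw [← sub_eq_sum_crossing hd hfper, Contour.homologyClass, hcomp _ (hΓ.1 k).1,
      hcomp _ (hΓ.1 k).2]
  apply ha
  funext k
  refine Fintype.linearIndependent_iff.mp hΓ.2 a ?_ k
  simp only [hcls, Finset.smul_sum, smul_smul]
  rw [Finset.sum_comm]
  refine Finset.sum_eq_zero fun ρ _ => ?_
  rw [← Finset.sum_smul]
  have : ∑ k, a k * crossing d u z Γ ρ k = 0 := by
    have := congrFun hca ρ
    rw [Matrix.mulVec, dotProduct] at this
    rw [← this.trans (Pi.zero_apply _)]
    exact Finset.sum_congr rfl fun k _ => mul_comm _ _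
  rw [this, zero_smul]


/-! ### Choice of the steps in the `m`-th sector, and the Fourier–Laplace transforms. -/

theorem eventually_comap_re_atTop {p : ℂ → Prop} :
    (∀ᶠ ζ in comap Complex.re atTop, p ζ) ↔ ∃ R : ℝ, ∀ ζ : ℂ, R ≤ ζ.re → p ζ := by
  rw [(atTop_basis.comap Complex.re).eventually_iff]
  simp

theorem exp_two_pi_div_pow_of_modEq {d : ℕ} (hd : 1 ≤ d) {j : ℤ} {k : ℕ} (h : ∃ q : ℤ, j = k + q * d) :
    Complex.exp (2 * Real.pi * j / d * Complex.I) = Complex.exp (2 * Real.pi * Complex.I / d) ^ k := by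
  obtain ⟨q, rfl⟩ := h
  have hdC : (d : ℂ) ≠ 0 := by exact_mod_cast (by omega : d ≠ 0)
  rw [← Complex.exp_nat_mul]
  have : (2 * Real.pi * ((k + q * d : ℤ) : ℂ) / d * Complex.I : ℂ) =
      k * (2 * Real.pi * Complex.I / d) + q * (2 * Real.pi * Complex.I) := by
    push_cast; field_simp
  rw [this, Complex.exp_add, Complex.exp_int_mul_two_pi_mul_I, mul_one]

theorem saddleApprox_eq {d : ℕ} (hd : 1 ≤ d) {r : ℂ} (hr : r ≠ 0) {j : ℤ} {k : ℕ}
    (h : ∃ q : ℤ, j = k + q * d) (ζ : ℂ) : saddleApprox d r j ζ =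
      Complex.exp (2 * Real.pi * Complex.I / d) ^ k / r * Complex.exp (ζ / d) := by
  rw [saddleApprox, Complex.exp_sub, Complex.exp_add, Complex.exp_log hr,
    exp_two_pi_div_pow_of_modEq hd h]
  ring

/-- If saddle and step differ by a fixed `z`, everything in the constant that depends on the
potential is common to all steps, and only the universal phase `exp (i π p / d)` varies. This allows
Stokes matrices that do not see the potential. -/
theorem saddleConst_add {d : ℕ} (hd : 1 ≤ d) (c g r : ℂ) (β : ℝ) (p z : ℤ) :
    saddleConst d c g r β p (p + z) =
      Complex.exp (Real.pi * p / d * Complex.I) * saddleConst d c g r β 0 z := by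
  have hdC : (d : ℂ) ≠ 0 := by exact_mod_cast (by omega : d ≠ 0)
  have hd1 : (d : ℂ) + 1 ≠ 0 := by exact_mod_cast (by positivity : (d : ℝ) + 1 ≠ 0)
  rw [saddleConst, saddleConst, mul_left_comm, ← Complex.exp_add]
  congr 2
  rw [logScale, logScale]
  push_cast
  field_simp
  ring

/-- As `V` has degree at least two, the term `x y` does not change the directions of decay. A
primitive thus has one limit per decay sector, and an integral only sees the labels of the two ends.
-/
theorem exists_sector_limits {d N : ℕ} (hd : 1 ≤ d) (hN : 0 < N) {V : ℂ[X]} (hV : V.natDegree = d + 1)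
    {T u : ℂ} (hu : u ∈ decaySectors V T) (P : ℂ[X]) (x : ℂ) :
    ∃ (Ψ : ℂ → ℂ) (R : ℤ → ℂ),
      (∀ y, HasDerivAt Ψ (P.eval y * Complex.exp ((N / T : ℂ) * (x * y - V.eval y))) y) ∧
      (∀ q : ℤ, Tendsto (fun v : ℝ => Ψ (v * Complex.exp
        ((centreAngle d V T u + 2 * Real.pi * q / (d + 1) : ℝ) * Complex.I))) atTop (𝓝 (R q))) ∧
      ∀ γ : Contour, γ.Admissible V T →
        γ.integral (fun y => P.eval y * Complex.exp ((N / T : ℂ) * (x * y - V.eval y))) =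
          R (sectorLabel d u γ.endDir) - R (sectorLabel d u γ.startDir) := by
  have hu1 : V.derivative.leadingCoeff * u ^ (d + 1) / T ≠ 0 := fun h => by
    rw [mem_decaySectors_iff hV, h, Complex.zero_re] at hu; exact hu.false
  have h0 : V.derivative.leadingCoeff / T ≠ 0 := fun h => hu1 (by rw [mul_div_right_comm, h, zero_mul])
  have hT : T ≠ 0 := fun h => h0 (by rw [h, div_zero])
  have hNC : (N : ℂ) ≠ 0 := by exact_mod_cast hN.ne'
  have hc : (N / T : ℂ) ≠ 0 := div_ne_zero hNC hT
  have hsub := fun p => mem_decaySectors_of_openSector hV h0 (exp_centreAngle hu1) p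
  set β := centreAngle d V T u with hβ
  set c : ℂ := N / T with hcdef
  set Q : ℂ[X] := C c * (V - C x * X) with hQ
  have hlow : (C x * X : ℂ[X]).natDegree < V.natDegree :=
    ((natDegree_C_mul_le x X).trans natDegree_X_le).trans_lt (by omega)
  have hQn : Q.natDegree = d + 1 := by
    rw [hQ, natDegree_C_mul hc, natDegree_sub_eq_left_of_natDegree_lt hlow, hV]
  have hQl : Q.leadingCoeff = c * V.leadingCoeff := by
    rw [hQ, leadingCoeff_mul, leadingCoeff_C, leadingCoeff_sub_of_degree_lt]
    exact degree_lt_degree hlow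
  have hQd : decayDirs Q = decaySectors V T := by
    ext v
    have : Q.leadingCoeff * v ^ Q.natDegree =
        ((N : ℝ) : ℂ) * (V.leadingCoeff * v ^ V.natDegree / T) := by
      rw [hQl, hQn, hV, hcdef]; push_cast; ring
    simp only [decayDirs, decaySectors, Set.mem_ofPred_eq, this, Complex.re_ofReal_mul]
    exact mul_pos_iff_of_pos_left (by exact_mod_cast hN)
  have hQe : ∀ y, Complex.exp (-Q.eval y) = Complex.exp (c * (x * y - V.eval y)) := fun y => by
    congr 1; simp [hQ]; ring
  obtain ⟨Ψ, hΨ⟩ : ∃ Ψ : ℂ → ℂ, ∀ y, HasDerivAt Ψ (P.eval y * Complex.exp (-Q.eval y)) y := by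
    have hdiff : Differentiable ℂ (fun y => P.eval y * Complex.exp (-Q.eval y)) := by fun_prop
    obtain ⟨Ψ, h⟩ := hdiff.isExactOn_univ
    exact ⟨Ψ, fun y => h y (Set.mem_univ y)⟩
  have hpos : 0 < Real.pi / (2 * (d + 1)) := by positivity
  have hmemD : ∀ q : ℤ, Complex.exp ((β + 2 * Real.pi * q / (d + 1) : ℝ) * Complex.I) ∈
      openSector (β + 2 * Real.pi * q / (d + 1)) (Real.pi / (2 * (d + 1))) := fun q =>
    exp_mem_openSector (by rwa [sub_self, abs_zero])
  have hex := fun q : ℤ => exists_tendsto_primitive (by omega : 1 ≤ Q.natDegree) hΨ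
    (hQd ▸ hsub q (hmemD q))
  choose R hR using hex
  refine ⟨Ψ, R, fun y => by rw [← hQe]; exact hΨ y, hR, fun γ hγ => ?_⟩
  simp only [← hQe]
  have hseg : ∀ v ∈ decaySectors V T, segment ℝ v (Complex.exp
      ((β + 2 * Real.pi * sectorLabel d u v / (d + 1) : ℝ) * Complex.I)) ⊆ decayDirs Q := fun v hv => by
    rw [hQd]
    refine subset_trans ?_ (hsub (sectorLabel d u v))
    refine (convex_openSector hpos ?_).segment_subset (mem_openSector_sectorLabel hV hu hv) (hmemD _)
    rw [div_le_div_iff_of_pos_left Real.pi_pos (by positivity) two_pos]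
    have : (0 : ℝ) ≤ d := by positivity
    linarith
  exact γ.integral_eq_sub (by omega) hΨ (hseg _ hγ.2) (hseg _ hγ.1) (hR _) (hR _)

/-- The offset of the saddle points of the `m`-th sector. -/
noncomputable def windowAngle (d : ℕ) (α : ℝ) (c u : ℂ) (m : ℤ) : ℝ :=
  (α + u.arg + c.arg + m * (Real.pi / d)) / d - Real.pi / (d + 1)

/-- The index of the first of the paths used in the `m`-th sector. -/
noncomputable def windowStart (d : ℕ) (α : ℝ) (c u : ℂ) (m : ℤ) : ℤ :=
  ⌊(-(Real.pi / d) - windowAngle d α c u m) * (d * (d + 1)) / (2 * Real.pi)⌋ + 1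

/-- The angle of the saddle moves by `q = 2π / (d (d + 1))` from one step to the next and by `π /
d²` when `x` crosses the sector. The window starts at the first index above the lower limit `-π /
d`, so at most one `q` is lost there, and `q + (d - 1) q + π / d² = 2π / d - ε₂` with `ε₂ > 0` for
`d ≥ 2`. For `d = 1` there is no condition. -/
theorem exists_window_margin {d : ℕ} (hd : 1 ≤ d) (α : ℝ) (c u : ℂ) (m : ℤ) :
    ∃ ε > (0 : ℝ), ∀ p : ℤ, windowStart d α c u m ≤ p → p ≤ windowStart d α c u m + (d - 1) →
      ∀ f : ℝ, 0 ≤ f → f ≤ 1 → 2 ≤ d →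
        |windowAngle d α c u m + f * (Real.pi / d) / d + 2 * Real.pi * p / (d * (d + 1))| ≤
          Real.pi / d - ε := by
  set κ := windowAngle d α c u m with hκ
  set z := windowStart d α c u m with hz
  have hpi := Real.pi_pos
  have hd1 : (1 : ℝ) ≤ d := by exact_mod_cast hd
  have hd0 : (0 : ℝ) < d := by linarith
  set q := 2 * Real.pi / (d * (d + 1)) with hq
  have hq0 : 0 < q := by positivity
  set F := (-(Real.pi / d) - κ) * (d * (d + 1)) / (2 * Real.pi) with hF
  have hFq : F * q = -(Real.pi / d) - κ := by rw [hF, hq]; field_simp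
  have h1 : F < z := by
    rw [hz, windowStart, ← hκ, ← hF]; push_cast; exact Int.lt_floor_add_one F
  have h2 : (z : ℝ) ≤ F + 1 := by
    rw [hz, windowStart, ← hκ, ← hF]; push_cast; linarith [Int.floor_le F]
  have h1q := mul_lt_mul_of_pos_right h1 hq0
  have h2q := mul_le_mul_of_nonneg_right h2 hq0.le
  set ε₂ := Real.pi * (d - 1) / (d ^ 2 * (d + 1)) with hε₂
  by_cases hd2 : 2 ≤ d
  · have hd2' : (2 : ℝ) ≤ d := by exact_mod_cast hd2
    have hε₂0 : 0 < ε₂ := div_pos (mul_pos hpi (by linarith)) (by positivity)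
    refine ⟨min (z * q - F * q) ε₂, lt_min (by linarith) hε₂0, fun p hp hp' f hf hf' _ => ?_⟩
    have e1 : 2 * Real.pi * p / (d * (d + 1)) = p * q := by rw [hq]; ring
    have hpR : (z : ℝ) ≤ p := by exact_mod_cast hp
    have hpR' : (p : ℝ) ≤ z + (d - 1) := by exact_mod_cast hp'
    have hpq := mul_le_mul_of_nonneg_right hpR hq0.le
    have hpq' := mul_le_mul_of_nonneg_right hpR' hq0.le
    have hfd : 0 ≤ Real.pi / d / d := by positivity
    have e2 : f * (Real.pi / d) / d = f * (Real.pi / d / d) := by ring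
    have e3 : q + (d - 1) * q + Real.pi / d / d = 2 * (Real.pi / d) - ε₂ := by
      rw [hq, hε₂]; field_simp; ring
    rw [e1, e2, abs_le]
    have m1 := min_le_left (z * q - F * q) ε₂
    have m2 := min_le_right (z * q - F * q) ε₂
    have f1 : 0 ≤ f * (Real.pi / d / d) := by positivity
    have f2 : f * (Real.pi / d / d) ≤ Real.pi / d / d := mul_le_of_le_one_left hfd hf'
    constructor <;> linarith
  · exact ⟨1, one_pos, fun p _ _ f _ _ h => absurd h hd2⟩

/-- By `hβ` the arguments of `c`, `r^d` and `exp (i (d + 1) β)` add up to zero modulo `2π`. The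
integer measures the choices of branch in `arg c`, `log r` and `β`; it becomes the offset between
the indices of steps and of saddles. -/
theorem exists_turning {d : ℕ} (hd : 1 ≤ d) {c g r : ℂ} (hc : c ≠ 0) (hg : g ≠ 0) (hr : r ^ d = g)
    {β : ℝ} (hβ : c * g * Complex.exp (((d + 1) * β : ℝ) * Complex.I) = ‖c * g‖) :
    ∃ z : ℤ, c.arg + d * (Complex.log r).im + (d + 1) * β = 2 * Real.pi * z := by
  have hr0 : r ≠ 0 := fun h => hg (by rw [← hr, h, zero_pow (by omega)])
  have hcg : ((‖c * g‖ : ℝ) : ℂ) ≠ 0 := by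
    exact_mod_cast norm_ne_zero_iff.mpr (mul_ne_zero hc hg)
  have e : Complex.exp (((c.arg + d * (Complex.log r).im + (d + 1) * β : ℝ) : ℂ) * Complex.I) = 1 := by
    have h1 : g = ‖g‖ * Complex.exp ((d * (Complex.log r).im : ℝ) * Complex.I) := by
      have h2 : g = Complex.exp (d * Complex.log r) := by
        rw [Complex.exp_nat_mul, Complex.exp_log hr0, hr]
      have h3 : ‖g‖ = Real.exp (d * (Complex.log r).re) := by
        rw [h2, Complex.norm_exp, ← Complex.ofReal_natCast, Complex.re_ofReal_mul]
      rw [h3, Complex.ofReal_exp, ← Complex.exp_add]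
      conv_lhs => rw [h2, ← Complex.re_add_im (Complex.log r)]
      congr 1
      push_cast
      ring
    have h4 : (‖c * g‖ : ℂ) * Complex.exp (((c.arg + d * (Complex.log r).im + (d + 1) * β : ℝ) : ℂ) *
        Complex.I) = ‖c * g‖ := by
      conv_rhs => rw [← hβ]
      rw [Complex.ofReal_add, Complex.ofReal_add, add_mul, add_mul, Complex.exp_add, Complex.exp_add,
        norm_mul, Complex.ofReal_mul]
      have h5 := Complex.norm_mul_exp_arg_mul_I c
      conv_rhs => rw [← h5, h1]
      ring
    exact mul_left_cancel₀ hcg (by rw [h4, mul_one])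
  obtain ⟨z, hz⟩ := Complex.exp_eq_one_iff.mp e
  refine ⟨z, ?_⟩
  have : ((c.arg + d * (Complex.log r).im + (d + 1) * β : ℝ) : ℂ) = ((2 * Real.pi * z : ℝ) : ℂ) := by
    apply mul_right_cancel₀ Complex.I_ne_zero
    rw [hz]; push_cast; ring
  exact_mod_cast this

/-- The residue modulo `d` of an integer. -/
def residue (d : ℕ) (hd : 0 < d) (q : ℤ) : Fin d :=
  ⟨(q % d).toNat, by
    have h1 := Int.emod_nonneg q (by omega : (d : ℤ) ≠ 0)
    have h2 := Int.emod_lt_of_pos q (by omega : (0 : ℤ) < d)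
    omega⟩

theorem exists_residue_eq {d : ℕ} (hd : 0 < d) (q : ℤ) :
    ∃ k : ℤ, (((residue d hd q : Fin d) : ℕ) : ℤ) = q + k * d :=
  ⟨-(q / d), by
    have h1 := Int.emod_nonneg q (by omega : (d : ℤ) ≠ 0)
    have h2 := Int.mul_ediv_add_emod q d
    simp only [residue, Int.toNat_of_nonneg h1]
    linear_combination h2⟩

/-- Distinct saddles are reached by distinct steps: the step `p` goes through the saddle `p + z`
modulo `d`. -/
theorem residue_injective {d : ℕ} (hd : 0 < d) (z : ℤ) :
    Function.Injective (fun k : Fin d => residue d hd ((k : ℕ) + 1 - z)) := by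
  intro k k' h
  obtain ⟨a, ha⟩ := exists_residue_eq hd ((k : ℕ) + 1 - z)
  obtain ⟨b, hb⟩ := exists_residue_eq hd ((k' : ℕ) + 1 - z)
  simp only at h
  rw [h, hb] at ha
  have hk := k.2
  have hk' := k'.2
  have h1 : ((k' : ℕ) : ℤ) - (k : ℕ) = (a - b) * d := by linear_combination ha
  have h2 : a - b = 0 := by
    by_contra hne
    have h3 : (1 : ℤ) ≤ |a - b| := Int.one_le_abs hne
    have h4 : |((k' : ℕ) : ℤ) - (k : ℕ)| = |a - b| * d := by rw [h1, abs_mul, Nat.abs_cast]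
    have h5 : |((k' : ℕ) : ℤ) - (k : ℕ)| < d := by rw [abs_lt]; constructor <;> omega
    nlinarith
  rw [h2, zero_mul] at h1
  exact Fin.ext (by omega)

namespace Model

variable {d₁ d₂ N : ℕ} {T : ℂ} {Γy : Fin d₂ → Contour}

theorem g₂_eq (M : Model d₁ d₂ N T Γy) : M.g₂ (d₂ + 1) = M.V₂.derivative.leadingCoeff := by
  rw [leadingCoeff_derivative_eq M.natDegree_V₂, g₂, leadingCoeff, M.natDegree_V₂]
  push_cast; ring

theorem s_ne_zero (M : Model d₁ d₂ N T Γy) (n : ℕ) : M.s n ≠ 0 := fun h =>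
  M.h_ne_zero n (by rw [← M.s_sq, h]; simp)

theorem fourier_eq (M : Model d₁ d₂ N T Γy) (k : Fin d₂) (n : ℕ) (x : ℂ) :
    M.fourier k n x = (M.s n)⁻¹ * (Γy k).integral (fun y =>
      (M.σ n).eval y * Complex.exp ((N / T : ℂ) * (x * y - M.V₂.eval y))) := by
  rw [fourier, Contour.integral, Contour.integral, ← MeasureTheory.integral_const_mul]
  congr 1
  funext t
  rw [φ, show (N / T : ℂ) * (x * (Γy k).toFun t - M.V₂.eval ((Γy k).toFun t)) =
    -(N / T) * M.V₂.eval ((Γy k).toFun t) + N / T * (x * (Γy k).toFun t) by ring, Complex.exp_add]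
  ring

/-- `F k` is the integral over the step of the window that goes through the `k`-th saddle;
`crossing` reassembles the contours from the steps. The order of the quantifiers matters: `D` and
`z` serve for all `n` and `m`, and the coefficients `a` serve for all `m` and all saddles. -/
theorem fourier_expansion (M : Model d₁ d₂ N T Γy) (hd : 0 < d₂) (hN : 0 < N) (α : ℝ) {r : ℂ}
    (hr : r ^ d₂ = M.g₂ (d₂ + 1)) {y : Fin d₂ → ℂ → ℂ} (hy : M.IsSaddles r y) :
    ∃ (D : ℂ) (z : ℤ), D ≠ 0 ∧ ∀ n : ℕ, ∃ a : ℕ → ℂ, a 0 = 1 ∧ ∀ m : ℤ, ∃ (F : Fin d₂ → ℂ → ℂ) (K R : ℝ),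
      ∀ ζ ∈ M.sector hd α m, R ≤ ζ.re →
        (∀ col, M.fourier col n (Complex.exp ζ) = (M.s n)⁻¹ * ∑ k, F k ζ *
          (crossing d₂ (Γy ⟨0, hd⟩).endDir (windowStart d₂ α (N / T) (Γy ⟨0, hd⟩).endDir m) Γy
            (residue d₂ hd ((k : ℕ) + 1 - z)) col : ℤ)) ∧
        ∀ k, M.V₂.derivative.eval (y k ζ) = Complex.exp ζ ∧
          ‖F k ζ * Complex.exp (-((N / T : ℂ) * (Complex.exp ζ * y k ζ - M.V₂.eval (y k ζ)))) /
            (Complex.exp (Real.pi * windowIndex d₂ (windowStart d₂ α (N / T) (Γy ⟨0, hd⟩).endDir m)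
                ((residue d₂ hd ((k : ℕ) + 1 - z) : Fin d₂) : ℕ) / d₂ * Complex.I) * D *
              Complex.exp (-((d₂ - 1) / (2 * d₂) * ζ)) *
              (Complex.exp (2 * Real.pi * Complex.I / d₂) ^ ((k : ℕ) + 1) / r *
                Complex.exp (ζ / d₂)) ^ n) -
            ∑ l ∈ Finset.range d₂, a l * (Complex.exp (2 * Real.pi * Complex.I / d₂) ^ ((k : ℕ) + 1) / r *
                Complex.exp (ζ / d₂))⁻¹ ^ l‖ ≤ K * Real.exp (-ζ.re) := by
  set u := (Γy ⟨0, hd⟩).endDir with hu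
  have hud : u ∈ decaySectors M.V₂ T := (M.basis_y.1 _).2
  have hV := M.natDegree_V₂
  set g := M.V₂.derivative.leadingCoeff with hg
  have hu1 : g * u ^ (d₂ + 1) / T ≠ 0 := fun h => by
    rw [mem_decaySectors_iff hV, h, Complex.zero_re] at hud; exact hud.false
  have h0 : g / T ≠ 0 := fun h => hu1 (by rw [mul_div_right_comm, h, zero_mul])
  have hT : T ≠ 0 := fun h => h0 (by rw [h, div_zero])
  have hg0 : g ≠ 0 := fun h => h0 (by rw [h, zero_div])
  have hNC : (N : ℂ) ≠ 0 := by exact_mod_cast hN.ne'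
  set c : ℂ := N / T with hcdef
  have hc : c ≠ 0 := div_ne_zero hNC hT
  set β := centreAngle d₂ M.V₂ T u with hβdef
  have hβ : c * g * Complex.exp (((d₂ + 1) * β : ℝ) * Complex.I) = ‖c * g‖ := by
    have h1 := exp_centreAngle (d := d₂) (V := M.V₂) (T := T) (u := u) hu1
    rw [← hg, ← hβdef] at h1
    have h2 : c * g = N * (g / T) := by rw [hcdef]; ring
    rw [h2, mul_assoc, h1, norm_mul, Complex.norm_natCast]; push_cast; ring
  have hrg : r ^ d₂ = g := by rw [hr, M.g₂_eq]
  have hr0 : r ≠ 0 := fun h => hg0 (by rw [← hrg, h, zero_pow (by omega)])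
  obtain ⟨z, hz⟩ := exists_turning hd hc hg0 hrg hβ
  refine ⟨saddleConst d₂ c g r β 0 z, z, saddleConst_ne_zero hd _ _ _ _ _ _, fun n => ?_⟩
  obtain ⟨a, ha0, hexp⟩ := saddle_contribution hd hV (M.monic_σ n) (M.natDegree_σ n) hc hg hβ hrg
  refine ⟨a, ha0, fun m => ?_⟩
  have hlim := fun x => exists_sector_limits hd hN hV hud (M.σ n) x
  choose Ψ Rl hΨ hRl hint using hlim
  set zm := windowStart d₂ α c u m with hzm
  set p : Fin d₂ → ℤ := fun k =>
    windowIndex d₂ zm ((residue d₂ hd ((k : ℕ) + 1 - z) : Fin d₂) : ℕ) with hp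
  obtain ⟨ε, hε, hmargin⟩ := exists_window_margin hd α c u m
  have hsad := fun k => hexp (p k) (p k + z) ε hε
  choose η hη K R hsad using hsad
  have hj : ∀ k : Fin d₂, ∃ q : ℤ, p k + z = ((k : ℕ) + 1 : ℕ) + q * d₂ := fun k => by
    obtain ⟨q, hq⟩ := exists_residue_eq hd ((k : ℕ) + 1 - z)
    obtain ⟨q', hq'⟩ := exists_windowIndex_eq d₂ zm
      ((residue d₂ hd ((k : ℕ) + 1 - z) : Fin d₂) : ℕ)
    refine ⟨q + q', ?_⟩
    simp only [hp]
    rw [hq', hq]; push_cast; ring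
  have hclose : ∀ k, ∃ R' : ℝ, ∀ ζ : ℂ, R' ≤ ζ.re → M.V₂.derivative.eval (y k ζ) = Complex.exp ζ ∧
      ‖y k ζ / saddleApprox d₂ r (p k + z) ζ - 1‖ ≤ η k := fun k => by
    rw [← eventually_comap_re_atTop]
    refine (hy k).1.and ?_
    set w := Complex.exp (2 * Real.pi * Complex.I / d₂) ^ ((k : ℕ) + 1) / r with hw
    have hw0 : w ≠ 0 := div_ne_zero (pow_ne_zero _ (Complex.exp_ne_zero _)) hr0
    have h1 := ((hy k).2.div_const w)
    rw [div_self hw0] at h1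
    have h2 := (Metric.tendsto_nhds.mp h1) (η k) (hη k)
    filter_upwards [h2] with ζ hζ
    rw [dist_eq_norm] at hζ
    refine le_of_eq_of_le ?_ hζ.le
    rw [saddleApprox_eq hd hr0 (hj k), ← hw, neg_div, Complex.exp_neg]
    congr 2
    have := Complex.exp_ne_zero (ζ / d₂)
    field_simp
  choose R' hclose using hclose
  refine ⟨fun k ζ => Rl (Complex.exp ζ) (p k + 1) - Rl (Complex.exp ζ) (p k), ∑ k, |K k|,
    ∑ k, (|R k| + |R' k|), fun ζ hζ hζR => ⟨fun col => ?_, fun k => ?_⟩⟩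
  · rw [M.fourier_eq, hint _ _ (M.basis_y.1 col)]
    congr 1
    have hper : ∀ q k : ℤ, Rl (Complex.exp ζ) (q + k * (d₂ + 1)) = Rl (Complex.exp ζ) q := fun q k => by
      refine tendsto_nhds_unique ((hRl (Complex.exp ζ) (q + k * (d₂ + 1))).congr fun v => ?_)
        (hRl (Complex.exp ζ) q)
      congr 2
      have hd1 : (d₂ : ℂ) + 1 ≠ 0 := by exact_mod_cast (by positivity : (d₂ : ℝ) + 1 ≠ 0)
      have : ((β + 2 * Real.pi * ((q + k * (d₂ + 1) : ℤ) : ℝ) / (d₂ + 1) : ℝ) : ℂ) * Complex.I =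
          (β + 2 * Real.pi * q / (d₂ + 1) : ℝ) * Complex.I + k * (2 * Real.pi * Complex.I) := by
        push_cast; field_simp; ring
      rw [this, Complex.exp_add, Complex.exp_int_mul_two_pi_mul_I, mul_one]
    rw [sub_eq_sum_crossing hd hper u zm Γy col]
    symm
    refine Fintype.sum_bijective _ (Finite.injective_iff_bijective.mp (residue_injective hd z)) _ _
      fun k => ?_
    rw [zsmul_eq_mul, mul_comm]
  · have hRk : |R k| + |R' k| ≤ ζ.re :=
      (Finset.single_le_sum (f := fun k => |R k| + |R' k|) (fun k _ => by positivity)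
        (Finset.mem_univ k)).trans hζR
    have hc1 := hclose k ζ (by linarith [le_abs_self (R' k), abs_nonneg (R k)])
    refine ⟨hc1.1, ?_⟩
    have hwin := windowIndex_mem hd zm ((residue d₂ hd ((k : ℕ) + 1 - z) : Fin d₂) : ℕ)
    have hd0 : (0 : ℝ) < d₂ := by exact_mod_cast hd
    have key := hsad k ζ (by linarith [le_abs_self (R k), abs_nonneg (R' k)]) (fun h2 => by
      have hζ' : ζ.im ∈ Set.Icc _ _ := hζ
      rw [M.g₂_eq, ← hg, ← hu] at hζ'
      -- In the angle of the saddle the rotation `θ / (d₂ + 1)` of the sector cancels against the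
      -- one contained in `β`, and `2 π z / d₂` cancels `arg r`. What remains is `windowAngle`,
      -- which does not involve the potential. The number `f` is the relative position of `ζ` in the
      -- sector.
      set θ := Complex.arg (g * u ^ (d₂ + 1) / T) with hθ
      have hβ2 : β = u.arg - θ / (d₂ + 1) := rfl
      set f := (ζ.im - (α + θ / (d₂ + 1) + m * (Real.pi / d₂))) / (Real.pi / d₂) with hf
      have hpd : 0 < Real.pi / d₂ := by positivity
      have hf0 : 0 ≤ f := div_nonneg (by linarith [hζ'.1]) hpd.le
      have hf1 : f ≤ 1 := by rw [hf, div_le_one hpd]; linarith [hζ'.2]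
      have hfe : f * (Real.pi / d₂) = ζ.im - (α + θ / (d₂ + 1) + m * (Real.pi / d₂)) := by
        rw [hf]; field_simp
      have := hmargin (p k) hwin.1 hwin.2 f hf0 hf1 h2
      refine le_of_eq_of_le ?_ this
      congr 1
      rw [windowAngle, hfe, hβ2]
      push_cast
      rw [hβ2] at hz
      have e1 : 2 * Real.pi * z / d₂ = (c.arg + d₂ * (Complex.log r).im +
        (d₂ + 1) * (u.arg - θ / (d₂ + 1))) / d₂ := by rw [hz]
      rw [mul_add, add_div, e1]
      field_simp
      ring) (y k ζ) hc1.1 hc1.2 (Ψ (Complex.exp ζ)) (hΨ _) _ _ (hRl _ _) (hRl _ _)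
    rw [saddleConst_add hd, saddleApprox_eq hd hr0 (hj k)] at key
    refine key.trans (mul_le_mul_of_nonneg_right ?_ (Real.exp_pos _).le)
    exact (le_abs_self _).trans (Finset.single_le_sum (f := fun k => |K k|)
      (fun k _ => abs_nonneg _) (Finset.mem_univ k))

end Model


/-! ### Joint decay of the weight on products of contours. -/

/-- The direction of the end of the contour at parameter `t`. -/
noncomputable def Contour.dir (γ : Contour) (t : ℝ) : ℂ := if 0 ≤ t then γ.endDir else γ.startDir

theorem Contour.dir_mem (γ : Contour) (t : ℝ) : γ.dir t ∈ ({γ.startDir, γ.endDir} : Set ℂ) := by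
  unfold Contour.dir
  split_ifs <;> simp

/-- Far out the contour is a ray up to a relative error `η`; the constant covers the compact part.
-/
theorem Contour.exists_norm_sub_end_le (γ : Contour) {η : ℝ} (hη : 0 < η) :
    ∃ K > (0 : ℝ), ∀ t, 0 ≤ t → ‖γ.toFun t - t * γ.endDir‖ ≤ η * t + K := by
  obtain ⟨R, hR⟩ := (Metric.tendsto_nhds.mp γ.tendsto_div_end η hη).exists_forall_of_atTop
  obtain ⟨B, hB⟩ := (isCompact_Icc (a := 0) (b := max R 1)).exists_bound_of_continuousOn
    (f := fun t : ℝ => γ.toFun t - t * γ.endDir)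
    ((γ.differentiable.continuous.sub (by fun_prop)).continuousOn)
  refine ⟨|B| + 1, by positivity, fun t ht => ?_⟩
  rcases le_total t (max R 1) with h | h
  · have h1 := hB t ⟨ht, h⟩
    have h2 : 0 ≤ η * t := by positivity
    linarith [le_abs_self B]
  · have h1 := hR t ((le_max_left _ _).trans h)
    have ht0 : 0 < t := by linarith [le_max_right R 1]
    have htC : (t : ℂ) ≠ 0 := by exact_mod_cast ht0.ne'
    rw [dist_eq_norm, show γ.toFun t / (t : ℂ) - γ.endDir = (γ.toFun t - t * γ.endDir) / t by
      field_simp, norm_div, Complex.norm_real, Real.norm_of_nonneg ht, div_lt_iff₀ ht0] at h1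
    linarith [abs_nonneg B]

theorem Contour.exists_norm_sub_dir_le (γ : Contour) {η : ℝ} (hη : 0 < η) :
    ∃ K > (0 : ℝ), ∀ t, ‖γ.toFun t - |t| * γ.dir t‖ ≤ η * |t| + K := by
  obtain ⟨K, hK, h⟩ := γ.exists_norm_sub_end_le hη
  obtain ⟨K', hK', h'⟩ := γ.reverse.exists_norm_sub_end_le hη
  refine ⟨K + K', by positivity, fun t => ?_⟩
  unfold Contour.dir
  split_ifs with ht
  · rw [abs_of_nonneg ht]; linarith [h t ht]
  · have h1 := h' (-t) (by linarith)
    rw [abs_of_neg (not_le.mp ht)]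
    simp only [Contour.reverse, neg_neg] at h1
    linarith

theorem Contour.exists_norm_le (γ : Contour) : ∃ C > (0 : ℝ), ∀ t, ‖γ.toFun t‖ ≤ C * (1 + |t|) := by
  obtain ⟨K, hK, h⟩ := γ.exists_norm_sub_dir_le one_pos
  refine ⟨‖γ.startDir‖ + ‖γ.endDir‖ + 1 + K, by positivity, fun t => ?_⟩
  have h1 : ‖γ.dir t‖ ≤ ‖γ.startDir‖ + ‖γ.endDir‖ := by
    unfold Contour.dir
    split_ifs <;> linarith [norm_nonneg γ.startDir, norm_nonneg γ.endDir]
  have h2 := norm_sub_norm_le (γ.toFun t) (|t| * γ.dir t)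
  rw [norm_mul, Complex.norm_real, Real.norm_of_nonneg (abs_nonneg t)] at h2
  have h3 := h t
  have h4 : |t| * ‖γ.dir t‖ ≤ |t| * (‖γ.startDir‖ + ‖γ.endDir‖) := by gcongr
  nlinarith [abs_nonneg t, norm_nonneg γ.startDir, norm_nonneg γ.endDir]

theorem Contour.exists_re_lower_end (γ : Contour) {Q : ℂ[X]} (he : 1 ≤ Q.natDegree)
    (h : γ.endDir ∈ decayDirs Q) : ∃ δ > (0 : ℝ), ∃ R : ℝ, ∀ t, R ≤ t →
      δ * t ^ Q.natDegree ≤ (Q.eval (γ.toFun t)).re := by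
  obtain ⟨ε, hε, δ, hδ, R, hR, hlow⟩ :=
    cone_lower_bound Q he (isCompact_singleton (x := γ.endDir)) (by simpa using h)
  obtain ⟨R', hR'⟩ := (Metric.tendsto_nhds.mp γ.tendsto_div_end ε hε).exists_forall_of_atTop
  refine ⟨δ, hδ, max R R', fun t ht => ?_⟩
  have ht1 : R ≤ t := (le_max_left _ _).trans ht
  have htC : (t : ℂ) ≠ 0 := by exact_mod_cast (by linarith : (0 : ℝ) < t).ne'
  have h1 := hR' t ((le_max_right _ _).trans ht)
  rw [dist_eq_norm] at h1
  have h2 := hlow t ht1 (γ.toFun t / t) ⟨_, rfl, h1.le⟩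
  rwa [mul_div_cancel₀ _ htC] at h2

theorem Contour.exists_re_lower (γ : Contour) {Q : ℂ[X]} (he : 1 ≤ Q.natDegree)
    (h : γ.endDir ∈ decayDirs Q) (h' : γ.startDir ∈ decayDirs Q) :
    ∃ δ > (0 : ℝ), ∃ K > (0 : ℝ), ∀ t, δ * |t| ^ Q.natDegree - K ≤ (Q.eval (γ.toFun t)).re := by
  obtain ⟨δ, hδ, R, h1⟩ := γ.exists_re_lower_end he h
  obtain ⟨δ', hδ', R', h2⟩ := γ.reverse.exists_re_lower_end he h'
  set B := max (max R R') 0 with hB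
  obtain ⟨M, hM⟩ := (isCompact_Icc (a := -B) (b := B)).exists_bound_of_continuousOn
    (f := fun t : ℝ => Q.eval (γ.toFun t)) (by
      have := γ.differentiable.continuous
      fun_prop)
  have hd0 : 0 < min δ δ' := lt_min hδ hδ'
  refine ⟨min δ δ', hd0, |M| + min δ δ' * B ^ Q.natDegree + 1, by positivity, fun t => ?_⟩
  have hK : 0 ≤ |M| + min δ δ' * B ^ Q.natDegree := by positivity
  have hpow : 0 ≤ |t| ^ Q.natDegree := by positivity
  rcases le_total |t| B with h | h
  · have h3 := hM t (abs_le.mp h)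
    have h4 := (abs_le.mp ((Complex.abs_re_le_norm _).trans h3)).1
    have h5 : min δ δ' * |t| ^ Q.natDegree ≤ min δ δ' * B ^ Q.natDegree := by gcongr
    linarith [le_abs_self M]
  · rcases le_total 0 t with h0 | h0
    · rw [abs_of_nonneg h0] at *
      have h3 := h1 t (((le_max_left _ _).trans (le_max_left _ _)).trans h)
      have h4 : min δ δ' * t ^ Q.natDegree ≤ δ * t ^ Q.natDegree :=
        mul_le_mul_of_nonneg_right (min_le_left _ _) hpow
      linarith
    · rw [abs_of_nonpos h0] at *
      have h3 := h2 (-t) (((le_max_right _ _).trans (le_max_left _ _)).trans h)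
      simp only [Contour.reverse, neg_neg] at h3
      have h4 : min δ δ' * (-t) ^ Q.natDegree ≤ δ' * (-t) ^ Q.natDegree :=
        mul_le_mul_of_nonneg_right (min_le_right _ _) hpow
      linarith

/-- Young's inequality puts `δ' / 4` on `(1 + b)²`. The possibly large factor `E` that this leaves
on `(1 + a)²` is absorbed by `a^p`, because `p ≥ 3`. -/
theorem exists_quadratic_le_cubic {δ δ' C : ℝ} (hδ : 0 < δ) (hδ' : 0 < δ') {p q : ℕ}
    (hp : 3 ≤ p) (hq : 2 ≤ q) : ∃ ε > (0 : ℝ), ∃ K : ℝ, ∀ a b : ℝ, 0 ≤ a → 0 ≤ b →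
      ε * (a ^ 2 + b ^ 2) - K ≤ δ * a ^ p + δ' * b ^ q - C * (1 + a) * (1 + b) := by
  have hpow : ∀ (x : ℝ) (k l : ℕ), 0 ≤ x → k ≤ l → x ^ k ≤ x ^ l + 1 := fun x k l hx hkl => by
    rcases le_total x 1 with h | h
    · have := pow_le_one₀ hx h (n := k)
      have := pow_nonneg hx l
      linarith
    · have := pow_le_pow_right₀ h hkl
      linarith
  set E := C ^ 2 / δ' with hE
  have hE0 : 0 ≤ E := by positivity
  set A := (1 + 2 * E) / δ with hA
  have hA0 : 0 < A := by positivity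
  refine ⟨min 1 (δ' / 2), by positivity, (1 + 2 * E) * A ^ 2 + δ + δ' + 2 * E + δ' / 2,
    fun a b ha hb => ?_⟩
  have h1 : C * (1 + a) * (1 + b) ≤ E * (1 + a) ^ 2 + δ' / 4 * (1 + b) ^ 2 := by
    have h2 : E * δ' = C ^ 2 := by rw [hE]; field_simp
    have h3 : 0 ≤ (2 * C * (1 + a) - δ' * (1 + b)) ^ 2 := sq_nonneg _
    have h4 : 4 * δ' * (C * (1 + a) * (1 + b)) ≤
        4 * δ' * (E * (1 + a) ^ 2 + δ' / 4 * (1 + b) ^ 2) := by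
      have : 4 * δ' * (E * (1 + a) ^ 2 + δ' / 4 * (1 + b) ^ 2) =
        4 * (E * δ') * (1 + a) ^ 2 + δ' ^ 2 * (1 + b) ^ 2 := by ring
      rw [this, h2]; nlinarith
    exact le_of_mul_le_mul_left h4 (by positivity)
  have h5 : (1 + a) ^ 2 ≤ 2 + 2 * a ^ 2 := by nlinarith [sq_nonneg (a - 1)]
  have h6 : (1 + b) ^ 2 ≤ 2 + 2 * b ^ 2 := by nlinarith [sq_nonneg (b - 1)]
  have h7 := hpow a 3 p ha hp
  have h8 := hpow b 2 q hb hq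
  have h9 : (1 + 2 * E) * a ^ 2 ≤ δ * a ^ 3 + (1 + 2 * E) * A ^ 2 := by
    rcases le_total a A with h | h
    · have : a ^ 2 ≤ A ^ 2 := pow_le_pow_left₀ ha h 2
      have h10 : (1 + 2 * E) * a ^ 2 ≤ (1 + 2 * E) * A ^ 2 := by gcongr
      have : 0 ≤ δ * a ^ 3 := by positivity
      linarith
    · have h10 : 1 + 2 * E ≤ δ * a := by
        rw [hA, div_le_iff₀ hδ] at h; linarith
      have h11 : (1 + 2 * E) * a ^ 2 ≤ δ * a * a ^ 2 := by gcongr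
      have : 0 ≤ (1 + 2 * E) * A ^ 2 := by positivity
      nlinarith
  have h12 : E * (1 + a) ^ 2 ≤ E * (2 + 2 * a ^ 2) := by gcongr
  have h13 : δ' / 4 * (1 + b) ^ 2 ≤ δ' / 4 * (2 + 2 * b ^ 2) := by gcongr
  have h14 : δ * a ^ 3 ≤ δ * (a ^ p + 1) := by gcongr
  have h15 : δ' * b ^ 2 ≤ δ' * (b ^ q + 1) := by gcongr
  have h16 : min 1 (δ' / 2) * (a ^ 2 + b ^ 2) ≤ 1 * a ^ 2 + δ' / 2 * b ^ 2 := by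
    rw [mul_add]
    exact add_le_add (mul_le_mul_of_nonneg_right (min_le_left _ _) (sq_nonneg _))
      (mul_le_mul_of_nonneg_right (min_le_right _ _) (sq_nonneg _))
  linarith

/-- A quadratic form that is positive on finitely many quadrants stays coercive near them. -/
theorem exists_coercive_of_pos {l₁ l₂ b : ℂ} {S S' : Set ℂ} (hS : S.Finite) (hS' : S'.Finite)
    (h : ∀ u ∈ S, ∀ v ∈ S', ∀ a b' : ℝ, 0 ≤ a → 0 ≤ b' → 0 < a + b' →
      0 < (l₁ * (a * u) ^ 2 + l₂ * (b' * v) ^ 2 - b * ((a * u) * (b' * v))).re) :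
    ∃ δ > (0 : ℝ), ∀ u ∈ S, ∀ v ∈ S', ∀ a b' : ℝ, 0 ≤ a → 0 ≤ b' →
      δ * (a + b') ^ 2 ≤ (l₁ * (a * u) ^ 2 + l₂ * (b' * v) ^ 2 - b * ((a * u) * (b' * v))).re := by
  set f : ℝ × ℂ × ℂ → ℝ := fun p => (l₁ * (p.1 * p.2.1) ^ 2 +
    l₂ * ((1 - p.1 : ℝ) * p.2.2) ^ 2 - b * ((p.1 * p.2.1) * ((1 - p.1 : ℝ) * p.2.2))).re with hf
  set Kc : Set (ℝ × ℂ × ℂ) := Set.Icc (0 : ℝ) 1 ×ˢ (S ×ˢ S') with hK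
  have hKc : IsCompact Kc := isCompact_Icc.prod (hS.isCompact.prod hS'.isCompact)
  obtain ⟨δ, hδ, hmin⟩ : ∃ δ > (0 : ℝ), ∀ p ∈ Kc, δ ≤ f p := by
    rcases Kc.eq_empty_or_nonempty with he | hne
    · exact ⟨1, one_pos, by simp [he]⟩
    · obtain ⟨p₀, hp₀, hmin⟩ := hKc.exists_isMinOn hne (f := f)
        (by simp only [hf]; exact Continuous.continuousOn (by fun_prop))
      exact ⟨f p₀, h _ hp₀.2.1 _ hp₀.2.2 _ _ hp₀.1.1 (by linarith [hp₀.1.2]) (by linarith),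
        fun p hp => hmin hp⟩
  refine ⟨δ, hδ, fun u hu v hv a b' ha hb => ?_⟩
  rcases (add_nonneg ha hb).eq_or_lt with h0 | h0
  · have ha0 : a = 0 := by linarith
    have hb0 : b' = 0 := by linarith
    simp [ha0, hb0]
  · have h1 := hmin (a / (a + b'), u, v) ⟨⟨by positivity, by rw [div_le_one h0]; linarith⟩, hu, hv⟩
    have h2 : (l₁ * (a * u) ^ 2 + l₂ * (b' * v) ^ 2 - b * ((a * u) * (b' * v))).re =
        (a + b') ^ 2 * f (a / (a + b'), u, v) := by
      simp only [hf]
      rw [← Complex.re_ofReal_mul]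
      congr 1
      have h3 : (1 - a / (a + b') : ℝ) = b' / (a + b') := by field_simp; ring
      have h4 : (a + b' : ℂ) ≠ 0 := by exact_mod_cast h0.ne'
      rw [h3]
      push_cast
      field_simp
    rw [h2, mul_comm]
    gcongr

/-- Transfers coercivity from the asymptotic rays to the contours themselves. -/
theorem quadratic_perturbation (l₁ l₂ b X Y e f : ℂ) {Λ ρ η : ℝ} (hη : 0 ≤ η)
    (h₁ : ‖l₁‖ ≤ Λ) (h₂ : ‖l₂‖ ≤ Λ) (h₃ : ‖b‖ ≤ Λ) (hX : ‖X‖ ≤ ρ) (hY : ‖Y‖ ≤ ρ) (he : ‖e‖ ≤ η)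
    (hf : ‖f‖ ≤ η) :
    (l₁ * X ^ 2 + l₂ * Y ^ 2 - b * (X * Y)).re - 6 * Λ * η * (ρ + η) ≤
      (l₁ * (X + e) ^ 2 + l₂ * (Y + f) ^ 2 - b * ((X + e) * (Y + f))).re := by
  have hΛ : 0 ≤ Λ := (norm_nonneg _).trans h₁
  have hρ : 0 ≤ ρ := (norm_nonneg _).trans hX
  have key : ‖(l₁ * (X + e) ^ 2 + l₂ * (Y + f) ^ 2 - b * ((X + e) * (Y + f))) -
      (l₁ * X ^ 2 + l₂ * Y ^ 2 - b * (X * Y))‖ ≤ 6 * Λ * η * (ρ + η) := by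
    have e1 : (l₁ * (X + e) ^ 2 + l₂ * (Y + f) ^ 2 - b * ((X + e) * (Y + f))) -
      (l₁ * X ^ 2 + l₂ * Y ^ 2 - b * (X * Y)) =
      (l₁ * (e * (2 * X + e)) + l₂ * (f * (2 * Y + f))) - b * (e * Y + X * f + e * f) := by ring
    rw [e1]
    have n1 : ‖l₁ * (e * (2 * X + e))‖ ≤ Λ * (η * (2 * ρ + η)) := by
      rw [norm_mul, norm_mul]
      have : ‖2 * X + e‖ ≤ 2 * ρ + η := (norm_add_le _ _).trans (by
        rw [norm_mul, Complex.norm_ofNat]; linarith)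
      gcongr
    have n2 : ‖l₂ * (f * (2 * Y + f))‖ ≤ Λ * (η * (2 * ρ + η)) := by
      rw [norm_mul, norm_mul]
      have : ‖2 * Y + f‖ ≤ 2 * ρ + η := (norm_add_le _ _).trans (by
        rw [norm_mul, Complex.norm_ofNat]; linarith)
      gcongr
    have n3 : ‖b * (e * Y + X * f + e * f)‖ ≤ Λ * (η * ρ + ρ * η + η * η) := by
      rw [norm_mul]
      have : ‖e * Y + X * f + e * f‖ ≤ η * ρ + ρ * η + η * η := by
        refine (norm_add₃_le).trans ?_
        rw [norm_mul, norm_mul, norm_mul]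
        gcongr
      gcongr
    have n4 := (norm_sub_le _ _).trans (add_le_add ((norm_add_le _ _).trans (add_le_add n1 n2)) n3)
    refine n4.trans ?_
    nlinarith [mul_nonneg hΛ (mul_nonneg hη hη)]
  have := (abs_le.mp ((Complex.abs_re_le_norm _).trans key)).1
  rw [Complex.sub_re] at this
  linarith

theorem mul_le_sq_div {δ : ℝ} (hδ : 0 < δ) (a ρ : ℝ) : a * ρ ≤ δ / 4 * ρ ^ 2 + a ^ 2 / δ := by
  rw [← sub_nonneg]
  have : δ / 4 * ρ ^ 2 + a ^ 2 / δ - a * ρ = (δ * ρ / 2 - a) ^ 2 / δ := by field_simp; ring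
  rw [this]
  positivity

namespace Model

variable {d₁ d₂ N : ℕ} {T : ℂ} {Γy : Fin d₂ → Contour}

/-- The exponent `(N/T) (V₁(x) + V₂(y) - x y)`. -/
noncomputable def action (M : Model d₁ d₂ N T Γy) (x y : ℂ) : ℂ :=
  N / T * (M.V₁.eval x + M.V₂.eval y - x * y)

theorem mem_decayDirs_smul {V : ℂ[X]} {N : ℕ} {T v : ℂ} (hN : 0 < N) (hT : T ≠ 0)
    (hv : v ∈ decaySectors V T) : v ∈ decayDirs (C (N / T : ℂ) * V) := by
  have hNC : (N : ℂ) ≠ 0 := by exact_mod_cast hN.ne'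
  have : (C (N / T : ℂ) * V).leadingCoeff * v ^ (C (N / T : ℂ) * V).natDegree =
      ((N : ℝ) : ℂ) * (V.leadingCoeff * v ^ V.natDegree / T) := by
    rw [leadingCoeff_mul, leadingCoeff_C, natDegree_C_mul (div_ne_zero hNC hT)]; push_cast; ring
  simp only [decayDirs, Set.mem_ofPred_eq, this, Complex.re_ofReal_mul]
  exact mul_pos (by exact_mod_cast hN) hv

/-- As soon as one of the degrees is at least three, the coupling `x y` is dominated by the two
potentials. -/
theorem action_lower_of_cubic (M : Model d₁ d₂ N T Γy) (hN : 0 < N) (hT : T ≠ 0)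
    (h : 2 ≤ d₁ ∨ 2 ≤ d₂) (i : Fin d₁) (j : Fin d₂) :
    ∃ δ > (0 : ℝ), ∃ K : ℝ, ∀ t s : ℝ, δ * (t ^ 2 + s ^ 2) - K ≤
      (M.action ((M.Γx i).toFun t) ((Γy j).toFun s)).re := by
  have hi := i.pos
  have hj := j.pos
  have hNC : (N : ℂ) ≠ 0 := by exact_mod_cast hN.ne'
  have hc : (N / T : ℂ) ≠ 0 := div_ne_zero hNC hT
  have hn₁ : (C (N / T : ℂ) * M.V₁).natDegree = d₁ + 1 := by rw [natDegree_C_mul hc, M.natDegree_V₁]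
  have hn₂ : (C (N / T : ℂ) * M.V₂).natDegree = d₂ + 1 := by rw [natDegree_C_mul hc, M.natDegree_V₂]
  obtain ⟨δ₁, hδ₁, K₁, hK₁, h₁⟩ := (M.Γx i).exists_re_lower (Q := C (N / T : ℂ) * M.V₁) (by omega)
    (mem_decayDirs_smul hN hT (M.basis_x.1 i).2) (mem_decayDirs_smul hN hT (M.basis_x.1 i).1)
  obtain ⟨δ₂, hδ₂, K₂, hK₂, h₂⟩ := (Γy j).exists_re_lower (Q := C (N / T : ℂ) * M.V₂) (by omega)
    (mem_decayDirs_smul hN hT (M.basis_y.1 j).2) (mem_decayDirs_smul hN hT (M.basis_y.1 j).1)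
  obtain ⟨C₁, hC₁, b₁⟩ := (M.Γx i).exists_norm_le
  obtain ⟨C₂, hC₂, b₂⟩ := (Γy j).exists_norm_le
  set C := ‖(N / T : ℂ)‖ * C₁ * C₂ with hCdef
  have hC0 : 0 ≤ C := by positivity
  rw [hn₁] at h₁
  rw [hn₂] at h₂
  have hred : ∀ t s : ℝ, δ₁ * |t| ^ (d₁ + 1) + δ₂ * |s| ^ (d₂ + 1) - C * (1 + |t|) * (1 + |s|) -
      (K₁ + K₂) ≤ (M.action ((M.Γx i).toFun t) ((Γy j).toFun s)).re := fun t s => by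
    set x := (M.Γx i).toFun t
    set y := (Γy j).toFun s
    have e : M.action x y = (Polynomial.C (N / T : ℂ) * M.V₁).eval x +
        (Polynomial.C (N / T : ℂ) * M.V₂).eval y - N / T * (x * y) := by
      rw [action, eval_mul, eval_mul, eval_C, eval_C]; ring
    rw [e, Complex.sub_re, Complex.add_re]
    have h3 : (N / T * (x * y) : ℂ).re ≤ C * (1 + |t|) * (1 + |s|) := by
      refine (Complex.re_le_norm _).trans ?_
      rw [norm_mul, norm_mul]
      calc _ ≤ ‖(N / T : ℂ)‖ * (C₁ * (1 + |t|) * (C₂ * (1 + |s|))) := by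
            gcongr
            · exact b₁ t
            · exact b₂ s
        _ = _ := by rw [hCdef]; ring
    linarith [h₁ t, h₂ s]
  rcases h with h | h
  · obtain ⟨ε, hε, K, hq⟩ := exists_quadratic_le_cubic hδ₁ hδ₂ (C := C) (p := d₁ + 1) (q := d₂ + 1)
      (by omega) (by omega)
    refine ⟨ε, hε, K + (K₁ + K₂), fun t s => ?_⟩
    have h4 := hq |t| |s| (abs_nonneg _) (abs_nonneg _)
    rw [sq_abs, sq_abs] at h4
    linarith [hred t s]
  · obtain ⟨ε, hε, K, hq⟩ := exists_quadratic_le_cubic hδ₂ hδ₁ (C := C) (p := d₂ + 1) (q := d₁ + 1)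
      (by omega) (by omega)
    refine ⟨ε, hε, K + (K₁ + K₂), fun t s => ?_⟩
    have h4 := hq |s| |t| (abs_nonneg _) (abs_nonneg _)
    rw [sq_abs, sq_abs] at h4
    have h5 := hred t s
    have h6 : C * (1 + |t|) * (1 + |s|) = C * (1 + |s|) * (1 + |t|) := by ring
    linarith

set_option maxHeartbeats 1000000 in
-- When both potentials are quadratic the coupling is of the same order as they are. Positivity on
-- the quadrants spanned by end directions gives coercivity on the rays, and the contours are close
-- enough to their rays to inherit it.
theorem action_lower_of_gaussian (M : Model d₁ d₂ N T Γy) (hN : 0 < N) (h1 : d₁ = 1) (h2 : d₂ = 1)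
    (i : Fin d₁) (j : Fin d₂) :
    ∃ δ > (0 : ℝ), ∃ K : ℝ, ∀ t s : ℝ, δ * (t ^ 2 + s ^ 2) - K ≤
      (M.action ((M.Γx i).toFun t) ((Γy j).toFun s)).re := by
  set c : ℂ := N / T with hc
  set l₁ := c * M.V₁.leadingCoeff with hl₁
  set l₂ := c * M.V₂.leadingCoeff with hl₂
  obtain ⟨δ, hδ, hco⟩ := exists_coercive_of_pos (l₁ := l₁) (l₂ := l₂) (b := c)
    (S := {(M.Γx i).startDir, (M.Γx i).endDir}) (S' := {(Γy j).startDir, (Γy j).endDir})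
    (Set.toFinite _) (Set.toFinite _) (fun u hu v hv a b ha hb hab => by
      have := M.gaussian h1 h2 i j u hu v hv a b ha hb hab
      have e : l₁ * (a * u) ^ 2 + l₂ * (b * v) ^ 2 - c * ((a * u) * (b * v)) = ((N : ℝ) : ℂ) *
        ((M.V₁.leadingCoeff * (a * u) ^ 2 + M.V₂.leadingCoeff * (b * v) ^ 2 - (a * u) * (b * v)) / T) := by
        rw [hl₁, hl₂, hc]; push_cast; ring
      rw [e, Complex.re_ofReal_mul]
      exact mul_pos (by exact_mod_cast hN) this)
  set Λ := ‖l₁‖ + ‖l₂‖ + ‖c‖ with hΛ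
  have hΛ0 : 0 ≤ Λ := by positivity
  obtain ⟨C₁, hC₁, b₁⟩ := (M.Γx i).exists_norm_le
  obtain ⟨C₂, hC₂, b₂⟩ := (Γy j).exists_norm_le
  set B := ‖(M.Γx i).startDir‖ + ‖(M.Γx i).endDir‖ + ‖(Γy j).startDir‖ + ‖(Γy j).endDir‖ with hB
  have hB0 : 0 ≤ B := by positivity
  -- The deviation from the rays is allowed to cost `δ / 4`; the terms linear in `ρ` will cost
  -- another `δ / 4`.
  obtain ⟨η, hη, hη1, hηδ⟩ : ∃ η > (0 : ℝ), η ≤ 1 ∧ 6 * Λ * η * (B + 1) ≤ δ / 4 := by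
    refine ⟨min 1 (δ / (24 * (Λ + 1) * (B + 1))), by positivity, min_le_left _ _, ?_⟩
    have h3 : min 1 (δ / (24 * (Λ + 1) * (B + 1))) ≤ δ / (24 * (Λ + 1) * (B + 1)) := min_le_right _ _
    rw [le_div_iff₀ (by positivity)] at h3
    have h4 : 0 < min 1 (δ / (24 * (Λ + 1) * (B + 1))) := by positivity
    nlinarith [mul_pos h4 (by positivity : 0 < B + 1)]
  obtain ⟨K₁, hK₁, e₁⟩ := (M.Γx i).exists_norm_sub_dir_le hη
  obtain ⟨K₂, hK₂, e₂⟩ := (Γy j).exists_norm_sub_dir_le hη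
  obtain ⟨D₁, hD₁, p₁⟩ := exists_norm_eval_sub_leading_le M.V₁ (e := 2) (by rw [M.natDegree_V₁, h1])
  obtain ⟨D₂, hD₂, p₂⟩ := exists_norm_eval_sub_leading_le M.V₂ (e := 2) (by rw [M.natDegree_V₂, h2])
  set K := K₁ + K₂ with hK
  set F := ‖c‖ * (D₁ * (1 + C₁) + D₂ * (1 + C₂)) with hF
  have hF0 : 0 ≤ F := by positivity
  set lin := 6 * Λ * K * (B + 2) + F with hlin
  have hlin0 : 0 ≤ lin := by positivity
  refine ⟨δ / 4, by positivity, lin ^ 2 / δ + 6 * Λ * K * K + 2 * F, fun t s => ?_⟩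
  set x := (M.Γx i).toFun t with hx
  set y := (Γy j).toFun s with hy
  set ρ := |t| + |s| with hρ
  have ht0 := abs_nonneg t
  have hs0 := abs_nonneg s
  have hρ0 : 0 ≤ ρ := by positivity
  have hdx : ‖(M.Γx i).dir t‖ ≤ B := by
    have := norm_nonneg (M.Γx i).startDir
    have := norm_nonneg (M.Γx i).endDir
    have := norm_nonneg (Γy j).startDir
    have := norm_nonneg (Γy j).endDir
    unfold Contour.dir
    split_ifs <;> linarith
  have hdy : ‖(Γy j).dir s‖ ≤ B := by
    have := norm_nonneg (M.Γx i).startDir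
    have := norm_nonneg (M.Γx i).endDir
    have := norm_nonneg (Γy j).startDir
    have := norm_nonneg (Γy j).endDir
    unfold Contour.dir
    split_ifs <;> linarith
  have h3 := quadratic_perturbation l₁ l₂ c (|t| * (M.Γx i).dir t) (|s| * (Γy j).dir s)
    (x - |t| * (M.Γx i).dir t) (y - |s| * (Γy j).dir s) (Λ := Λ) (ρ := B * ρ) (η := η * ρ + K)
    (by positivity) (by rw [hΛ]; linarith [norm_nonneg l₂, norm_nonneg c])
    (by rw [hΛ]; linarith [norm_nonneg l₁, norm_nonneg c])
    (by rw [hΛ]; linarith [norm_nonneg l₁, norm_nonneg l₂])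
    (by
      rw [norm_mul, Complex.norm_real, Real.norm_of_nonneg ht0, mul_comm B]
      exact mul_le_mul (by linarith) hdx (norm_nonneg _) hρ0)
    (by
      rw [norm_mul, Complex.norm_real, Real.norm_of_nonneg hs0, mul_comm B]
      exact mul_le_mul (by linarith) hdy (norm_nonneg _) hρ0)
    ((e₁ t).trans (add_le_add (mul_le_mul_of_nonneg_left (by linarith) hη.le) (by linarith)))
    ((e₂ s).trans (add_le_add (mul_le_mul_of_nonneg_left (by linarith) hη.le) (by linarith)))
  rw [add_sub_cancel, add_sub_cancel] at h3
  have h4 := hco _ ((M.Γx i).dir_mem t) _ ((Γy j).dir_mem s) |t| |s| ht0 hs0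
  have h5 : (l₁ * x ^ 2 + l₂ * y ^ 2 - c * (x * y)).re - F * (1 + ρ) - F ≤ (M.action x y).re := by
    have h6 : ‖c * (M.V₁.eval x - M.V₁.leadingCoeff * x ^ 2) +
        c * (M.V₂.eval y - M.V₂.leadingCoeff * y ^ 2)‖ ≤ F * (1 + ρ) := by
      refine (norm_add_le _ _).trans ?_
      rw [norm_mul, norm_mul]
      have h7 : ‖M.V₁.eval x - M.V₁.leadingCoeff * x ^ 2‖ ≤ D₁ * ((1 + C₁) * (1 + ρ)) := by
        refine (p₁ x).trans ?_
        have := b₁ t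
        norm_num
        have h8 : 1 + ‖x‖ ≤ (1 + C₁) * (1 + ρ) := by
          have h9 : C₁ * (1 + |t|) ≤ C₁ * (1 + ρ) := mul_le_mul_of_nonneg_left (by linarith) hC₁.le
          linarith
        exact mul_le_mul_of_nonneg_left h8 hD₁.le
      have h7' : ‖M.V₂.eval y - M.V₂.leadingCoeff * y ^ 2‖ ≤ D₂ * ((1 + C₂) * (1 + ρ)) := by
        refine (p₂ y).trans ?_
        have := b₂ s
        norm_num
        have h8 : 1 + ‖y‖ ≤ (1 + C₂) * (1 + ρ) := by
          have h9 : C₂ * (1 + |s|) ≤ C₂ * (1 + ρ) := mul_le_mul_of_nonneg_left (by linarith) hC₂.le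
          linarith
        exact mul_le_mul_of_nonneg_left h8 hD₂.le
      calc _ ≤ ‖c‖ * (D₁ * ((1 + C₁) * (1 + ρ))) + ‖c‖ * (D₂ * ((1 + C₂) * (1 + ρ))) := by gcongr
        _ = _ := by rw [hF]; ring
    have h9 := (abs_le.mp ((Complex.abs_re_le_norm _).trans h6)).1
    have h10 : M.action x y = (l₁ * x ^ 2 + l₂ * y ^ 2 - c * (x * y)) +
        (c * (M.V₁.eval x - M.V₁.leadingCoeff * x ^ 2) +
        c * (M.V₂.eval y - M.V₂.leadingCoeff * y ^ 2)) := by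
      rw [action, hl₁, hl₂]; ring
    rw [h10, Complex.add_re (l₁ * x ^ 2 + l₂ * y ^ 2 - c * (x * y))]
    linarith
  have h11 : 6 * Λ * (η * ρ + K) * (B * ρ + (η * ρ + K)) ≤
      δ / 4 * ρ ^ 2 + 6 * Λ * K * (B + 2) * ρ + 6 * Λ * K * K := by
    have e : 6 * Λ * (η * ρ + K) * (B * ρ + (η * ρ + K)) =
        6 * Λ * η * (B + η) * ρ ^ 2 + 6 * Λ * K * (B + 2 * η) * ρ + 6 * Λ * K * K := by ring
    rw [e]
    have : 6 * Λ * η * (B + η) ≤ δ / 4 :=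
      le_trans (by gcongr) hηδ
    have h12 : 6 * Λ * K * (B + 2 * η) ≤ 6 * Λ * K * (B + 2) := by
      have : B + 2 * η ≤ B + 2 := by linarith
      gcongr
    gcongr
  have h14 : t ^ 2 + s ^ 2 ≤ ρ ^ 2 := by
    rw [← sq_abs t, ← sq_abs s, hρ, add_sq]
    have := mul_nonneg ht0 hs0
    linarith
  have h16 : lin * ρ = 6 * Λ * K * (B + 2) * ρ + F * ρ := by rw [hlin]; ring
  have h4' : δ * ρ ^ 2 ≤ (l₁ * (|t| * (M.Γx i).dir t) ^ 2 + l₂ * (|s| * (Γy j).dir s) ^ 2 -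
    c * (|t| * (M.Γx i).dir t * (|s| * (Γy j).dir s))).re := h4
  have h17 : 0 ≤ δ * ρ ^ 2 := mul_nonneg hδ.le (sq_nonneg ρ)
  have h18 : 6 * Λ * K * (B + 2) * ρ + F * ρ ≤ δ / 4 * ρ ^ 2 + lin ^ 2 / δ := by
    rw [← h16]; exact mul_le_sq_div hδ lin ρ
  have h15 : δ / 4 * (t ^ 2 + s ^ 2) ≤ δ / 4 * ρ ^ 2 :=
    mul_le_mul_of_nonneg_left h14 (by positivity)
  generalize lin ^ 2 / δ = LL at h18 ⊢
  generalize 6 * Λ * K * (B + 2) * ρ = P₁ at h11 h18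
  generalize 6 * Λ * K * K = P₂ at h11 ⊢
  generalize 6 * Λ * (η * ρ + K) * (B * ρ + (η * ρ + K)) = P₃ at h11 h3
  rw [mul_add, mul_one] at h5
  linarith

/-- Joint decay of the weight. -/
theorem exists_action_lower (M : Model d₁ d₂ N T Γy) (hN : 0 < N) (hT : T ≠ 0) (i : Fin d₁)
    (j : Fin d₂) : ∃ δ > (0 : ℝ), ∃ K : ℝ, ∀ t s : ℝ, δ * (t ^ 2 + s ^ 2) - K ≤
      (M.action ((M.Γx i).toFun t) ((Γy j).toFun s)).re := by
  have hi := i.pos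
  have hj := j.pos
  by_cases h : 2 ≤ d₁ ∨ 2 ≤ d₂
  · exact M.action_lower_of_cubic hN hT h i j
  · exact M.action_lower_of_gaussian hN (by omega) (by omega) i j

end Model


/-! ### The inner integral as a density on the contours `Γˣ`. -/

theorem integrable_exp_neg_abs : MeasureTheory.Integrable (fun t : ℝ => Real.exp (-|t|)) := by
  rw [← MeasureTheory.integrableOn_univ, ← Set.Iic_union_Ioi (a := (0 : ℝ))]
  refine MeasureTheory.IntegrableOn.union ?_ ?_
  · refine (integrableOn_exp_mul_Iic one_pos 0).congr_fun (fun t ht => ?_) measurableSet_Iic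
    simp only [abs_of_nonpos (Set.mem_Iic.mp ht)]; ring_nf
  · refine (exp_neg_integrableOn_Ioi 0 one_pos).congr_fun (fun t ht => ?_) measurableSet_Ioi
    simp only [abs_of_pos (Set.mem_Ioi.mp ht)]; ring_nf

/-- Completing the square, `-δ t² ≤ 1 / δ - 2 |t|`; one of the two `|t|` pays for the polynomial. -/
theorem exists_pow_mul_gaussian_le (n : ℕ) {δ : ℝ} (hδ : 0 < δ) :
    ∃ C > (0 : ℝ), ∀ t : ℝ, (1 + |t|) ^ n * Real.exp (-(δ * t ^ 2)) ≤ C * Real.exp (-|t|) := by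
  obtain ⟨C, hC, h⟩ := exists_one_add_pow_le_exp n one_pos
  refine ⟨C * Real.exp (1 / δ), by positivity, fun t => ?_⟩
  have h1 : Real.exp (-(δ * t ^ 2)) ≤ Real.exp (1 / δ) * Real.exp (-(2 * |t|)) := by
    rw [← Real.exp_add]
    apply Real.exp_le_exp.mpr
    rw [← sq_abs t, ← sub_nonneg]
    have : 1 / δ + -(2 * |t|) - -(δ * |t| ^ 2) = (1 - δ * |t|) ^ 2 / δ := by field_simp; ring
    rw [this]; positivity
  calc _ ≤ (C * Real.exp (1 * |t|)) * (Real.exp (1 / δ) * Real.exp (-(2 * |t|))) :=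
        mul_le_mul (h _ (abs_nonneg t)) h1 (Real.exp_pos _).le (by positivity)
    _ = C * Real.exp (1 / δ) * (Real.exp (1 * |t|) * Real.exp (-(2 * |t|))) := by ring
    _ = _ := by rw [← Real.exp_add]; congr 2; ring

theorem Contour.exists_norm_eval_le (γ : Contour) (p : ℂ[X]) :
    ∃ C > (0 : ℝ), ∀ t, ‖p.eval (γ.toFun t)‖ ≤ C * (1 + |t|) ^ p.natDegree := by
  obtain ⟨C, hC, h⟩ := TwoMatrix.exists_norm_eval_le p le_rfl
  obtain ⟨C', hC', h'⟩ := γ.exists_norm_le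
  refine ⟨C * (1 + C') ^ p.natDegree, by positivity, fun t => (h _).trans ?_⟩
  rw [mul_assoc, ← mul_pow]
  have h0 := abs_nonneg t
  have h1 := h' t
  have : 1 + ‖γ.toFun t‖ ≤ (1 + C') * (1 + |t|) := by nlinarith
  gcongr

namespace Model

variable {d₁ d₂ N : ℕ} {T : ℂ} {Γy : Fin d₂ → Contour}

/-- The integrand `p(x) σ(y) e^{-action}` pulled back to the two contours. -/
noncomputable def kernel (M : Model d₁ d₂ N T Γy) (i : Fin d₁) (j : Fin d₂) (p σ : ℂ[X]) (t s : ℝ) : ℂ :=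
  p.eval ((M.Γx i).toFun t) * (σ.eval ((Γy j).toFun s) *
    Complex.exp (-M.action ((M.Γx i).toFun t) ((Γy j).toFun s))) * deriv (Γy j).toFun s

theorem exists_kernel_le (M : Model d₁ d₂ N T Γy) (hN : 0 < N) (hT : T ≠ 0) (i : Fin d₁)
    (j : Fin d₂) (p σ : ℂ[X]) : ∃ C > (0 : ℝ), ∀ t s : ℝ,
      ‖M.kernel i j p σ t s‖ ≤ C * Real.exp (-|t|) * Real.exp (-|s|) := by
  obtain ⟨δ, hδ, K, h⟩ := M.exists_action_lower hN hT i j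
  obtain ⟨C₁, hC₁, b₁⟩ := (M.Γx i).exists_norm_eval_le p
  obtain ⟨C₂, hC₂, b₂⟩ := (Γy j).exists_norm_eval_le σ
  obtain ⟨C₃, hC₃, b₃⟩ := (Γy j).exists_norm_deriv_le
  obtain ⟨C₄, hC₄, b₄⟩ := exists_pow_mul_gaussian_le p.natDegree hδ
  obtain ⟨C₅, hC₅, b₅⟩ := exists_pow_mul_gaussian_le σ.natDegree hδ
  refine ⟨C₁ * C₂ * C₃ * Real.exp K * C₄ * C₅, by positivity, fun t s => ?_⟩
  rw [kernel, norm_mul, norm_mul, norm_mul, Complex.norm_exp, Complex.neg_re]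
  have h1 : Real.exp (-(M.action ((M.Γx i).toFun t) ((Γy j).toFun s)).re) ≤
      Real.exp K * Real.exp (-(δ * t ^ 2)) * Real.exp (-(δ * s ^ 2)) := by
    rw [← Real.exp_add, ← Real.exp_add]
    apply Real.exp_le_exp.mpr
    linarith [h t s]
  have ht := b₁ t
  have hs := b₂ s
  have hs' := b₃ s
  calc _ ≤ (C₁ * (1 + |t|) ^ p.natDegree) * ((C₂ * (1 + |s|) ^ σ.natDegree) *
        (Real.exp K * Real.exp (-(δ * t ^ 2)) * Real.exp (-(δ * s ^ 2)))) * C₃ := by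
        gcongr
    _ = C₁ * C₂ * C₃ * Real.exp K * ((1 + |t|) ^ p.natDegree * Real.exp (-(δ * t ^ 2))) *
        ((1 + |s|) ^ σ.natDegree * Real.exp (-(δ * s ^ 2))) := by ring
    _ ≤ C₁ * C₂ * C₃ * Real.exp K * (C₄ * Real.exp (-|t|)) * (C₅ * Real.exp (-|s|)) := by
        have := b₄ t
        have := b₅ s
        gcongr
    _ = _ := by ring

/-- The derivative is again a combination of kernels, so `exists_kernel_le` bounds it too and gives
a Lipschitz estimate. -/
theorem kernel_hasDerivAt (M : Model d₁ d₂ N T Γy) (i : Fin d₁) (j : Fin d₂) (p σ : ℂ[X]) (t s : ℝ) :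
    HasDerivAt (fun t => M.kernel i j p σ t s) (deriv (M.Γx i).toFun t *
      (M.kernel i j p.derivative σ t s - N / T * M.kernel i j (p * M.V₁.derivative) σ t s +
        N / T * M.kernel i j p (X * σ) t s)) t := by
  set x := (M.Γx i).toFun with hx
  set y := (Γy j).toFun s with hy
  have hxd : HasDerivAt x (deriv x t) t := ((M.Γx i).differentiable t).hasDerivAt
  have h1 : HasDerivAt (fun z => p.eval z * (σ.eval y * Complex.exp (-M.action z y)) *
      deriv (Γy j).toFun s) ((p.derivative.eval (x t) * (σ.eval y * Complex.exp (-M.action (x t) y)) +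
        p.eval (x t) * (σ.eval y * (Complex.exp (-M.action (x t) y) *
          (-(N / T * (M.V₁.derivative.eval (x t) - y)))))) * deriv (Γy j).toFun s) (x t) := by
    have ha : HasDerivAt (fun z => -M.action z y) (-(N / T * (M.V₁.derivative.eval (x t) - y))) (x t) := by
      have h2 : HasDerivAt (fun z : ℂ => z * y) y (x t) := by
        simpa using (hasDerivAt_id (x t)).mul_const y
      exact ((((M.V₁.hasDerivAt (x t)).add_const (M.V₂.eval y)).sub h2).const_mul (N / T : ℂ)).neg
    exact ((p.hasDerivAt (x t)).mul ((ha.cexp).const_mul (σ.eval y))).mul_const _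
  have h3 := h1.comp t hxd
  refine h3.congr_deriv ?_
  simp only [kernel, eval_mul, eval_X]
  ring

theorem continuous_kernel (M : Model d₁ d₂ N T Γy) (i : Fin d₁) (j : Fin d₂) (p σ : ℂ[X]) (t : ℝ) :
    Continuous (M.kernel i j p σ t) := by
  have h1 := (Γy j).differentiable.continuous
  have h2 := (Γy j).continuous_deriv
  unfold kernel action
  fun_prop

theorem integrable_kernel (M : Model d₁ d₂ N T Γy) (hN : 0 < N) (hT : T ≠ 0) (i : Fin d₁)
    (j : Fin d₂) (p σ : ℂ[X]) (t : ℝ) : MeasureTheory.Integrable (M.kernel i j p σ t) := by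
  obtain ⟨C, hC, h⟩ := M.exists_kernel_le hN hT i j p σ
  exact (integrable_exp_neg_abs.const_mul (C * Real.exp (-|t|))).mono'
    (M.continuous_kernel i j p σ t).aestronglyMeasurable (Eventually.of_forall fun s => h t s)

theorem exists_kernel_sub_le (M : Model d₁ d₂ N T Γy) (hN : 0 < N) (hT : T ≠ 0) (i : Fin d₁)
    (j : Fin d₂) (p σ : ℂ[X]) : ∃ C > (0 : ℝ), ∀ t t' s : ℝ,
      ‖M.kernel i j p σ t s - M.kernel i j p σ t' s‖ ≤ C * |t - t'| * Real.exp (-|s|) := by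
  obtain ⟨C₁, hC₁, b₁⟩ := M.exists_kernel_le hN hT i j p.derivative σ
  obtain ⟨C₂, hC₂, b₂⟩ := M.exists_kernel_le hN hT i j (p * M.V₁.derivative) σ
  obtain ⟨C₃, hC₃, b₃⟩ := M.exists_kernel_le hN hT i j p (X * σ)
  obtain ⟨D, hD, hder⟩ := (M.Γx i).exists_norm_deriv_le
  set E := D * (C₁ + ‖(N / T : ℂ)‖ * C₂ + ‖(N / T : ℂ)‖ * C₃) with hE
  refine ⟨E, by positivity, fun t t' s => ?_⟩
  have h1 : ∀ τ ∈ (Set.univ : Set ℝ), ‖deriv (M.Γx i).toFun τ *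
      (M.kernel i j p.derivative σ τ s - N / T * M.kernel i j (p * M.V₁.derivative) σ τ s +
        N / T * M.kernel i j p (X * σ) τ s)‖ ≤ E * Real.exp (-|s|) := fun τ _ => by
    have hle : ∀ C' : ℝ, 0 < C' → C' * Real.exp (-|τ|) * Real.exp (-|s|) ≤ C' * Real.exp (-|s|) := by
      intro C' hC'
      have : Real.exp (-|τ|) ≤ 1 := Real.exp_le_one_iff.mpr (neg_nonpos.mpr (abs_nonneg τ))
      exact mul_le_mul_of_nonneg_right (mul_le_of_le_one_right hC'.le this) (Real.exp_pos _).le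
    rw [norm_mul]
    have h2 : ‖M.kernel i j p.derivative σ τ s - N / T * M.kernel i j (p * M.V₁.derivative) σ τ s +
        N / T * M.kernel i j p (X * σ) τ s‖ ≤ C₁ * Real.exp (-|s|) +
          ‖(N / T : ℂ)‖ * (C₂ * Real.exp (-|s|)) + ‖(N / T : ℂ)‖ * (C₃ * Real.exp (-|s|)) := by
      refine (norm_add_le _ _).trans (add_le_add ((norm_sub_le _ _).trans (add_le_add ?_ ?_)) ?_)
      · exact (b₁ τ s).trans (hle _ hC₁)
      · rw [norm_mul]
        exact mul_le_mul_of_nonneg_left ((b₂ τ s).trans (hle _ hC₂)) (norm_nonneg _)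
      · rw [norm_mul]
        exact mul_le_mul_of_nonneg_left ((b₃ τ s).trans (hle _ hC₃)) (norm_nonneg _)
    calc _ ≤ D * (C₁ * Real.exp (-|s|) +
          ‖(N / T : ℂ)‖ * (C₂ * Real.exp (-|s|)) + ‖(N / T : ℂ)‖ * (C₃ * Real.exp (-|s|))) :=
          mul_le_mul (hder τ) h2 (norm_nonneg _) hD.le
      _ = _ := by rw [hE]; ring
  have h2 := convex_univ.norm_image_sub_le_of_norm_hasDerivWithin_le
    (f := fun t => M.kernel i j p σ t s)
    (fun τ _ => (M.kernel_hasDerivAt i j p σ τ s).hasDerivWithinAt) h1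
    (Set.mem_univ t') (Set.mem_univ t)
  rw [Real.norm_eq_abs] at h2
  exact h2.trans_eq (by ring)

/-- The inner integral, `p(x) ∫ σ(y) e^{-action} dy` at `x = Γx i t`. -/
noncomputable def transform (M : Model d₁ d₂ N T Γy) (i : Fin d₁) (j : Fin d₂) (p σ : ℂ[X]) (t : ℝ) : ℂ :=
  ∫ s, M.kernel i j p σ t s

theorem transform_eq_mul (M : Model d₁ d₂ N T Γy) (i : Fin d₁) (j : Fin d₂) (p q σ : ℂ[X]) (t : ℝ) :
    M.transform i j (p * q) σ t = p.eval ((M.Γx i).toFun t) * M.transform i j q σ t := by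
  rw [transform, transform, ← MeasureTheory.integral_const_mul]
  congr 1
  funext s
  rw [kernel, kernel, eval_mul]; ring

/-- These are the two properties that `Contour.exists_cauchy_le` asks of a density: decay for the
distant part of the contour, the Lipschitz bound for points close to it. -/
theorem exists_transform_bounds (M : Model d₁ d₂ N T Γy) (hN : 0 < N) (hT : T ≠ 0) (i : Fin d₁)
    (j : Fin d₂) (p σ : ℂ[X]) : ∃ C > (0 : ℝ), (∀ t, ‖M.transform i j p σ t‖ ≤ C * Real.exp (-|t|)) ∧
      ∀ t t', ‖M.transform i j p σ t - M.transform i j p σ t'‖ ≤ C * |t - t'| := by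
  obtain ⟨C₁, hC₁, b₁⟩ := M.exists_kernel_le hN hT i j p σ
  obtain ⟨C₂, hC₂, b₂⟩ := M.exists_kernel_sub_le hN hT i j p σ
  set I := ∫ s : ℝ, Real.exp (-|s|) with hI
  have hI0 : 0 ≤ I := MeasureTheory.integral_nonneg fun s => (Real.exp_pos _).le
  refine ⟨C₁ * I + C₂ * I + 1, by positivity, fun t => ?_, fun t t' => ?_⟩
  · have h1 : ‖M.transform i j p σ t‖ ≤ ∫ s : ℝ, C₁ * Real.exp (-|t|) * Real.exp (-|s|) :=
      MeasureTheory.norm_integral_le_of_norm_le (integrable_exp_neg_abs.const_mul _)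
        (Eventually.of_forall fun s => b₁ t s)
    rw [MeasureTheory.integral_const_mul] at h1
    have : 0 ≤ (C₂ * I + 1) * Real.exp (-|t|) := by positivity
    calc _ ≤ _ := h1
      _ ≤ _ := by rw [← hI]; linarith
  · have h1 : ‖M.transform i j p σ t - M.transform i j p σ t'‖ ≤
        ∫ s : ℝ, C₂ * |t - t'| * Real.exp (-|s|) := by
      rw [transform, transform, ← MeasureTheory.integral_sub (M.integrable_kernel hN hT i j p σ t)
        (M.integrable_kernel hN hT i j p σ t')]
      exact MeasureTheory.norm_integral_le_of_norm_le (integrable_exp_neg_abs.const_mul _)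
        (Eventually.of_forall fun s => b₂ t t' s)
    rw [MeasureTheory.integral_const_mul] at h1
    have : 0 ≤ (C₁ * I + 1) * |t - t'| := by positivity
    calc _ ≤ _ := h1
      _ ≤ _ := by rw [← hI]; linarith

end Model


/-! ### Cauchy integrals bounded uniformly up to the contour. -/

theorem abs_log_le_add_inv {a : ℝ} (ha : 0 < a) : |Real.log a| ≤ a + a⁻¹ := by
  have h1 := Real.log_le_sub_one_of_pos ha
  have h2 := Real.log_le_sub_one_of_pos (inv_pos.mpr ha)
  rw [Real.log_inv] at h2
  have h3 : 0 < a⁻¹ := inv_pos.mpr ha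
  rw [abs_le]
  constructor <;> linarith

/-- The logarithmic integral along a path crossing the imaginary axis only once. -/
theorem norm_integral_logDeriv_le {z z' : ℝ → ℂ} {a b c : ℝ} (hab : a ≤ b)
    (hz : ∀ t ∈ Set.Icc a b, HasDerivAt z (z' t) t) (hz' : ContinuousOn z' (Set.Icc a b))
    (hne : ∀ t ∈ Set.Icc a b, z t ≠ 0) (hre : ∀ t ∈ Set.Icc a b, (z t).re = 0 → t = c) :
    ‖∫ t in a..b, z' t / z t‖ ≤ ‖z b‖ + ‖z b‖⁻¹ + (‖z a‖ + ‖z a‖⁻¹) + 2 * Real.pi := by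
  -- The path can meet the imaginary axis only at `z c`, so one of the two half-axes is free.
  -- Rotation by `w = ± i` makes it the cut of the logarithm, which is then a primitive along the
  -- whole path.
  obtain ⟨w, hw, hwn, hslit⟩ : ∃ w : ℂ, w ≠ 0 ∧ ‖w‖ = 1 ∧ ∀ t ∈ Set.Icc a b, w * z t ∈ Complex.slitPlane := by
    rcases lt_or_ge 0 (z c).im with h | h
    · refine ⟨-Complex.I, by simp, by simp, fun t ht => ?_⟩
      rw [Complex.mem_slitPlane_iff]
      by_cases h0 : (z t).re = 0
      · left
        have := hre t ht h0
        subst this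
        simpa using h
      · right; simpa using h0
    · refine ⟨Complex.I, by simp, by simp, fun t ht => ?_⟩
      rw [Complex.mem_slitPlane_iff]
      by_cases h0 : (z t).re = 0
      · left
        have h1 := hre t ht h0
        subst h1
        have h2 : (z t).im ≠ 0 := fun h2 => hne t ht (Complex.ext h0 h2)
        have h3 : (z t).im < 0 := lt_of_le_of_ne h h2
        simpa using h3
      · right; simpa using h0
  have hI : ∫ t in a..b, z' t / z t = Complex.log (w * z b) - Complex.log (w * z a) := by
    refine intervalIntegral.integral_eq_sub_of_hasDerivAt (f := fun t => Complex.log (w * z t))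
      (fun t ht => ?_) ?_
    · rw [Set.uIcc_of_le hab] at ht
      have h1 := ((hz t ht).const_mul w).clog_real (hslit t ht)
      refine h1.congr_deriv ?_
      have := hne t ht
      field_simp
    · refine ContinuousOn.intervalIntegrable ?_
      rw [Set.uIcc_of_le hab]
      exact hz'.div (fun t ht => (hz t ht).continuousAt.continuousWithinAt) hne
  have hlog : ∀ t ∈ Set.Icc a b, ‖Complex.log (w * z t)‖ ≤ ‖z t‖ + ‖z t‖⁻¹ + Real.pi := fun t ht => by
    refine (Complex.norm_le_abs_re_add_abs_im _).trans ?_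
    rw [Complex.log_re, Complex.log_im, norm_mul, hwn, one_mul]
    exact add_le_add (abs_log_le_add_inv (norm_pos_iff.mpr (hne t ht))) (Complex.abs_arg_le_pi _)
  rw [hI]
  refine (norm_sub_le _ _).trans ?_
  linarith [hlog b (Set.right_mem_Icc.mpr hab), hlog a (Set.left_mem_Icc.mpr hab)]

theorem Contour.eventually_re_deriv (γ : Contour) (hu : γ.endDir ≠ 0) :
    ∃ B : ℝ, ∀ t, B ≤ t → 1 / 2 ≤ (deriv γ.toFun t / γ.endDir).re := by
  have h1 := (γ.tendsto_end.div_const γ.endDir)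
  rw [div_self hu] at h1
  have h2 := (Complex.continuous_re.tendsto 1).comp h1
  have h3 := h2.eventually_const_lt (by norm_num : (1 / 2 : ℝ) < (1 : ℂ).re)
  obtain ⟨B, hB⟩ := h3.exists_forall_of_atTop
  exact ⟨B, fun t ht => (hB t ht).le⟩

/-- Beyond `B` the contour advances steadily in its end direction. It thus passes the abscissa of
`x` at most once and leaves it at a linear rate. -/
theorem Contour.re_sub_ge (γ : Contour) {B : ℝ}
    (hB : ∀ t, B ≤ t → 1 / 2 ≤ (deriv γ.toFun t / γ.endDir).re) (x : ℂ) {t t' : ℝ} (ht : B ≤ t)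
    (htt : t ≤ t') : (t' - t) / 2 ≤
      ((γ.toFun t' - x) / γ.endDir).re - ((γ.toFun t - x) / γ.endDir).re := by
  have hder : ∀ τ, HasDerivAt (fun τ => ((γ.toFun τ - x) / γ.endDir).re)
      (deriv γ.toFun τ / γ.endDir).re τ := fun τ =>
    Complex.reCLM.hasFDerivAt.comp_hasDerivAt τ
      (((γ.differentiable τ).hasDerivAt.sub_const x).div_const γ.endDir)
  have h := (convex_Ici B).mul_sub_le_image_sub_of_le_deriv
    (f := fun τ => ((γ.toFun τ - x) / γ.endDir).re) (C := 1 / 2)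
    (fun τ _ => (hder τ).continuousAt.continuousWithinAt)
    (fun τ _ => (hder τ).differentiableAt.differentiableWithinAt)
    (fun τ hτ => by
      rw [interior_Ici] at hτ
      rw [(hder τ).deriv]
      exact hB τ (le_of_lt hτ)) t ht t' (ht.trans htt) htt
  linarith

/-- In the coordinate `z = (γ - x) / endDir` the tail comes close to `0` only near one parameter
`c`. On `[c - 1, c + 1]` the Lipschitz bound makes `(F t - F c) / z` bounded, and the constant `F c`
leaves a logarithmic integral of size `O(1 + |c| + ‖x‖)`, where the decay of `F c` compensates
`|c|`. The distance from `x` to the contour never enters. -/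
theorem Contour.norm_cauchy_end_le (γ : Contour) (hu : γ.endDir ≠ 0) {B : ℝ}
    (hB : ∀ t, B ≤ t → 1 / 2 ≤ (deriv γ.toFun t / γ.endDir).re) {F : ℝ → ℂ} {C : ℝ} (hC : 0 < C)
    (hF : ∀ t, ‖F t‖ ≤ C * Real.exp (-|t|)) (hF' : ∀ t t', ‖F t - F t'‖ ≤ C * |t - t'|) :
    ∃ K R : ℝ, ∀ x : ℂ, x ∉ Set.range γ.toFun → R ≤ ‖x‖ →
      ‖∫ t in Set.Ioi B, F t * deriv γ.toFun t / (x - γ.toFun t)‖ ≤ K * (1 + ‖x‖) := by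
  set u := γ.endDir with hudef
  have hun : 0 < ‖u‖ := norm_pos_iff.mpr hu
  obtain ⟨D, hD, hder⟩ := γ.exists_norm_deriv_le
  obtain ⟨C₁, hC₁, hγ⟩ := γ.exists_norm_le
  obtain ⟨M, hM⟩ := (isCompact_Icc (a := B) (b := B + 2)).exists_bound_of_continuousOn
    γ.differentiable.continuous.continuousOn
  set I₀ := ∫ t : ℝ, Real.exp (-|t|) with hI₀
  have hI₀0 : 0 ≤ I₀ := MeasureTheory.integral_nonneg fun t => (Real.exp_pos _).le
  set D' := D / ‖u‖ with hD'
  have hD'0 : 0 < D' := by positivity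
  set K₁ := 2 * C * D' * I₀ with hK₁
  set K₂ := 4 * C * D' + C * (2 * C₁ * 2 / ‖u‖ + 2 / ‖u‖ + 4 + 2 * Real.pi) with hK₂
  refine ⟨K₁ + K₂, M + ‖u‖ / 2, fun x hx hxR => ?_⟩
  set z : ℝ → ℂ := fun t => (γ.toFun t - x) / u with hz
  set z' : ℝ → ℂ := fun t => deriv γ.toFun t / u with hz'
  have hzd : ∀ t, HasDerivAt z (z' t) t := fun t =>
    ((γ.differentiable t).hasDerivAt.sub_const x).div_const u
  have hz0 : ∀ t, z t ≠ 0 := fun t => div_ne_zero (sub_ne_zero.mpr fun h => hx ⟨t, h⟩) hu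
  have hz'n : ∀ t, ‖z' t‖ ≤ D' := fun t => by
    rw [hz', hD']; simp only [norm_div]; exact div_le_div_of_nonneg_right (hder t) hun.le
  have hzc : Continuous z := by
    have := γ.differentiable.continuous
    fun_prop
  have hz'c : Continuous z' := γ.continuous_deriv.div_const u
  have hFc : Continuous F := by
    rw [Metric.continuous_iff]
    intro t ε hε
    refine ⟨ε / C, by positivity, fun t' ht' => ?_⟩
    rw [dist_eq_norm] at *
    rw [Real.norm_eq_abs, lt_div_iff₀ hC] at ht'
    exact (hF' t' t).trans_lt (by linarith)
  have heq : ∀ t, F t * deriv γ.toFun t / (x - γ.toFun t) = -(F t * (z' t / z t)) := fun t => by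
    have h1 := hz0 t
    have h2 : x - γ.toFun t ≠ 0 := sub_ne_zero.mpr fun h => hx ⟨t, h.symm⟩
    have h3 : γ.toFun t - x ≠ 0 := sub_ne_zero.mpr fun h => hx ⟨t, h⟩
    simp only [hz, hz']
    field_simp
    ring
  simp only [heq]
  rw [MeasureTheory.integral_neg, norm_neg]
  have hφ : ∀ {t t' : ℝ}, B ≤ t → t ≤ t' → (t' - t) / 2 ≤ (z t').re - (z t).re :=
    fun ht htt => γ.re_sub_ge hB x ht htt
  have hq : ∀ t, (1 / 2 ≤ ‖z t‖) → ‖z' t / z t‖ ≤ 2 * D' := fun t h => by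
    rw [norm_div, div_le_iff₀ (by linarith)]
    nlinarith [hz'n t]
  have hK₂0 : 0 ≤ K₂ := by positivity
  have hx0 := norm_nonneg x
  have hbound1 : ∀ (G : ℝ → ℂ) (μ : MeasureTheory.Measure ℝ), μ ≤ MeasureTheory.volume →
      (∀ᵐ t ∂μ, ‖G t‖ ≤ 2 * C * D' * Real.exp (-|t|)) → ‖∫ t, G t ∂μ‖ ≤ K₁ := fun G μ hμ hG => by
    refine (MeasureTheory.norm_integral_le_of_norm_le
      ((integrable_exp_neg_abs.const_mul _).mono_measure hμ) hG).trans ?_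
    refine (MeasureTheory.integral_mono_measure hμ (Eventually.of_forall fun t => ?_)
      (integrable_exp_neg_abs.const_mul _)).trans ?_
    · exact mul_nonneg (by positivity) (Real.exp_pos _).le
    · rw [MeasureTheory.integral_const_mul]
  have hfar : ∀ t, 1 / 2 ≤ ‖z t‖ → ‖F t * (z' t / z t)‖ ≤ 2 * C * D' * Real.exp (-|t|) := fun t ht => by
    rw [norm_mul]
    calc _ ≤ C * Real.exp (-|t|) * (2 * D') :=
          mul_le_mul (hF t) (hq t ht) (norm_nonneg _) (by positivity)
      _ = _ := by ring
  -- If the tail has passed the abscissa of `x` at `B + 1`, then `‖z‖ ≥ 1 / 2` throughout: up to `B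
  -- + 2` because `‖x‖` is large, beyond because the contour has advanced. Otherwise it crosses at
  -- some `c ≥ B + 1`, so that `[c - 1, c + 1]` lies in the tail.
  rcases lt_or_ge 0 (z (B + 1)).re with hcase | hcase
  · have h1 : ‖∫ t in Set.Ioi B, F t * (z' t / z t)‖ ≤ K₁ := by
      refine hbound1 _ _ MeasureTheory.Measure.restrict_le_self ?_
      filter_upwards [MeasureTheory.ae_restrict_mem measurableSet_Ioi] with t ht
      refine hfar t ?_
      rcases le_total t (B + 2) with h | h
      · have h2 := hM t ⟨(Set.mem_Ioi.mp ht).le, h⟩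
        simp only [hz, norm_div]
        rw [le_div_iff₀ hun]
        have h3 := norm_sub_norm_le x (γ.toFun t)
        rw [norm_sub_rev] at h3
        linarith
      · have h2 := hφ (by linarith : B ≤ B + 1) (by linarith : B + 1 ≤ t)
        exact le_trans (by linarith) (Complex.re_le_norm (z t))
    refine h1.trans ?_
    have : 0 ≤ K₁ := (norm_nonneg _).trans h1
    nlinarith [mul_nonneg this hx0, mul_nonneg hK₂0 hx0]
  · obtain ⟨c, hc, hcz⟩ : ∃ c, B + 1 ≤ c ∧ (z c).re = 0 := by
      set b := B + 1 + 2 * (-(z (B + 1)).re) with hb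
      have hle : B + 1 ≤ b := by linarith
      have h2 := hφ (by linarith : B ≤ B + 1) hle
      have h3 := intermediate_value_Icc hle (f := fun t => (z t).re)
        (Complex.continuous_re.comp hzc).continuousOn
      obtain ⟨c, hc, hc'⟩ := h3 ⟨hcase, by linarith⟩
      exact ⟨c, hc.1, hc'⟩
    have hdist : ∀ t, B ≤ t → |t - c| / 2 ≤ ‖z t‖ := fun t ht => by
      refine le_trans ?_ (Complex.abs_re_le_norm (z t))
      rcases le_total t c with h | h
      · have := hφ ht h
        rw [abs_of_nonpos (by linarith), abs_of_nonpos (by linarith)]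
        linarith
      · have := hφ (by linarith : B ≤ c) h
        rw [abs_of_nonneg (by linarith), abs_of_nonneg (by linarith)]
        linarith
    set J := Set.Ioc (c - 1) (c + 1) with hJ
    set S := Set.Ioi B \ J with hS
    have hJB : J ⊆ Set.Ioi B := fun t ht => by
      have := ht.1; simp only [Set.mem_Ioi]; linarith
    have hcont : Continuous fun t => F t * (z' t / z t) := hFc.mul (hz'c.div hzc hz0)
    have hcontJ : MeasureTheory.IntegrableOn (fun t => F t * (z' t / z t)) J :=
      (hcont.continuousOn.integrableOn_Icc).mono_set Set.Ioc_subset_Icc_self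
    have hfarS : ∀ t ∈ S, ‖F t * (z' t / z t)‖ ≤ 2 * C * D' * Real.exp (-|t|) := fun t ht => by
      refine hfar t (le_trans ?_ (hdist t (le_of_lt ht.1)))
      have : 1 ≤ |t - c| := by
        by_contra hcon
        rw [not_le, abs_lt] at hcon
        exact ht.2 ⟨by linarith, by linarith⟩
      linarith
    have hmS : MeasurableSet S := measurableSet_Ioi.diff measurableSet_Ioc
    have hintS : MeasureTheory.IntegrableOn (fun t => F t * (z' t / z t)) S := by
      refine ((integrable_exp_neg_abs.const_mul (2 * C * D')).integrableOn (s := S)).mono'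
        hcont.aestronglyMeasurable ?_
      filter_upwards [MeasureTheory.ae_restrict_mem hmS] with t ht using hfarS t ht
    have hsplit : ∫ t in Set.Ioi B, F t * (z' t / z t) =
        (∫ t in S, F t * (z' t / z t)) + ∫ t in J, F t * (z' t / z t) := by
      rw [← MeasureTheory.setIntegral_union Set.disjoint_sdiff_left measurableSet_Ioc hintS hcontJ,
        Set.sdiff_union_of_subset hJB]
    have hS1 : ‖∫ t in S, F t * (z' t / z t)‖ ≤ K₁ := by
      refine hbound1 _ _ MeasureTheory.Measure.restrict_le_self ?_
      filter_upwards [MeasureTheory.ae_restrict_mem hmS] with t ht using hfarS t ht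
    have hab : c - 1 ≤ c + 1 := by linarith
    have hJ1 : ∫ t in J, F t * (z' t / z t) =
        (∫ t in (c - 1)..(c + 1), (F t - F c) * (z' t / z t)) +
          F c * ∫ t in (c - 1)..(c + 1), z' t / z t := by
      rw [hJ, ← intervalIntegral.integral_of_le hab, ← intervalIntegral.integral_const_mul,
        ← intervalIntegral.integral_add]
      · congr 1; funext t; ring
      · exact ((hFc.sub continuous_const).mul (hz'c.div hzc hz0)).intervalIntegrable _ _
      · exact (continuous_const.mul (hz'c.div hzc hz0)).intervalIntegrable _ _
    have hJ2 : ‖∫ t in (c - 1)..(c + 1), (F t - F c) * (z' t / z t)‖ ≤ 4 * C * D' := by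
      refine (intervalIntegral.norm_integral_le_of_norm_le_const (C := 2 * C * D') fun t ht => ?_).trans
        (le_of_eq ?_)
      · rw [Set.uIoc_of_le hab] at ht
        have h1 := hdist t (by linarith [ht.1])
        have h2 := hF' t c
        have h3 := hz'n t
        have h4 : 0 < ‖z t‖ := norm_pos_iff.mpr (hz0 t)
        rw [norm_mul, norm_div, ← mul_div_assoc, div_le_iff₀ h4]
        calc _ ≤ C * |t - c| * D' := mul_le_mul h2 h3 (norm_nonneg _) (by positivity)
          _ ≤ C * (2 * ‖z t‖) * D' := by gcongr; linarith
          _ = _ := by ring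
      · rw [show c + 1 - (c - 1) = 2 by ring, abs_of_pos two_pos]; ring
    have hlog := norm_integral_logDeriv_le (z := z) (z' := z') (c := c) hab (fun t _ => hzd t)
      hz'c.continuousOn (fun t _ => hz0 t) (fun t ht h0 => by
        have h1 : |t - c| / 2 ≤ 0 := by
          have hBt : B ≤ t := by linarith [ht.1]
          rcases le_total t c with h | h
          · have := hφ hBt h
            rw [abs_of_nonpos (by linarith)]; linarith
          · have := hφ (by linarith : B ≤ c) h
            rw [abs_of_nonneg (by linarith)]; linarith
        have h2 : |t - c| = 0 := le_antisymm (by linarith) (abs_nonneg _)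
        linarith [abs_eq_zero.mp h2])
    have hzn : ∀ t, |t| ≤ 1 + |c| → ‖z t‖ ≤ (2 * C₁ * (1 + |c|) + ‖x‖) / ‖u‖ := fun t ht => by
      simp only [hz, norm_div]
      gcongr
      refine (norm_sub_le _ _).trans (add_le_add ((hγ t).trans ?_) le_rfl)
      have : 1 + |t| ≤ 2 * (1 + |c|) := by linarith [abs_nonneg c]
      nlinarith
    have hinv : ∀ t, B ≤ t → |t - c| = 1 → ‖z t‖⁻¹ ≤ 2 := fun t ht h1 => by
      have := hdist t ht
      rw [h1] at this
      rw [show (2 : ℝ) = (1 / 2)⁻¹ by norm_num]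
      exact inv_anti₀ (by norm_num) this
    have hcp : |c + 1| ≤ 1 + |c| := (abs_add_le _ _).trans (by rw [abs_one]; linarith)
    have hcm : |c - 1| ≤ 1 + |c| := (abs_sub _ _).trans (by rw [abs_one]; linarith)
    have hlog2 : ‖∫ t in (c - 1)..(c + 1), z' t / z t‖ ≤
        2 * ((2 * C₁ * (1 + |c|) + ‖x‖) / ‖u‖) + 4 + 2 * Real.pi := by
      refine hlog.trans ?_
      have h1 := hzn _ hcp
      have h2 := hzn _ hcm
      have h3 := hinv (c + 1) (by linarith) (by simp)
      have h4 := hinv (c - 1) (by linarith) (by simp)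
      linarith
    have hJ3 : ‖F c * ∫ t in (c - 1)..(c + 1), z' t / z t‖ ≤
        C * (2 * C₁ * 2 / ‖u‖ + 2 / ‖u‖ + 4 + 2 * Real.pi) * (1 + ‖x‖) := by
      rw [norm_mul]
      have h1 : Real.exp (-|c|) * (1 + |c|) ≤ 1 := by
        rw [Real.exp_neg, inv_mul_le_iff₀ (Real.exp_pos _), mul_one, add_comm]
        exact Real.add_one_le_exp _
      have h2 : Real.exp (-|c|) ≤ 1 := Real.exp_le_one_iff.mpr (neg_nonpos.mpr (abs_nonneg c))
      have h3 := Real.exp_pos (-|c|)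
      have hpi := Real.pi_pos
      calc _ ≤ C * Real.exp (-|c|) * (2 * ((2 * C₁ * (1 + |c|) + ‖x‖) / ‖u‖) + 4 + 2 * Real.pi) :=
            mul_le_mul (hF c) hlog2 (norm_nonneg _) (by positivity)
        _ = C * (2 * C₁ * 2 / ‖u‖ * (Real.exp (-|c|) * (1 + |c|)) + 2 / ‖u‖ * (Real.exp (-|c|) * ‖x‖) +
            (4 + 2 * Real.pi) * Real.exp (-|c|)) := by field_simp; ring
        _ ≤ C * (2 * C₁ * 2 / ‖u‖ * 1 + 2 / ‖u‖ * (1 * ‖x‖) + (4 + 2 * Real.pi) * 1) := by gcongr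
        _ ≤ _ := by
          rw [mul_assoc C]
          refine mul_le_mul_of_nonneg_left ?_ hC.le
          have e1 : 0 ≤ 2 * C₁ * 2 / ‖u‖ * ‖x‖ := by positivity
          have e2 : 0 ≤ 2 / ‖u‖ := by positivity
          have e3 : 0 ≤ (4 + 2 * Real.pi) * ‖x‖ := by positivity
          linarith
    rw [hsplit, hJ1]
    have hK₁0 : 0 ≤ K₁ := (norm_nonneg _).trans hS1
    have h4 : 0 ≤ 4 * C * D' * ‖x‖ := by positivity
    have h5 : 0 ≤ K₁ * ‖x‖ := by positivity
    calc _ ≤ K₁ + (4 * C * D' + C * (2 * C₁ * 2 / ‖u‖ + 2 / ‖u‖ + 4 + 2 * Real.pi) * (1 + ‖x‖)) :=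
          (norm_add_le _ _).trans (add_le_add hS1 ((norm_add_le _ _).trans (add_le_add hJ2 hJ3)))
      _ ≤ _ := by rw [hK₂]; linarith


theorem continuous_of_lipschitz {F : ℝ → ℂ} {C : ℝ} (hC : 0 < C)
    (hF : ∀ t t', ‖F t - F t'‖ ≤ C * |t - t'|) : Continuous F := by
  rw [Metric.continuous_iff]
  intro t ε hε
  refine ⟨ε / C, by positivity, fun t' ht' => ?_⟩
  rw [dist_eq_norm] at *
  rw [Real.norm_eq_abs, lt_div_iff₀ hC] at ht'
  exact (hF t' t).trans_lt (by linarith)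

theorem Contour.tendsto_norm_atTop (γ : Contour) (hu : γ.endDir ≠ 0) :
    Tendsto (fun t => ‖γ.toFun t‖) atTop atTop := by
  have hun : 0 < ‖γ.endDir‖ := norm_pos_iff.mpr hu
  have h1 := γ.tendsto_div_end.norm.pos_mul_atTop hun tendsto_id
  refine h1.congr' ?_
  filter_upwards [eventually_gt_atTop 0] with t ht
  have : (t : ℂ) ≠ 0 := by exact_mod_cast ht.ne'
  rw [norm_div, Complex.norm_real, Real.norm_of_nonneg ht.le]
  simp only [id]
  field_simp

/-- A crude bound for the Cauchy integral, uniform up to the contour. -/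
theorem Contour.exists_cauchy_le (γ : Contour) (hu : γ.endDir ≠ 0) (hv : γ.startDir ≠ 0) {F : ℝ → ℂ}
    {C : ℝ} (hC : 0 < C) (hF : ∀ t, ‖F t‖ ≤ C * Real.exp (-|t|))
    (hF' : ∀ t t', ‖F t - F t'‖ ≤ C * |t - t'|) :
    ∃ K R : ℝ, ∀ x : ℂ, x ∉ Set.range γ.toFun → R ≤ ‖x‖ →
      MeasureTheory.Integrable (fun t => F t * deriv γ.toFun t / (x - γ.toFun t)) ∧
      ‖∫ t, F t * deriv γ.toFun t / (x - γ.toFun t)‖ ≤ K * (1 + ‖x‖) := by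
  obtain ⟨B₁, hB₁⟩ := γ.eventually_re_deriv hu
  obtain ⟨B₂, hB₂⟩ := γ.reverse.eventually_re_deriv hv
  set B := max (max B₁ B₂) 0 with hB
  have hB0 : 0 ≤ B := le_max_right _ _
  have hB1 : B₁ ≤ B := (le_max_left _ _).trans (le_max_left _ _)
  have hB2 : B₂ ≤ B := (le_max_right _ _).trans (le_max_left _ _)
  obtain ⟨K₁, R₁, h₁⟩ := γ.norm_cauchy_end_le hu (fun t ht => hB₁ t (hB1.trans ht)) hC hF hF'
  obtain ⟨K₂, R₂, h₂⟩ := γ.reverse.norm_cauchy_end_le hv (fun t ht => hB₂ t (hB2.trans ht)) hC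
    (F := fun t => F (-t)) (fun t => by simpa using hF (-t)) (fun t t' => by
      refine (hF' (-t) (-t')).trans_eq ?_
      rw [show -t - -t' = -(t - t') by ring, abs_neg])
  obtain ⟨D, hD, hder⟩ := γ.exists_norm_deriv_le
  obtain ⟨M, hM⟩ := (isCompact_Icc (a := -B) (b := B)).exists_bound_of_continuousOn
    γ.differentiable.continuous.continuousOn
  have hFc := continuous_of_lipschitz hC hF'
  refine ⟨K₁ + K₂ + C * D * (2 * B), max (max R₁ R₂) (M + 1), fun x hx hxR => ?_⟩
  have hne : ∀ t, x - γ.toFun t ≠ 0 := fun t => sub_ne_zero.mpr fun h => hx ⟨t, h.symm⟩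
  set f : ℝ → ℂ := fun t => F t * deriv γ.toFun t / (x - γ.toFun t) with hf
  have hfc : Continuous f :=
    (hFc.mul γ.continuous_deriv).div (continuous_const.sub γ.differentiable.continuous) hne
  have hint : MeasureTheory.Integrable f := by
    have hb : ∀ᶠ t in cocompact ℝ, ‖f t‖ ≤ C * D * Real.exp (-|t|) := by
      have hlarge : ∀ t, ‖x‖ + 1 ≤ ‖γ.toFun t‖ → ‖f t‖ ≤ C * D * Real.exp (-|t|) := fun t ht => by
        have h3 : 1 ≤ ‖x - γ.toFun t‖ := by
          have := norm_sub_norm_le (γ.toFun t) x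
          rw [norm_sub_rev] at this
          linarith
        rw [hf]
        simp only [norm_div, norm_mul]
        rw [div_le_iff₀ (by linarith)]
        calc _ ≤ C * Real.exp (-|t|) * D :=
              mul_le_mul (hF t) (hder t) (norm_nonneg _) (by positivity)
          _ = C * D * Real.exp (-|t|) * 1 := by ring
          _ ≤ _ := by gcongr
      rw [cocompact_eq_atBot_atTop, eventually_sup]
      constructor
      · have := (γ.reverse.tendsto_norm_atTop hv).comp tendsto_neg_atBot_atTop
        filter_upwards [this.eventually_ge_atTop (‖x‖ + 1)] with t ht
        refine hlarge t ?_
        simpa [Contour.reverse] using ht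
      · filter_upwards [(γ.tendsto_norm_atTop hu).eventually_ge_atTop (‖x‖ + 1)] with t ht
          using hlarge t ht
    refine hfc.locallyIntegrable.integrable_of_isBigO_cocompact
      (Asymptotics.IsBigO.of_bound (C * D) (g := fun t => Real.exp (-|t|)) ?_)
      (integrable_exp_neg_abs.integrableAtFilter _)
    filter_upwards [hb] with t ht
    rwa [Real.norm_of_nonneg (Real.exp_pos _).le]
  refine ⟨hint, ?_⟩
  have hx0 := norm_nonneg x
  have e1 : ∫ t in Set.Ioi B, f t = ∫ t in Set.Ioi B, F t * deriv γ.toFun t / (x - γ.toFun t) := rfl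
  have hend := h₁ x hx (((le_max_left _ _).trans (le_max_left _ _)).trans hxR)
  have hstart : ‖∫ t in Set.Iic (-B), f t‖ ≤ K₂ * (1 + ‖x‖) := by
    rw [← integral_comp_neg_Ioi]
    have h3 := h₂ x (fun ⟨t, ht⟩ => hx ⟨-t, ht⟩)
      (((le_max_right _ _).trans (le_max_left _ _)).trans hxR)
    rw [← norm_neg, ← MeasureTheory.integral_neg]
    refine le_of_eq_of_le ?_ h3
    congr 2
    funext t
    rw [γ.deriv_reverse, hf]
    simp only [Contour.reverse]
    ring
  have hmid : ‖∫ t in (-B)..B, f t‖ ≤ C * D * (2 * B) := by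
    refine (intervalIntegral.norm_integral_le_of_norm_le_const (C := C * D) fun t ht => ?_).trans
      (le_of_eq ?_)
    · rw [Set.uIoc_of_le (by linarith)] at ht
      have h3 := hM t ⟨ht.1.le, ht.2⟩
      have h4 : 1 ≤ ‖x - γ.toFun t‖ := by
        have := norm_sub_norm_le x (γ.toFun t)
        linarith [(le_max_right _ _).trans hxR]
      rw [hf]
      simp only [norm_div, norm_mul]
      rw [div_le_iff₀ (by linarith)]
      have h5 : Real.exp (-|t|) ≤ 1 := Real.exp_le_one_iff.mpr (neg_nonpos.mpr (abs_nonneg t))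
      have h6 : ‖F t‖ ≤ C := (hF t).trans (mul_le_of_le_one_right hC.le h5)
      calc _ ≤ C * D := mul_le_mul h6 (hder t) (norm_nonneg _) hC.le
        _ ≤ _ := le_mul_of_one_le_right (by positivity) h4
    · rw [show B - -B = 2 * B by ring, abs_of_nonneg (by positivity)]
  have hsplit : ∫ t, f t = (∫ t in Set.Iic (-B), f t) + ((∫ t in (-B)..B, f t) +
      ∫ t in Set.Ioi B, f t) := by
    rw [intervalIntegral.integral_of_le (by linarith),
      ← MeasureTheory.setIntegral_union (Set.Ioc_disjoint_Ioi le_rfl) measurableSet_Ioi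
        hint.integrableOn hint.integrableOn, Set.Ioc_union_Ioi_eq_Ioi (by linarith),
      ← MeasureTheory.setIntegral_union (Set.Iic_disjoint_Ioi le_rfl) measurableSet_Ioi
        hint.integrableOn hint.integrableOn, Set.Iic_union_Ioi, MeasureTheory.setIntegral_univ]
  rw [hsplit]
  have : 0 ≤ C * D * (2 * B) * ‖x‖ := by positivity
  calc _ ≤ K₂ * (1 + ‖x‖) + (C * D * (2 * B) + K₁ * (1 + ‖x‖)) :=
        (norm_add_le _ _).trans (add_le_add hstart ((norm_add_le _ _).trans (add_le_add hmid hend)))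
    _ ≤ _ := by linarith

/-! ### Moments and the expansion of the Hilbert transforms. -/

namespace Model

variable {d₁ d₂ N : ℕ} {T : ℂ} {Γy : Fin d₂ → Contour}

theorem endDir_ne_zero {V : ℂ[X]} (hV : 0 < V.natDegree) {T v : ℂ} (hv : v ∈ decaySectors V T) :
    v ≠ 0 := by
  rintro rfl
  have : (0 : ℝ) < (V.leadingCoeff * 0 ^ V.natDegree / T).re := hv
  rw [zero_pow hV.ne'] at this
  simp at this

/-- The integral of `p(x) σ(y) e^{-action}` over `∑ κᵢⱼ Γˣᵢ × Γʸⱼ`. -/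
noncomputable def pairing (M : Model d₁ d₂ N T Γy) (p σ : ℂ[X]) : ℂ :=
  ∑ i, ∑ j, M.κ i j * ∫ t, M.transform i j p σ t * deriv (M.Γx i).toFun t

theorem pairing_eq (M : Model d₁ d₂ N T Γy) (p σ : ℂ[X]) :
    M.pairing p σ = doubleIntegral M.κ M.Γx Γy (fun x y =>
      p.eval x * σ.eval y * Complex.exp (-(N / T) * (M.V₁.eval x + M.V₂.eval y - x * y))) := by
  rw [pairing, doubleIntegral]
  refine Finset.sum_congr rfl fun i _ => Finset.sum_congr rfl fun j _ => ?_
  congr 1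
  rw [Contour.integral]
  congr 1
  funext t
  congr 1
  rw [Contour.integral, transform]
  congr 1
  funext s
  rw [kernel, action, neg_mul]
  ring

theorem integrable_transform (M : Model d₁ d₂ N T Γy) (hN : 0 < N) (hT : T ≠ 0) (i : Fin d₁)
    (j : Fin d₂) (p σ : ℂ[X]) :
    MeasureTheory.Integrable (fun t => M.transform i j p σ t * deriv (M.Γx i).toFun t) := by
  obtain ⟨C, hC, h, h'⟩ := M.exists_transform_bounds hN hT i j p σ
  obtain ⟨D, hD, hder⟩ := (M.Γx i).exists_norm_deriv_le
  have hc := continuous_of_lipschitz hC h'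
  refine (integrable_exp_neg_abs.const_mul (C * D)).mono'
    (hc.mul (M.Γx i).continuous_deriv).aestronglyMeasurable (Eventually.of_forall fun t => ?_)
  rw [norm_mul]
  calc _ ≤ C * Real.exp (-|t|) * D := mul_le_mul (h t) (hder t) (norm_nonneg _) (by positivity)
    _ = _ := by ring

theorem transform_eq (M : Model d₁ d₂ N T Γy) (i : Fin d₁) (j : Fin d₂) (p σ : ℂ[X]) (t : ℝ) :
    M.transform i j p σ t = p.eval ((M.Γx i).toFun t) * M.transform i j 1 σ t := by
  rw [← M.transform_eq_mul, mul_one]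

theorem pairing_add_smul (M : Model d₁ d₂ N T Γy) (hN : 0 < N) (hT : T ≠ 0) (p q σ : ℂ[X]) (a : ℂ) :
    M.pairing (p + C a * q) σ = M.pairing p σ + a * M.pairing q σ := by
  rw [pairing, pairing, pairing, Finset.mul_sum, ← Finset.sum_add_distrib]
  refine Finset.sum_congr rfl fun i _ => ?_
  rw [Finset.mul_sum, ← Finset.sum_add_distrib]
  refine Finset.sum_congr rfl fun j _ => ?_
  have h : ∀ t, M.transform i j (p + C a * q) σ t * deriv (M.Γx i).toFun t =
      M.transform i j p σ t * deriv (M.Γx i).toFun t +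
        a * (M.transform i j q σ t * deriv (M.Γx i).toFun t) := fun t => by
    rw [M.transform_eq i j (p + C a * q), M.transform_eq i j p, M.transform_eq i j q, eval_add,
      eval_mul, eval_C]
    ring
  simp only [h]
  rw [MeasureTheory.integral_add (M.integrable_transform hN hT i j p σ)
    ((M.integrable_transform hN hT i j q σ).const_mul a), MeasureTheory.integral_const_mul]
  ring

theorem pairing_π (M : Model d₁ d₂ N T Γy) (n m : ℕ) :
    M.pairing (M.π n) (M.σ m) = if n = m then M.h n else 0 := by
  rw [pairing_eq, M.biorthogonal]

theorem coeff_π_of_lt (M : Model d₁ d₂ N T Γy) {n k : ℕ} (h : n < k) : (M.π n).coeff k = 0 :=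
  coeff_eq_zero_of_natDegree_lt (by rwa [M.natDegree_π])

theorem coeff_π_self (M : Model d₁ d₂ N T Γy) (n : ℕ) : (M.π n).coeff n = 1 := by
  have := M.monic_π n
  rwa [Monic, leadingCoeff, M.natDegree_π] at this

/-- Removing the top coefficient with a multiple of `π n`, where `n < m`, does not change the
pairing with `σ m`. -/
theorem pairing_eq_zero (M : Model d₁ d₂ N T Γy) (hN : 0 < N) (hT : T ≠ 0) (m n : ℕ) (hn : n ≤ m) :
    ∀ p : ℂ[X], (∀ k, n ≤ k → p.coeff k = 0) → M.pairing p (M.σ m) = 0 := by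
  induction n with
  | zero =>
    intro p hp
    have : p = 0 := Polynomial.ext fun k => by simpa using hp k (Nat.zero_le k)
    rw [this]
    simp [pairing, transform, kernel]
  | succ n ih =>
    intro p hp
    have h1 := ih (by omega) (p + C (-(p.coeff n)) * M.π n) fun k hk => by
      rw [coeff_add, coeff_C_mul]
      rcases hk.eq_or_lt with rfl | hk
      · rw [M.coeff_π_self]; ring
      · rw [M.coeff_π_of_lt hk, hp k hk]; ring
    rw [M.pairing_add_smul hN hT, M.pairing_π, if_neg (by omega), mul_zero, add_zero] at h1
    exact h1

theorem pairing_X_pow_self (M : Model d₁ d₂ N T Γy) (hN : 0 < N) (hT : T ≠ 0) (m : ℕ) :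
    M.pairing (X ^ m) (M.σ m) = M.h m := by
  have h1 := M.pairing_eq_zero hN hT m m le_rfl (X ^ m + C (-1) * M.π m) fun k hk => by
    rw [coeff_add, coeff_C_mul, coeff_X_pow]
    rcases hk.eq_or_lt with rfl | hk
    · rw [M.coeff_π_self, if_pos rfl]; ring
    · rw [M.coeff_π_of_lt hk, if_neg (by omega)]; ring
  rw [M.pairing_add_smul hN hT, M.pairing_π, if_pos rfl] at h1
  linear_combination h1

theorem hilbert_eq (M : Model d₁ d₂ N T Γy) (m : ℕ) (x : ℂ) :
    M.hilbert m x = Complex.exp (N / T * M.V₁.eval x) * ((M.s m)⁻¹ * ∑ i, ∑ j, M.κ i j *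
      ∫ t, M.transform i j 1 (M.σ m) t * deriv (M.Γx i).toFun t / (x - (M.Γx i).toFun t)) := by
  rw [hilbert, doubleIntegral, Finset.mul_sum Finset.univ _ (M.s m)⁻¹]
  congr 1
  refine Finset.sum_congr rfl fun i _ => ?_
  rw [Finset.mul_sum]
  refine Finset.sum_congr rfl fun j _ => ?_
  rw [mul_left_comm]
  congr 1
  rw [Contour.integral, ← MeasureTheory.integral_const_mul]
  congr 1
  funext t
  have : (Γy j).integral (fun y => M.φ m y / (x - (M.Γx i).toFun t) *
      Complex.exp (-(N / T) * M.V₁.eval ((M.Γx i).toFun t)) *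
      Complex.exp (N / T * ((M.Γx i).toFun t * y))) =
      (M.s m)⁻¹ / (x - (M.Γx i).toFun t) * M.transform i j 1 (M.σ m) t := by
    rw [Contour.integral, transform, ← MeasureTheory.integral_const_mul]
    congr 1
    funext s
    rw [kernel, φ, action, eval_one, show -((N : ℂ) / T * (M.V₁.eval ((M.Γx i).toFun t) +
      M.V₂.eval ((Γy j).toFun s) - (M.Γx i).toFun t * (Γy j).toFun s)) =
      -(N / T) * M.V₂.eval ((Γy j).toFun s) + -(N / T) * M.V₁.eval ((M.Γx i).toFun t) +
      N / T * ((M.Γx i).toFun t * (Γy j).toFun s) by ring, Complex.exp_add, Complex.exp_add]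
    ring
  rw [this]
  ring

/-- The finite geometric series of `1 / (x - x')` turns the Cauchy integral into moments. Those of
order below `m` vanish, and the one of order `m` is `h m = s m ^ 2`, which the normalization by `s
m` reduces to `s m`. -/
theorem hilbert_expansion (M : Model d₁ d₂ N T Γy) (hN : 0 < N) (hT : T ≠ 0) (m : ℕ) :
    ∃ K R : ℝ, ∀ x : ℂ, R ≤ ‖x‖ → (∀ i, x ∉ Set.range (M.Γx i).toFun) →
      ‖M.hilbert m x / Complex.exp (N / T * M.V₁.eval x) * x ^ (m + 1) - M.s m‖ ≤ K / ‖x‖ := by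
  have hb : ∀ (i : Fin d₁) (j : Fin d₂) (p : ℂ[X]), ∃ K R : ℝ, ∀ x : ℂ,
      x ∉ Set.range (M.Γx i).toFun → R ≤ ‖x‖ →
      MeasureTheory.Integrable (fun t => M.transform i j p (M.σ m) t * deriv (M.Γx i).toFun t /
        (x - (M.Γx i).toFun t)) ∧
      ‖∫ t, M.transform i j p (M.σ m) t * deriv (M.Γx i).toFun t / (x - (M.Γx i).toFun t)‖ ≤
        K * (1 + ‖x‖) := fun i j p => by
    obtain ⟨C, hC, h, h'⟩ := M.exists_transform_bounds hN hT i j p (M.σ m)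
    have hV : 0 < M.V₁.natDegree := by rw [M.natDegree_V₁]; omega
    exact (M.Γx i).exists_cauchy_le (endDir_ne_zero hV (M.basis_x.1 i).2)
      (endDir_ne_zero hV (M.basis_x.1 i).1) hC h h'
  choose K R hKR using hb
  -- Two terms beyond the leading one: the remainder is only known to be `O(‖x‖)`, and division by
  -- `x ^ 2` makes it `O(1 / ‖x‖)`.
  set q := m + 3 with hq
  set Z := ∑ i, ∑ j, ‖M.κ i j‖ * |K i j (X ^ q)| with hZ
  have hZ0 : 0 ≤ Z := Finset.sum_nonneg fun i _ => Finset.sum_nonneg fun j _ => by positivity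
  set μ : ℕ → ℂ := fun k => M.pairing (X ^ k) (M.σ m) with hμ
  refine ⟨‖(M.s m)⁻¹‖ * (‖μ (m + 1)‖ + ‖μ (m + 2)‖ + 2 * Z),
    1 + ∑ i, ∑ j, (|R i j 1| + |R i j (X ^ q)|), fun x hxR hx => ?_⟩
  have hR : ∀ i j, |R i j 1| + |R i j (X ^ q)| ≤ ∑ i, ∑ j, (|R i j 1| + |R i j (X ^ q)|) := fun i j =>
    (Finset.single_le_sum (f := fun j => |R i j 1| + |R i j (X ^ q)|) (fun _ _ => by positivity)
      (Finset.mem_univ j)).trans (Finset.single_le_sum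
        (f := fun i => ∑ j, (|R i j 1| + |R i j (X ^ q)|))
        (fun _ _ => Finset.sum_nonneg fun _ _ => by positivity) (Finset.mem_univ i))
  have hR0 : 0 ≤ ∑ i, ∑ j, (|R i j 1| + |R i j (X ^ q)|) :=
    Finset.sum_nonneg fun _ _ => Finset.sum_nonneg fun _ _ => by positivity
  have hx1 : 1 ≤ ‖x‖ := by linarith
  have hx0 : x ≠ 0 := norm_pos_iff.mp (by linarith)
  set H : Fin d₁ → Fin d₂ → ℂ[X] → ℂ := fun i j p =>
    ∫ t, M.transform i j p (M.σ m) t * deriv (M.Γx i).toFun t / (x - (M.Γx i).toFun t) with hH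
  have h1 := fun i j => hKR i j 1 x (hx i) (by
    linarith [hR i j, le_abs_self (R i j 1), abs_nonneg (R i j (X ^ q))])
  have h2 := fun i j => hKR i j (X ^ q) x (hx i) (by
    linarith [hR i j, le_abs_self (R i j (X ^ q)), abs_nonneg (R i j 1)])
  have hgeom : ∀ i j, x ^ q * H i j 1 = ∑ k ∈ Finset.range q, x ^ (q - 1 - k) *
      (∫ t, M.transform i j (X ^ k) (M.σ m) t * deriv (M.Γx i).toFun t) + H i j (X ^ q) := fun i j => by
    have hp : ∀ t, x ^ q * (M.transform i j 1 (M.σ m) t * deriv (M.Γx i).toFun t /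
        (x - (M.Γx i).toFun t)) = ∑ k ∈ Finset.range q, x ^ (q - 1 - k) *
          (M.transform i j (X ^ k) (M.σ m) t * deriv (M.Γx i).toFun t) +
        M.transform i j (X ^ q) (M.σ m) t * deriv (M.Γx i).toFun t / (x - (M.Γx i).toFun t) :=
      fun t => by
        set g := (M.Γx i).toFun t
        have hne : x - g ≠ 0 := sub_ne_zero.mpr fun h => hx i ⟨t, h.symm⟩
        have hg := geom_sum₂_mul g x q
        have e1 : ∑ k ∈ Finset.range q, x ^ (q - 1 - k) *
            (M.transform i j (X ^ k) (M.σ m) t * deriv (M.Γx i).toFun t) =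
            (∑ k ∈ Finset.range q, g ^ k * x ^ (q - 1 - k)) *
              (M.transform i j 1 (M.σ m) t * deriv (M.Γx i).toFun t) := by
          rw [Finset.sum_mul]
          refine Finset.sum_congr rfl fun k _ => ?_
          rw [M.transform_eq i j (X ^ k), eval_pow, eval_X]; ring
        rw [e1, M.transform_eq i j (X ^ q), eval_pow, eval_X]
        field_simp
        linear_combination (M.transform i j 1 (M.σ m) t * deriv (M.Γx i).toFun t) * hg
    have hint : ∀ k ∈ Finset.range q, MeasureTheory.Integrable (fun t => x ^ (q - 1 - k) *
          (M.transform i j (X ^ k) (M.σ m) t * deriv (M.Γx i).toFun t)) := fun k _ =>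
      (M.integrable_transform hN hT i j _ _).const_mul _
    simp only [hH]
    rw [← MeasureTheory.integral_const_mul]
    simp only [hp]
    rw [MeasureTheory.integral_add (MeasureTheory.integrable_finsetSum _ hint) (h2 i j).1,
      MeasureTheory.integral_finsetSum _ hint]
    congr 1
    exact Finset.sum_congr rfl fun k _ => MeasureTheory.integral_const_mul _ _
  have hsum : x ^ q * ∑ i, ∑ j, M.κ i j * H i j 1 =
      ∑ k ∈ Finset.range q, x ^ (q - 1 - k) * μ k + ∑ i, ∑ j, M.κ i j * H i j (X ^ q) := by
    have e1 : x ^ q * ∑ i, ∑ j, M.κ i j * H i j 1 = ∑ i, ∑ j, M.κ i j * (x ^ q * H i j 1) := by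
      simp only [Finset.mul_sum]
      exact Finset.sum_congr rfl fun i _ => Finset.sum_congr rfl fun j _ => by ring
    rw [e1]
    simp only [hgeom, mul_add, Finset.sum_add_distrib, hμ, pairing, Finset.mul_sum]
    congr 1
    rw [Finset.sum_comm' (t' := Finset.univ) (s' := fun _ => Finset.range q) (by simp)]
    refine Finset.sum_congr rfl fun i _ => ?_
    rw [Finset.sum_comm]
    exact Finset.sum_congr rfl fun j _ => Finset.sum_congr rfl fun k _ => by ring
  have hmom : ∑ k ∈ Finset.range q, x ^ (q - 1 - k) * μ k =
      x ^ 2 * M.h m + x * μ (m + 1) + μ (m + 2) := by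
    rw [hq, Finset.sum_range_succ, Finset.sum_range_succ, Finset.sum_range_succ,
      Finset.sum_eq_zero fun k hk => ?_]
    · rw [zero_add, show m + 3 - 1 - m = 2 by omega, show m + 3 - 1 - (m + 1) = 1 by omega,
        show m + 3 - 1 - (m + 2) = 0 by omega, hμ]
      simp only [M.pairing_X_pow_self hN hT]
      ring
    · have hk' := Finset.mem_range.mp hk
      rw [hμ]
      simp only
      rw [M.pairing_eq_zero hN hT m m le_rfl (X ^ k) fun l hl => by
        rw [coeff_X_pow, if_neg (by omega)], mul_zero]
  have hrem : ‖∑ i, ∑ j, M.κ i j * H i j (X ^ q)‖ ≤ Z * (1 + ‖x‖) := by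
    rw [hZ, Finset.sum_mul]
    refine (norm_sum_le _ _).trans (Finset.sum_le_sum fun i _ => ?_)
    rw [Finset.sum_mul]
    refine (norm_sum_le _ _).trans (Finset.sum_le_sum fun j _ => ?_)
    rw [norm_mul, mul_assoc]
    refine mul_le_mul_of_nonneg_left ((h2 i j).2.trans ?_) (norm_nonneg _)
    exact mul_le_mul_of_nonneg_right (le_abs_self _) (by positivity)
  have hs := M.s_ne_zero m
  have hmain : M.hilbert m x / Complex.exp (N / T * M.V₁.eval x) * x ^ (m + 1) - M.s m =
      (M.s m)⁻¹ * ((x * μ (m + 1) + μ (m + 2) + ∑ i, ∑ j, M.κ i j * H i j (X ^ q)) / x ^ 2) := by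
    rw [M.hilbert_eq, mul_div_cancel_left₀ _ (Complex.exp_ne_zero _)]
    have e2 : (∑ i, ∑ j, M.κ i j * H i j 1) * x ^ (m + 1) * x ^ 2 = x ^ 2 * M.h m + x * μ (m + 1) +
        μ (m + 2) + ∑ i, ∑ j, M.κ i j * H i j (X ^ q) := by
      rw [← hmom, ← hsum, hq]; ring
    rw [← M.s_sq] at e2
    simp only [hH] at e2 ⊢
    field_simp
    linear_combination e2
  rw [hmain, norm_mul, norm_div, norm_pow, mul_div_assoc]
  refine mul_le_mul_of_nonneg_left ?_ (norm_nonneg _)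
  rw [div_le_div_iff₀ (by positivity) (by linarith)]
  have h3 : ‖x * μ (m + 1) + μ (m + 2) + ∑ i, ∑ j, M.κ i j * H i j (X ^ q)‖ ≤
      (‖μ (m + 1)‖ + ‖μ (m + 2)‖ + 2 * Z) * ‖x‖ := by
    refine (norm_add_le _ _).trans ((add_le_add ((norm_add_le _ _).trans
      (add_le_add (norm_mul_le _ _) le_rfl)) hrem).trans ?_)
    have := le_mul_of_one_le_right (norm_nonneg (μ (m + 2))) hx1
    have := le_mul_of_one_le_right hZ0 hx1
    linarith
  calc _ ≤ (‖μ (m + 1)‖ + ‖μ (m + 2)‖ + 2 * Z) * ‖x‖ * ‖x‖ := by gcongr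
    _ = _ := by ring

end Model


/-! ### Discrete Fourier inversion over the saddles. -/

/-- The root of unity `ω^{k+1}`, `ω = e^{2iπ/d}`, attached to the `k`-th saddle. -/
noncomputable def sheetRoot (d : ℕ) (k : Fin d) : ℂ :=
  Complex.exp (2 * Real.pi * Complex.I / d) ^ ((k : ℕ) + 1)

theorem sheetRoot_ne_zero {d : ℕ} (k : Fin d) : sheetRoot d k ≠ 0 :=
  pow_ne_zero _ (Complex.exp_ne_zero _)

theorem norm_sheetRoot {d : ℕ} (k : Fin d) : ‖sheetRoot d k‖ = 1 := by
  rw [sheetRoot, norm_pow, show (2 * Real.pi * Complex.I / d : ℂ) =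
    ((2 * Real.pi / d : ℝ) : ℂ) * Complex.I by push_cast; ring, Complex.norm_exp_ofReal_mul_I, one_pow]

theorem sheetRoot_pow_comm {d : ℕ} (k p : Fin d) :
    sheetRoot d k ^ ((p : ℕ) + 1) = sheetRoot d p ^ ((k : ℕ) + 1) := by
  rw [sheetRoot, sheetRoot, ← pow_mul, ← pow_mul, mul_comm ((k : ℕ) + 1)]

theorem sum_sheetRoot_zpow {d : ℕ} (hd : 0 < d) (s : ℤ) :
    ∑ k : Fin d, sheetRoot d k ^ s = if (d : ℤ) ∣ s then (d : ℂ) else 0 := by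
  have hω := Complex.isPrimitiveRoot_exp d hd.ne'
  set ω := Complex.exp (2 * Real.pi * Complex.I / d) with hωd
  have h0 : ω ≠ 0 := Complex.exp_ne_zero _
  have h1 : ∀ k : Fin d, sheetRoot d k ^ s = ω ^ s * (ω ^ s) ^ (k : ℕ) := fun k => by
    rw [sheetRoot, ← hωd, ← zpow_natCast, ← zpow_natCast, ← zpow_mul, ← zpow_mul, ← zpow_add₀ h0]
    congr 1; push_cast; ring
  simp only [h1]
  rw [← Finset.mul_sum, Fin.sum_univ_eq_sum_range (fun k => (ω ^ s) ^ k) d]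
  split_ifs with h
  · rw [(hω.zpow_eq_one_iff_dvd s).mpr h]; simp
  · have h2 : ω ^ s ≠ 1 := fun h3 => h ((hω.zpow_eq_one_iff_dvd s).mp h3)
    rw [geom_sum_eq h2, ← zpow_natCast, ← zpow_mul, mul_comm s, zpow_mul, zpow_natCast, hω.pow_eq_one,
      one_zpow, sub_self, zero_div, mul_zero]

/-- By the symmetry of `ω^{ij}` this is a sum of `(k - k')`-th powers of all the roots, and `|k -
k'| < d`. -/
theorem sum_sheetRoot_orthogonal {d : ℕ} (hd : 0 < d) (k k' : Fin d) :
    ∑ p : Fin d, sheetRoot d k ^ ((p : ℕ) + 1) * sheetRoot d k' ^ (-((p : ℕ) + 1 : ℤ)) =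
      if k = k' then (d : ℂ) else 0 := by
  have h : ∀ p : Fin d, sheetRoot d k ^ ((p : ℕ) + 1) * sheetRoot d k' ^ (-((p : ℕ) + 1 : ℤ)) =
      sheetRoot d p ^ ((k : ℤ) - k') := fun p => by
    rw [zpow_neg, show ((p : ℕ) + 1 : ℤ) = (((p : ℕ) + 1 : ℕ) : ℤ) by push_cast; rfl, zpow_natCast,
      sheetRoot_pow_comm k, sheetRoot_pow_comm k', ← zpow_natCast, ← zpow_natCast, ← zpow_neg,
      ← zpow_add₀ (sheetRoot_ne_zero p)]
    congr 1; push_cast; ring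
  simp only [h]
  rw [sum_sheetRoot_zpow hd]
  have hk := k.2
  have hk' := k'.2
  congr 1
  refine propext ⟨fun ⟨q, hq⟩ => Fin.ext ?_, fun h => by simp [h]⟩
  have h1 : q < 1 := by by_contra h1; nlinarith
  have h2 : -1 < q := by by_contra h1; nlinarith
  have : q = 0 := by omega
  subst this
  omega

/-- The exponents of `x^G` in the rows of positive index, extended to index `0`. -/
noncomputable def growth (d n i : ℕ) : ℂ := (2 * n + 2 * i - 1 - d) / (2 * d)

theorem growth_sub {d : ℕ} (hd : 0 < d) (n i p : ℕ) : growth d n i - growth d n p = (i - p) / d := by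
  have : (d : ℂ) ≠ 0 := by exact_mod_cast hd.ne'
  rw [growth, growth]; field_simp; ring

/-- The solution of `P x^G Ω = (h x^{-n}, A)`. -/
noncomputable def dftMatrix (d n : ℕ) (A : Fin (d + 1) → Fin d → ℂ) (h : Fin (d + 1) → ℂ) (ζ : ℂ) :
    Matrix (Fin (d + 1)) (Fin (d + 1)) ℂ :=
  fun i p => Fin.cases (h i) (fun q => Complex.exp (-(growth d n (q + 1) * ζ)) *
    ((d : ℂ)⁻¹ * ∑ k, sheetRoot d k ^ (-((q : ℕ) + 1 : ℤ)) * A i k)) p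

theorem mul_xPowG_apply_zero (d n : ℕ) (P : Matrix (Fin (d + 1)) (Fin (d + 1)) ℂ) (ζ : ℂ)
    (i : Fin (d + 1)) : (P * xPowG d n ζ) i 0 = P i 0 * Complex.exp (-(n : ℂ) * ζ) := by
  rw [xPowG, Matrix.mul_diagonal, if_pos rfl]

theorem mul_xPowG_apply_succ (d n : ℕ) (P : Matrix (Fin (d + 1)) (Fin (d + 1)) ℂ) (ζ : ℂ)
    (i : Fin (d + 1)) (q : Fin d) :
    (P * xPowG d n ζ) i q.succ = P i q.succ * Complex.exp (growth d n (q + 1) * ζ) := by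
  rw [xPowG, Matrix.mul_diagonal, if_neg (Fin.succ_ne_zero q), growth]
  simp

theorem mul_Ω_apply_zero (d : ℕ) (P : Matrix (Fin (d + 1)) (Fin (d + 1)) ℂ) (i : Fin (d + 1)) :
    (P * Ω d) i 0 = P i 0 := by
  rw [Matrix.mul_apply, Fin.sum_univ_succ]
  simp [Ω]

theorem Ω_succ_succ (d : ℕ) (q k : Fin d) : Ω d q.succ k.succ = sheetRoot d k ^ ((q : ℕ) + 1) := by
  rw [Ω, if_neg (by simp), if_neg (by simp), sheetRoot, ← pow_mul, Fin.val_succ, Fin.val_succ,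
    mul_comm ((q : ℕ) + 1)]

theorem mul_Ω_apply_succ (d : ℕ) (P : Matrix (Fin (d + 1)) (Fin (d + 1)) ℂ) (i : Fin (d + 1))
    (k : Fin d) : (P * Ω d) i k.succ = ∑ q : Fin d, P i q.succ * sheetRoot d k ^ ((q : ℕ) + 1) := by
  rw [Matrix.mul_apply, Fin.sum_univ_succ]
  simp only [Ω_succ_succ]
  simp [Ω]

theorem dftMatrix_mul_zero (d n : ℕ) (A : Fin (d + 1) → Fin d → ℂ) (h : Fin (d + 1) → ℂ) (ζ : ℂ)
    (i : Fin (d + 1)) :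
    (dftMatrix d n A h ζ * xPowG d n ζ * Ω d) i 0 = h i * Complex.exp (-(n : ℂ) * ζ) := by
  rw [mul_Ω_apply_zero, mul_xPowG_apply_zero]; rfl

/-- Fourier inversion is valid for arbitrary data `A`. The factorization in the main theorem is
therefore exact, and the asymptotics reduce to the size of `dftMatrix`. -/
theorem dftMatrix_mul_succ {d : ℕ} (hd : 0 < d) (n : ℕ) (A : Fin (d + 1) → Fin d → ℂ)
    (h : Fin (d + 1) → ℂ) (ζ : ℂ) (i : Fin (d + 1)) (k : Fin d) :
    (dftMatrix d n A h ζ * xPowG d n ζ * Ω d) i k.succ = A i k := by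
  have hd' : (d : ℂ) ≠ 0 := by exact_mod_cast hd.ne'
  rw [mul_Ω_apply_succ]
  simp only [mul_xPowG_apply_succ]
  have h1 : ∀ q : Fin d, dftMatrix d n A h ζ i q.succ * Complex.exp (growth d n (q + 1) * ζ) *
      sheetRoot d k ^ ((q : ℕ) + 1) = (d : ℂ)⁻¹ * ∑ k', A i k' *
        (sheetRoot d k ^ ((q : ℕ) + 1) * sheetRoot d k' ^ (-((q : ℕ) + 1 : ℤ))) := fun q => by
    have e : Complex.exp (-(growth d n (q + 1) * ζ)) * Complex.exp (growth d n (q + 1) * ζ) = 1 := by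
      rw [← Complex.exp_add, neg_add_cancel, Complex.exp_zero]
    have e2 : ∑ k', A i k' *
        (sheetRoot d k ^ ((q : ℕ) + 1) * sheetRoot d k' ^ (-((q : ℕ) + 1 : ℤ))) =
        sheetRoot d k ^ ((q : ℕ) + 1) * ∑ k', sheetRoot d k' ^ (-((q : ℕ) + 1 : ℤ)) * A i k' := by
      rw [Finset.mul_sum]
      exact Finset.sum_congr rfl fun _ _ => by ring
    rw [e2, dftMatrix, Fin.cases_succ]
    generalize (∑ k', sheetRoot d k' ^ (-((q : ℕ) + 1 : ℤ)) * A i k') = Z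
    linear_combination ((d : ℂ)⁻¹ * Z * sheetRoot d k ^ ((q : ℕ) + 1)) * e
  simp only [h1]
  rw [← Finset.mul_sum, Finset.sum_comm]
  simp only [← Finset.mul_sum, sum_sheetRoot_orthogonal hd]
  simp only [mul_ite, mul_zero, Finset.sum_ite_eq, Finset.mem_univ, if_true]
  field_simp

/-- The limit of `dftMatrix`. -/
noncomputable def dftLimit (d : ℕ) (b : Fin (d + 1) → ℕ → ℂ) : Matrix (Fin (d + 1)) (Fin (d + 1)) ℂ :=
  fun i p => Fin.cases (if i = 0 then 1 else 0)
    (fun q => ∑ l ∈ Finset.range d, if (i : ℕ) = q + 1 + l then b i l else 0) p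

theorem dftLimit_self (d : ℕ) {b : Fin (d + 1) → ℕ → ℂ} (hb : ∀ i : Fin d, b i.succ 0 = 1)
    (i : Fin (d + 1)) : dftLimit d b i i = 1 := by
  refine Fin.cases (by simp [dftLimit]) (fun q => ?_) i
  have hq := q.2
  rw [dftLimit, Fin.cases_succ, Finset.sum_eq_single 0]
  · simp [hb]
  · intro l _ hl
    rw [Fin.val_succ, if_neg (by omega)]
  · intro h; exact absurd (Finset.mem_range.mpr (by omega)) h

theorem dftLimit_of_lt (d : ℕ) (b : Fin (d + 1) → ℕ → ℂ) {i j : Fin (d + 1)} (h : i < j) :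
    dftLimit d b i j = 0 := by
  revert h
  refine Fin.cases (fun h => absurd h (Fin.not_lt_zero i)) (fun q h => ?_) j
  have h' : (i : ℕ) < q + 1 := h
  rw [dftLimit, Fin.cases_succ]
  exact Finset.sum_eq_zero fun l _ => if_neg (by omega)

theorem dftLimit_zero (d : ℕ) (b : Fin (d + 1) → ℕ → ℂ) {i : Fin (d + 1)} (h : i ≠ 0) :
    dftLimit d b i 0 = 0 := by
  simp [dftLimit, h]


theorem norm_exp_div_natCast (d : ℕ) (ζ : ℂ) (s : ℤ) :
    ‖Complex.exp (s / d * ζ)‖ = Real.exp (s * ζ.re / d) := by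
  rw [Complex.norm_exp, show (s / d * ζ : ℂ) = ((s / d : ℝ) : ℂ) * ζ by push_cast; ring,
    Complex.re_ofReal_mul]
  congr 1; ring

theorem norm_exp_rpow (d : ℕ) (ζ : ℂ) :
    ‖Complex.exp ζ‖ ^ (-1 / (d : ℝ)) = Real.exp (-ζ.re / d) := by
  rw [Complex.norm_exp, ← Real.exp_mul]
  congr 1; ring

/-- The entries in the columns of positive index, separated into the contributions of the terms of
the expansions and of their remainders. -/
theorem dftMatrix_succ_eq {d : ℕ} (hd : 0 < d) (n : ℕ) (b : Fin (d + 1) → ℕ → ℂ)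
    (A R : Fin (d + 1) → Fin d → ℂ) (h : Fin (d + 1) → ℂ) (ζ : ℂ) (i : Fin (d + 1))
    (hA : ∀ k, A i k = Complex.exp (growth d n i * ζ) * sheetRoot d k ^ (i : ℕ) *
      (∑ l ∈ Finset.range d, b i l * (sheetRoot d k * Complex.exp (ζ / d))⁻¹ ^ l + R i k))
    (q : Fin d) :
    dftMatrix d n A h ζ i q.succ = (∑ l ∈ Finset.range d,
        if (d : ℤ) ∣ (i : ℕ) - ((q : ℕ) + 1) - l then
          b i l * Complex.exp ((((i : ℕ) - ((q : ℕ) + 1) - l : ℤ) : ℂ) / d * ζ) else 0) +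
      Complex.exp ((((i : ℕ) - ((q : ℕ) + 1) : ℤ) : ℂ) / d * ζ) *
        ((d : ℂ)⁻¹ * ∑ k, sheetRoot d k ^ ((i : ℕ) - ((q : ℕ) + 1) : ℤ) * R i k) := by
  have hd' : (d : ℂ) ≠ 0 := by exact_mod_cast hd.ne'
  have hg : Complex.exp (-(growth d n (q + 1) * ζ)) * Complex.exp (growth d n i * ζ) =
      Complex.exp ((((i : ℕ) - ((q : ℕ) + 1) : ℤ) : ℂ) / d * ζ) := by
    rw [← Complex.exp_add]
    congr 1
    have := growth_sub hd n i (q + 1)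
    push_cast at this ⊢
    linear_combination ζ * this
  have hterm : ∀ (k : Fin d), sheetRoot d k ^ (-((q : ℕ) + 1 : ℤ)) * A i k =
      Complex.exp (growth d n i * ζ) * (∑ l ∈ Finset.range d, b i l * Complex.exp (-(l / d * ζ)) *
        sheetRoot d k ^ ((i : ℕ) - ((q : ℕ) + 1) - l : ℤ) +
        sheetRoot d k ^ ((i : ℕ) - ((q : ℕ) + 1) : ℤ) * R i k) := fun k => by
    have hw := sheetRoot_ne_zero k
    have e1 : sheetRoot d k ^ ((i : ℕ) - ((q : ℕ) + 1) : ℤ) =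
        sheetRoot d k ^ (-((q : ℕ) + 1 : ℤ)) * sheetRoot d k ^ (i : ℕ) := by
      rw [← zpow_natCast, ← zpow_add₀ hw, neg_add_eq_sub]
    have e2 : ∑ l ∈ Finset.range d, b i l * Complex.exp (-(l / d * ζ)) *
        sheetRoot d k ^ ((i : ℕ) - ((q : ℕ) + 1) - l : ℤ) =
        sheetRoot d k ^ ((i : ℕ) - ((q : ℕ) + 1) : ℤ) *
          ∑ l ∈ Finset.range d, b i l * (sheetRoot d k * Complex.exp (ζ / d))⁻¹ ^ l := by
      rw [Finset.mul_sum]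
      refine Finset.sum_congr rfl fun l _ => ?_
      rw [zpow_sub₀ hw, zpow_natCast, mul_inv, mul_pow, ← Complex.exp_neg, ← Complex.exp_nat_mul,
        show (l : ℂ) * -(ζ / d) = -(l / d * ζ) by ring, inv_pow]
      ring
    rw [hA, e2, e1]; ring
  rw [dftMatrix, Fin.cases_succ]
  simp only [hterm]
  rw [← Finset.mul_sum, Finset.sum_add_distrib, Finset.sum_comm]
  simp only [← Finset.mul_sum, sum_sheetRoot_zpow hd]
  have e3 : ∀ e x y : ℂ, Complex.exp (-(growth d n (q + 1) * ζ)) * ((d : ℂ)⁻¹ *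
      (Complex.exp (growth d n i * ζ) * (x + y))) =
      Complex.exp ((((i : ℕ) - ((q : ℕ) + 1) : ℤ) : ℂ) / d * ζ) * ((d : ℂ)⁻¹ * x) +
      Complex.exp ((((i : ℕ) - ((q : ℕ) + 1) : ℤ) : ℂ) / d * ζ) * ((d : ℂ)⁻¹ * y) :=
    fun e x y => by rw [← hg]; ring
  rw [e3 1, Finset.mul_sum, Finset.mul_sum]
  congr 1
  refine Finset.sum_congr rfl fun l _ => ?_
  split_ifs
  · have e4 : Complex.exp ((((i : ℕ) - ((q : ℕ) + 1) - l : ℤ) : ℂ) / d * ζ) =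
        Complex.exp ((((i : ℕ) - ((q : ℕ) + 1) : ℤ) : ℂ) / d * ζ) * Complex.exp (-(l / d * ζ)) := by
      rw [← Complex.exp_add]; congr 1; push_cast; ring
    rw [e4]; field_simp
  · simp

/-- The average over the sheets keeps the powers `x^{s/d}` for which `d` divides `s = i - (q + 1) -
l`. As `s ≤ d - 1`, such an `s` is either zero, which gives `dftLimit`, or negative. The remainders
`O(1 / x)` are multiplied by at most `x^{(d-1)/d}`; this is why the expansions are carried to `d`
terms. -/
theorem norm_dftMatrix_sub_le {d : ℕ} (hd : 0 < d) (n : ℕ) (b : Fin (d + 1) → ℕ → ℂ) {K : ℝ}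
    (A : Fin (d + 1) → Fin d → ℂ) (h : Fin (d + 1) → ℂ) (ζ : ℂ) (hζ : 0 ≤ ζ.re)
    (hA : ∀ i k, ‖A i k / (Complex.exp (growth d n i * ζ) * sheetRoot d k ^ (i : ℕ)) -
      ∑ l ∈ Finset.range d, b i l * (sheetRoot d k * Complex.exp (ζ / d))⁻¹ ^ l‖ ≤
        K * Real.exp (-ζ.re))
    (hh : ∀ i, ‖h i - if i = 0 then 1 else 0‖ ≤ K * Real.exp (-ζ.re)) (i p : Fin (d + 1)) :
    ‖dftMatrix d n A h ζ i p - dftLimit d b i p‖ ≤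
      (∑ i, ∑ l ∈ Finset.range d, ‖b i l‖ + K) * Real.exp (-ζ.re / d) := by
  have hd0 : (0 : ℝ) < d := by exact_mod_cast hd
  have hd1 : (1 : ℝ) ≤ d := by exact_mod_cast hd
  have hK : 0 ≤ K := by
    have := (norm_nonneg _).trans (hh 0)
    exact nonneg_of_mul_nonneg_left this (Real.exp_pos _)
  have hmono : Real.exp (-ζ.re) ≤ Real.exp (-ζ.re / d) := by
    apply Real.exp_le_exp.mpr
    rw [le_div_iff₀ hd0]
    nlinarith
  have hB : 0 ≤ ∑ i, ∑ l ∈ Finset.range d, ‖b i l‖ := by positivity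
  refine Fin.cases ?_ (fun q => ?_) p
  · refine (hh i).trans ((mul_le_mul_of_nonneg_left hmono hK).trans ?_)
    exact mul_le_mul_of_nonneg_right (by linarith) (Real.exp_pos _).le
  set R : Fin (d + 1) → Fin d → ℂ := fun i k =>
    A i k / (Complex.exp (growth d n i * ζ) * sheetRoot d k ^ (i : ℕ)) -
      ∑ l ∈ Finset.range d, b i l * (sheetRoot d k * Complex.exp (ζ / d))⁻¹ ^ l with hR
  rw [dftMatrix_succ_eq hd n b A R h ζ i (fun k => by
    have := sheetRoot_ne_zero k
    have := Complex.exp_ne_zero (growth d n i * ζ)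
    rw [hR]; simp only [add_sub_cancel]
    rw [mul_div_cancel₀]
    positivity)]
  have hi := i.2
  have hq := q.2
  rw [add_sub_right_comm, dftLimit, Fin.cases_succ, ← Finset.sum_sub_distrib, add_mul]
  refine (norm_add_le _ _).trans (add_le_add ?_ ?_)
  · have h1 : ∀ l ∈ Finset.range d, ‖(if (d : ℤ) ∣ (i : ℕ) - ((q : ℕ) + 1) - l then
        b i l * Complex.exp ((((i : ℕ) - ((q : ℕ) + 1) - l : ℤ) : ℂ) / d * ζ) else 0) -
        (if (i : ℕ) = q + 1 + l then b i l else 0)‖ ≤ ‖b i l‖ * Real.exp (-ζ.re / d) := fun l _ => by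
      by_cases hl : (i : ℕ) = q + 1 + l
      · have e : ((i : ℕ) : ℤ) - ((q : ℕ) + 1) - l = 0 := by omega
        rw [e, if_pos (dvd_zero _), if_pos hl]
        simp only [Int.cast_zero, zero_div, zero_mul, Complex.exp_zero, mul_one, sub_self, norm_zero]
        positivity
      · rw [if_neg hl, sub_zero]
        split_ifs with hdv
        · rw [norm_mul, norm_exp_div_natCast]
          refine mul_le_mul_of_nonneg_left (Real.exp_le_exp.mpr ?_) (norm_nonneg _)
          have h2 : ((i : ℕ) : ℤ) - ((q : ℕ) + 1) - l ≤ -1 := by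
            by_contra h3
            have := Int.le_of_dvd (by omega) hdv
            omega
          have h3 : ((((i : ℕ) : ℤ) - ((q : ℕ) + 1) - l : ℤ) : ℝ) ≤ -1 := by exact_mod_cast h2
          rw [div_le_div_iff_of_pos_right hd0]
          nlinarith
        · rw [norm_zero]; positivity
    refine (norm_sum_le _ _).trans ((Finset.sum_le_sum h1).trans ?_)
    rw [← Finset.sum_mul]
    exact mul_le_mul_of_nonneg_right (Finset.single_le_sum
      (f := fun i => ∑ l ∈ Finset.range d, ‖b i l‖) (fun _ _ => by positivity) (Finset.mem_univ i))
      (Real.exp_pos _).le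
  · have h1 : ‖(d : ℂ)⁻¹ * ∑ k, sheetRoot d k ^ ((i : ℕ) - ((q : ℕ) + 1) : ℤ) * R i k‖ ≤
        K * Real.exp (-ζ.re) := by
      rw [norm_mul, norm_inv, Complex.norm_natCast, inv_mul_le_iff₀ hd0]
      refine (norm_sum_le _ _).trans ((Finset.sum_le_sum
        (g := fun _ => K * Real.exp (-ζ.re)) fun k _ => ?_).trans_eq ?_)
      · rw [norm_mul, norm_zpow, norm_sheetRoot, one_zpow, one_mul]; exact hA i k
      · rw [Finset.sum_const, Finset.card_univ, Fintype.card_fin, nsmul_eq_mul]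
    rw [norm_mul, norm_exp_div_natCast]
    calc _ ≤ Real.exp (((((i : ℕ) : ℤ) - ((q : ℕ) + 1) : ℤ) : ℝ) * ζ.re / d) *
          (K * Real.exp (-ζ.re)) := mul_le_mul_of_nonneg_left h1 (Real.exp_pos _).le
      _ = K * Real.exp (((((i : ℕ) : ℤ) - ((q : ℕ) + 1) : ℤ) : ℝ) * ζ.re / d + -ζ.re) := by
          rw [Real.exp_add]; ring
      _ ≤ _ := by
          refine mul_le_mul_of_nonneg_left (Real.exp_le_exp.mpr ?_) hK
          have h3 : ((((i : ℕ) : ℤ) - ((q : ℕ) + 1) : ℤ) : ℝ) ≤ d - 1 := by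
            have : (((i : ℕ) : ℤ) - ((q : ℕ) + 1) : ℤ) ≤ (d : ℤ) - 1 := by omega
            exact_mod_cast this
          rw [← sub_nonneg]
          have e : -ζ.re / d - (((((i : ℕ) : ℤ) - ((q : ℕ) + 1) : ℤ) : ℝ) * ζ.re / d + -ζ.re) =
            (d - 1 - ((((i : ℕ) : ℤ) - ((q : ℕ) + 1) : ℤ) : ℝ)) * ζ.re / d := by
            field_simp; ring
          rw [e]
          exact div_nonneg (mul_nonneg (by linarith) hζ) hd0.le

/-- The entries of `dftMatrix * x^G * Ω` are equivalent to those of `x^G * Ω`. -/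
theorem norm_dftMatrix_mul_sub_le {d : ℕ} (hd : 0 < d) (n : ℕ) (b : Fin (d + 1) → ℕ → ℂ)
    (hb : ∀ i : Fin d, b i.succ 0 = 1) {K : ℝ}
    (A : Fin (d + 1) → Fin d → ℂ) (h : Fin (d + 1) → ℂ) (ζ : ℂ) (hζ : 0 ≤ ζ.re)
    (hA : ∀ i k, ‖A i k / (Complex.exp (growth d n i * ζ) * sheetRoot d k ^ (i : ℕ)) -
      ∑ l ∈ Finset.range d, b i l * (sheetRoot d k * Complex.exp (ζ / d))⁻¹ ^ l‖ ≤
        K * Real.exp (-ζ.re))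
    (hh : ∀ i, ‖h i - if i = 0 then 1 else 0‖ ≤ K * Real.exp (-ζ.re)) (i j : Fin (d + 1))
    (hij : Ω d i j ≠ 0) :
    ‖(dftMatrix d n A h ζ * xPowG d n ζ * Ω d) i j - (xPowG d n ζ * Ω d) i j‖ ≤
      (∑ i, ∑ l ∈ Finset.range d, ‖b i l‖ + K) * Real.exp (-ζ.re / d) *
        ‖(xPowG d n ζ * Ω d) i j‖ := by
  have hd0 : (0 : ℝ) < d := by exact_mod_cast hd
  have hd1 : (1 : ℝ) ≤ d := by exact_mod_cast hd
  have hK : 0 ≤ K := by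
    have := (norm_nonneg _).trans (hh 0)
    exact nonneg_of_mul_nonneg_left this (Real.exp_pos _)
  have hmono : Real.exp (-ζ.re) ≤ Real.exp (-ζ.re / d) := by
    apply Real.exp_le_exp.mpr
    rw [le_div_iff₀ hd0]
    nlinarith
  have hB : 0 ≤ ∑ i, ∑ l ∈ Finset.range d, ‖b i l‖ := by positivity
  revert hij
  refine Fin.cases ?_ (fun k => ?_) j <;> refine Fin.cases ?_ (fun q => ?_) i
  · intro _
    rw [dftMatrix_mul_zero, ← Matrix.one_mul (xPowG d n ζ), mul_Ω_apply_zero, mul_xPowG_apply_zero,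
      Matrix.one_apply_eq, ← sub_mul, norm_mul, one_mul]
    refine mul_le_mul_of_nonneg_right ?_ (norm_nonneg _)
    have := hh 0
    rw [if_pos rfl] at this
    refine this.trans ((mul_le_mul_of_nonneg_left hmono hK).trans ?_)
    exact mul_le_mul_of_nonneg_right (by linarith) (Real.exp_pos _).le
  · exact fun h => absurd (by simp [Ω]) h
  · exact fun h => absurd (by simp [Ω]) h
  · intro _
    have e : (xPowG d n ζ * Ω d) q.succ k.succ =
        Complex.exp (growth d n (q + 1) * ζ) * sheetRoot d k ^ ((q : ℕ) + 1) := by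
      rw [xPowG, Matrix.diagonal_mul, Ω_succ_succ, if_neg (Fin.succ_ne_zero q), growth]
      simp
    have hne : Complex.exp (growth d n (q + 1) * ζ) * sheetRoot d k ^ ((q : ℕ) + 1) ≠ 0 :=
      mul_ne_zero (Complex.exp_ne_zero _) (pow_ne_zero _ (sheetRoot_ne_zero k))
    rw [dftMatrix_mul_succ hd, e]
    have h1 := hA q.succ k
    rw [Fin.val_succ] at h1
    set W := Complex.exp (growth d n (q + 1) * ζ) * sheetRoot d k ^ ((q : ℕ) + 1)
    rw [show A q.succ k - W = (A q.succ k / W - 1) * W by field_simp, norm_mul]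
    refine mul_le_mul_of_nonneg_right ?_ (norm_nonneg _)
    -- Without the inversion nothing is amplified: the term `l = 0` is `1` by `hb`, and every other
    -- term has a factor `x^{-1/d}`.
    obtain ⟨d', rfl⟩ : ∃ d', d = d' + 1 := ⟨d - 1, by omega⟩
    have h2 : ‖∑ l ∈ Finset.range (d' + 1), b q.succ l *
        (sheetRoot (d' + 1) k * Complex.exp (ζ / (d' + 1 : ℕ)))⁻¹ ^ l - 1‖ ≤
        (∑ l ∈ Finset.range (d' + 1), ‖b q.succ l‖) * Real.exp (-ζ.re / (d' + 1 : ℕ)) := by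
      rw [Finset.sum_range_succ', pow_zero, mul_one, hb, add_sub_cancel_right, Finset.sum_mul,
        Finset.sum_range_succ']
      refine (norm_sum_le _ _).trans (le_add_of_le_of_nonneg (Finset.sum_le_sum fun l _ => ?_)
        (by positivity))
      rw [norm_mul, norm_pow, norm_inv, norm_mul, norm_sheetRoot, one_mul, Complex.norm_exp,
        ← Real.exp_neg, Complex.div_natCast_re, ← neg_div]
      refine mul_le_mul_of_nonneg_left ?_ (norm_nonneg _)
      exact pow_le_of_le_one (Real.exp_pos _).le (Real.exp_le_one_iff.mpr
        (div_nonpos_of_nonpos_of_nonneg (by linarith) hd0.le)) (Nat.succ_ne_zero l)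
    have h3 : ∑ l ∈ Finset.range (d' + 1), ‖b q.succ l‖ ≤
        ∑ i, ∑ l ∈ Finset.range (d' + 1), ‖b i l‖ := Finset.single_le_sum
      (f := fun i => ∑ l ∈ Finset.range (d' + 1), ‖b i l‖) (fun _ _ => by positivity)
      (Finset.mem_univ q.succ)
    have h4 := norm_add_le (A q.succ k / W - ∑ l ∈ Finset.range (d' + 1), b q.succ l *
        (sheetRoot (d' + 1) k * Complex.exp (ζ / (d' + 1 : ℕ)))⁻¹ ^ l)
      (∑ l ∈ Finset.range (d' + 1), b q.succ l *
        (sheetRoot (d' + 1) k * Complex.exp (ζ / (d' + 1 : ℕ)))⁻¹ ^ l - 1)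
    rw [sub_add_sub_cancel] at h4
    refine h4.trans ((add_le_add (h1.trans (mul_le_mul_of_nonneg_left hmono hK))
      (h2.trans (mul_le_mul_of_nonneg_right h3 (Real.exp_pos _).le))).trans_eq ?_)
    ring


/-! ### Connection matrices and Stokes matrices. -/

/-- The embedding `B ↦ diag(1, B)`. -/
noncomputable def augment (d : ℕ) :
    Matrix (Fin d) (Fin d) ℂ →* Matrix (Fin (d + 1)) (Fin (d + 1)) ℂ where
  toFun B := Matrix.of fun i j => Fin.cases (Fin.cases 1 (fun _ => 0) j)
    (fun k => Fin.cases 0 (fun l => B k l) j) i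
  map_one' := by
    ext i j
    refine Fin.cases ?_ (fun k => ?_) i <;> refine Fin.cases ?_ (fun l => ?_) j <;>
      simp [Matrix.one_apply, Fin.succ_ne_zero, (Fin.succ_ne_zero _).symm]
  map_mul' A B := by
    ext i j
    refine Fin.cases ?_ (fun k => ?_) i <;> refine Fin.cases ?_ (fun l => ?_) j <;>
      simp [Matrix.mul_apply, Fin.sum_univ_succ]

@[simp] theorem augment_zero_zero {d : ℕ} (B : Matrix (Fin d) (Fin d) ℂ) : augment d B 0 0 = 1 := rfl

@[simp] theorem augment_zero_succ {d : ℕ} (B : Matrix (Fin d) (Fin d) ℂ) (l : Fin d) :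
    augment d B 0 l.succ = 0 := rfl

@[simp] theorem augment_succ_zero {d : ℕ} (B : Matrix (Fin d) (Fin d) ℂ) (k : Fin d) :
    augment d B k.succ 0 = 0 := rfl

@[simp] theorem augment_succ_succ {d : ℕ} (B : Matrix (Fin d) (Fin d) ℂ) (k l : Fin d) :
    augment d B k.succ l.succ = B k l := rfl

/-- The matrix that expresses the integrals along the contours `Γ` by those along the steepest
descent paths through the saddles, in the `m`-th sector. -/
noncomputable def connection {d : ℕ} (hd : 0 < d) (α : ℝ) (c : ℂ) (Γ : Fin d → Contour) (m : ℤ) :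
    Matrix (Fin d) (Fin d) ℂ :=
  fun ρ col => Complex.exp (Real.pi *
      windowIndex d (windowStart d α c (Γ ⟨0, hd⟩).endDir m) (ρ : ℕ) / d * Complex.I) *
    (crossing d (Γ ⟨0, hd⟩).endDir (windowStart d α c (Γ ⟨0, hd⟩).endDir m) Γ ρ col : ℤ)

/-- A diagonal matrix of phases times the integral matrix `crossing`. -/
theorem det_connection_ne_zero {d : ℕ} (hd : 0 < d) (α : ℝ) (c : ℂ) {V : ℂ[X]}
    (hV : V.natDegree = d + 1) {T : ℂ} {Γ : Fin d → Contour} (hΓ : IsContourBasis Γ V T) (m : ℤ) :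
    (connection hd α c Γ m).det ≠ 0 := by
  have h : connection hd α c Γ m = Matrix.diagonal (fun ρ : Fin d => Complex.exp (Real.pi *
      windowIndex d (windowStart d α c (Γ ⟨0, hd⟩).endDir m) (ρ : ℕ) / d * Complex.I)) *
      (Int.castRingHom ℂ).mapMatrix (crossing d (Γ ⟨0, hd⟩).endDir
        (windowStart d α c (Γ ⟨0, hd⟩).endDir m) Γ) := by
    ext ρ col
    rw [Matrix.diagonal_mul]; rfl
  rw [h, Matrix.det_mul, Matrix.det_diagonal, ← RingHom.map_det]
  refine mul_ne_zero (Finset.prod_ne_zero_iff.mpr fun _ _ => Complex.exp_ne_zero _) ?_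
  have := det_crossing_ne_zero hd hV hΓ (hΓ.1 ⟨0, hd⟩).2
    (windowStart d α c (Γ ⟨0, hd⟩).endDir m)
  simpa using this

open Classical in
/-- The connection matrix as an invertible matrix, when it is one. -/
noncomputable def connectionGL {d : ℕ} (hd : 0 < d) (α : ℝ) (c : ℂ) (Γ : Fin d → Contour) (m : ℤ) :
    GL (Fin d) ℂ :=
  -- The default value does not occur when a model exists on these contours, by
  -- `det_connection_ne_zero`. It lets `stokes` be defined from the contours alone.
  if h : (connection hd α c Γ m).det ≠ 0 then
    Matrix.GeneralLinearGroup.mkOfDetNeZero (connection hd α c Γ m) h else 1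

theorem coe_connectionGL {d : ℕ} (hd : 0 < d) (α : ℝ) (c : ℂ) {Γ : Fin d → Contour} {m : ℤ}
    (h : (connection hd α c Γ m).det ≠ 0) :
    (connectionGL hd α c Γ m).val = connection hd α c Γ m := by
  rw [connectionGL, dif_pos h]; rfl

/-- The generalized permutation matrix with the entry `a k` in row `k` and column `f k`. -/
noncomputable def monomialMatrix {d : ℕ} (a : Fin d → ℂ) (ha : ∀ k, a k ≠ 0) {f : Fin d → Fin d}
    (hf : Function.Injective f) : GL (Fin d) ℂ :=
  have h : (Matrix.of fun k ρ => if f k = ρ then a k else 0) *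
      (Matrix.of fun ρ k => if f k = ρ then (a k)⁻¹ else 0) = (1 : Matrix (Fin d) (Fin d) ℂ) := by
    ext k k'
    rw [Matrix.mul_apply, Matrix.one_apply]
    simp only [Matrix.of_apply, ite_mul, zero_mul, Finset.sum_ite_eq, Finset.mem_univ, if_true]
    by_cases h : k = k'
    · simp [h, ha]
    · rw [if_neg fun h' => h (hf h').symm, if_neg h, mul_zero]
  ⟨_, _, h, mul_eq_one_comm.mp h⟩

theorem monomialMatrix_mul_apply {d : ℕ} (a : Fin d → ℂ) (ha : ∀ k, a k ≠ 0) {f : Fin d → Fin d}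
    (hf : Function.Injective f) (B : Matrix (Fin d) (Fin d) ℂ) (k l : Fin d) :
    ((monomialMatrix a ha hf).val * B) k l = a k * B (f k) l := by
  rw [Matrix.mul_apply]
  simp [monomialMatrix]

/-- The Stokes matrices. -/
noncomputable def stokes {d : ℕ} (hd : 0 < d) (α : ℝ) (c : ℂ) (Γ : Fin d → Contour) (m : ℤ) :
    GL (Fin (d + 1)) ℂ :=
  Units.map (augment d) ((connectionGL hd α c Γ m)⁻¹ * connectionGL hd α c Γ (m + 1))

namespace Model

variable {d₁ d₂ N : ℕ} {T : ℂ} {Γy : Fin d₂ → Contour}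

/-- `T_k = x y_k - V₂(y_k) + V₂(0)` at a saddle `y_k`. -/
theorem sum_saddle_eq (M : Model d₁ d₂ N T Γy) {x y : ℂ} (h : M.V₂.derivative.eval y = x) :
    ∑ l ∈ Finset.range (d₂ + 1), (l / (l + 1) : ℂ) * M.g₂ (l + 1) * y ^ (l + 1) =
      x * y - M.V₂.eval y + M.V₂.coeff 0 := by
  have h1 : M.V₂.eval y = ∑ l ∈ Finset.range (d₂ + 1), M.V₂.coeff (l + 1) * y ^ (l + 1) +
      M.V₂.coeff 0 := by
    rw [eval_eq_sum_range' (n := d₂ + 2) (by rw [M.natDegree_V₂]; omega), Finset.sum_range_succ']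
    simp
  have h2 : x * y = ∑ l ∈ Finset.range (d₂ + 1), M.V₂.coeff (l + 1) * (l + 1) * y ^ (l + 1) := by
    rw [← h, eval_eq_sum_range' (n := d₂ + 1)
      ((natDegree_derivative_lt (by rw [M.natDegree_V₂]; omega)).trans_eq M.natDegree_V₂),
      Finset.sum_mul]
    exact Finset.sum_congr rfl fun l _ => by rw [coeff_derivative]; ring
  rw [h1, h2, sub_add_eq_sub_sub, sub_add_cancel, ← Finset.sum_sub_distrib]
  refine Finset.sum_congr rfl fun l _ => ?_
  have : (l + 1 : ℂ) ≠ 0 := by exact_mod_cast Nat.succ_ne_zero l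
  rw [g₂]; push_cast; field_simp; ring

theorem Y₀_ne_zero (M : Model d₁ d₂ N T Γy) {r : ℂ} (hr : r ≠ 0) (n : ℕ) (i : Fin (d₂ + 1)) :
    M.Y₀ r n i i ≠ 0 := by
  rw [Y₀, Matrix.diagonal_apply_eq]
  split_ifs
  · exact M.s_ne_zero _
  · exact div_ne_zero (inv_ne_zero (pow_ne_zero _ hr)) (M.s_ne_zero _)

theorem g₂_ne_zero (M : Model d₁ d₂ N T Γy) : M.g₂ (d₂ + 1) ≠ 0 := by
  rw [g₂, ← M.natDegree_V₂]
  refine mul_ne_zero (by rw [M.natDegree_V₂]; exact_mod_cast Nat.succ_ne_zero d₂) ?_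
  exact leadingCoeff_ne_zero.mpr fun h => by have := M.natDegree_V₂; rw [h] at this; simp at this

/-- The normalized expansion of the Fourier–Laplace transforms along all the contours. -/
theorem exists_fundamental_expansion (M : Model d₁ d₂ N T Γy) (hd : 0 < d₂) (hN : 0 < N) (α : ℝ)
    {n : ℕ} (hn : 1 ≤ n) {r : ℂ} (hr : r ^ d₂ = M.g₂ (d₂ + 1)) {y : Fin d₂ → ℂ → ℂ}
    (hy : M.IsSaddles r y) :
    ∃ (X : GL (Fin d₂) ℂ) (b : Fin (d₂ + 1) → ℕ → ℂ), (∀ i : Fin d₂, b i.succ 0 = 1) ∧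
      ∀ m : ℤ, ∃ (A : ℂ → Fin (d₂ + 1) → Fin d₂ → ℂ) (K R : ℝ), ∀ ζ ∈ M.sector hd α m, R ≤ ζ.re →
        (∀ (i : Fin (d₂ + 1)) col, M.fourier col (n - 1 + i) (Complex.exp ζ) =
          M.Y₀ r n i i * ∑ k, A ζ i k * M.expT y ζ k.succ k.succ *
            (X.val * connection hd α (N / T) Γy m) k col) ∧
        ∀ (i : Fin (d₂ + 1)) k,
          ‖A ζ i k / (Complex.exp (growth d₂ n i * ζ) * sheetRoot d₂ k ^ (i : ℕ)) -
            ∑ l ∈ Finset.range d₂, b i l * (sheetRoot d₂ k * Complex.exp (ζ / d₂))⁻¹ ^ l‖ ≤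
              K * Real.exp (-ζ.re) := by
  have hr0 : r ≠ 0 := fun h => M.g₂_ne_zero (by rw [← hr, h, zero_pow hd.ne'])
  obtain ⟨D, z, hD, hex⟩ := M.fourier_expansion hd hN α hr hy
  choose a ha0 hex using fun i : Fin (d₂ + 1) => hex (n - 1 + i)
  -- `T_k` differs from the critical value by `V₂(0)` (`sum_saddle_eq`); this constant is moved to
  -- the right factor.
  set v : ℂ := Complex.exp (N / T * M.V₂.coeff 0) with hv
  have hv0 : v ≠ 0 := Complex.exp_ne_zero _
  set c : Fin d₂ → ℂ := fun k => r * sheetRoot d₂ k ^ (n - 1) * D * v⁻¹ with hc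
  have hc0 : ∀ k, c k ≠ 0 := fun k => mul_ne_zero (mul_ne_zero (mul_ne_zero hr0
    (pow_ne_zero _ (sheetRoot_ne_zero k))) hD) (inv_ne_zero hv0)
  -- The discrepancy between `Y₀` and the natural normalization of the rows. It equals `1` in the
  -- rows of positive index; row `0` of these columns has limit zero, so its value there is
  -- immaterial.
  set τ : Fin (d₂ + 1) → ℂ := fun i => (r ^ (n + (i : ℕ)))⁻¹ / (M.s (n - 1 + i) * M.Y₀ r n i i)
    with hτ
  -- This factor puts the steps in the order of the saddles and collects all the constants that
  -- depend on the model and on `n`. It is chosen before `m`.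
  refine ⟨monomialMatrix c hc0 (residue_injective hd z), fun i l => τ i * a i l * r ^ l,
    fun i => ?_, fun m => ?_⟩
  · have := M.s_ne_zero (n - 1 + (i.succ : Fin (d₂ + 1)))
    have := pow_ne_zero (n + (i.succ : Fin (d₂ + 1))) hr0
    simp only [hτ, ha0, pow_zero, mul_one]
    rw [Y₀, Matrix.diagonal_apply_eq, if_neg (Fin.succ_ne_zero i)]
    field_simp
  choose F K R hFK using fun i => hex i m
  set ε : Fin d₂ → ℂ := fun k => Complex.exp (Real.pi *
    windowIndex d₂ (windowStart d₂ α (N / T) (Γy ⟨0, hd⟩).endDir m)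
      ((residue d₂ hd ((k : ℕ) + 1 - z) : Fin d₂) : ℕ) / d₂ * Complex.I) with hε
  have hε0 : ∀ k, ε k ≠ 0 := fun k => Complex.exp_ne_zero _
  refine ⟨fun ζ i k => F i k ζ / (M.s (n - 1 + i) * M.Y₀ r n i i * c k * ε k *
    M.expT y ζ k.succ k.succ), ∑ i, ‖τ i‖ * |K i|, ∑ i, |R i|, fun ζ hζ hζR => ?_⟩
  have hT0 : ∀ k : Fin d₂, M.expT y ζ k.succ k.succ ≠ 0 := fun k => by
    rw [expT, Matrix.diagonal_apply_eq]; exact Complex.exp_ne_zero _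
  have hall := fun i => hFK i ζ hζ (((le_abs_self _).trans (Finset.single_le_sum
    (f := fun i => |R i|) (fun _ _ => abs_nonneg _) (Finset.mem_univ i))).trans hζR)
  refine ⟨fun i col => ?_, fun i k => ?_⟩
  · rw [(hall i).1 col, Finset.mul_sum, Finset.mul_sum]
    refine Finset.sum_congr rfl fun k _ => ?_
    have h1 : ((monomialMatrix c hc0 (residue_injective hd z)).val *
        connection hd α (N / T) Γy m) k col = c k * (ε k *
          (crossing d₂ (Γy ⟨0, hd⟩).endDir (windowStart d₂ α (N / T) (Γy ⟨0, hd⟩).endDir m) Γy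
            (residue d₂ hd ((k : ℕ) + 1 - z)) col : ℤ)) := by
      rw [monomialMatrix_mul_apply]; rfl
    rw [h1]
    have := M.s_ne_zero (n - 1 + i)
    have := M.Y₀_ne_zero hr0 n i
    have := hc0 k
    have := hε0 k
    have := hT0 k
    field_simp
  · obtain ⟨hsad, hbd⟩ := (hall i).2 k
    have hTe : M.expT y ζ k.succ k.succ = Complex.exp ((N / T : ℂ) *
        (Complex.exp ζ * y k ζ - M.V₂.eval (y k ζ))) * v := by
      rw [expT, Matrix.diagonal_apply_eq, Fin.cases_succ, M.sum_saddle_eq hsad, mul_add,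
        Complex.exp_add]
    have hw := sheetRoot_ne_zero k
    change ‖F i k ζ * Complex.exp (-((N / T : ℂ) * (Complex.exp ζ * y k ζ - M.V₂.eval (y k ζ)))) /
      (ε k * D * Complex.exp (-((d₂ - 1) / (2 * d₂) * ζ)) *
        (sheetRoot d₂ k / r * Complex.exp (ζ / d₂)) ^ (n - 1 + i)) -
      ∑ l ∈ Finset.range d₂, a i l * (sheetRoot d₂ k / r * Complex.exp (ζ / d₂))⁻¹ ^ l‖ ≤
        K i * Real.exp (-ζ.re) at hbd
    have hgE : Complex.exp (growth d₂ n i * ζ) = Complex.exp (-((d₂ - 1) / (2 * d₂) * ζ)) *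
        Complex.exp (ζ / d₂) ^ (n - 1 + i) := by
      rw [← Complex.exp_nat_mul, ← Complex.exp_add, growth]
      congr 1
      have : (d₂ : ℂ) ≠ 0 := by exact_mod_cast hd.ne'
      push_cast [Nat.cast_sub hn]
      field_simp
      ring
    have e1 : F i k ζ / (M.s (n - 1 + i) * M.Y₀ r n i i * c k * ε k * M.expT y ζ k.succ k.succ) /
        (Complex.exp (growth d₂ n i * ζ) * sheetRoot d₂ k ^ (i : ℕ)) = τ i *
        (F i k ζ * Complex.exp (-((N / T : ℂ) * (Complex.exp ζ * y k ζ - M.V₂.eval (y k ζ)))) /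
          (ε k * D * Complex.exp (-((d₂ - 1) / (2 * d₂) * ζ)) *
            (sheetRoot d₂ k / r * Complex.exp (ζ / d₂)) ^ (n - 1 + i))) := by
      simp only [hτ, hc]
      rw [hTe, hgE, Complex.exp_neg ((N / T : ℂ) * _), show n + (i : ℕ) = n - 1 + i + 1 by omega,
        mul_pow, div_pow, pow_succ r, pow_add (sheetRoot d₂ k)]
      have h1 := M.s_ne_zero (n - 1 + i)
      have h2 := M.Y₀_ne_zero hr0 n i
      have h3 := hε0 k
      have h4 := Complex.exp_ne_zero ((N / T : ℂ) * (Complex.exp ζ * y k ζ - M.V₂.eval (y k ζ)))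
      have h5 := Complex.exp_ne_zero (ζ / d₂)
      have h6 := Complex.exp_ne_zero (-((d₂ - 1) / (2 * d₂) * ζ) : ℂ)
      have h7 := pow_ne_zero (n - 1 + i) hr0
      have h8 := pow_ne_zero (n - 1) hw
      have h9 := pow_ne_zero i hw
      have h10 := pow_ne_zero (n - 1 + i) h5
      generalize Complex.exp ((N / T : ℂ) * (Complex.exp ζ * y k ζ - M.V₂.eval (y k ζ))) = x1 at *
      generalize Complex.exp (-((d₂ - 1) / (2 * d₂) * ζ) : ℂ) = x2 at *
      generalize r ^ (n - 1 + i) = x3 at *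
      generalize sheetRoot d₂ k ^ (n - 1) = x4 at *
      generalize sheetRoot d₂ k ^ (i : ℕ) = x5 at *
      generalize Complex.exp (ζ / d₂) ^ (n - 1 + i) = x6 at *
      field_simp
    have e2 : ∑ l ∈ Finset.range d₂, τ i * a i l * r ^ l *
        (sheetRoot d₂ k * Complex.exp (ζ / d₂))⁻¹ ^ l = τ i * ∑ l ∈ Finset.range d₂, a i l *
          (sheetRoot d₂ k / r * Complex.exp (ζ / d₂))⁻¹ ^ l := by
      rw [Finset.mul_sum]
      refine Finset.sum_congr rfl fun l _ => ?_
      rw [show (sheetRoot d₂ k / r * Complex.exp (ζ / d₂))⁻¹ =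
        r * (sheetRoot d₂ k * Complex.exp (ζ / d₂))⁻¹ by field_simp, mul_pow]
      ring
    simp only
    rw [e1, e2, ← mul_sub, norm_mul, Finset.sum_mul]
    refine (mul_le_mul_of_nonneg_left hbd (norm_nonneg _)).trans (le_trans ?_
      (Finset.single_le_sum (f := fun i => ‖τ i‖ * |K i| * Real.exp (-ζ.re))
        (fun _ _ => by positivity) (Finset.mem_univ i)))
    rw [mul_assoc]
    exact mul_le_mul_of_nonneg_left (mul_le_mul_of_nonneg_right (le_abs_self _)
      (Real.exp_pos _).le) (norm_nonneg _)

end Model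


namespace Model

variable {d₁ d₂ N : ℕ} {T : ℂ} {Γy : Fin d₂ → Contour}

/-- The normalized asymptotics of the Hilbert transforms. -/
theorem exists_hilbert_column (M : Model d₁ d₂ N T Γy) (hN : 0 < N) (hT : T ≠ 0) {n : ℕ}
    (hn : 1 ≤ n) {r : ℂ} (hr : r ≠ 0) (y : Fin d₂ → ℂ → ℂ) :
    ∃ K R : ℝ, ∀ ζ : ℂ, R ≤ ζ.re → (∀ i, Complex.exp ζ ∉ Set.range (M.Γx i).toFun) →
      ∀ i : Fin (d₂ + 1), ‖M.hilbert (n - 1 + i) (Complex.exp ζ) /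
        (M.Y₀ r n i i * M.expT y ζ 0 0 * Complex.exp (-(n : ℂ) * ζ)) - if i = 0 then 1 else 0‖ ≤
          K * Real.exp (-ζ.re) := by
  choose K R hKR using fun i : Fin (d₂ + 1) => M.hilbert_expansion hN hT (n - 1 + i)
  refine ⟨∑ i : Fin (d₂ + 1), (‖M.s (n - 1 + i)‖ + |K i|) / ‖M.Y₀ r n i i‖, ∑ i, |R i|,
    fun ζ hζ hx i => ?_⟩
  have hR0 : 0 ≤ ∑ i, |R i| := Finset.sum_nonneg fun _ _ => abs_nonneg _
  have hζ0 : 0 ≤ ζ.re := hR0.trans hζ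
  set x := Complex.exp ζ with hxd
  have hx0 : x ≠ 0 := Complex.exp_ne_zero _
  have hxn : ‖x‖ = Real.exp ζ.re := Complex.norm_exp ζ
  have hx1 : 1 ≤ ‖x‖ := by rw [hxn]; exact Real.one_le_exp hζ0
  have hRx : R i ≤ ‖x‖ := by
    have h1 := Finset.single_le_sum (f := fun i => |R i|) (fun _ _ => abs_nonneg _)
      (Finset.mem_univ i)
    have h2 := Real.add_one_le_exp ζ.re
    have h3 := le_abs_self (R i)
    rw [hxn]; linarith
  have hbd := hKR i x hRx hx
  have hY := M.Y₀_ne_zero hr n i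
  have hYn : 0 < ‖M.Y₀ r n i i‖ := norm_pos_iff.mpr hY
  have hV : M.expT y ζ 0 0 = Complex.exp (N / T * M.V₁.eval x) := by
    rw [expT, Matrix.diagonal_apply_eq]; rfl
  set w := M.hilbert (n - 1 + i) x / Complex.exp (N / T * M.V₁.eval x) * x ^ (n - 1 + i + 1) with hw
  have e1 : M.hilbert (n - 1 + i) x / (M.Y₀ r n i i * M.expT y ζ 0 0 *
      Complex.exp (-(n : ℂ) * ζ)) = w / M.Y₀ r n i i / x ^ (i : ℕ) := by
    have hV0 := Complex.exp_ne_zero (N / T * M.V₁.eval x)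
    rw [hV, neg_mul, Complex.exp_neg, Complex.exp_nat_mul, ← hxd, hw,
      show n - 1 + (i : ℕ) + 1 = n + i by omega, pow_add]
    field_simp
  rw [e1, Real.exp_neg, ← hxn, ← div_eq_mul_inv]
  refine le_trans ?_ (div_le_div_of_nonneg_right (Finset.single_le_sum
    (f := fun i : Fin (d₂ + 1) => (‖M.s (n - 1 + i)‖ + |K i|) / ‖M.Y₀ r n i i‖)
    (fun _ _ => by positivity) (Finset.mem_univ i)) (norm_nonneg _))
  have hK : K i / ‖x‖ ≤ |K i| / ‖x‖ := div_le_div_of_nonneg_right (le_abs_self _) (norm_nonneg _)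
  split_ifs with hi
  · subst hi
    have hY' : M.Y₀ r n 0 0 = M.s (n - 1 + (0 : Fin (d₂ + 1))) := by
      rw [Y₀, Matrix.diagonal_apply_eq, if_pos rfl]; rfl
    rw [Fin.val_zero, pow_zero, div_one, div_sub_one hY, norm_div, div_right_comm]
    refine div_le_div_of_nonneg_right ?_ hYn.le
    rw [hY']
    refine hbd.trans (hK.trans (div_le_div_of_nonneg_right ?_ (norm_nonneg _)))
    exact le_add_of_nonneg_left (norm_nonneg _)
  -- Row `i` is smaller than row `0` by `x^{-i}`, whence the zeros of `L` in column `0`.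
  · have hi1 : (i : ℕ) ≠ 0 := fun h => hi (Fin.ext h)
    have h1 : ‖w‖ ≤ ‖M.s (n - 1 + i)‖ + |K i| := by
      have h2 := norm_sub_norm_le w (M.s (n - 1 + i))
      have h3 : |K i| / ‖x‖ ≤ |K i| := div_le_self (abs_nonneg _) hx1
      linarith
    rw [sub_zero, norm_div, norm_div, norm_pow]
    exact div_le_div₀ (by positivity) (div_le_div_of_nonneg_right h1 hYn.le) (by linarith)
      (le_self_pow₀ hx1 hi1)

end Model

end TwoMatrix

/-! ### Assembly of the columns. -/

open TwoMatrix in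
theorem mainTheorem7 (d₁ d₂ N : ℕ) (hd₂ : 0 < d₂) (hN : 0 < N) (T : ℂ) (hT : T ≠ 0)
    (Γy : Fin d₂ → Contour) (α : ℝ) :
    ∃ S : ℤ → GL (Fin (d₂ + 1)) ℂ,
      ∀ (M : Model d₁ d₂ N T Γy) (n : ℕ), 1 ≤ n →
      ∀ r : ℂ, r ^ d₂ = M.g₂ (d₂ + 1) →
      ∀ y : Fin d₂ → ℂ → ℂ, M.IsSaddles r y →
      ∃ (L : Matrix (Fin (d₂ + 1)) (Fin (d₂ + 1)) ℂ) (C : ℤ → GL (Fin (d₂ + 1)) ℂ),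
        (∀ i, L i i = 1) ∧ (∀ i j, i < j → L i j = 0) ∧ (∀ i, i ≠ 0 → L i 0 = 0) ∧
        (∀ m, (C m)⁻¹ * C (m + 1) = S m) ∧
        ∀ m, ∃ (E : ℂ → Matrix (Fin (d₂ + 1)) (Fin (d₂ + 1)) ℂ) (K R : ℝ),
          ∀ ζ ∈ M.sector hd₂ α m, R ≤ ζ.re →
            (∀ i, Complex.exp ζ ∉ Set.range (M.Γx i).toFun) →
            M.fundamental n (Complex.exp ζ) =
              M.Y₀ r n * (L + E ζ) * xPowG d₂ n ζ * Ω d₂ * M.expT y ζ * (C m).val ∧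
            (∀ i j, ‖E ζ i j‖ ≤ K * ‖Complex.exp ζ‖ ^ (-1 / (d₂ : ℝ))) ∧
            (∀ i j, Ω d₂ i j ≠ 0 →
              ‖((L + E ζ) * xPowG d₂ n ζ * Ω d₂) i j - (xPowG d₂ n ζ * Ω d₂) i j‖
                ≤ K * ‖Complex.exp ζ‖ ^ (-1 / (d₂ : ℝ)) * ‖(xPowG d₂ n ζ * Ω d₂) i j‖) := by
  refine ⟨stokes hd₂ α (N / T) Γy, fun M n hn r hr y hy => ?_⟩
  have hr0 : r ≠ 0 := fun h => M.g₂_ne_zero (by rw [← hr, h, zero_pow hd₂.ne'])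
  obtain ⟨X, b, hb, hA⟩ := M.exists_fundamental_expansion hd₂ hN α hn hr hy
  obtain ⟨K₂, R₂, hH⟩ := M.exists_hilbert_column hN hT hn hr0 y
  -- The factor `X` is the same for all `m`, so it cancels from the quotient of two consecutive `C
  -- m`, which is then `stokes`.
  refine ⟨dftLimit d₂ b, fun m => Units.map (augment d₂) (X * connectionGL hd₂ α (N / T) Γy m),
    dftLimit_self d₂ hb, fun i j h => dftLimit_of_lt d₂ b h, fun i h => dftLimit_zero d₂ b h,
    fun m => ?_, fun m => ?_⟩
  · rw [stokes, ← map_inv, ← map_mul]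
    congr 1
    group
  obtain ⟨A, K₁, R₁, hA⟩ := hA m
  set h : ℂ → Fin (d₂ + 1) → ℂ := fun ζ i => M.hilbert (n - 1 + i) (Complex.exp ζ) /
    (M.Y₀ r n i i * M.expT y ζ 0 0 * Complex.exp (-(n : ℂ) * ζ)) with hh
  -- With `E` the exact deviation from `L`, the product formula is an identity; estimates enter only
  -- in the two bounds. Both Fourier and Hilbert constants are replaced by their maximum.
  refine ⟨fun ζ => dftMatrix d₂ n (A ζ) (h ζ) ζ - dftLimit d₂ b,
    ∑ i, ∑ l ∈ Finset.range d₂, ‖b i l‖ + max K₁ K₂, max (max R₁ R₂) 0, fun ζ hζ hR hx => ?_⟩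
  obtain ⟨hcol, hexp⟩ := hA ζ hζ ((le_max_left _ _).trans ((le_max_left _ _).trans hR))
  have hH := hH ζ ((le_max_right _ _).trans ((le_max_left _ _).trans hR)) hx
  have hζ0 : 0 ≤ ζ.re := (le_max_right _ _).trans hR
  have h1 : ∀ i k, ‖A ζ i k / (Complex.exp (growth d₂ n i * ζ) * sheetRoot d₂ k ^ (i : ℕ)) -
      ∑ l ∈ Finset.range d₂, b i l * (sheetRoot d₂ k * Complex.exp (ζ / d₂))⁻¹ ^ l‖ ≤
        max K₁ K₂ * Real.exp (-ζ.re) := fun i k =>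
    (hexp i k).trans (mul_le_mul_of_nonneg_right (le_max_left _ _) (Real.exp_pos _).le)
  have h2 : ∀ i, ‖h ζ i - if i = 0 then 1 else 0‖ ≤ max K₁ K₂ * Real.exp (-ζ.re) := fun i =>
    (hH i).trans (mul_le_mul_of_nonneg_right (le_max_right _ _) (Real.exp_pos _).le)
  simp only [add_sub_cancel, norm_exp_rpow]
  refine ⟨?_, norm_dftMatrix_sub_le hd₂ n b (A ζ) (h ζ) ζ hζ0 h1 h2,
    norm_dftMatrix_mul_sub_le hd₂ n b hb (A ζ) (h ζ) ζ hζ0 h1 h2⟩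
  have hC : (Units.map (augment d₂ : Matrix (Fin d₂) (Fin d₂) ℂ →* _)
      (X * connectionGL hd₂ α (N / T) Γy m)).val =
      augment d₂ (X.val * connection hd₂ α (N / T) Γy m) := by
    rw [← coe_connectionGL hd₂ α (N / T)
      (det_connection_ne_zero hd₂ α (N / T) M.natDegree_V₂ M.basis_y m)]
    rfl
  rw [hC, Matrix.mul_assoc (M.Y₀ r n), Matrix.mul_assoc (M.Y₀ r n), Matrix.mul_assoc (M.Y₀ r n),
    Matrix.mul_assoc (M.Y₀ r n)]
  set P := dftMatrix d₂ n (A ζ) (h ζ) ζ * xPowG d₂ n ζ * Ω d₂ with hP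
  have hY : ∀ (Q : Matrix (Fin (d₂ + 1)) (Fin (d₂ + 1)) ℂ) (i j), (M.Y₀ r n * Q) i j =
      M.Y₀ r n i i * Q i j := fun Q i j => by
    rw [Model.Y₀, Matrix.diagonal_mul, Matrix.diagonal_apply_eq]
  have hT' : ∀ (Q : Matrix (Fin (d₂ + 1)) (Fin (d₂ + 1)) ℂ) (i j), (Q * M.expT y ζ) i j =
      Q i j * M.expT y ζ j j := fun Q i j => by
    rw [Model.expT, Matrix.mul_diagonal, Matrix.diagonal_apply_eq]
  ext i j
  rw [hY, Matrix.mul_apply, Fin.sum_univ_succ]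
  simp only [hT']
  rw [hP, dftMatrix_mul_zero]
  simp only [dftMatrix_mul_succ hd₂]
  refine Fin.cases ?_ (fun col => ?_) j
  · simp only [augment_zero_zero, augment_succ_zero, mul_zero, Finset.sum_const_zero, add_zero, mul_one]
    have e1 := M.Y₀_ne_zero hr0 n i
    have e2 := Complex.exp_ne_zero (-(n : ℂ) * ζ)
    have e3 : M.expT y ζ 0 0 ≠ 0 := by
      rw [Model.expT, Matrix.diagonal_apply_eq]; exact Complex.exp_ne_zero _
    change M.hilbert (n - 1 + i) (Complex.exp ζ) = _
    rw [hh]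
    field_simp
  · simp only [augment_zero_succ, augment_succ_succ, mul_zero, zero_add]
    exact hcol i col
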